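/- Let $p$ be a prime, $f\ge 1$, $k=\mathbb F_{p^f}$, and write $W$ for $p$-typical Witt vectors, $F$ and $V$ for Frobenius and Verschiebung, $w_0$ for the $0$th ghost component, $I(R)=\ker(w_0:W(R)\to R)$. For a $W(k)$-algebra $R$, regard $W(R)$ as a $W(k)$-algebra through the diagonal $W(k)\to W(W(k))\to W(R)$. \textbf{$\Phi$-data.} Let $\mathcal G$ be a smooth affine group scheme over $\mathbb Z_p=W(\mathbb F_p)$ with Lie algebra $\mathfrak g$, and let $\mu:\mathbb G_m\to\mathcal G$ be a cocharacter defined over $W(k)$. Let $\mathcal G^-\subset\mathcal G_{W(k)}$ (resp. $\mathcal G^+$) be the subgroup of those $g$ for which $z\mapsto\mu(z)^{-1}g\mu(z)$ extends to $\mathbb A^1$ (resp. for which $z\mapsto\mu(z)g\mu(z)^{-1}$ extends to $\mathbb A^1$ with value $1$ at $z=0$). Assume that $(\mathcal G,\mu)$ is a $\Phi$-datum: the only $\mu$-weight of $\mathfrak g^+=\operatorname{Lie}\mathcal G^+$ (the sum of the weight spaces of positive weight in $W(k)\otimes\mathfrak g$) is $1$, and $\mathcal G_{W(k)}$ has connected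 fibres. Then $\mathcal G^+$ is a vector group on which conjugation by $\mu(z)$ is multiplication by $z$. \textbf{Nilpotence.} Let $S$ be a $W(k)$-algebra with an endomorphism $\tau$ that induces $F$ on $W(k)$, and let $U\in\mathcal G(S)$. Call $U$ $F$-nilpotent if some iterate of the $\tau$-linear endomorphism $\operatorname{Ad}(U)\circ(\tau\otimes\mathrm{id})\circ\beta$ of $S\otimes\mathfrak g$ maps $S\otimes\mathfrak g$ into $p(S\otimes\mathfrak g)$; here $\beta=p\operatorname{Ad}(\mu(p))^{-1}$ is multiplication by $p^{1-n}$ on the part of weight $n\le1$. \textbf{Windows.} A frame over $W(k)$ is a triple $(A,J,\tau)$, where $A$ is a $p$-adically separated and complete torsion-free $W(k)$-algebra, $\tau$ is a ring endomorphism of $A$ with $\tau(a)\equiv a^p\pmod p$, and $J\subset A$ is an ideal that has divided powers and contains a power of $p$. Let $\hat{\mathcal G}_J^-(A)$ be the group formed by the products of elements of $\mathcal G^-(A)$ and of $\ker(\mathcal G^+(A)\to\mathcal G^+(A/J))$. The groupoid $\hat{\mathcal B}'_{A,J}(\mathcal G,\mu)$ of nilpotent $\mathcal G$-windows over $(A,J)$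 has as objects the $F$-nilpotent $U\in\mathcal G(A)$, and as morphisms $U'\to U$ the $h\in\hat{\mathcal G}_J^-(A)$ with $U'=h^{-1}U\,\tau(\mu(p)^{-1}h\mu(p))$ in $\mathcal G(A[\tfrac1p])$; composition is multiplication. \textbf{Banal displays.} Let $R$ be a $W(k)$-algebra in which $p$ is nilpotent, and let $\mathcal I(R)$ be the group of all $g\in\mathcal G(W(R))$ with $w_0(g)\in\mathcal G^-(R)$. The twisted Frobenius is the homomorphism $\Phi:\mathcal I(R)\to\mathcal G(W(R))$ that is $g\mapsto F(\mu(p)^{-1}g\mu(p))$ on $\mathcal G^-(W(R))$ (where $\mu(p)^{-1}g\mu(p)$ is the value at $z=p$ of the extension of $\mu(z)^{-1}g\mu(z)$ to $\mathbb A^1$), and that is given by $V^{-1}$ on the linear coordinates of the vector group $\mathcal G^+$ on $\ker(w_0:\mathcal G^+(W(R))\to\mathcal G^+(R))$, with values in the Frobenius pull-back of $\mathcal G^+$. The groupoid $\mathcal B'^{\,\mathrm{ban}}_R(\mathcal G,\mu)$ of nilpotent banal displays with $\mathcal G$-structure over $R$ has as objects the $U\in\mathcal G(W(R))$ such that $\operatorname{Spec}(R/pR)$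 has a covering by affine open subschemes $\operatorname{Spec}R_l$ for which the image of $U$ in $\mathcal G(W(R_l))$ is $F$-nilpotent (with respect to $F$ on $W(R_l)$), and as morphisms $U'\to U$ the $h\in\mathcal I(R)$ with $U'=h^{-1}U\Phi(h)$. \textbf{Lemma.} Let $(A,J,\tau)$ be a frame over $W(k)$. Let $\delta:A\to W(A)$ be Cartier's diagonal, the ring homomorphism with ghost components $a\mapsto(a,\tau(a),\tau^2(a),\dots)$. Then the twisted Frobenius $\Phi:\mathcal I(A/J)\to\mathcal G(W(A/J))$ exists and is unique, the maps induced by $\delta$ and by $W(A)\to W(A/J)$ on objects and on morphisms define functors $$\hat{\mathcal B}'_{A,J}(\mathcal G,\mu)\longrightarrow\hat{\mathcal B}'_{W(A),\,W(J)+I(A)}(\mathcal G,\mu)\longrightarrow\mathcal B'^{\,\mathrm{ban}}_{A/J}(\mathcal G,\mu)$$ (where $W(A)$ carries the endomorphism $F$), and both functors, hence also their composite, are equivalences of categories. -/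

import Mathlib

noncomputable section

open CategoryTheory Polynomial TensorProduct
open scoped LaurentPolynomial

namespace GDisplay

universe u v w

/-! ### Witt vectors: Cartier's diagonal -/

section Diagonal

variable {p : ℕ} {A : Type u} [CommRing A]

theorem ghostComponent_eq_sum [Fact p.Prime] (n : ℕ) (x : WittVector p A) :
    WittVector.ghostComponent n x =
      ∑ i ∈ Finset.range (n + 1), (p : A) ^ i * x.coeff i ^ p ^ (n - i) := by
  rw [WittVector.ghostComponent_apply, aeval_wittPolynomial]

theorem ghost_ext [Fact p.Prime] (hp : ∀ a : A, (p : A) * a = 0 → a = 0) {x y : WittVector p A}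
    (h : ∀ n, WittVector.ghostComponent n x = WittVector.ghostComponent n y) : x = y := by
  have hpow : ∀ (n : ℕ) (a : A), (p : A) ^ n * a = 0 → a = 0 := by
    intro n
    induction n with
    | zero => intro a; simp
    | succ n ih =>
      intro a ha
      exact hp a (ih _ (by rw [← mul_assoc, ← pow_succ]; exact ha))
  ext n
  induction n using Nat.strong_induction_on with
  | _ n ih =>
    have h1 := h n
    rw [ghostComponent_eq_sum, ghostComponent_eq_sum, Finset.sum_range_succ,
      Finset.sum_range_succ, Finset.sum_congr rfl (fun i hi => by
        rw [ih i (Finset.mem_range.mp hi)])] at h1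
    simp only [Nat.sub_self, pow_zero, pow_one, add_right_inj] at h1
    exact sub_eq_zero.mp (hpow n _ (by rw [mul_sub, h1, sub_self]))

/-- The Witt coordinates of the Witt vector with ghost components `a, τ a, τ² a, …`. -/
def diagCoeff (p : ℕ) (τ : A →+* A) (a : A) (n : ℕ) : A :=
  Classical.epsilon fun y : A => (p : A) ^ n * y =
    τ^[n] a - ∑ i : Fin n, (p : A) ^ (i : ℕ) * diagCoeff p τ a i ^ p ^ (n - (i : ℕ))
  termination_by n
  decreasing_by exact i.2

theorem diagCoeff_spec {τ : A →+* A} (hτ : ∀ a : A, (p : A) ∣ τ a - a ^ p) (a : A) (n : ℕ) :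
    ∑ i ∈ Finset.range (n + 1), (p : A) ^ i * diagCoeff p τ a i ^ p ^ (n - i) = τ^[n] a := by
  induction n with
  | zero =>
    have h : ∃ y : A, (p : A) ^ 0 * y =
        τ^[0] a - ∑ i : Fin 0, (p : A) ^ (i : ℕ) * diagCoeff p τ a i ^ p ^ (0 - (i : ℕ)) :=
      ⟨a, by simp⟩
    have := Classical.epsilon_spec h
    rw [← diagCoeff] at this
    simpa using this
  | succ n ih =>
    have h : ∃ y : A, (p : A) ^ (n + 1) * y = τ^[n + 1] a -
        ∑ i : Fin (n + 1), (p : A) ^ (i : ℕ) * diagCoeff p τ a i ^ p ^ (n + 1 - (i : ℕ)) := by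
      suffices hd : (p : A) ^ (n + 1) ∣ τ^[n + 1] a -
          ∑ i : Fin (n + 1), (p : A) ^ (i : ℕ) * diagCoeff p τ a i ^ p ^ (n + 1 - (i : ℕ)) by
        obtain ⟨y, hy⟩ := hd
        exact ⟨y, hy.symm⟩
      rw [Function.iterate_succ_apply', ← ih, map_sum, Finset.sum_range, ← Finset.sum_sub_distrib]
      refine Finset.dvd_sum fun i _ => ?_
      have hi : (i : ℕ) ≤ n := Nat.lt_succ_iff.mp i.2
      rw [map_mul, map_pow, map_pow, map_natCast, ← mul_sub,
        show n + 1 - (i : ℕ) = (n - i) + 1 by omega, pow_succ' p (n - i), pow_mul]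
      conv_lhs => rw [show n + 1 = (i : ℕ) + ((n - i) + 1) by omega, pow_add]
      exact mul_dvd_mul_left _ (dvd_sub_pow_of_dvd_sub (hτ _) _)
    have := Classical.epsilon_spec h
    rw [← diagCoeff] at this
    rw [Finset.sum_range_succ, Finset.sum_range]
    simp only [Nat.sub_self, pow_zero, pow_one]
    rw [this]
    ring

/-- Cartier's diagonal `A → W(A)` of a ring without `p`-torsion and with a Frobenius lift `τ`:
the ring homomorphism `a ↦ (a, τ a, τ² a, …)` in ghost components. -/
def cartierDiagonal [Fact p.Prime] (τ : A →+* A) (hp : ∀ a : A, (p : A) * a = 0 → a = 0)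
    (hτ : ∀ a : A, (p : A) ∣ τ a - a ^ p) : A →+* WittVector p A :=
  have hg : ∀ (a : A) (n : ℕ),
      WittVector.ghostComponent n (WittVector.mk p (diagCoeff p τ a)) = τ^[n] a := fun a n => by
    rw [ghostComponent_eq_sum]
    exact diagCoeff_spec hτ a n
  { toFun := fun a => WittVector.mk p (diagCoeff p τ a)
    map_one' := ghost_ext hp fun n => by rw [hg, map_one, iterate_map_one]
    map_zero' := ghost_ext hp fun n => by rw [hg, map_zero, iterate_map_zero]
    map_mul' := fun a b => ghost_ext hp fun n => by
      rw [map_mul, hg, hg, hg, iterate_map_mul]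
    map_add' := fun a b => ghost_ext hp fun n => by
      rw [map_add, hg, hg, hg, iterate_map_add] }

theorem ghostComponent_cartierDiagonal [Fact p.Prime] (τ : A →+* A)
    (hp : ∀ a : A, (p : A) * a = 0 → a = 0)
    (hτ : ∀ a : A, (p : A) ∣ τ a - a ^ p) (a : A) (n : ℕ) :
    WittVector.ghostComponent n (cartierDiagonal τ hp hτ a) = τ^[n] a := by
  rw [ghostComponent_eq_sum]
  exact diagCoeff_spec hτ a n

end Diagonal

/-! ### The rings `W(R)` as algebras over `ℤ_p = W(𝔽_p)` and over `W(k)` -/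

section Structure

variable {p : ℕ} [Fact p.Prime]

/-- Ring homomorphisms from `ℤ_p` to a `p`-adically separated ring are unique. -/
theorem padicInt_hom_ext {A : Type u} [CommRing A] [IsHausdorff (Ideal.span {(p : A)}) A]
    (f g : ℤ_[p] →+* A) : f = g := by
  ext z
  refine (IsHausdorff.eq_iff_smodEq (I := Ideal.span {(p : A)})).mpr fun n => ?_
  rw [SModEq.sub_mem, smul_eq_mul, Ideal.mul_top, Ideal.span_singleton_pow,
    Ideal.mem_span_singleton]
  obtain ⟨y, hy⟩ := Ideal.mem_span_singleton.mp (PadicInt.appr_spec n z)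
  have hz : z = z.appr n + (p : ℤ_[p]) ^ n * y := by rw [← hy]; ring
  refine ⟨f y - g y, ?_⟩
  conv_lhs => rw [hz]
  simp only [map_add, map_mul, map_pow, map_natCast]
  ring

theorem padicInt_frobenius (z : ℤ_[p]) : (p : ℤ_[p]) ∣ RingHom.id ℤ_[p] z - z ^ p := by
  have h : z - z ^ p ∈ RingHom.ker (PadicInt.toZMod : ℤ_[p] →+* ZMod p) := by
    rw [RingHom.mem_ker, map_sub, map_pow, ZMod.pow_card, sub_self]
  rwa [PadicInt.ker_toZMod, PadicInt.maximalIdeal_eq_span_p, Ideal.mem_span_singleton] at h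

/-- The diagonal `ℤ_p = W(𝔽_p) → W(W(𝔽_p)) = W(ℤ_p)`. -/
def padicDiagonal (p : ℕ) [Fact p.Prime] : ℤ_[p] →+* WittVector p ℤ_[p] :=
  cartierDiagonal (RingHom.id ℤ_[p])
    (fun _ ha => (mul_eq_zero.mp ha).resolve_left (NeZero.ne (p : ℤ_[p]))) padicInt_frobenius

/-- For a `ℤ_p`-algebra `R`, the ring `W(R)` is a `ℤ_p`-algebra through `ℤ_p → W(ℤ_p) → W(R)`. -/
instance wittAlgebra (R : Type u) [CommRing R] [Algebra ℤ_[p] R] :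
    Algebra ℤ_[p] (WittVector p R) :=
  ((WittVector.map (algebraMap ℤ_[p] R)).comp (padicDiagonal p)).toAlgebra

/-- `W(k)` is an algebra over `ℤ_p = W(𝔽_p)` by functoriality, if `k` has characteristic `p`. -/
instance wittAlgebraOfCharP (k : Type w) [CommRing k] [CharP k p] :
    Algebra ℤ_[p] (WittVector p k) :=
  ((WittVector.map (ZMod.castHom (dvd_refl p) k)).comp
    (WittVector.equiv p).symm.toRingHom).toAlgebra

theorem algebraMap_witt (R : Type u) [CommRing R] [Algebra ℤ_[p] R] (z : ℤ_[p]) :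
    algebraMap ℤ_[p] (WittVector p R) z =
      WittVector.map (algebraMap ℤ_[p] R) (padicDiagonal p z) := rfl

theorem ghostComponent_padicDiagonal (z : ℤ_[p]) (n : ℕ) :
    WittVector.ghostComponent n (padicDiagonal p z) = z := by
  rw [padicDiagonal, ghostComponent_cartierDiagonal]
  exact Function.iterate_fixed rfl n

theorem ghostComponent_map {A B : Type*} [CommRing A] [CommRing B] (f : A →+* B)
    (x : WittVector p A) (n : ℕ) :
    WittVector.ghostComponent n (WittVector.map f x) = f (WittVector.ghostComponent n x) := by
  simp [ghostComponent_eq_sum, WittVector.map_coeff]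

theorem frobenius_map {A B : Type*} [CommRing A] [CommRing B] (f : A →+* B)
    (x : WittVector p A) :
    WittVector.frobenius (WittVector.map f x) = WittVector.map f (WittVector.frobenius x) := by
  ext n
  rw [WittVector.coeff_frobenius, WittVector.map_coeff, WittVector.coeff_frobenius,
    MvPolynomial.aeval_def, MvPolynomial.aeval_def, MvPolynomial.eval₂_comp_left,
    RingHom.ext_int (f.comp (algebraMap ℤ A)) (algebraMap ℤ B)]
  rfl

variable (p) in
/-- `W(φ) : W(R) → W(R')` as a homomorphism of `ℤ_p`-algebras. -/
def wittMap {R R' : Type*} [CommRing R] [CommRing R'] [Algebra ℤ_[p] R] [Algebra ℤ_[p] R']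
    (φ : R →ₐ[ℤ_[p]] R') : WittVector p R →ₐ[ℤ_[p]] WittVector p R' :=
  { WittVector.map (φ : R →+* R') with
    commutes' := fun z => by
      change WittVector.map (φ : R →+* R') (algebraMap ℤ_[p] (WittVector p R) z) = _
      rw [algebraMap_witt, algebraMap_witt]
      ext n
      simp [WittVector.map_coeff] }

variable (p) in
/-- The Frobenius `F : W(R) → W(R)` as a homomorphism of `ℤ_p`-algebras. -/
def wittFrob (R : Type u) [CommRing R] [Algebra ℤ_[p] R] :
    WittVector p R →ₐ[ℤ_[p]] WittVector p R :=
  { (WittVector.frobenius : WittVector p R →+* WittVector p R) with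
    commutes' := fun z => by
      change WittVector.frobenius (algebraMap ℤ_[p] (WittVector p R) z) = _
      have h : WittVector.frobenius (padicDiagonal p z) = padicDiagonal p z :=
        ghost_ext (fun _ ha => (mul_eq_zero.mp ha).resolve_left (NeZero.ne (p : ℤ_[p])))
          fun n => by
            rw [WittVector.ghostComponent_frobenius, ghostComponent_padicDiagonal,
              ghostComponent_padicDiagonal]
      rw [algebraMap_witt, frobenius_map, h] }

variable (p) in
/-- The zeroth ghost component `w₀ : W(R) → R` as a homomorphism of `ℤ_p`-algebras. -/
def wittZero (R : Type u) [CommRing R] [Algebra ℤ_[p] R] : WittVector p R →ₐ[ℤ_[p]] R :=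
  { (WittVector.ghostComponent 0 : WittVector p R →+* R) with
    commutes' := fun z => by
      change WittVector.ghostComponent 0 (algebraMap ℤ_[p] (WittVector p R) z) = _
      rw [algebraMap_witt, ghostComponent_map, ghostComponent_padicDiagonal] }

section BaseField

variable {k : Type w} [Field k] [Finite k] [CharP k p]

theorem wittField_torsionFree (a : WittVector p k) (h : (p : WittVector p k) * a = 0) : a = 0 :=
  WittVector.eq_zero_of_p_mul_eq_zero a (by rw [mul_comm]; exact h)

theorem wittField_frobenius (a : WittVector p k) :
    (p : WittVector p k) ∣ WittVector.frobenius a - a ^ p := by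
  rw [← Ideal.mem_span_singleton, WittVector.mem_span_p_iff_coeff_zero_eq_zero]
  change WittVector.constantCoeff (WittVector.frobenius a - a ^ p) = 0
  rw [map_sub, map_pow, sub_eq_zero]
  exact WittVector.coeff_frobenius_charP p a 0

/-- The diagonal `Δ : W(k) → W(W(k))` as a homomorphism of `ℤ_p`-algebras. -/
def wittDiagonal (p : ℕ) [Fact p.Prime] (k : Type w) [Field k] [Finite k] [CharP k p] :
    WittVector p k →ₐ[ℤ_[p]] WittVector p (WittVector p k) :=
  { cartierDiagonal WittVector.frobenius wittField_torsionFree wittField_frobenius with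
    commutes' := fun z => by
      refine ghost_ext wittField_torsionFree fun n => ?_
      change WittVector.ghostComponent n (cartierDiagonal WittVector.frobenius
        wittField_torsionFree wittField_frobenius (algebraMap ℤ_[p] (WittVector p k) z)) = _
      rw [ghostComponent_cartierDiagonal, algebraMap_witt, ghostComponent_map,
        ghostComponent_padicDiagonal, ← RingHom.coe_pow, ← RingHom.comp_apply,
        padicInt_hom_ext ((WittVector.frobenius ^ n).comp (algebraMap ℤ_[p] (WittVector p k)))] }

/-- The `W(k)`-algebra structure `W(k) → W(W(k)) → W(R)` of `W(R)`, for a `W(k)`-algebra `R` with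
structure map `c`. -/
def wittStr {R : Type u} [CommRing R] [Algebra ℤ_[p] R] (c : WittVector p k →ₐ[ℤ_[p]] R) :
    WittVector p k →ₐ[ℤ_[p]] WittVector p R :=
  (wittMap p c).comp (wittDiagonal p k)

end BaseField

end Structure

/-! ### Points of the group scheme `G = Spec O` -/

section Points

variable (p : ℕ) [Fact p.Prime] (O : Type v) [CommRing O] [HopfAlgebra ℤ_[p] O]

/-- The set `G(S)` of `S`-valued points of the affine group scheme `G = Spec O` over `ℤ_p`. -/
def Pt (S : Type*) [CommRing S] [Algebra ℤ_[p] S] : Type _ := WithConv (O →ₐ[ℤ_[p]] S)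

variable {O} {S S' : Type*} [CommRing S] [Algebra ℤ_[p] S] [CommRing S'] [Algebra ℤ_[p] S']

/-- The `S`-valued point with the given comorphism. -/
def Pt.mk (f : O →ₐ[ℤ_[p]] S) : Pt p O S := WithConv.toConv f

variable {p}

/-- The comorphism `O → S` of an `S`-valued point. -/
def Pt.hom (g : Pt p O S) : O →ₐ[ℤ_[p]] S := WithConv.ofConv g

instance Pt.monoid : Monoid (Pt p O S) := inferInstanceAs (Monoid (WithConv (O →ₐ[ℤ_[p]] S)))

/-- The group structure of `G(S)`: multiplication is given by the comultiplication of `O`, and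
inversion by the antipode. -/
instance Pt.group : Group (Pt p O S) :=
  { Pt.monoid with
    inv := fun g => Pt.mk p (g.hom.comp (HopfAlgebra.antipodeAlgHom ℤ_[p] O))
    inv_mul_cancel := fun g => by
      have H : (Algebra.TensorProduct.lmul' ℤ_[p]).comp
          (Algebra.TensorProduct.map g.hom g.hom) =
          g.hom.comp (Algebra.TensorProduct.lmul' ℤ_[p]) := by ext <;> simp
      have e : (Algebra.TensorProduct.lmul' ℤ_[p]).comp
          ((Algebra.TensorProduct.map (g.hom.comp (HopfAlgebra.antipodeAlgHom ℤ_[p] O))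
            g.hom).comp (Bialgebra.comulAlgHom ℤ_[p] O)) =
          (Algebra.ofId ℤ_[p] S).comp (Bialgebra.counitAlgHom ℤ_[p] O) := by
        have e1 : Algebra.TensorProduct.map (g.hom.comp (HopfAlgebra.antipodeAlgHom ℤ_[p] O))
            g.hom = (Algebra.TensorProduct.map g.hom g.hom).comp
              (Algebra.TensorProduct.map (HopfAlgebra.antipodeAlgHom ℤ_[p] O)
                (AlgHom.id ℤ_[p] O)) := by ext <;> simp
        rw [e1, AlgHom.comp_assoc, ← AlgHom.comp_assoc, H, AlgHom.comp_assoc]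
        ext x
        have := congrArg g.hom (HopfAlgebra.mul_antipode_rTensor_comul_apply (R := ℤ_[p]) x)
        simp only [LinearMap.rTensor, AlgHom.commutes] at this
        exact this
      exact congrArg WithConv.toConv e }

/-- Functoriality `G(S) → G(S')` of points. -/
def Pt.map (φ : S →ₐ[ℤ_[p]] S') : Pt p O S →* Pt p O S' where
  toFun g := Pt.mk p (φ.comp g.hom)
  map_one' := by
    refine congrArg WithConv.toConv (AlgHom.ext fun x => ?_)
    change φ (algebraMap ℤ_[p] S (Coalgebra.counit x)) = algebraMap ℤ_[p] S' (Coalgebra.counit x)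
    simp
  map_mul' g h := congrArg WithConv.toConv (AlgHom.comp_convMul_distrib φ g h)

/-- The Lie algebra `Lie(G)(S) = S ⊗ 𝔤`, as the `S`-module of `S`-valued derivations of `O` at the
unit section. -/
def lieAlg (p : ℕ) [Fact p.Prime] (O : Type v) [CommRing O] [HopfAlgebra ℤ_[p] O]
    (S : Type*) [CommRing S] [Algebra ℤ_[p] S] : Submodule S (O →ₗ[ℤ_[p]] S) where
  carrier := {d | ∀ x y : O, d (x * y) =
    (Coalgebra.counit x : ℤ_[p]) • d y + (Coalgebra.counit y : ℤ_[p]) • d x}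
  add_mem' := fun {d e} hd he x y => by
    simp only [LinearMap.add_apply, hd x y, he x y, smul_add]
    abel
  zero_mem' := fun x y => by simp
  smul_mem' := fun s d hd x y => by
    simp only [LinearMap.smul_apply, hd x y, smul_add, smul_comm s]

/-- The adjoint action `Ad(g) d = g d g⁻¹`, the products being taken in the convolution algebra
(the algebra of `S`-valued distributions). -/
def adj (g : Pt p O S) (d : O →ₗ[ℤ_[p]] S) : O →ₗ[ℤ_[p]] S :=
  (WithConv.toConv g.hom.toLinearMap * WithConv.toConv d *
    WithConv.toConv (g⁻¹).hom.toLinearMap).ofConv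

end Points

/-! ### Cocharacters, the subgroups `G⁻` and `G⁺` -/

section Cocharacter

/-- The inclusion of constants `S → S[T, T⁻¹]`. -/
def constLaurent (p : ℕ) [Fact p.Prime] (S : Type*) [CommRing S] [Algebra ℤ_[p] S] :
    S →ₐ[ℤ_[p]] S[T;T⁻¹] :=
  (Algebra.ofId S S[T;T⁻¹]).restrictScalars ℤ_[p]

/-- The inclusion `S[T] → S[T, T⁻¹]`. -/
def polyLaurent (p : ℕ) [Fact p.Prime] (S : Type*) [CommRing S] [Algebra ℤ_[p] S] :
    S[X] →ₐ[ℤ_[p]] S[T;T⁻¹] :=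
  (Polynomial.toLaurentAlg : S[X] →ₐ[S] S[T;T⁻¹]).restrictScalars ℤ_[p]

/-- Evaluation `S[T] → S` at `s`. -/
def evalPoly (p : ℕ) [Fact p.Prime] {S : Type*} [CommRing S] [Algebra ℤ_[p] S] (s : S) :
    S[X] →ₐ[ℤ_[p]] S :=
  (Polynomial.aeval s : S[X] →ₐ[S] S).restrictScalars ℤ_[p]

/-- The `ℤ_p`-linear map `S[T, T⁻¹] → S` that discards the negative powers of `T` and evaluates at
`s`. -/
def evalTrunc (p : ℕ) [Fact p.Prime] {S : Type*} [CommRing S] [Algebra ℤ_[p] S] (s : S) :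
    S[T;T⁻¹] →ₗ[ℤ_[p]] S where
  toFun f := (LaurentPolynomial.trunc f).eval s
  map_add' f g := by simp
  map_smul' r f := by
    have h : LaurentPolynomial.trunc (algebraMap ℤ_[p] S r • f) =
        algebraMap ℤ_[p] S r • LaurentPolynomial.trunc f := by
      induction f using LaurentPolynomial.induction_on' with
      | add f g hf hg => simp only [smul_add, map_add, hf, hg]
      | C_mul_T n a =>
        rw [LaurentPolynomial.smul_eq_C_mul, ← mul_assoc, ← map_mul,
          LaurentPolynomial.trunc_C_mul_T, LaurentPolynomial.trunc_C_mul_T]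
        split_ifs
        · rw [Polynomial.smul_monomial, smul_eq_mul]
        · rw [smul_zero]
    rw [← algebraMap_smul S r f, h, RingHom.id_apply, Polynomial.eval_smul, smul_eq_mul,
      Algebra.smul_def]

variable {p : ℕ} [Fact p.Prime] {k : Type w} [Field k] [Finite k] [CharP k p]
  {O : Type v} [CommRing O] [HopfAlgebra ℤ_[p] O]
  {S : Type*} [CommRing S] [Algebra ℤ_[p] S]

variable (p k O) in
/-- Cocharacters `μ : 𝔾_m → G` over `W(k)`. -/
abbrev Cochar : Type _ :=
  (WittVector p k ⊗[ℤ_[p]] O) →ₐc[WittVector p k] (WittVector p k)[T;T⁻¹]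

/-- The point `μ(T) ∈ G(W(k)[T, T⁻¹])`. -/
def Cochar.univ (μ : Cochar p k O) : O →ₐ[ℤ_[p]] (WittVector p k)[T;T⁻¹] :=
  ((μ : (WittVector p k ⊗[ℤ_[p]] O) →ₐ[WittVector p k]
    (WittVector p k)[T;T⁻¹]).restrictScalars ℤ_[p]).comp Algebra.TensorProduct.includeRight

/-- The point `μ(T) ∈ G(S[T, T⁻¹])`, for a `W(k)`-algebra `S` with structure map `c`. -/
def Cochar.gen (μ : Cochar p k O) (c : WittVector p k →ₐ[ℤ_[p]] S) : Pt p O S[T;T⁻¹] :=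
  Pt.mk p ((AddMonoidAlgebra.mapAlgHom ℤ c).comp μ.univ)

/-- The point `μ(z) ∈ G(S)` for a unit `z` of a `W(k)`-algebra `S` with structure map `c`. -/
def Cochar.atUnit (μ : Cochar p k O) (c : WittVector p k →ₐ[ℤ_[p]] S) (z : Sˣ) : Pt p O S :=
  Pt.mk p (AlgHom.comp
    { LaurentPolynomial.eval₂ (c : WittVector p k →+* S) z with
      commutes' := fun r => by
        change LaurentPolynomial.eval₂ (c : WittVector p k →+* S) z
          (algebraMap ℤ_[p] (WittVector p k)[T;T⁻¹] r) = _
        rw [LaurentPolynomial.algebraMap_apply, LaurentPolynomial.eval₂_C]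
        exact c.commutes r } μ.univ)

/-- `G⁻(S)`: the points `g` of `G` for which `μ(T)⁻¹ g μ(T)` extends from `𝔾_m` to `𝔸¹`. -/
def Cochar.neg (μ : Cochar p k O) (c : WittVector p k →ₐ[ℤ_[p]] S) : Subgroup (Pt p O S) :=
  (Pt.map (polyLaurent p S)).range.comap
    ((MulAut.conj (μ.gen c)⁻¹).toMonoidHom.comp (Pt.map (constLaurent p S)))

/-- `G⁺(S)`: the points `g` of `G` for which `μ(T) g μ(T)⁻¹` extends from `𝔾_m` to `𝔸¹` with
value `1` at `T = 0`. -/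
def Cochar.pos (μ : Cochar p k O) (c : WittVector p k →ₐ[ℤ_[p]] S) : Subgroup (Pt p O S) :=
  ((Pt.map (evalPoly p (0 : S))).ker.map (Pt.map (polyLaurent p S))).comap
    ((MulAut.conj (μ.gen c)).toMonoidHom.comp (Pt.map (constLaurent p S)))

/-- `μ` is a `Φ`-datum: the only weight of `𝔤⁺`, the sum of the weight spaces of positive weight
of `W(k) ⊗ 𝔤`, is `1`, and `G` has connected fibres over `W(k)`. -/
structure Cochar.IsPhiDatum (μ : Cochar p k O) : Prop where
  weight : ∀ n : ℤ, 0 < n → n ≠ 1 → ∀ d ∈ lieAlg p O (WittVector p k),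
    adj (μ.gen (AlgHom.id ℤ_[p] (WittVector p k)))
        ((constLaurent p (WittVector p k)).toLinearMap ∘ₗ d) =
      (LaurentPolynomial.T n : (WittVector p k)[T;T⁻¹]) •
        ((constLaurent p (WittVector p k)).toLinearMap ∘ₗ d) → d = 0
  connected : ∀ q : PrimeSpectrum (WittVector p k),
    ConnectedSpace (PrimeSpectrum (q.asIdeal.Fiber (WittVector p k ⊗[ℤ_[p]] O)))

/-- The endomorphism `p · Ad(μ(p))⁻¹` of `S ⊗ 𝔤`, i.e. the value at `T = p` of `T · Ad(μ(T))⁻¹`,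
which is a polynomial in `T` as the weights of `𝔤` are at most `1`. -/
def Cochar.beta (μ : Cochar p k O) (c : WittVector p k →ₐ[ℤ_[p]] S) (d : O →ₗ[ℤ_[p]] S) :
    O →ₗ[ℤ_[p]] S :=
  evalTrunc p (p : S) ∘ₗ ((LaurentPolynomial.T 1 : S[T;T⁻¹]) •
    adj (μ.gen c)⁻¹ ((constLaurent p S).toLinearMap ∘ₗ d))

/-- The `τ`-linear endomorphism `F♭ = Ad(U) ∘ (τ ⊗ id) ∘ p Ad(μ(p))⁻¹` of `S ⊗ 𝔤`. -/
def Cochar.frobFlat (μ : Cochar p k O) (c : WittVector p k →ₐ[ℤ_[p]] S) (τ : S →ₐ[ℤ_[p]] S)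
    (U : Pt p O S) (d : O →ₗ[ℤ_[p]] S) : O →ₗ[ℤ_[p]] S :=
  adj U (τ.toLinearMap ∘ₗ μ.beta c d)

/-- The realization of `U` in the adjoint representation is `F`-nilpotent: some iterate of `F♭`
maps `S ⊗ 𝔤` into `p (S ⊗ 𝔤)`. -/
def Cochar.IsFNilpotent (μ : Cochar p k O) (c : WittVector p k →ₐ[ℤ_[p]] S)
    (τ : S →ₐ[ℤ_[p]] S) (U : Pt p O S) : Prop :=
  ∃ n : ℕ, ∀ d ∈ lieAlg p O S, ∃ d' ∈ lieAlg p O S, (μ.frobFlat c τ U)^[n] d = (p : S) • d'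

end Cocharacter

/-! ### Groupoids of twisted conjugacy classes -/

section TwistedConj

variable {X : Type u} {Y : Type v} [Group X] [Group Y]

/-- Objects of the groupoid attached to a homomorphism `φ : K → Y` from a subgroup `K` of `X` to a
group `Y` to which `X` is mapped by `ι`: the elements of `X` with the property `N`. -/
structure TwistedConj (ι : X →* Y) (K : Subgroup X) (φ : K →* Y) (N : X → Prop) where
  /-- the underlying element -/
  pt : X
  prop : N pt

namespace TwistedConj

variable {ι : X →* Y} {K : Subgroup X} {φ : K →* Y} {N : X → Prop}

/-- A morphism `U' → U` is an element `h` of `K` with `U' = h⁻¹ U φ(h)`. -/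
@[ext]
structure Hom (U' U : TwistedConj ι K φ N) where
  /-- the underlying element -/
  elt : K
  eq : ι U'.pt = (ι elt)⁻¹ * ι U.pt * φ elt

/-- Composition of morphisms is multiplication: `U'' → U' → U` given by `h'` and `h` is `h h'`. -/
instance : CategoryTheory.Groupoid (TwistedConj ι K φ N) where
  Hom := Hom
  id U := ⟨1, by simp⟩
  comp f g := ⟨g.elt * f.elt, by
    rw [f.eq, g.eq]
    simp only [Subgroup.coe_mul, map_mul, mul_inv_rev, mul_assoc]⟩
  inv f := ⟨f.elt⁻¹, by
    rw [f.eq]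
    simp [mul_assoc]⟩
  id_comp f := Hom.ext (mul_one _)
  comp_id f := Hom.ext (one_mul _)
  assoc f g h := Hom.ext (mul_assoc _ _ _).symm
  inv_comp f := Hom.ext (mul_inv_cancel _)
  comp_inv f := Hom.ext (inv_mul_cancel _)

/-- The element of `X` that underlies a morphism. -/
def elt {U' U : TwistedConj ι K φ N} (h : U' ⟶ U) : X := (Hom.elt h : X)

end TwistedConj

end TwistedConj

/-! ### Frames and windows -/

section Windows

variable {p : ℕ} [Fact p.Prime] {k : Type w} [Field k] [Finite k] [CharP k p]
  {O : Type v} [CommRing O] [HopfAlgebra ℤ_[p] O]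

variable (p k) in
/-- The structure map of a `W(k)`-algebra. -/
def baseMap (R : Type u) [CommRing R] [Algebra (WittVector p k) R] [Algebra ℤ_[p] R]
    [IsScalarTower ℤ_[p] (WittVector p k) R] : WittVector p k →ₐ[ℤ_[p]] R :=
  IsScalarTower.toAlgHom ℤ_[p] (WittVector p k) R

variable (p k) in
/-- `(A, J, τ)` is a frame over `W(k)`. -/
structure IsFrame (A : Type u) [CommRing A] [Algebra (WittVector p k) A] (J : Ideal A)
    (τ : A →+* A) : Prop where
  complete : IsAdicComplete (Ideal.span {(p : A)}) A
  frobenius : ∀ a : A, (p : A) ∣ τ a - a ^ p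
  torsionFree : Module.IsTorsionFree (WittVector p k) A
  pd : Nonempty (DividedPowers J)
  pow_mem : ∃ n : ℕ, (p : A) ^ n ∈ J

namespace IsFrame

variable {A : Type u} [CommRing A] [Algebra (WittVector p k) A] {J : Ideal A} {τ : A →+* A}

theorem eq_zero_of_p_mul (h : IsFrame p k A J τ) (a : A) (ha : (p : A) * a = 0) : a = 0 := by
  have := h.torsionFree
  have hr : IsRegular (p : WittVector p k) := by
    rw [← isLeftRegular_iff_isRegular, isLeftRegular_iff_right_eq_zero_of_mul]
    exact wittField_torsionFree
  refine hr.isSMulRegular (M := A) ?_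
  simpa [Algebra.smul_def] using ha

variable [Algebra ℤ_[p] A]

/-- The Frobenius lift of a frame is automatically `ℤ_p`-linear. -/
def tau (h : IsFrame p k A J τ) : A →ₐ[ℤ_[p]] A :=
  { τ with
    commutes' := fun z => by
      have := h.complete
      exact DFunLike.congr_fun (padicInt_hom_ext (τ.comp (algebraMap ℤ_[p] A)) _) z }

/-- Cartier's diagonal `δ : A → W(A)` of a frame. -/
def diag (h : IsFrame p k A J τ) : A →ₐ[ℤ_[p]] WittVector p A :=
  { cartierDiagonal τ h.eq_zero_of_p_mul h.frobenius with
    commutes' := fun z => by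
      refine ghost_ext h.eq_zero_of_p_mul fun n => ?_
      change WittVector.ghostComponent n (cartierDiagonal τ h.eq_zero_of_p_mul h.frobenius
        (algebraMap ℤ_[p] A z)) = _
      rw [ghostComponent_cartierDiagonal, algebraMap_witt, ghostComponent_map,
        ghostComponent_padicDiagonal]
      exact Function.iterate_fixed (h.tau.commutes z) n }

end IsFrame

variable {A : Type u} [CommRing A] [Algebra ℤ_[p] A]

variable (p A) in
/-- The localization map `A → A[1/p]`. -/
def toLoc : A →ₐ[ℤ_[p]] Localization.Away (p : A) :=
  IsScalarTower.toAlgHom ℤ_[p] A (Localization.Away (p : A))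

/-- The extension `A[1/p] → A[1/p]` of an endomorphism `τ` of `A`. -/
def locMap (τ : A →ₐ[ℤ_[p]] A) :
    Localization.Away (p : A) →ₐ[ℤ_[p]] Localization.Away (p : A) :=
  IsLocalization.liftAlgHom (M := Submonoid.powers (p : A)) (f := (toLoc p A).comp τ) (by
    rintro ⟨_, n, rfl⟩
    have h : IsUnit (toLoc p A (p : A)) :=
      IsLocalization.Away.algebraMap_isUnit (S := Localization.Away (p : A)) (p : A)
    simpa using h.pow n)

variable (p A) in
/-- `p` as a unit of `A[1/p]`. -/
def pUnit : (Localization.Away (p : A))ˣ :=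
  (IsLocalization.Away.algebraMap_isUnit (S := Localization.Away (p : A)) (p : A)).unit

/-- The group generated by `G⁻(A)` and the kernel of `G⁺(A) → G⁺(A/J)`; if `J` is contained in the
radical of `A` then it is the product of these two groups. -/
def Cochar.hatNeg (μ : Cochar p k O) (c : WittVector p k →ₐ[ℤ_[p]] A) (J : Ideal A) :
    Subgroup (Pt p O A) :=
  μ.neg c ⊔ (μ.pos c ⊓ (Pt.map (Ideal.Quotient.mkₐ ℤ_[p] J)).ker)

/-- The map `τ ∘ Int(μ(p)⁻¹)`, as a homomorphism from `G(A)` to `G(A[1/p])`. -/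
def Cochar.windowTwist (μ : Cochar p k O) (c : WittVector p k →ₐ[ℤ_[p]] A)
    (τ : A →ₐ[ℤ_[p]] A) : Pt p O A →* Pt p O (Localization.Away (p : A)) :=
  (Pt.map (locMap τ)).comp
    ((MulAut.conj (μ.atUnit ((toLoc p A).comp c) (pUnit p A))⁻¹).toMonoidHom.comp
      (Pt.map (toLoc p A)))

/-- The groupoid of nilpotent windows with `G`-structure over `(A, J, τ)`: its objects are the
`U ∈ G(A)` that satisfy the nilpotence condition, and morphisms `U' → U` are elements `h` of
`Ĝ⁻_J(A)` with `U' = h⁻¹ U τ(μ(p)⁻¹ h μ(p))` in `G(A[1/p])`. -/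
abbrev NilpWindow (μ : Cochar p k O) (c : WittVector p k →ₐ[ℤ_[p]] A) (τ : A →ₐ[ℤ_[p]] A)
    (J : Ideal A) : Type _ :=
  TwistedConj (Pt.map (toLoc p A)) (μ.hatNeg c J)
    ((μ.windowTwist c τ).comp (μ.hatNeg c J).subtype) (μ.IsFNilpotent c τ)

end Windows

/-! ### Banal displays -/

section Displays

variable {p : ℕ} [Fact p.Prime] {k : Type w} [Field k] [Finite k] [CharP k p]
  {O : Type v} [CommRing O] [HopfAlgebra ℤ_[p] O] {R : Type u} [CommRing R] [Algebra ℤ_[p] R]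

/-- The group of all `g ∈ G(W(R))` with `w₀(g) ∈ G⁻(R)`. -/
def Cochar.displayGroup (μ : Cochar p k O) (c : WittVector p k →ₐ[ℤ_[p]] R) :
    Subgroup (Pt p O (WittVector p R)) :=
  (μ.neg c).comap (Pt.map (wittZero p R))

/-- A homomorphism `Φ` from the display group to `G(W(R))` is the twisted Frobenius if
* on `G⁻(W(R))` it is `F ∘ Int(μ(p)⁻¹)`, where `Int(μ(p)⁻¹) g` is the value at `T = p` of the
  extension `γ` of `μ(T)⁻¹ g μ(T)` to `𝔸¹`;
* on the kernel of `w₀ : G⁺(W(R)) → G⁺(R)` it is `V⁻¹`: as `G⁺` is a vector group on which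
  conjugation by `μ(T)` is multiplication by `T`, the linear coordinates of `g` are the coefficients
  of `T` in the extension `γ` of `μ(T) g μ(T)⁻¹` to `𝔸¹`, and `Φ g` is the element of the
  Frobenius pull-back of `G⁺` of which the linear coordinates have these as Verschiebungs. -/
structure Cochar.IsTwistedFrobenius (μ : Cochar p k O) (c : WittVector p k →ₐ[ℤ_[p]] R)
    (Φ : μ.displayGroup c →* Pt p O (WittVector p R)) : Prop where
  on_neg : ∀ (g : μ.displayGroup c) (γ : Pt p O (WittVector p R)[X]),
    Pt.map (polyLaurent p (WittVector p R)) γ =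
        (μ.gen (wittStr c))⁻¹ * Pt.map (constLaurent p (WittVector p R)) g * μ.gen (wittStr c) →
      Φ g = Pt.map (wittFrob p R) (Pt.map (evalPoly p (p : WittVector p R)) γ)
  on_pos : ∀ (g : μ.displayGroup c) (γ : Pt p O (WittVector p R)[X]),
    Pt.map (wittZero p R) g.1 = 1 →
    Pt.map (polyLaurent p (WittVector p R)) γ =
        μ.gen (wittStr c) * Pt.map (constLaurent p (WittVector p R)) g * (μ.gen (wittStr c))⁻¹ →
    Pt.map (evalPoly p (0 : WittVector p R)) γ = 1 →
      ∃ γ' : Pt p O (WittVector p R)[X],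
        Pt.map (polyLaurent p (WittVector p R)) γ' =
            μ.gen ((wittFrob p R).comp (wittStr c)) *
              Pt.map (constLaurent p (WittVector p R)) (Φ g) *
              (μ.gen ((wittFrob p R).comp (wittStr c)))⁻¹ ∧
          Pt.map (evalPoly p (0 : WittVector p R)) γ' = 1 ∧
          ∀ x : O, (γ.hom x).coeff 1 = WittVector.verschiebung ((γ'.hom x).coeff 1)

/-- The twisted Frobenius. -/
def Cochar.twistedFrobenius (μ : Cochar p k O) (c : WittVector p k →ₐ[ℤ_[p]] R) :
    μ.displayGroup c →* Pt p O (WittVector p R) :=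
  Classical.epsilon (μ.IsTwistedFrobenius c)

/-- The base change of `U ∈ G(W(R))` along `φ : R → R'` has an `F`-nilpotent realization in the
adjoint representation. -/
def Cochar.IsFNilpotentAlong (μ : Cochar p k O) (c : WittVector p k →ₐ[ℤ_[p]] R)
    {R' : Type u} [CommRing R'] (φ : R →+* R') (U : Pt p O (WittVector p R)) : Prop :=
  letI : Algebra ℤ_[p] R' := (φ.comp (algebraMap ℤ_[p] R)).toAlgebra
  letI φ' : R →ₐ[ℤ_[p]] R' := { φ with commutes' := fun _ => rfl }
  μ.IsFNilpotent (wittStr (φ'.comp c)) (wittFrob p R') (Pt.map (wittMap p φ') U)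

/-- The canonical ring homomorphism from `B` to the sections of the structure sheaf of `Spec B`
over an open subset `V`. -/
def toSections (B : Type u) [CommRing B] (V : (AlgebraicGeometry.Spec (CommRingCat.of B)).Opens) :
    B →+* (AlgebraicGeometry.Spec (CommRingCat.of B)).presheaf.obj (Opposite.op V) :=
  ((AlgebraicGeometry.Scheme.ΓSpecIso (CommRingCat.of B)).inv ≫
    (AlgebraicGeometry.Spec (CommRingCat.of B)).presheaf.map
      (CategoryTheory.homOfLE (le_top : V ≤ ⊤)).op).hom

/-- The nilpotence condition for the banal display over `R` given by `U ∈ G(W(R))`: `Spec (R/pR)`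
is covered by affine open subschemes over which the realization in the adjoint representation is
`F`-nilpotent. -/
def Cochar.IsDisplay (μ : Cochar p k O) (c : WittVector p k →ₐ[ℤ_[p]] R)
    (U : Pt p O (WittVector p R)) : Prop :=
  ∀ x : AlgebraicGeometry.Spec (CommRingCat.of (R ⧸ Ideal.span {(p : R)})),
    ∃ V : (AlgebraicGeometry.Spec (CommRingCat.of (R ⧸ Ideal.span {(p : R)}))).Opens,
      x ∈ V ∧ AlgebraicGeometry.IsAffineOpen V ∧
      μ.IsFNilpotentAlong c ((toSections (R ⧸ Ideal.span {(p : R)}) V).comp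
        (Ideal.Quotient.mk (Ideal.span {(p : R)}))) U

/-- The groupoid of nilpotent banal displays with `G`-structure over `R`: the banal display given
by `U ∈ G(W(R))` has the map `g ↦ U Φ(g)` from the display group to `G(W(R))` as its structure
map, and morphisms `U' → U` are elements `h` of the display group with `U' = h⁻¹ U Φ(h)`. -/
abbrev NilpBanalDisplay (μ : Cochar p k O) (c : WittVector p k →ₐ[ℤ_[p]] R) : Type _ :=
  TwistedConj (MonoidHom.id (Pt p O (WittVector p R))) (μ.displayGroup c) (μ.twistedFrobenius c)
    (μ.IsDisplay c)

variable (p) in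
/-- The ideal `W(J) + I(A)` of `W(A)`. -/
def wittIdeal {A : Type u} [CommRing A] (J : Ideal A) : Ideal (WittVector p A) :=
  RingHom.ker (WittVector.map (Ideal.Quotient.mk J) : WittVector p A →+* WittVector p (A ⧸ J)) ⊔
    RingHom.ker (WittVector.ghostComponent 0 : WittVector p A →+* A)

end Displays

end GDisplay

end

open CategoryTheory GDisplay

/-! Conjugation by the cocharacter grades the coordinate ring `W(k) ⊗ O`. A point lies in `G⁻`
exactly when it kills all functions of positive degree, and in `G⁺` exactly when it agrees with the
unit on functions of degree at most `0` (`Cochar.mem_neg`, `Cochar.mem_pos`). The weight condition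
makes functions of degree at least `2` vanish to second order at the unit
(`Cochar.Pres.mem_sq_of_isHom`); hence on `G⁺` a function of degree `n ≥ 1` is a form of degree `n`
in functions of degree `1`. Conjugation by `μ(p)⁻¹` divides values in degree `n` by `pⁿ`. So the
twist `τ(μ(p)⁻¹ h μ(p))` is integral on `G⁻`, and also on those points of `G⁺` whose linear
coordinates become divisible by `p` under `τ`. As `p` is not a zero divisor, the twist is then
unique (`Cochar.IsTwist`).

Smoothness provides homogeneous generators together with a homogeneous section `ξ` of the first
order thickening (`Cochar.exists_pres`). Substituting `ξ` squares the ideal generated by the values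
of the equations: this is a Newton iteration that respects the grading. Over `W(A)`, complete for
the kernels of `W(A) → W_n(A/pⁿ)`, it lifts points from `W(A/J)` together with their membership in
`G⁻` or `G⁺`, and it factors points near the unit into a point of `G⁻` and a point of `G⁺`
(`Cochar.Pres.exists_lift`, `Cochar.Pres.factor`). Therefore the display group over `A/J` is the
image of `Ĝ⁻` over `W(A)`, and `Φ` is the twist over `W(A)` passed to the quotient.

The equivalences come from contraction. For `e` near the unit, the operator `e ↦ U e' U⁻¹`, with
`e'` the twist of `e`, is `F♭/p` to first order (`Cochar.Pres.isTwist_dev`). Divided powers give `x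
^ p ∈ pJ` for `x ∈ J`, so the `n`th ghost component of an element of `W(J)` lies in `pⁿJ`, and `F/p`
acts on `W(J)`. Nilpotence of `F♭` then makes the operator contract along the ideals `wittPD`
(`Cochar.Pres.contraction`). Fixed points are trivial and successive conjugations converge, so that
reduction to `W(A/J)` is fully faithful. It is essentially surjective because points lift, and
because the nilpotence condition can be tested modulo `J` and `p`.

For the diagonal, `θ = δ ∘ w₀` is an idempotent endomorphism of `W(A)`. The point `E = U θ(U)⁻¹` is
trivial under `w₀`; replacing `U` by `E⁻¹ U E'` produces a new deviation which is `(1 - θ)F♭/p` of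
the old one to first order. Since `F` maps `p ^ m I(A)` into `p ^ (m+1) W(A)`, nilpotence moves the
deviation from `p ^ m I(A)` into `p ^ (m+1) I(A)` after finitely many steps
(`Cochar.Pres.diag_contraction`). The limit lies in the image of `δ`. The same contraction kills
morphisms with trivial `w₀`, which gives fullness. -/

noncomputable section

open CategoryTheory Polynomial TensorProduct
open scoped LaurentPolynomial

namespace GDisplay

universe u v w

/-! ### Points and convolution -/

section Convolution

variable {p : ℕ} [Fact p.Prime] {O : Type v} [CommRing O] [HopfAlgebra ℤ_[p] O]
  {S S' : Type*} [CommRing S] [Algebra ℤ_[p] S] [CommRing S'] [Algebra ℤ_[p] S']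

/-- The distribution attached to a point. -/
def Pt.lin (g : Pt p O S) : WithConv (O →ₗ[ℤ_[p]] S) := WithConv.toConv g.hom.toLinearMap

theorem Pt.lin_mul (g h : Pt p O S) : (g * h).lin = g.lin * h.lin := rfl

theorem Pt.lin_one : (1 : Pt p O S).lin = 1 := rfl

theorem Pt.lin_apply (g : Pt p O S) (x : O) : g.lin x = g.hom x := rfl

theorem Pt.one_hom (x : O) : (1 : Pt p O S).hom x = algebraMap ℤ_[p] S (Coalgebra.counit x) := rfl

theorem Pt.map_hom (φ : S →ₐ[ℤ_[p]] S') (g : Pt p O S) (x : O) :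
    (Pt.map φ g).hom x = φ (g.hom x) := rfl

theorem Pt.ext {g h : Pt p O S} (e : ∀ x, g.hom x = h.hom x) : g = h :=
  congrArg WithConv.toConv (AlgHom.ext e)

theorem Pt.lin_mul_lin_inv (g : Pt p O S) : g.lin * g⁻¹.lin = 1 := by
  rw [← Pt.lin_mul, mul_inv_cancel, Pt.lin_one]

theorem Pt.map_comp {S'' : Type*} [CommRing S''] [Algebra ℤ_[p] S''] (ψ : S' →ₐ[ℤ_[p]] S'')
    (φ : S →ₐ[ℤ_[p]] S') (g : Pt p O S) : Pt.map (ψ.comp φ) g = Pt.map ψ (Pt.map φ g) := rfl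

theorem Pt.map_injective {φ : S →ₐ[ℤ_[p]] S'} (hφ : Function.Injective φ) :
    Function.Injective (Pt.map φ : Pt p O S → Pt p O S') := fun g h e =>
  Pt.ext fun x => hφ (by rw [← Pt.map_hom, ← Pt.map_hom, e])

theorem adj_eq (g : Pt p O S) (d : O →ₗ[ℤ_[p]] S) :
    adj g d = (g.lin * WithConv.toConv d * g⁻¹.lin).ofConv := rfl

theorem comp_conv (φ : S →ₐ[ℤ_[p]] S') (f g : WithConv (O →ₗ[ℤ_[p]] S)) :
    φ.toLinearMap ∘ₗ (f * g).ofConv = (WithConv.toConv (φ.toLinearMap ∘ₗ f.ofConv) *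
      WithConv.toConv (φ.toLinearMap ∘ₗ g.ofConv)).ofConv :=
  LinearMap.algHom_comp_convMul_distrib φ f g

/-- Meant for maps `L` that are not multiplicative, such as the second component of dual numbers or
`laurentEval`; a product rule between the values of the two factors is enough. -/
theorem comp_conv_of_bilinear (L : S →ₗ[ℤ_[p]] S') {f g : WithConv (O →ₗ[ℤ_[p]] S)}
    {f' g' : WithConv (O →ₗ[ℤ_[p]] S')} (h : ∀ x y, L (f x * g y) = f' x * g' y) (x : O) :
    L ((f * g) x) = (f' * g') x := by
  rw [(Coalgebra.Repr.arbitrary ℤ_[p] x).convMul_apply,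
    (Coalgebra.Repr.arbitrary ℤ_[p] x).convMul_apply, map_sum]
  exact Finset.sum_congr rfl fun i _ => h _ _

theorem conv_mem_left (𝔞 : Ideal S) {f g : WithConv (O →ₗ[ℤ_[p]] S)} (h : ∀ x, f x ∈ 𝔞) (x : O) :
    (f * g) x ∈ 𝔞 := by
  rw [(Coalgebra.Repr.arbitrary ℤ_[p] x).convMul_apply]
  exact sum_mem fun i _ => 𝔞.mul_mem_right _ (h _)

theorem conv_mem_right (𝔞 : Ideal S) {f g : WithConv (O →ₗ[ℤ_[p]] S)} (h : ∀ x, g x ∈ 𝔞) (x : O) :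
    (f * g) x ∈ 𝔞 := by
  rw [(Coalgebra.Repr.arbitrary ℤ_[p] x).convMul_apply]
  exact sum_mem fun i _ => 𝔞.mul_mem_left _ (h _)

theorem conv_mem_mul {𝔞 𝔟 : Ideal S} {f g : WithConv (O →ₗ[ℤ_[p]] S)} (h : ∀ x, f x ∈ 𝔞)
    (h' : ∀ x, g x ∈ 𝔟) (x : O) : (f * g) x ∈ 𝔞 * 𝔟 := by
  rw [(Coalgebra.Repr.arbitrary ℤ_[p] x).convMul_apply]
  exact sum_mem fun i _ => Ideal.mul_mem_mul (h _) (h' _)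

/-! #### The adjoint action -/

theorem adj_mul (g h : Pt p O S) (d : O →ₗ[ℤ_[p]] S) : adj (g * h) d = adj g (adj h d) := by
  rw [adj_eq, adj_eq, adj_eq, mul_inv_rev, Pt.lin_mul, Pt.lin_mul]
  simp only [mul_assoc, WithConv.toConv_ofConv]

theorem adj_one (d : O →ₗ[ℤ_[p]] S) : adj (1 : Pt p O S) d = d := by
  rw [adj_eq, inv_one, Pt.lin_one, one_mul, mul_one]

theorem adj_inv_adj (g : Pt p O S) (d : O →ₗ[ℤ_[p]] S) : adj g⁻¹ (adj g d) = d := by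
  rw [← adj_mul, inv_mul_cancel, adj_one]

theorem adj_adj_inv (g : Pt p O S) (d : O →ₗ[ℤ_[p]] S) : adj g (adj g⁻¹ d) = d := by
  rw [← adj_mul, mul_inv_cancel, adj_one]

theorem adj_add (g : Pt p O S) (d e : O →ₗ[ℤ_[p]] S) : adj g (d + e) = adj g d + adj g e := by
  rw [adj_eq, adj_eq, adj_eq, WithConv.toConv_add, mul_add, add_mul, WithConv.ofConv_add]

theorem adj_smul (g : Pt p O S) (s : S) (d : O →ₗ[ℤ_[p]] S) : adj g (s • d) = s • adj g d := by
  rw [adj_eq, adj_eq, WithConv.toConv_smul, mul_smul_comm, smul_mul_assoc, WithConv.ofConv_smul]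

/-- The adjoint action as a linear map. -/
def adjL (g : Pt p O S) : (O →ₗ[ℤ_[p]] S) →ₗ[S] (O →ₗ[ℤ_[p]] S) where
  toFun := adj g
  map_add' := adj_add g
  map_smul' := adj_smul g

theorem adj_sub (g : Pt p O S) (d e : O →ₗ[ℤ_[p]] S) : adj g (d - e) = adj g d - adj g e :=
  map_sub (adjL g) d e

theorem map_adj (φ : S →ₐ[ℤ_[p]] S') (g : Pt p O S) (d : O →ₗ[ℤ_[p]] S) :
    φ.toLinearMap ∘ₗ adj g d = adj (Pt.map φ g) (φ.toLinearMap ∘ₗ d) := by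
  rw [adj_eq, comp_conv, comp_conv, adj_eq, ← map_inv]
  rfl

theorem adj_mem (𝔞 : Ideal S) (g : Pt p O S) {d : O →ₗ[ℤ_[p]] S} (h : ∀ x, d x ∈ 𝔞) (x : O) :
    adj g d x ∈ 𝔞 :=
  conv_mem_left 𝔞 (fun y => conv_mem_right 𝔞 (g := WithConv.toConv d) h y) x

theorem lin_conj (u g : Pt p O S) :
    (u * g * u⁻¹).lin.ofConv = adj u g.lin.ofConv := rfl

theorem adj_unit (u : Pt p O S) :
    adj u (1 : WithConv (O →ₗ[ℤ_[p]] S)).ofConv = (1 : WithConv (O →ₗ[ℤ_[p]] S)).ofConv := by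
  rw [adj_eq, WithConv.toConv_ofConv, mul_one, Pt.lin_mul_lin_inv]

/-! #### Points congruent to the unit -/

variable (p O) in
/-- The group of points that are trivial modulo `𝔞`. -/
def Pt.congr (𝔞 : Ideal S) : Subgroup (Pt p O S) :=
  (Pt.map (Ideal.Quotient.mkₐ ℤ_[p] 𝔞)).ker

instance (𝔞 : Ideal S) : (Pt.congr p O 𝔞).Normal := by unfold Pt.congr; infer_instance

theorem Pt.mem_congr {𝔞 : Ideal S} {g : Pt p O S} :
    g ∈ Pt.congr p O 𝔞 ↔ ∀ x, g.hom x - algebraMap ℤ_[p] S (Coalgebra.counit x) ∈ 𝔞 := by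
  constructor
  · intro h x
    rw [← Ideal.Quotient.eq]
    have := congrArg (fun e : Pt p O (S ⧸ 𝔞) => e.hom x) (MonoidHom.mem_ker.mp h)
    exact this
  · intro h
    refine MonoidHom.mem_ker.mpr (Pt.ext fun x => ?_)
    exact Ideal.Quotient.eq.mpr (h x)

theorem Pt.congr_mono {𝔞 𝔟 : Ideal S} (h : 𝔞 ≤ 𝔟) : Pt.congr p O 𝔞 ≤ Pt.congr p O 𝔟 :=
  fun _ hg => Pt.mem_congr.mpr fun x => h (Pt.mem_congr.mp hg x)

theorem Pt.map_eq_iff_congr {𝔞 : Ideal S} {g h : Pt p O S} :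
    Pt.map (Ideal.Quotient.mkₐ ℤ_[p] 𝔞) g = Pt.map (Ideal.Quotient.mkₐ ℤ_[p] 𝔞) h ↔
      g⁻¹ * h ∈ Pt.congr p O 𝔞 := by
  rw [Pt.congr, MonoidHom.mem_ker, map_mul, map_inv, inv_mul_eq_one]

theorem Pt.inv_mul_mem_congr_iff {𝔞 : Ideal S} {g h : Pt p O S} :
    g⁻¹ * h ∈ Pt.congr p O 𝔞 ↔ ∀ x, g.hom x - h.hom x ∈ 𝔞 := by
  rw [← Pt.map_eq_iff_congr]
  constructor
  · intro e x
    rw [← Ideal.Quotient.eq]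
    exact congrArg (fun e : Pt p O (S ⧸ 𝔞) => e.hom x) e
  · intro e
    exact Pt.ext fun x => Ideal.Quotient.eq.mpr (e x)

theorem Pt.map_mem_congr {𝔞 : Ideal S} {𝔟 : Ideal S'} (φ : S →ₐ[ℤ_[p]] S')
    (h : ∀ a ∈ 𝔞, φ a ∈ 𝔟) {g : Pt p O S} (hg : g ∈ Pt.congr p O 𝔞) :
    Pt.map φ g ∈ Pt.congr p O 𝔟 := by
  refine Pt.mem_congr.mpr fun x => ?_
  have := h _ (Pt.mem_congr.mp hg x)
  rwa [map_sub, AlgHom.commutes] at this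

theorem Pt.eq_one_of_mem_congr_bot {g : Pt p O S} (h : g ∈ Pt.congr p O (⊥ : Ideal S)) : g = 1 :=
  Pt.ext fun x => sub_eq_zero.mp (by simpa [Pt.one_hom] using Pt.mem_congr.mp h x)

/-! #### The Lie algebra -/

theorem comp_mem_lieAlg (φ : S →ₗ[ℤ_[p]] S') {d : O →ₗ[ℤ_[p]] S} (h : d ∈ lieAlg p O S) :
    φ ∘ₗ d ∈ lieAlg p O S' := fun x y => by
  rw [LinearMap.comp_apply, h x y, map_add, map_smul, map_smul]
  rfl

/-- The tangent vector at the unit section given by a derivation. -/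
def tangentPt (d : O →ₗ[ℤ_[p]] S) (hd : d ∈ lieAlg p O S) : Pt p O (DualNumber S) :=
  Pt.mk p (AlgHom.ofLinearMap
    ((TrivSqZeroExt.inlAlgHom ℤ_[p] S S).toLinearMap ∘ₗ (Algebra.linearMap ℤ_[p] S ∘ₗ
        Coalgebra.counit) + (TrivSqZeroExt.inrHom S S).restrictScalars ℤ_[p] ∘ₗ d)
    (by
      have h1 : d 1 = 0 := by simpa using hd 1 1
      ext <;> simp [h1])
    (fun x y => by
      change TrivSqZeroExt.inl (algebraMap ℤ_[p] S (Coalgebra.counit (x * y))) +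
          TrivSqZeroExt.inr (d (x * y)) =
        (TrivSqZeroExt.inl (algebraMap ℤ_[p] S (Coalgebra.counit x)) + TrivSqZeroExt.inr (d x)) *
        (TrivSqZeroExt.inl (algebraMap ℤ_[p] S (Coalgebra.counit y)) + TrivSqZeroExt.inr (d y))
      have h : d (x * y) = algebraMap ℤ_[p] S (Coalgebra.counit x) * d y +
          algebraMap ℤ_[p] S (Coalgebra.counit y) * d x := by
        rw [hd x y, Algebra.smul_def, Algebra.smul_def]
      apply TrivSqZeroExt.ext <;> simp [h, mul_comm]))

theorem tangentPt_hom (d : O →ₗ[ℤ_[p]] S) (hd : d ∈ lieAlg p O S) (x : O) :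
    (tangentPt d hd).hom x =
      TrivSqZeroExt.inl (algebraMap ℤ_[p] S (Coalgebra.counit x)) + TrivSqZeroExt.inr (d x) := rfl

/-- Over the dual numbers `g (1 + ε d) g⁻¹` is again a point that reduces to the unit, and its
`ε`-part is `Ad(g) d`. Multiplicativity of this point is the derivation property. -/
theorem adj_mem_lieAlg (g : Pt p O S) {d : O →ₗ[ℤ_[p]] S} (hd : d ∈ lieAlg p O S) :
    adj g d ∈ lieAlg p O S := by
  set i : S →ₐ[ℤ_[p]] DualNumber S := TrivSqZeroExt.inlAlgHom ℤ_[p] S S with hi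
  set q : DualNumber S →ₐ[ℤ_[p]] S := TrivSqZeroExt.fstHom ℤ_[p] S S with hq
  set D := Pt.map i g * tangentPt d hd * Pt.map i g⁻¹ with hD
  have hsnd : ∀ x, (D.hom x).snd = adj g d x := fun x => by
    refine comp_conv_of_bilinear ((TrivSqZeroExt.sndHom S S).restrictScalars ℤ_[p])
      (f := (Pt.map i g * tangentPt d hd).lin) (g := (Pt.map i g⁻¹).lin)
      (f' := g.lin * WithConv.toConv d) (g' := g⁻¹.lin) (fun x y => ?_) x
    have h2 := comp_conv_of_bilinear ((TrivSqZeroExt.sndHom S S).restrictScalars ℤ_[p])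
      (f := (Pt.map i g).lin) (g := (tangentPt d hd).lin)
      (f' := g.lin) (g' := WithConv.toConv d) (fun x y => by
        simp [Pt.lin_apply, Pt.map_hom, tangentPt_hom, hi]) x
    rw [← h2]
    change (((Pt.map i g).lin * (tangentPt d hd).lin) x * i (g⁻¹.hom y)).snd =
      (((Pt.map i g).lin * (tangentPt d hd).lin) x).snd * g⁻¹.hom y
    rw [TrivSqZeroExt.snd_mul]
    simp [hi, mul_comm]
  have hfst : ∀ x, (D.hom x).fst = algebraMap ℤ_[p] S (Coalgebra.counit x) := fun x => by
    have : Pt.map q D = 1 := by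
      rw [hD, map_mul, map_mul, ← Pt.map_comp, ← Pt.map_comp]
      have h1 : q.comp i = AlgHom.id ℤ_[p] S := by ext; simp [hi, hq]
      have h2 : Pt.map q (tangentPt d hd) = 1 := Pt.ext fun y => by
        rw [Pt.map_hom, tangentPt_hom]; simp [hq, Pt.one_hom]
      rw [h1, h2, mul_one, ← map_mul, mul_inv_cancel, map_one]
    exact congrArg (fun e : Pt p O S => e.hom x) this
  intro x y
  rw [← hsnd, map_mul, TrivSqZeroExt.snd_mul, hfst, hfst, hsnd, hsnd]
  simp [Algebra.smul_def, mul_comm]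

end Convolution

/-! ### The grading of `W(k) ⊗ O` by conjugation with the cocharacter -/

section Grading

variable {p : ℕ} [Fact p.Prime] {k : Type w} [Field k] [CharP k p]
  {O : Type v} [CommRing O] [HopfAlgebra ℤ_[p] O]
  {S S' : Type*} [CommRing S] [Algebra ℤ_[p] S] [CommRing S'] [Algebra ℤ_[p] S']

/-- The `W(k)`-linear extension of a linear map `O → S`. -/
def lext (c : WittVector p k →ₐ[ℤ_[p]] S) (d : O →ₗ[ℤ_[p]] S) :
    (WittVector p k ⊗[ℤ_[p]] O) →ₗ[ℤ_[p]] S :=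
  LinearMap.mul' ℤ_[p] S ∘ₗ TensorProduct.map c.toLinearMap d

/-- The `W(k)`-linear extension `W(k) ⊗ O → S` of the comorphism of a point. -/
def ext (c : WittVector p k →ₐ[ℤ_[p]] S) (g : Pt p O S) :
    (WittVector p k ⊗[ℤ_[p]] O) →ₐ[ℤ_[p]] S :=
  Algebra.TensorProduct.productMap c g.hom

theorem lext_tmul (c : WittVector p k →ₐ[ℤ_[p]] S) (d : O →ₗ[ℤ_[p]] S) (a : WittVector p k)
    (x : O) : lext c d (a ⊗ₜ x) = c a * d x := rfl

theorem ext_tmul (c : WittVector p k →ₐ[ℤ_[p]] S) (g : Pt p O S) (a : WittVector p k)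
    (x : O) : ext c g (a ⊗ₜ x) = c a * g.hom x := rfl

theorem ext_one_tmul (c : WittVector p k →ₐ[ℤ_[p]] S) (g : Pt p O S) (x : O) :
    ext c g (1 ⊗ₜ x) = g.hom x := by rw [ext_tmul, map_one, one_mul]

theorem lext_one_tmul (c : WittVector p k →ₐ[ℤ_[p]] S) (d : O →ₗ[ℤ_[p]] S) (x : O) :
    lext c d (1 ⊗ₜ x) = d x := by rw [lext_tmul, map_one, one_mul]

theorem ext_toLinearMap (c : WittVector p k →ₐ[ℤ_[p]] S) (g : Pt p O S)
    (x : WittVector p k ⊗[ℤ_[p]] O) : ext c g x = lext c g.lin.ofConv x := by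
  induction x with
  | zero => simp
  | add x y hx hy => rw [map_add, map_add, hx, hy]
  | tmul b x => rfl

theorem lext_algebraMap_mul (c : WittVector p k →ₐ[ℤ_[p]] S) (d : O →ₗ[ℤ_[p]] S)
    (a : WittVector p k) (x : WittVector p k ⊗[ℤ_[p]] O) : lext c d (a • x) = c a * lext c d x := by
  induction x with
  | zero => simp
  | add x y hx hy => rw [smul_add, map_add, map_add, hx, hy, mul_add]
  | tmul b x => rw [TensorProduct.smul_tmul', lext_tmul, lext_tmul, smul_eq_mul, map_mul, mul_assoc]

theorem ext_smul (c : WittVector p k →ₐ[ℤ_[p]] S) (g : Pt p O S)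
    (a : WittVector p k) (x : WittVector p k ⊗[ℤ_[p]] O) : ext c g (a • x) = c a * ext c g x := by
  rw [ext_toLinearMap, ext_toLinearMap, lext_algebraMap_mul]

theorem lext_comp (φ : S →ₐ[ℤ_[p]] S') (c : WittVector p k →ₐ[ℤ_[p]] S) (d : O →ₗ[ℤ_[p]] S)
    (x : WittVector p k ⊗[ℤ_[p]] O) :
    lext (φ.comp c) (φ.toLinearMap ∘ₗ d) x = φ (lext c d x) := by
  induction x with
  | zero => simp
  | add x y hx hy => rw [map_add, map_add, hx, hy, map_add]
  | tmul b x => rw [lext_tmul, lext_tmul, map_mul]; rfl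

theorem ext_map (φ : S →ₐ[ℤ_[p]] S') (c : WittVector p k →ₐ[ℤ_[p]] S) (g : Pt p O S)
    (x : WittVector p k ⊗[ℤ_[p]] O) : ext (φ.comp c) (Pt.map φ g) x = φ (ext c g x) := by
  rw [ext_toLinearMap, ext_toLinearMap, ← lext_comp]
  rfl

theorem lext_add (c : WittVector p k →ₐ[ℤ_[p]] S) (d e : O →ₗ[ℤ_[p]] S)
    (x : WittVector p k ⊗[ℤ_[p]] O) : lext c (d + e) x = lext c d x + lext c e x := by
  induction x with
  | zero => simp
  | add x y hx hy => simp only [map_add, hx, hy]; abel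
  | tmul b x => simp only [lext_tmul, LinearMap.add_apply, mul_add]

theorem lext_smul (c : WittVector p k →ₐ[ℤ_[p]] S) (s : S) (d : O →ₗ[ℤ_[p]] S)
    (x : WittVector p k ⊗[ℤ_[p]] O) : lext c (s • d) x = s * lext c d x := by
  induction x with
  | zero => simp
  | add x y hx hy => simp only [map_add, hx, hy]; ring
  | tmul b x => simp only [lext_tmul, LinearMap.smul_apply, smul_eq_mul]; ring

theorem ext_eq_of_forall {c : WittVector p k →ₐ[ℤ_[p]] S} {g h : Pt p O S}
    (e : ∀ x, ext c g x = ext c h x) : g = h :=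
  Pt.ext fun x => by rw [← ext_one_tmul c, e, ext_one_tmul]

/-- The point of `G` given by a homomorphism on `W(k) ⊗ O`. -/
def ptOfHom (f : (WittVector p k ⊗[ℤ_[p]] O) →ₐ[ℤ_[p]] S) : Pt p O S :=
  Pt.mk p (f.comp Algebra.TensorProduct.includeRight)

theorem ext_ptOfHom {c : WittVector p k →ₐ[ℤ_[p]] S} {f : (WittVector p k ⊗[ℤ_[p]] O) →ₐ[ℤ_[p]] S}
    (h : ∀ a, f (a ⊗ₜ 1) = c a) (x) : ext c (ptOfHom f) x = f x := by
  induction x with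
  | zero => simp
  | add x y hx hy => simp only [map_add, hx, hy]
  | tmul b x =>
    rw [ext_tmul, ← h]
    change f _ * f (1 ⊗ₜ x) = _
    rw [← map_mul, Algebra.TensorProduct.tmul_mul_tmul, one_mul, mul_one]

/-- `T` as a unit of `S[T, T⁻¹]`. -/
def unitT (S : Type*) [CommRing S] : S[T;T⁻¹]ˣ :=
  ⟨LaurentPolynomial.T 1, LaurentPolynomial.T (-1), by rw [← LaurentPolynomial.T_add]; rfl,
    by rw [← LaurentPolynomial.T_add]; rfl⟩

theorem unitT_zpow (n : ℤ) : ((unitT S ^ n : S[T;T⁻¹]ˣ) : S[T;T⁻¹]) = LaurentPolynomial.T n := by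
  have h : ∀ n : ℕ, ((unitT S ^ n : S[T;T⁻¹]ˣ) : S[T;T⁻¹]) = LaurentPolynomial.T n := fun n => by
    rw [Units.val_pow_eq_pow_val]
    change LaurentPolynomial.T 1 ^ n = _
    rw [LaurentPolynomial.T_pow, mul_one]
  have h' : ∀ n : ℕ, (((unitT S)⁻¹ ^ n : S[T;T⁻¹]ˣ) : S[T;T⁻¹]) = LaurentPolynomial.T (-n) :=
    fun n => by
      rw [Units.val_pow_eq_pow_val]
      change LaurentPolynomial.T (-1) ^ n = _
      rw [LaurentPolynomial.T_pow, mul_neg, mul_one]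
  obtain ⟨m, rfl | rfl⟩ := n.eq_nat_or_neg
  · rw [zpow_natCast, h]
  · rw [zpow_neg, zpow_natCast, ← inv_pow, h']

/-- Evaluation of Laurent polynomials over `W(k)` at a unit of a `W(k)`-algebra. -/
def evalUnit (c : WittVector p k →ₐ[ℤ_[p]] S) (z : Sˣ) : (WittVector p k)[T;T⁻¹] →ₐ[ℤ_[p]] S :=
  { LaurentPolynomial.eval₂ (c : WittVector p k →+* S) z with
      commutes' := fun r => by
        change LaurentPolynomial.eval₂ (c : WittVector p k →+* S) z
          (algebraMap ℤ_[p] (WittVector p k)[T;T⁻¹] r) = _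
        rw [LaurentPolynomial.algebraMap_apply, LaurentPolynomial.eval₂_C]
        exact c.commutes r }

theorem evalUnit_C_mul_T (c : WittVector p k →ₐ[ℤ_[p]] S) (z : Sˣ) (a : WittVector p k) (n : ℤ) :
    evalUnit c z (LaurentPolynomial.C a * LaurentPolynomial.T n) = c a * (z ^ n : Sˣ) :=
  LaurentPolynomial.eval₂_C_mul_T _ _ _ _

theorem laurentAlgHom_ext {R : Type*} [CommRing R] [Algebra ℤ_[p] R] {f g : R[T;T⁻¹] →ₐ[ℤ_[p]] S}
    (h : ∀ a n, f (LaurentPolynomial.C a * LaurentPolynomial.T n) =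
      g (LaurentPolynomial.C a * LaurentPolynomial.T n)) : f = g := by
  refine AlgHom.ext fun x => ?_
  induction x using LaurentPolynomial.induction_on' with
  | add x y hx hy => rw [map_add, map_add, hx, hy]
  | C_mul_T n a => exact h a n

theorem Cochar.atUnit_eq (μ : Cochar p k O) (c : WittVector p k →ₐ[ℤ_[p]] S) (z : Sˣ) :
    μ.atUnit c z = Pt.map (evalUnit c z) (Pt.mk p μ.univ) := rfl

theorem constLaurent_apply (s : S) : constLaurent p S s = LaurentPolynomial.C s := rfl

theorem evalUnit_unitT (c : WittVector p k →ₐ[ℤ_[p]] S) :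
    evalUnit ((constLaurent p S).comp c) (unitT S) = AddMonoidAlgebra.mapAlgHom ℤ c := by
  refine laurentAlgHom_ext fun a n => ?_
  rw [evalUnit_C_mul_T, unitT_zpow, ← LaurentPolynomial.single_eq_C_mul_T,
    AddMonoidAlgebra.mapAlgHom_single, LaurentPolynomial.single_eq_C_mul_T]
  rfl

theorem Cochar.gen_eq (μ : Cochar p k O) (c : WittVector p k →ₐ[ℤ_[p]] S) :
    μ.gen c = μ.atUnit ((constLaurent p S).comp c) (unitT S) := by
  rw [atUnit_eq, evalUnit_unitT]
  rfl

theorem Cochar.map_atUnit (μ : Cochar p k O) (φ : S →ₐ[ℤ_[p]] S')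
    (c : WittVector p k →ₐ[ℤ_[p]] S) (z : Sˣ) :
    Pt.map φ (μ.atUnit c z) = μ.atUnit (φ.comp c) (Units.map (φ : S →* S') z) := by
  rw [atUnit_eq, atUnit_eq, ← Pt.map_comp]
  congr 1
  refine congrArg _ (laurentAlgHom_ext fun a n => ?_)
  rw [AlgHom.comp_apply, evalUnit_C_mul_T, evalUnit_C_mul_T, map_mul, ← map_zpow]
  rfl

/-- The functional `∑ bₙ Tⁿ ↦ ∑ d(bₙ) zⁿ`. -/
def laurentEval (c : WittVector p k →ₐ[ℤ_[p]] S) (d : O →ₗ[ℤ_[p]] S) (z : Sˣ) :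
    (WittVector p k ⊗[ℤ_[p]] O)[T;T⁻¹] →+ S :=
  AddMonoidAlgebra.liftNC (lext c d).toAddMonoidHom
    fun n : Multiplicative ℤ => ((z ^ n.toAdd : Sˣ) : S)

theorem laurentEval_C_mul_T (c : WittVector p k →ₐ[ℤ_[p]] S) (d : O →ₗ[ℤ_[p]] S) (z : Sˣ) (b) (n) :
    laurentEval c d z (LaurentPolynomial.C b * LaurentPolynomial.T n) =
      lext c d b * (z ^ n : Sˣ) := by
  rw [← LaurentPolynomial.single_eq_C_mul_T]
  exact AddMonoidAlgebra.liftNC_single _ _ _ _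

/-- The inclusion of `W(k)[T, T⁻¹]` into `(W(k) ⊗ O)[T, T⁻¹]`. -/
def laurentIncl (p : ℕ) [Fact p.Prime] (k : Type w) [Field k] [CharP k p] (O : Type v) [CommRing O]
    [HopfAlgebra ℤ_[p] O] :
    (WittVector p k)[T;T⁻¹] →ₐ[ℤ_[p]] (WittVector p k ⊗[ℤ_[p]] O)[T;T⁻¹] :=
  AddMonoidAlgebra.mapAlgHom ℤ Algebra.TensorProduct.includeLeft

theorem laurentIncl_C_mul_T (a : WittVector p k) (n : ℤ) :
    laurentIncl p k O (LaurentPolynomial.C a * LaurentPolynomial.T n) =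
      LaurentPolynomial.C (a ⊗ₜ 1) * LaurentPolynomial.T n := by
  rw [← LaurentPolynomial.single_eq_C_mul_T, ← LaurentPolynomial.single_eq_C_mul_T]
  exact AddMonoidAlgebra.mapAlgHom_single _ _ _

theorem laurentEval_mul (c : WittVector p k →ₐ[ℤ_[p]] S) (d : O →ₗ[ℤ_[p]] S) (z : Sˣ) (f y) :
    laurentEval c d z (laurentIncl p k O f * y) = evalUnit c z f * laurentEval c d z y := by
  induction f using LaurentPolynomial.induction_on' with
  | add f g hf hg => rw [map_add, add_mul, map_add, hf, hg, map_add, add_mul]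
  | C_mul_T n a =>
    induction y using LaurentPolynomial.induction_on' with
    | add f g hf hg => rw [mul_add, map_add, hf, hg, map_add, mul_add]
    | C_mul_T m b =>
      rw [laurentIncl_C_mul_T, mul_mul_mul_comm, ← map_mul, ← LaurentPolynomial.T_add,
        laurentEval_C_mul_T, evalUnit_C_mul_T, laurentEval_C_mul_T,
        show (a ⊗ₜ[ℤ_[p]] (1 : O)) * b = a • b by rw [Algebra.smul_def]; rfl,
        lext_algebraMap_mul, zpow_add, Units.val_mul]
      ring

/-- `laurentEval` as a `ℤ_p`-linear map. -/
def laurentEvalL (c : WittVector p k →ₐ[ℤ_[p]] S) (d : O →ₗ[ℤ_[p]] S) (z : Sˣ) :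
    (WittVector p k ⊗[ℤ_[p]] O)[T;T⁻¹] →ₗ[ℤ_[p]] S :=
  { laurentEval c d z with
    map_smul' := fun r y => by
      change laurentEval c d z (r • y) = r • laurentEval c d z y
      have h : algebraMap ℤ_[p] (WittVector p k ⊗[ℤ_[p]] O)[T;T⁻¹] r =
        laurentIncl p k O (algebraMap _ _ r) := (AlgHom.commutes _ r).symm
      rw [Algebra.smul_def, h, laurentEval_mul, AlgHom.commutes, ← Algebra.smul_def] }

theorem laurentEvalL_apply (c : WittVector p k →ₐ[ℤ_[p]] S) (d : O →ₗ[ℤ_[p]] S) (z : Sˣ) (y) :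
    laurentEvalL c d z y = laurentEval c d z y := rfl

variable (p k O) in
/-- The universal point of `G` over `W(k) ⊗ O`. -/
def univPt : Pt p O (WittVector p k ⊗[ℤ_[p]] O) := Pt.mk p Algebra.TensorProduct.includeRight

variable (p k O) in
/-- The structure map of the `W(k)`-algebra `W(k) ⊗ O`. -/
def incl : WittVector p k →ₐ[ℤ_[p]] (WittVector p k ⊗[ℤ_[p]] O) :=
  Algebra.TensorProduct.includeLeft

/-- The point `μ(T)⁻¹ g μ(T)`, for the universal point `g`. -/
def Cochar.coactPt (μ : Cochar p k O) : Pt p O (WittVector p k ⊗[ℤ_[p]] O)[T;T⁻¹] :=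
  (μ.gen (incl p k O))⁻¹ * Pt.map (constLaurent p _) (univPt p k O) * μ.gen (incl p k O)

/-- A single universal conjugate computes the conjugate of every linear functional `d`, not only of
points. This is possible because `laurentEval` is linear over evaluation of `W(k)[T, T⁻¹]` at `z`,
so the two outer factors of the convolution product can be pulled out. -/
theorem Cochar.conj_atUnit (μ : Cochar p k O) (c : WittVector p k →ₐ[ℤ_[p]] S) (z : Sˣ)
    (d : O →ₗ[ℤ_[p]] S) (x : O) :
    adj (μ.atUnit c z)⁻¹ d x = laurentEval c d z (μ.coactPt.hom x) := by
  have e1 : ∀ (g : Pt p O (WittVector p k)[T;T⁻¹]) (y : (WittVector p k ⊗[ℤ_[p]] O)[T;T⁻¹]) (x : O),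
      laurentEval c d z ((Pt.map (laurentIncl p k O) g).hom x * y) =
        (Pt.map (evalUnit c z) g).hom x * laurentEval c d z y := fun g y x => laurentEval_mul _ _ _ _ _
  rw [adj_eq, inv_inv, ← laurentEvalL_apply]
  symm
  refine comp_conv_of_bilinear (laurentEvalL c d z)
    (f := ((μ.gen (incl p k O))⁻¹ * Pt.map (constLaurent p _) (univPt p k O)).lin)
    (g := (μ.gen (incl p k O)).lin) (fun x y => ?_) x
  -- `laurentEval_mul` pulls out factors on the left; the right-hand factor `μ(T)` has to be moved
  -- there first.
  rw [mul_comm]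
  have h1 := e1 (Pt.mk p μ.univ) (((μ.gen (incl p k O))⁻¹ *
    Pt.map (constLaurent p _) (univPt p k O)).hom x) y
  refine Eq.trans h1 ?_
  rw [mul_comm]
  congr 1
  refine comp_conv_of_bilinear (laurentEvalL c d z) (f := (μ.gen (incl p k O))⁻¹.lin)
    (g := (Pt.map (constLaurent p _) (univPt p k O)).lin) (fun x y => ?_) x
  refine Eq.trans (e1 (Pt.mk p μ.univ)⁻¹ _ _) ?_
  congr 1
  rw [Pt.lin_apply, Pt.map_hom, constLaurent_apply, ← mul_one (LaurentPolynomial.C _),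
    ← LaurentPolynomial.T_zero, laurentEval_C_mul_T, zpow_zero, Units.val_one, mul_one]
  exact lext_one_tmul c d y

end Grading

/-! ### The coaction of `𝔾_m` and the decomposition into homogeneous components -/

section Coaction

variable {p : ℕ} [Fact p.Prime] {k : Type w} [Field k] [CharP k p]
  {O : Type v} [CommRing O] [HopfAlgebra ℤ_[p] O]
  {S S' : Type*} [CommRing S] [Algebra ℤ_[p] S] [CommRing S'] [Algebra ℤ_[p] S']

theorem Cochar.counit_univ (μ : Cochar p k O) (x : O) :
    (Coalgebra.counit (R := WittVector p k) (μ.univ x) : WittVector p k) =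
      algebraMap ℤ_[p] _ (Coalgebra.counit x) := by
  have h := CoalgHomClass.counit_comp_apply μ ((1 : WittVector p k) ⊗ₜ[ℤ_[p]] x)
  refine Eq.trans h ?_
  rw [TensorProduct.counit_tmul, Algebra.smul_def]
  simp

theorem Cochar.atUnit_one (μ : Cochar p k O) (c : WittVector p k →ₐ[ℤ_[p]] S) :
    μ.atUnit c 1 = 1 := by
  refine Pt.ext fun x => ?_
  have h : ∀ f : (WittVector p k)[T;T⁻¹],
      evalUnit c 1 f = c (Coalgebra.counit (R := WittVector p k) f) := fun f => by
    induction f using LaurentPolynomial.induction_on' with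
    | add f g hf hg => rw [map_add, map_add, map_add, hf, hg]
    | C_mul_T n a =>
      rw [evalUnit_C_mul_T, one_zpow, Units.val_one, mul_one, LaurentPolynomial.counit_C_mul_T]
      rfl
  refine Eq.trans (h (μ.univ x)) ?_
  rw [μ.counit_univ, AlgHom.commutes]
  rfl

/-- Evaluation at a unit as a `W(k)`-linear map. -/
def evalUnitL (c : WittVector p k →ₐ[ℤ_[p]] S) (z : Sˣ) :
    letI := c.toAlgebra
    (WittVector p k)[T;T⁻¹] →ₗ[WittVector p k] S :=
  letI := c.toAlgebra
  { toFun := evalUnit c z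
    map_add' := map_add _
    map_smul' := fun a f => by
      rw [LaurentPolynomial.smul_eq_C_mul, map_mul, ← mul_one (LaurentPolynomial.C a),
        ← LaurentPolynomial.T_zero, evalUnit_C_mul_T, zpow_zero, Units.val_one, mul_one]
      rfl }

/-- `T` is group-like and `μ` is a homomorphism of bialgebras; both sides are the evaluation at `(z,
z')` of the comultiplication. -/
theorem Cochar.atUnit_mul (μ : Cochar p k O) (c : WittVector p k →ₐ[ℤ_[p]] S) (z z' : Sˣ) :
    μ.atUnit c (z * z') = μ.atUnit c z * μ.atUnit c z' := by
  let : Algebra (WittVector p k) S := c.toAlgebra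
  refine Pt.ext fun x => ?_
  let M := LinearMap.mul' (WittVector p k) S ∘ₗ
    TensorProduct.map (evalUnitL c z) (evalUnitL c z')
  have h : ∀ f : (WittVector p k)[T;T⁻¹],
      evalUnit c (z * z') f = M (Coalgebra.comul (R := WittVector p k) f) := fun f => by
    induction f using LaurentPolynomial.induction_on' with
    | add f g hf hg => rw [map_add, map_add, map_add, hf, hg]
    | C_mul_T n a =>
      rw [evalUnit_C_mul_T, LaurentPolynomial.comul_C_mul_T_self]
      change _ = evalUnit c z (LaurentPolynomial.T n) * evalUnit c z' _
      rw [evalUnit_C_mul_T, ← one_mul (LaurentPolynomial.T n), ← map_one LaurentPolynomial.C,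
        evalUnit_C_mul_T, map_one, mul_zpow, Units.val_mul]
      ring
  have h2 := CoalgHomClass.map_comp_comul_apply μ ((1 : WittVector p k) ⊗ₜ[ℤ_[p]] x)
  refine Eq.trans (h (μ.univ x)) ?_
  refine Eq.trans (congrArg M h2.symm) ?_
  rw [← Pt.lin_apply (μ.atUnit c z * μ.atUnit c z'), Pt.lin_mul,
    (Coalgebra.Repr.arbitrary ℤ_[p] x).convMul_apply, TensorProduct.comul_tmul]
  conv_lhs => rw [← (Coalgebra.Repr.arbitrary ℤ_[p] x).eq]
  rw [TensorProduct.tmul_sum, map_sum, map_sum, map_sum]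
  refine Finset.sum_congr rfl fun i _ => ?_
  rfl

/-- Conjugation by `μ(T)⁻¹` on the coordinate ring. -/
def Cochar.coact (μ : Cochar p k O) :
    (WittVector p k ⊗[ℤ_[p]] O) →ₐ[ℤ_[p]] (WittVector p k ⊗[ℤ_[p]] O)[T;T⁻¹] :=
  ext ((constLaurent p _).comp (incl p k O)) μ.coactPt

/-- `x` is homogeneous of degree `n`. -/
def Cochar.IsHom (μ : Cochar p k O) (n : ℤ) (x : WittVector p k ⊗[ℤ_[p]] O) : Prop :=
  μ.coact x = LaurentPolynomial.C x * LaurentPolynomial.T (-n)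

theorem Cochar.lext_adj_atUnit (μ : Cochar p k O) (c : WittVector p k →ₐ[ℤ_[p]] S) (z : Sˣ)
    (d : O →ₗ[ℤ_[p]] S) (x : WittVector p k ⊗[ℤ_[p]] O) :
    lext c (adj (μ.atUnit c z)⁻¹ d) x = laurentEval c d z (μ.coact x) := by
  induction x with
  | zero => simp
  | add x y hx hy => rw [map_add, hx, hy, map_add, map_add]
  | tmul a x =>
    rw [lext_tmul, conj_atUnit, coact, ext_tmul]
    have h := laurentEval_mul c d z (LaurentPolynomial.C a * LaurentPolynomial.T 0) (μ.coactPt.hom x)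
    rw [laurentIncl_C_mul_T, evalUnit_C_mul_T, zpow_zero, Units.val_one, mul_one,
      LaurentPolynomial.T_zero, mul_one] at h
    exact h.symm

theorem Cochar.IsHom.lext_adj {μ : Cochar p k O} {n : ℤ} {x : WittVector p k ⊗[ℤ_[p]] O}
    (hx : μ.IsHom n x) (c : WittVector p k →ₐ[ℤ_[p]] S) (z : Sˣ) (d : O →ₗ[ℤ_[p]] S) :
    lext c (adj (μ.atUnit c z)⁻¹ d) x = lext c d x * (z ^ (-n) : Sˣ) := by
  rw [μ.lext_adj_atUnit, hx, laurentEval_C_mul_T]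

theorem Cochar.IsHom.lext_adj' {μ : Cochar p k O} {n : ℤ} {x : WittVector p k ⊗[ℤ_[p]] O}
    (hx : μ.IsHom n x) (c : WittVector p k →ₐ[ℤ_[p]] S) (z : Sˣ) (d : O →ₗ[ℤ_[p]] S) :
    lext c (adj (μ.atUnit c z) d) x = lext c d x * (z ^ n : Sˣ) := by
  have h := hx.lext_adj c z (adj (μ.atUnit c z) d)
  rw [adj_inv_adj] at h
  rw [h, mul_assoc, ← Units.val_mul, ← zpow_add, neg_add_cancel, zpow_zero, Units.val_one, mul_one]

theorem Cochar.IsHom.ext_conj {μ : Cochar p k O} {n : ℤ} {x : WittVector p k ⊗[ℤ_[p]] O}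
    (hx : μ.IsHom n x) (c : WittVector p k →ₐ[ℤ_[p]] S) (z : Sˣ) (g : Pt p O S) :
    ext c ((μ.atUnit c z)⁻¹ * g * μ.atUnit c z) x = ext c g x * (z ^ (-n) : Sˣ) := by
  have h := hx.lext_adj c z g.lin.ofConv
  rw [← lin_conj, inv_inv] at h
  rw [ext_toLinearMap, ext_toLinearMap, h]

theorem Cochar.IsHom.ext_conj' {μ : Cochar p k O} {n : ℤ} {x : WittVector p k ⊗[ℤ_[p]] O}
    (hx : μ.IsHom n x) (c : WittVector p k →ₐ[ℤ_[p]] S) (z : Sˣ) (g : Pt p O S) :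
    ext c (μ.atUnit c z * g * (μ.atUnit c z)⁻¹) x = ext c g x * (z ^ n : Sˣ) := by
  have h := hx.lext_adj' c z g.lin.ofConv
  rw [← lin_conj] at h
  rw [ext_toLinearMap, ext_toLinearMap, h]

theorem coeff_C_mul_T {R : Type*} [CommRing R] (a : R) (n m : ℤ) :
    (LaurentPolynomial.C a * LaurentPolynomial.T n : R[T;T⁻¹]).coeff m = if n = m then a else 0 := by
  rw [← LaurentPolynomial.single_eq_C_mul_T, AddMonoidAlgebra.coeff_single]
  exact Finsupp.single_apply

theorem ext_univPt (x : WittVector p k ⊗[ℤ_[p]] O) : ext (incl p k O) (univPt p k O) x = x := by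
  induction x with
  | zero => simp
  | add x y hx hy => rw [map_add, hx, hy]
  | tmul a x =>
    rw [ext_tmul]
    change (a ⊗ₜ[ℤ_[p]] (1 : O)) * ((1 : WittVector p k) ⊗ₜ[ℤ_[p]] x) = _
    rw [Algebra.TensorProduct.tmul_mul_tmul, one_mul, mul_one]

/-- The component of degree `n`. -/
def Cochar.proj (μ : Cochar p k O) (n : ℤ) (x : WittVector p k ⊗[ℤ_[p]] O) :
    WittVector p k ⊗[ℤ_[p]] O :=
  (μ.coact x).coeff (-n)

/-- Evaluating at `z T` rather than at `z` separates the degrees: the power of `T` remembers the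
index of the coefficient. -/
theorem coeff_laurentEval (c : WittVector p k →ₐ[ℤ_[p]] S) (d : O →ₗ[ℤ_[p]] S) (z : Sˣ)
    (f : (WittVector p k ⊗[ℤ_[p]] O)[T;T⁻¹]) (m : ℤ) :
    (laurentEval ((constLaurent p S).comp c) ((constLaurent p S).toLinearMap ∘ₗ d)
      (Units.map (constLaurent p S : S →* S[T;T⁻¹]) z * unitT S) f).coeff m =
      lext c d (f.coeff m) * (z ^ m : Sˣ) := by
  induction f using LaurentPolynomial.induction_on' with
  | add f g hf hg =>
    rw [map_add, AddMonoidAlgebra.coeff_add, AddMonoidAlgebra.coeff_add, Finsupp.add_apply,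
      Finsupp.add_apply, map_add, hf, hg, add_mul]
  | C_mul_T n a =>
    have h : ((Units.map (constLaurent p S : S →* S[T;T⁻¹]) z ^ n : S[T;T⁻¹]ˣ) : S[T;T⁻¹]) =
        LaurentPolynomial.C ((z ^ n : Sˣ) : S) := by
      rw [← map_zpow]
      rfl
    rw [laurentEval_C_mul_T, mul_zpow, Units.val_mul, unitT_zpow, lext_comp, constLaurent_apply, h,
      ← mul_assoc, ← map_mul, coeff_C_mul_T, coeff_C_mul_T]
    split_ifs with h
    · rw [h]
    · simp

/-- Coassociativity of the coaction. Since `μ(z T) = μ(z) μ(T)`, evaluation at `z T` can also be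
done by conjugating with `μ(z)` first; then compare coefficients of `T ^ m`. -/
theorem Cochar.lext_adj_coeff_coact (μ : Cochar p k O) (c : WittVector p k →ₐ[ℤ_[p]] S) (z : Sˣ)
    (d : O →ₗ[ℤ_[p]] S) (x : WittVector p k ⊗[ℤ_[p]] O) (m : ℤ) :
    lext c (adj (μ.atUnit c z)⁻¹ d) ((μ.coact x).coeff m) =
      lext c d ((μ.coact x).coeff m) * (z ^ m : Sˣ) := by
  set c' := (constLaurent p S).comp c with hc'
  set z' := Units.map (constLaurent p S : S →* S[T;T⁻¹]) z with hz'
  set d' := (constLaurent p S).toLinearMap ∘ₗ d with hd'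
  have h1 : laurentEval c' d' (z' * unitT S) (μ.coact x) =
      laurentEval c' (adj (μ.atUnit c' z')⁻¹ d') (unitT S) (μ.coact x) := by
    rw [← μ.lext_adj_atUnit, ← μ.lext_adj_atUnit, μ.atUnit_mul, mul_inv_rev, adj_mul]
  have h2 : adj (μ.atUnit c' z')⁻¹ d' =
      (constLaurent p S).toLinearMap ∘ₗ adj (μ.atUnit c z)⁻¹ d := by
    rw [map_adj, map_inv, μ.map_atUnit]
  have h3 := coeff_laurentEval c (adj (μ.atUnit c z)⁻¹ d) 1 (μ.coact x) m
  rw [map_one, one_mul, one_zpow, Units.val_one, mul_one] at h3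
  rw [← coeff_laurentEval, h1, h2, h3]

/-- The preceding identity for the universal point and `z = T`. -/
theorem Cochar.isHom_proj (μ : Cochar p k O) (n : ℤ) (x : WittVector p k ⊗[ℤ_[p]] O) :
    μ.IsHom n (μ.proj n x) := by
  have h := μ.lext_adj_coeff_coact ((constLaurent p _).comp (incl p k O)) (unitT _)
    (Pt.map (constLaurent p _) (univPt p k O)).lin.ofConv x (-n)
  rw [← ext_toLinearMap, ext_map, ext_univPt, unitT_zpow, ← lin_conj, ← ext_toLinearMap, inv_inv,
    ← μ.gen_eq] at h
  exact h

/-- Evaluation of the coaction at `T = 1` is conjugation by `μ(1) = 1`, so the coefficients add up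
to `x`. -/
theorem Cochar.sum_proj (μ : Cochar p k O) (x : WittVector p k ⊗[ℤ_[p]] O) :
    ∃ s : Finset ℤ, x = ∑ n ∈ s, μ.proj n x ∧ ∀ n ∉ s, μ.proj n x = 0 := by
  classical
  have h : ∀ f : (WittVector p k ⊗[ℤ_[p]] O)[T;T⁻¹],
      laurentEval (incl p k O) (univPt p k O).lin.ofConv 1 f = f.coeff.sum fun _ a => a := fun f => by
    induction f using LaurentPolynomial.induction_on' with
    | add f g hf hg =>
      rw [map_add, AddMonoidAlgebra.coeff_add, hf, hg, Finsupp.sum_add_index'] <;> simp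
    | C_mul_T n a =>
      rw [laurentEval_C_mul_T, one_zpow, Units.val_one, mul_one, ← ext_toLinearMap, ext_univPt,
        ← LaurentPolynomial.single_eq_C_mul_T, AddMonoidAlgebra.coeff_single]
      exact (Finsupp.sum_single_index (h := fun _ b => b) rfl).symm
  have h1 := h (μ.coact x)
  rw [← μ.lext_adj_atUnit, μ.atUnit_one, inv_one, adj_one, ← ext_toLinearMap, ext_univPt] at h1
  refine ⟨(μ.coact x).coeff.support.image fun n => -n, ?_, fun n hn => ?_⟩
  · rw [Finset.sum_image fun a _ b _ hab => neg_injective hab]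
    conv_lhs => rw [h1]
    refine Finset.sum_congr rfl fun n _ => ?_
    rw [proj, neg_neg]
  · by_contra hne
    exact hn (Finset.mem_image.mpr ⟨-n, Finsupp.mem_support_iff.mpr hne, neg_neg n⟩)

end Coaction

/-! ### Homogeneous functions; `G⁻` and `G⁺` in terms of degrees -/

section Homogeneous

variable {p : ℕ} [Fact p.Prime] {k : Type w} [Field k] [CharP k p]
  {O : Type v} [CommRing O] [HopfAlgebra ℤ_[p] O]
  {S S' : Type*} [CommRing S] [Algebra ℤ_[p] S] [CommRing S'] [Algebra ℤ_[p] S']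
  {μ : Cochar p k O} {n m : ℤ} {x y : WittVector p k ⊗[ℤ_[p]] O}

theorem Cochar.IsHom.zero : μ.IsHom n 0 := by simp [IsHom]

theorem Cochar.IsHom.add (hx : μ.IsHom n x) (hy : μ.IsHom n y) : μ.IsHom n (x + y) := by
  rw [IsHom] at *
  rw [map_add, hx, hy, map_add, add_mul]

theorem Cochar.IsHom.sum {ι : Type*} {s : Finset ι} {f : ι → WittVector p k ⊗[ℤ_[p]] O}
    (h : ∀ i ∈ s, μ.IsHom n (f i)) : μ.IsHom n (∑ i ∈ s, f i) := by
  classical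
  induction s using Finset.induction_on with
  | empty => exact .zero
  | insert a s ha ih =>
    rw [Finset.sum_insert ha]
    exact (h _ (by simp)).add (ih fun i hi => h i (by simp [hi]))

theorem Cochar.IsHom.mul (hx : μ.IsHom n x) (hy : μ.IsHom m y) : μ.IsHom (n + m) (x * y) := by
  rw [IsHom] at *
  rw [map_mul, hx, hy, map_mul, neg_add, LaurentPolynomial.T_add]
  ring

theorem Cochar.coact_smul (a : WittVector p k) (x : WittVector p k ⊗[ℤ_[p]] O) :
    μ.coact (a • x) = LaurentPolynomial.C (a ⊗ₜ 1) * μ.coact x := ext_smul _ _ _ _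

theorem smul_eq_tmul_mul (a : WittVector p k) (x : WittVector p k ⊗[ℤ_[p]] O) :
    a • x = (a ⊗ₜ 1) * x := by rw [Algebra.smul_def]; rfl

theorem Cochar.IsHom.smul (a : WittVector p k) (hx : μ.IsHom n x) : μ.IsHom n (a • x) := by
  rw [IsHom] at *
  rw [coact_smul, hx, smul_eq_tmul_mul, map_mul, mul_assoc]

theorem Cochar.IsHom.one : μ.IsHom 0 1 := by simp [IsHom]

theorem Cochar.proj_of_isHom (hx : μ.IsHom n x) (m : ℤ) : μ.proj m x = if n = m then x else 0 := by
  rw [proj, hx, coeff_C_mul_T]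
  simp only [neg_inj]

theorem Cochar.proj_add (n : ℤ) (x y : WittVector p k ⊗[ℤ_[p]] O) :
    μ.proj n (x + y) = μ.proj n x + μ.proj n y := by
  rw [proj, map_add, AddMonoidAlgebra.coeff_add]
  rfl

/-- Induction on homogeneous elements. -/
theorem Cochar.hom_induction (μ : Cochar p k O) {P : WittVector p k ⊗[ℤ_[p]] O → Prop}
    (h : ∀ n x, μ.IsHom n x → P x) (h0 : ∀ x y, P x → P y → P (x + y)) (x) : P x := by
  classical
  obtain ⟨s, hs, -⟩ := μ.sum_proj x
  rw [hs]
  have : ∀ t : Finset ℤ, P (∑ n ∈ t, μ.proj n x) := fun t => by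
    induction t using Finset.induction_on with
    | empty => rw [Finset.sum_empty]; exact h 0 0 .zero
    | insert a s ha ih => rw [Finset.sum_insert ha]; exact h0 _ _ (h a _ (μ.isHom_proj a x)) ih
  exact this s

variable (p k O) in
/-- The augmentation of `W(k) ⊗ O`. -/
def augm : (WittVector p k ⊗[ℤ_[p]] O) →ₐ[ℤ_[p]] WittVector p k :=
  ext (AlgHom.id ℤ_[p] _) 1

theorem augm_tmul (a : WittVector p k) (x : O) :
    augm p k O (a ⊗ₜ x) = a * algebraMap ℤ_[p] _ (Coalgebra.counit x) := rfl

theorem augm_smul (a : WittVector p k) (x : WittVector p k ⊗[ℤ_[p]] O) :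
    augm p k O (a • x) = a * augm p k O x := ext_smul _ _ _ _

theorem ext_one (c : WittVector p k →ₐ[ℤ_[p]] S) (x : WittVector p k ⊗[ℤ_[p]] O) :
    ext c 1 x = c (augm p k O x) := by
  rw [augm, ← ext_map, map_one]
  rfl

theorem lext_counit (c : WittVector p k →ₐ[ℤ_[p]] S) (x : WittVector p k ⊗[ℤ_[p]] O) :
    lext c (1 : WithConv (O →ₗ[ℤ_[p]] S)).ofConv x = c (augm p k O x) := by
  rw [← ext_one, ext_toLinearMap]
  rfl

/-- The unit is fixed by conjugation, so its value at `x` equals itself times `T ^ (-n)`. -/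
theorem Cochar.IsHom.augm_eq_zero (hx : μ.IsHom n x) (hn : n ≠ 0) : augm p k O x = 0 := by
  have h := hx.ext_conj (constLaurent p (WittVector p k)) (unitT _) 1
  rw [mul_one, inv_mul_cancel, ext_one, constLaurent_apply, unitT_zpow] at h
  have h2 := congrArg (fun f => f.coeff 0) h
  simp only [coeff_C_mul_T, LaurentPolynomial.C_apply, if_true] at h2
  rw [h2, if_neg (by omega)]

/-- A point with values in the image of an injective homomorphism. -/
theorem Pt.exists_map_eq {i : S →ₐ[ℤ_[p]] S'} (hi : Function.Injective i) (g : Pt p O S')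
    (h : ∀ x, ∃ y, i y = g.hom x) : ∃ γ : Pt p O S, Pt.map i γ = g := by
  let e := AlgEquiv.ofInjective i hi
  refine ⟨Pt.mk p ((e.symm : i.range →ₐ[ℤ_[p]] S).comp (g.hom.codRestrict i.range h)),
    Pt.ext fun x => ?_⟩
  exact congrArg Subtype.val (e.apply_symm_apply ⟨g.hom x, h x⟩)

theorem polyLaurent_injective : Function.Injective (polyLaurent p S) :=
  Polynomial.toLaurent_injective

variable (p S) in
/-- The inclusion of constants `S → S[T]`. -/
def constPoly : S →ₐ[ℤ_[p]] S[X] := Polynomial.CAlgHom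

theorem constPoly_apply (s : S) : constPoly p S s = Polynomial.C s := rfl

theorem polyLaurent_comp_constPoly (c : WittVector p k →ₐ[ℤ_[p]] S) :
    (polyLaurent p S).comp ((constPoly p S).comp c) = (constLaurent p S).comp c :=
  AlgHom.ext fun _ => Polynomial.toLaurent_C _

theorem ext_mem_range {i : S →ₐ[ℤ_[p]] S'} {c' : WittVector p k →ₐ[ℤ_[p]] S'} {g : Pt p O S'}
    (h : ∀ n x, μ.IsHom n x → ∃ y, i y = ext c' g x) (x : O) : ∃ y, i y = g.hom x := by
  have : ∀ z, ∃ y, i y = ext c' g z := μ.hom_induction h fun x y ⟨a, ha⟩ ⟨b, hb⟩ =>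
    ⟨a + b, by rw [map_add, map_add, ha, hb]⟩
  simpa [ext_one_tmul] using this (1 ⊗ₜ x)

theorem eq_of_forall_isHom (μ : Cochar p k O) {c : WittVector p k →ₐ[ℤ_[p]] S} {g h : Pt p O S}
    (e : ∀ n x, μ.IsHom n x → ext c g x = ext c h x) : g = h :=
  ext_eq_of_forall (c := c) (μ.hom_induction e fun x y hx hy => by rw [map_add, map_add, hx, hy])

theorem Cochar.IsHom.ext_gen_conj (hx : μ.IsHom n x) (c : WittVector p k →ₐ[ℤ_[p]] S)
    (g : Pt p O S) : ext ((constLaurent p S).comp c)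
      ((μ.gen c)⁻¹ * Pt.map (constLaurent p S) g * μ.gen c) x =
        LaurentPolynomial.C (ext c g x) * LaurentPolynomial.T (-n) := by
  rw [μ.gen_eq, hx.ext_conj, unitT_zpow, ext_map]
  rfl

theorem Cochar.IsHom.ext_gen_conj' (hx : μ.IsHom n x) (c : WittVector p k →ₐ[ℤ_[p]] S)
    (g : Pt p O S) : ext ((constLaurent p S).comp c)
      (μ.gen c * Pt.map (constLaurent p S) g * (μ.gen c)⁻¹) x =
        LaurentPolynomial.C (ext c g x) * LaurentPolynomial.T n := by
  rw [μ.gen_eq, hx.ext_conj', unitT_zpow, ext_map]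
  rfl

theorem coeff_toLaurent_neg (f : S[X]) (hn : n < 0) : (polyLaurent p S f).coeff n = 0 := by
  change (toLaurent f).coeff n = 0
  rw [LaurentPolynomial.coeff_toLaurent]
  refine Finsupp.mapDomain_of_notMem_range _ _ ?_
  rintro ⟨m, hm⟩
  simp at hm
  omega

theorem polyLaurent_C_mul_X_pow (s : S) (hn : 0 ≤ n) :
    polyLaurent p S (C s * X ^ n.toNat) = LaurentPolynomial.C s * LaurentPolynomial.T n := by
  change toLaurent _ = _
  rw [Polynomial.toLaurent_C_mul_X_pow, Int.toNat_of_nonneg hn]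

/-- Conjugation by `μ(T)⁻¹` multiplies the value at a function of degree `n` by `T ^ (-n)`, which is
a polynomial only for `n ≤ 0`; for `n > 0` the value itself has to vanish. -/
theorem Cochar.mem_neg {c : WittVector p k →ₐ[ℤ_[p]] S} {g : Pt p O S} :
    g ∈ μ.neg c ↔ ∀ n x, 0 < n → μ.IsHom n x → ext c g x = 0 := by
  have hmem : g ∈ μ.neg c ↔ ∃ γ : Pt p O S[X], Pt.map (polyLaurent p S) γ =
      (μ.gen c)⁻¹ * Pt.map (constLaurent p S) g * μ.gen c := by
    rw [neg, Subgroup.mem_comap, MonoidHom.mem_range]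
    simp [mul_assoc]
  rw [hmem]
  constructor
  · rintro ⟨γ, hγ⟩ n x hn hx
    have h := hx.ext_gen_conj c g
    rw [← hγ, ← polyLaurent_comp_constPoly, ext_map] at h
    have h2 := congrArg (fun f => f.coeff (-n)) h
    simp only [coeff_C_mul_T, if_true] at h2
    rw [← h2]
    exact coeff_toLaurent_neg _ (by omega)
  · intro h
    refine Pt.exists_map_eq polyLaurent_injective _
      (ext_mem_range (μ := μ) (c' := (constLaurent p S).comp c) fun n x hx => ?_)
    rw [hx.ext_gen_conj]
    rcases le_or_gt n 0 with hn | hn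
    · exact ⟨_, polyLaurent_C_mul_X_pow _ (neg_nonneg.mpr hn)⟩
    · exact ⟨0, by rw [h n x hn hx]; simp⟩

theorem Cochar.exists_of_mem_neg {c : WittVector p k →ₐ[ℤ_[p]] S} {g : Pt p O S}
    (h : g ∈ μ.neg c) : ∃ γ : Pt p O S[X], Pt.map (polyLaurent p S) γ =
      (μ.gen c)⁻¹ * Pt.map (constLaurent p S) g * μ.gen c := by
  rw [neg, Subgroup.mem_comap, MonoidHom.mem_range] at h
  simpa [mul_assoc] using h

theorem Cochar.mem_neg_of_eq {c : WittVector p k →ₐ[ℤ_[p]] S} {g : Pt p O S} {γ : Pt p O S[X]}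
    (h : Pt.map (polyLaurent p S) γ =
      (μ.gen c)⁻¹ * Pt.map (constLaurent p S) g * μ.gen c) : g ∈ μ.neg c := by
  rw [neg, Subgroup.mem_comap, MonoidHom.mem_range]
  exact ⟨γ, by simpa [mul_assoc] using h⟩

theorem Cochar.IsHom.ext_negExt (hx : μ.IsHom n x) (hn : n ≤ 0) {c : WittVector p k →ₐ[ℤ_[p]] S}
    {g : Pt p O S} {γ : Pt p O S[X]} (hγ : Pt.map (polyLaurent p S) γ =
      (μ.gen c)⁻¹ * Pt.map (constLaurent p S) g * μ.gen c) :
    ext ((constPoly p S).comp c) γ x = C (ext c g x) * X ^ (-n).toNat := by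
  refine polyLaurent_injective (p := p) ?_
  rw [polyLaurent_C_mul_X_pow _ (neg_nonneg.mpr hn), ← hx.ext_gen_conj, ← hγ,
    ← polyLaurent_comp_constPoly, ext_map]

theorem Cochar.IsHom.ext_negExt_eval (hx : μ.IsHom n x) (hn : n ≤ 0)
    {c : WittVector p k →ₐ[ℤ_[p]] S} {g : Pt p O S} {γ : Pt p O S[X]}
    (hγ : Pt.map (polyLaurent p S) γ =
      (μ.gen c)⁻¹ * Pt.map (constLaurent p S) g * μ.gen c) (s : S) :
    ext c (Pt.map (evalPoly p s) γ) x = ext c g x * s ^ (-n).toNat := by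
  have h := ext_map (evalPoly p s) ((constPoly p S).comp c) γ x
  rw [hx.ext_negExt hn hγ] at h
  refine Eq.trans (Eq.trans ?_ h) ?_
  · congr 1
    exact congrArg (fun c => ext c _) (AlgHom.ext fun a => (Polynomial.aeval_C s (c a)).symm)
  · simp [evalPoly]

theorem Cochar.mem_pos_iff_exists {c : WittVector p k →ₐ[ℤ_[p]] S} {g : Pt p O S} :
    g ∈ μ.pos c ↔ ∃ γ : Pt p O S[X], Pt.map (evalPoly p (0 : S)) γ = 1 ∧
      Pt.map (polyLaurent p S) γ =
        μ.gen c * Pt.map (constLaurent p S) g * (μ.gen c)⁻¹ := by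
  rw [pos, Subgroup.mem_comap, Subgroup.mem_map]
  simp [MonoidHom.mem_ker]

theorem Cochar.IsHom.ext_posExt (hx : μ.IsHom n x) (hn : 0 ≤ n) {c : WittVector p k →ₐ[ℤ_[p]] S}
    {g : Pt p O S} {γ : Pt p O S[X]} (hγ : Pt.map (polyLaurent p S) γ =
      μ.gen c * Pt.map (constLaurent p S) g * (μ.gen c)⁻¹) :
    ext ((constPoly p S).comp c) γ x = C (ext c g x) * X ^ n.toNat := by
  refine polyLaurent_injective (p := p) ?_
  rw [polyLaurent_C_mul_X_pow _ hn, ← hx.ext_gen_conj', ← hγ,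
    ← polyLaurent_comp_constPoly, ext_map]

theorem ext_evalPoly (c : WittVector p k →ₐ[ℤ_[p]] S) (γ : Pt p O S[X]) (s : S)
    (x : WittVector p k ⊗[ℤ_[p]] O) : ext c (Pt.map (evalPoly p s) γ) x =
      (ext ((constPoly p S).comp c) γ x).eval s := by
  have h := ext_map (evalPoly p s) ((constPoly p S).comp c) γ x
  have e : (evalPoly p s).comp ((constPoly p S).comp c) = c :=
    AlgHom.ext fun a => Polynomial.aeval_C s (c a)
  rw [e] at h
  rw [h]
  exact (Polynomial.coe_aeval_eq_eval s ▸ rfl)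

/-- Conjugation by `μ(T)` multiplies values in degree `n` by `T ^ n`. Extension to `𝔸¹` kills the
values in negative degrees, and the value `1` at `T = 0` fixes those in degree `0`. -/
theorem Cochar.mem_pos {c : WittVector p k →ₐ[ℤ_[p]] S} {g : Pt p O S} :
    g ∈ μ.pos c ↔ ∀ n x, n ≤ 0 → μ.IsHom n x → ext c g x = c (augm p k O x) := by
  rw [mem_pos_iff_exists]
  constructor
  · rintro ⟨γ, h0, hγ⟩ n x hn hx
    rcases hn.lt_or_eq with hn | rfl
    · rw [hx.augm_eq_zero hn.ne, map_zero]
      have h := hx.ext_gen_conj' c g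
      rw [← hγ, ← polyLaurent_comp_constPoly, ext_map] at h
      have h2 := congrArg (fun f => f.coeff n) h
      simp only [coeff_C_mul_T, if_true] at h2
      rw [← h2]
      exact coeff_toLaurent_neg _ hn
    · have h := hx.ext_posExt le_rfl hγ
      rw [← ext_one, ← h0, ext_evalPoly, h]
      simp
  · intro h
    obtain ⟨γ, hγ⟩ := Pt.exists_map_eq polyLaurent_injective
      (μ.gen c * Pt.map (constLaurent p S) g * (μ.gen c)⁻¹)
      (ext_mem_range (μ := μ) (c' := (constLaurent p S).comp c) fun n x hx => by
        rw [hx.ext_gen_conj']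
        rcases le_or_gt 0 n with hn | hn
        · exact ⟨_, polyLaurent_C_mul_X_pow _ hn⟩
        · refine ⟨0, ?_⟩
          rw [h n x hn.le hx, hx.augm_eq_zero hn.ne]
          simp)
    refine ⟨γ, eq_of_forall_isHom μ (c := c) fun n x hx => ?_, hγ⟩
    rw [ext_one, ext_evalPoly]
    rcases lt_trichotomy n 0 with hn | rfl | hn
    · have h1 := hx.ext_gen_conj' c g
      rw [h n x hn.le hx, hx.augm_eq_zero hn.ne, ← hγ, ← polyLaurent_comp_constPoly, ext_map,
        map_zero, map_zero, zero_mul] at h1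
      rw [polyLaurent_injective (p := p) (h1.trans (map_zero _).symm), hx.augm_eq_zero hn.ne]
      simp
    · rw [hx.ext_posExt le_rfl hγ, h 0 x le_rfl hx]
      simp
    · rw [hx.ext_posExt hn.le hγ, hx.augm_eq_zero hn.ne']
      have : n.toNat ≠ 0 := by omega
      simp [this]

/-- A point of both `G⁻` and `G⁺` is trivial. -/
theorem Cochar.eq_one_of_mem_neg_of_mem_pos {c : WittVector p k →ₐ[ℤ_[p]] S} {g : Pt p O S}
    (h : g ∈ μ.neg c) (h' : g ∈ μ.pos c) : g = 1 := by
  refine eq_of_forall_isHom μ (c := c) fun n x hx => ?_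
  rw [ext_one]
  rcases le_or_gt n 0 with hn | hn
  · exact mem_pos.mp h' n x hn hx
  · rw [mem_neg.mp h n x hn hx, hx.augm_eq_zero hn.ne', map_zero]

theorem Cochar.map_mem_neg (φ : S →ₐ[ℤ_[p]] S') {c : WittVector p k →ₐ[ℤ_[p]] S} {g : Pt p O S}
    (h : g ∈ μ.neg c) : Pt.map φ g ∈ μ.neg (φ.comp c) :=
  mem_neg.mpr fun n x hn hx => by rw [ext_map, mem_neg.mp h n x hn hx, map_zero]

theorem Cochar.map_mem_pos (φ : S →ₐ[ℤ_[p]] S') {c : WittVector p k →ₐ[ℤ_[p]] S} {g : Pt p O S}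
    (h : g ∈ μ.pos c) : Pt.map φ g ∈ μ.pos (φ.comp c) :=
  mem_pos.mpr fun n x hn hx => by rw [ext_map, mem_pos.mp h n x hn hx]; rfl

theorem ext_sub_augm_mem {𝔞 : Ideal S} {g : Pt p O S} (h : g ∈ Pt.congr p O 𝔞)
    (c : WittVector p k →ₐ[ℤ_[p]] S) (x : WittVector p k ⊗[ℤ_[p]] O) :
    ext c g x - c (augm p k O x) ∈ 𝔞 := by
  have h1 := MonoidHom.mem_ker.mp h
  rw [← Ideal.Quotient.eq]
  change Ideal.Quotient.mkₐ ℤ_[p] 𝔞 _ = Ideal.Quotient.mkₐ ℤ_[p] 𝔞 _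
  rw [← ext_map, h1, ext_one]
  rfl

theorem ext_mem_of_augm_eq_zero {𝔞 : Ideal S} {g : Pt p O S} (h : g ∈ Pt.congr p O 𝔞)
    (c : WittVector p k →ₐ[ℤ_[p]] S) (hx : augm p k O x = 0) : ext c g x ∈ 𝔞 := by
  simpa [hx] using ext_sub_augm_mem h c x

theorem mem_congr_of_ext {𝔞 : Ideal S} {g : Pt p O S} (c : WittVector p k →ₐ[ℤ_[p]] S)
    (h : ∀ x : WittVector p k ⊗[ℤ_[p]] O, ext c g x - c (augm p k O x) ∈ 𝔞) :
    g ∈ Pt.congr p O 𝔞 :=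
  Pt.mem_congr.mpr fun x => by
    have := h (1 ⊗ₜ x)
    rwa [ext_one_tmul, augm_tmul, one_mul, AlgHom.commutes] at this

end Homogeneous

/-! ### Homogeneous sections of first order thickenings -/

section GradedSection

open MvPolynomial in
-- First order Taylor formula. Multiplying `f` by a variable `X j` creates the single new error term
-- `κ j · ∑ i, pderiv i f * κ i`, which is quadratic in `K`.
theorem aeval_X_add_sub_mem {R ι : Type*} [CommRing R] [Fintype ι] {K : Ideal (MvPolynomial ι R)}
    {κ : ι → MvPolynomial ι R} (hκ : ∀ i, κ i ∈ K) (f : MvPolynomial ι R) :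
    MvPolynomial.aeval (fun i => X i + κ i) f - f - ∑ i, pderiv i f * κ i ∈ K ^ 2 := by
  classical
  induction f using MvPolynomial.induction_on with
  | C a => simp [MvPolynomial.algebraMap_eq]
  | add f g hf hg =>
    convert add_mem hf hg using 1
    simp only [map_add, add_mul, Finset.sum_add_distrib]
    ring
  | mul_X f j hf =>
    have h1 : ∑ i, pderiv i f * κ i ∈ K :=
      sum_mem fun i _ => K.mul_mem_left _ (hκ i)
    convert add_mem ((K ^ 2).mul_mem_right (X j + κ j) hf)
      (pow_two K ▸ Ideal.mul_mem_mul h1 (hκ j)) using 1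
    have h2 : ∑ i, pderiv i (f * X j) * κ i = (∑ i, pderiv i f * κ i) * X j + f * κ j := by
      simp only [Derivation.leibniz, smul_eq_mul, add_mul, Finset.sum_add_distrib, pderiv_X]
      rw [add_comm]
      congr 1
      · rw [Finset.sum_mul]
        exact Finset.sum_congr rfl fun i _ => by ring
      · rw [Finset.sum_eq_single j]
        · simp
        · intro b _ hb
          simp [Ne.symm hb]
        · simp
    rw [h2, map_mul, MvPolynomial.aeval_X]
    ring

attribute [local instance] MvPolynomial.weightedGradedAlgebra

open MvPolynomial in
theorem isHomogeneous_of_component_mem {R ι : Type*} [CommRing R] (w : ι → ℤ)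
    {K : Ideal (MvPolynomial ι R)}
    (hK : ∀ f ∈ K, ∀ m, weightedHomogeneousComponent w m f ∈ K) :
    K.IsHomogeneous (weightedHomogeneousSubmodule R w) := fun i f hf => by
  have := weightedDecomposition.decompose'_apply R w f i
  exact this ▸ hK f hf i

open MvPolynomial in
theorem component_mul {R ι : Type*} [CommRing R] (w : ι → ℤ) {f : MvPolynomial ι R} {m : ℤ}
    (hf : IsWeightedHomogeneous w f m) (n : ℤ) (g : MvPolynomial ι R) :
    weightedHomogeneousComponent w (m + n) (f * g) = f * weightedHomogeneousComponent w n g := by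
  have := DirectSum.coe_decompose_mul_add_of_left_mem (weightedHomogeneousSubmodule R w)
    (b := g) (j := n) hf
  exact (weightedDecomposition.decompose'_apply R w _ _).symm.trans
    (this.trans (by rw [← weightedDecomposition.decompose'_apply R w]; rfl))

open MvPolynomial in
/-- A smooth algebra with a homogeneous presentation has a homogeneous first order section. -/
theorem exists_homogeneous_section {R B ι : Type*} [CommRing R] [CommRing B] [Algebra R B]
    [Fintype ι] [Algebra.FormallySmooth R B] (w : ι → ℤ) (x : ι → B)
    (hx : Function.Surjective (MvPolynomial.aeval x : MvPolynomial ι R →ₐ[R] B))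
    (hK : ∀ f : MvPolynomial ι R, MvPolynomial.aeval x f = 0 → ∀ m,
      MvPolynomial.aeval x (weightedHomogeneousComponent w m f) = 0) :
    ∃ ξ : ι → MvPolynomial ι R, (∀ i, IsWeightedHomogeneous w (ξ i) (w i)) ∧
      (∀ i, MvPolynomial.aeval x (ξ i) = x i) ∧
      ∀ f : MvPolynomial ι R, MvPolynomial.aeval x f = 0 →
        MvPolynomial.aeval ξ f ∈ RingHom.ker (MvPolynomial.aeval x : MvPolynomial ι R →ₐ[R] B) ^ 2 := by
  classical
  set K := RingHom.ker (MvPolynomial.aeval x : MvPolynomial ι R →ₐ[R] B) with hKdef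
  have hKh : K.IsHomogeneous (weightedHomogeneousSubmodule R w) :=
    isHomogeneous_of_component_mem w hK
  have hK2 : (K ^ 2).IsHomogeneous (weightedHomogeneousSubmodule R w) := by
    rw [pow_two]; exact hKh.mul hKh
  -- Formal smoothness splits the thickening of `B` given by the polynomial ring modulo `K ^ 2`; `η`
  -- lifts the images of the generators under this splitting, without regard to degrees.
  obtain ⟨g, hg⟩ := (Algebra.FormallySmooth.iff_split_surjection
    (MvPolynomial.aeval x : MvPolynomial ι R →ₐ[R] B) hx).mp inferInstance
  choose η hη using fun i => Ideal.Quotient.mk_surjective (g (x i))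
  have hηx : ∀ i, MvPolynomial.aeval x (η i) = x i := fun i => by
    have := DFunLike.congr_fun hg (x i)
    rw [AlgHom.comp_apply, ← hη i] at this
    exact this
  have hηK : ∀ f ∈ K, MvPolynomial.aeval η f ∈ K ^ 2 := fun f hf => by
    have h1 : (Ideal.Quotient.mkₐ R (RingHom.ker (MvPolynomial.aeval x :
        MvPolynomial ι R →ₐ[R] B).toRingHom ^ 2)).comp (MvPolynomial.aeval η) = g.comp (MvPolynomial.aeval x) := by
      refine MvPolynomial.algHom_ext fun i => ?_
      simp only [AlgHom.comp_apply, MvPolynomial.aeval_X]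
      exact hη i
    have h2 := DFunLike.congr_fun h1 f
    rw [AlgHom.comp_apply, AlgHom.comp_apply, show MvPolynomial.aeval x f = 0 from hf, map_zero] at h2
    exact Ideal.Quotient.eq_zero_iff_mem.mp h2
  set κ := fun i => η i - X i with hκ
  have hκK : ∀ i, κ i ∈ K := fun i => by
    change MvPolynomial.aeval x (η i - X i) = 0
    rw [map_sub, hηx, MvPolynomial.aeval_X, sub_self]
  -- The condition on the correction `κ` is linear modulo `K ^ 2`, so only the part of `κ i` of
  -- degree `w i` is retained.
  set κ' := fun i => weightedHomogeneousComponent w (w i) (κ i)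
  have hκ'K : ∀ i, κ' i ∈ K := fun i => hK _ (hκK i) _
  refine ⟨fun i => X i + κ' i, fun i => (isWeightedHomogeneous_X R w i).add
    (weightedHomogeneousComponent_isWeightedHomogeneous _ _), fun i => ?_, fun f hf => ?_⟩
  · rw [map_add, MvPolynomial.aeval_X, show MvPolynomial.aeval x (κ' i) = 0 from hκ'K i, add_zero]
  have key : ∀ f ∈ K, f + ∑ i, pderiv i f * κ i ∈ K ^ 2 := fun f hf => by
    have h1 := aeval_X_add_sub_mem hκK f
    have h2 : (fun i => X i + κ i) = η := by ext1 i; simp [hκ]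
    rw [h2] at h1
    convert sub_mem (hηK f hf) h1 using 1
    ring
  have key' : ∀ f ∈ K, f + ∑ i, pderiv i f * κ' i ∈ K ^ 2 := fun f hf => by
    -- For `f` of degree `m`, the derivative `pderiv i f` has degree `m - w i`, so the degree `m`
    -- part of `∑ i, pderiv i f * κ i` involves exactly the parts `κ' i`.
    have h1 : ∀ m, ∀ f ∈ K, IsWeightedHomogeneous w f m → f + ∑ i, pderiv i f * κ' i ∈ K ^ 2 :=
      fun m f hf hm => by
        have h2 := weightedHomogeneousComponent_mem_of_mem R w hK2 (key f hf) m
        rw [map_add, hm.weightedHomogeneousComponent_same, map_sum] at h2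
        convert h2 using 3 with i
        have h3 : IsWeightedHomogeneous w (pderiv i f) (m - w i) := hm.pderiv (by ring)
        rw [← component_mul w h3, sub_add_cancel]
    have h2 := sum_weightedHomogeneousComponent w f
    rw [finsum_eq_sum _ (weightedHomogeneousComponent_finsupp f)] at h2
    rw [← h2]
    have h3 : ∀ s : Finset ℤ, (∑ m ∈ s, weightedHomogeneousComponent w m f) +
        ∑ i, pderiv i (∑ m ∈ s, weightedHomogeneousComponent w m f) * κ' i ∈ K ^ 2 := fun s => by
      simp only [map_sum, Finset.sum_mul]
      rw [Finset.sum_comm, ← Finset.sum_add_distrib]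
      exact sum_mem fun m _ => h1 m _ (hK f hf m)
        (weightedHomogeneousComponent_isWeightedHomogeneous _ _)
    exact h3 _
  convert add_mem (aeval_X_add_sub_mem hκ'K f) (key' f hf) using 1
  ring

end GradedSection

/-! ### Graded presentations -/

section Presentation

variable {p : ℕ} [Fact p.Prime] {k : Type w} [Field k] [CharP k p]
  {O : Type v} [CommRing O] [HopfAlgebra ℤ_[p] O] {μ : Cochar p k O}

theorem Cochar.IsHom.pow {n : ℤ} {x : WittVector p k ⊗[ℤ_[p]] O} (hx : μ.IsHom n x) (m : ℕ) :
    μ.IsHom (m • n) (x ^ m) := by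
  induction m with
  | zero => simpa using IsHom.one
  | succ m ih => rw [pow_succ, succ_nsmul]; exact ih.mul hx

theorem Cochar.IsHom.prod {ι : Type*} {n : ι → ℤ} {x : ι → WittVector p k ⊗[ℤ_[p]] O}
    (s : Finset ι) (hx : ∀ i ∈ s, μ.IsHom (n i) (x i)) :
    μ.IsHom (∑ i ∈ s, n i) (∏ i ∈ s, x i) := by
  classical
  induction s using Finset.induction_on with
  | empty => simpa using IsHom.one
  | insert a s ha ih =>
    rw [Finset.prod_insert ha, Finset.sum_insert ha]
    exact (hx a (by simp)).mul (ih fun i hi => hx i (by simp [hi]))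

theorem Cochar.isHom_aeval {ι : Type*} {w : ι → ℤ} {x : ι → WittVector p k ⊗[ℤ_[p]] O}
    (hx : ∀ i, μ.IsHom (w i) (x i)) {f : MvPolynomial ι (WittVector p k)} {n : ℤ}
    (hf : MvPolynomial.IsWeightedHomogeneous w f n) : μ.IsHom n (MvPolynomial.aeval x f) := by
  rw [f.as_sum, map_sum]
  refine IsHom.sum fun d hd => ?_
  rw [MvPolynomial.aeval_monomial, ← Algebra.smul_def]
  refine IsHom.smul _ ?_
  rw [← hf (MvPolynomial.mem_support_iff.mp hd), Finsupp.weight_apply, Finsupp.prod, Finsupp.sum]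
  exact IsHom.prod _ fun i _ => (hx i).pow _

theorem Cochar.proj_sum {ι : Type*} (n : ℤ) (s : Finset ι) (f : ι → WittVector p k ⊗[ℤ_[p]] O) :
    μ.proj n (∑ i ∈ s, f i) = ∑ i ∈ s, μ.proj n (f i) :=
  map_sum (AddMonoidHom.mk' (μ.proj n) (μ.proj_add n)) f s

theorem Cochar.proj_zero (n : ℤ) : μ.proj n 0 = 0 :=
  map_zero (AddMonoidHom.mk' (μ.proj n) (μ.proj_add n))

theorem Cochar.proj_aeval {ι : Type*} {w : ι → ℤ} {x : ι → WittVector p k ⊗[ℤ_[p]] O}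
    (hx : ∀ i, μ.IsHom (w i) (x i)) (f : MvPolynomial ι (WittVector p k)) (n : ℤ) :
    μ.proj n (MvPolynomial.aeval x f) =
      MvPolynomial.aeval x (MvPolynomial.weightedHomogeneousComponent w n f) := by
  classical
  have hfin := MvPolynomial.weightedHomogeneousComponent_finsupp (w := w) f
  conv_lhs => rw [← MvPolynomial.sum_weightedHomogeneousComponent w f, finsum_eq_sum _ hfin,
    map_sum, proj_sum]
  have h : ∀ m, μ.proj n (MvPolynomial.aeval x
      (MvPolynomial.weightedHomogeneousComponent w m f)) = if m = n then MvPolynomial.aeval x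
        (MvPolynomial.weightedHomogeneousComponent w m f) else 0 := fun m =>
    proj_of_isHom (isHom_aeval hx
      (MvPolynomial.weightedHomogeneousComponent_isWeightedHomogeneous _ _)) n
  simp only [h, Finset.sum_ite_eq']
  split_ifs with h1
  · rfl
  · rw [Set.Finite.mem_toFinset (hs := hfin), Function.mem_support, not_not] at h1
    rw [h1, map_zero]

/-- A presentation of `W(k) ⊗ O` by homogeneous generators in the augmentation ideal, with a
homogeneous section of the first order thickening. -/
structure Cochar.Pres (μ : Cochar p k O) (ι : Type) where
  /-- the generators -/
  x : ι → WittVector p k ⊗[ℤ_[p]] O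
  /-- the degrees -/
  deg : ι → ℤ
  /-- the section -/
  ξ : ι → MvPolynomial ι (WittVector p k)
  isHom : ∀ i, μ.IsHom (deg i) (x i)
  augm_eq : ∀ i, augm p k O (x i) = 0
  surj : Function.Surjective
    (MvPolynomial.aeval x : MvPolynomial ι (WittVector p k) →ₐ[WittVector p k] _)
  ξ_hom : ∀ i, MvPolynomial.IsWeightedHomogeneous deg (ξ i) (deg i)
  aeval_ξ : ∀ i, MvPolynomial.aeval x (ξ i) = x i
  ξ_ker : ∀ f : MvPolynomial ι (WittVector p k), MvPolynomial.aeval x f = 0 → MvPolynomial.aeval ξ f ∈ RingHom.ker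
    (MvPolynomial.aeval x : MvPolynomial ι (WittVector p k) →ₐ[WittVector p k] _) ^ 2

theorem Cochar.exists_pres (μ : Cochar p k O) [Algebra.Smooth ℤ_[p] O] :
    ∃ n : ℕ, Nonempty (μ.Pres (Fin n)) := by
  classical
  have hft : Algebra.FiniteType ℤ_[p] O := inferInstance
  have hft' : Algebra.FiniteType (WittVector p k) (WittVector p k ⊗[ℤ_[p]] O) := inferInstance
  obtain ⟨s, hs⟩ := hft'.out
  choose t ht _ using fun y => μ.sum_proj y
  set T : Finset (ℤ × (WittVector p k ⊗[ℤ_[p]] O)) :=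
    s.biUnion fun y => (t y).image fun n => (n, y) with hT
  set e := T.equivFin
  set d : Fin T.card → ℤ := fun j => (e.symm j).1.1 with hd
  -- Homogeneous components of a finite generating set, translated by constants to vanish at the
  -- unit. Constants have degree `0`, and only components of degree `0` can have non-zero
  -- augmentation, so homogeneity is kept.
  set x : Fin T.card → WittVector p k ⊗[ℤ_[p]] O := fun j =>
    μ.proj (d j) (e.symm j).1.2 -
      augm p k O (μ.proj (d j) (e.symm j).1.2) • 1 with hxdef
  have hx : ∀ i, μ.IsHom (d i) (x i) := fun i => by
    have h1 := μ.isHom_proj (d i) (e.symm i).1.2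
    by_cases h0 : d i = 0
    · rw [hxdef]
      dsimp only
      rw [sub_eq_add_neg, ← neg_smul]
      refine h1.add ?_
      rw [h0]
      exact IsHom.one.smul _
    · rw [hxdef]
      dsimp only
      rw [h1.augm_eq_zero h0, zero_smul, sub_zero]
      exact h1
  have haug : ∀ i, augm p k O (x i) = 0 := fun i => by
    rw [hxdef]
    dsimp only
    rw [map_sub, augm_smul, map_one, mul_one, sub_self]
  have hsurj : Function.Surjective
      (MvPolynomial.aeval x : MvPolynomial _ (WittVector p k) →ₐ[WittVector p k] _) := by
    rw [← AlgHom.range_eq_top, eq_top_iff, ← hs, Algebra.adjoin_le_iff]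
    intro y hy
    rw [ht y]
    refine sum_mem fun n hn => ?_
    have hmem : (n, y) ∈ T := Finset.mem_biUnion.mpr ⟨y, hy, Finset.mem_image_of_mem _ hn⟩
    have h1 : x (e ⟨(n, y), hmem⟩) = μ.proj n y - augm p k O (μ.proj n y) • 1 := by
      simp [hxdef, hd]
    have h2 : μ.proj n y = x (e ⟨(n, y), hmem⟩) + augm p k O (μ.proj n y) • 1 := by
      rw [h1, sub_add_cancel]
    rw [h2]
    refine add_mem ⟨MvPolynomial.X _, MvPolynomial.aeval_X _ _⟩ (Subalgebra.smul_mem _ (one_mem _) _)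
  obtain ⟨ξ, h1, h2, h3⟩ := exists_homogeneous_section (R := WittVector p k) d x hsurj
    fun f hf m => by rw [← μ.proj_aeval hx, hf, proj_zero]
  exact ⟨_, ⟨⟨x, d, ξ, hx, haug, hsurj, h1, h2, h3⟩⟩⟩

end Presentation

/-! ### Coordinates near the unit and the Lie algebra -/

section PresentationLie

variable {p : ℕ} [Fact p.Prime] {k : Type w} [Field k] [CharP k p]
  {O : Type v} [CommRing O] [HopfAlgebra ℤ_[p] O] {μ : Cochar p k O}
  {S : Type*} [CommRing S] [Algebra ℤ_[p] S]
  {ι : Type} (P : μ.Pres ι) (c : WittVector p k →ₐ[ℤ_[p]] S)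

variable (p k O) in
/-- The augmentation ideal of `W(k) ⊗ O`. -/
def augIdeal : Ideal (WittVector p k ⊗[ℤ_[p]] O) := RingHom.ker (augm p k O)

theorem mem_augIdeal {y : WittVector p k ⊗[ℤ_[p]] O} :
    y ∈ augIdeal p k O ↔ augm p k O y = 0 := Iff.rfl

theorem sub_augm_mem (y : WittVector p k ⊗[ℤ_[p]] O) :
    y - augm p k O y • 1 ∈ augIdeal p k O := by
  rw [mem_augIdeal, map_sub, augm_smul, map_one, mul_one, sub_self]

theorem ext_aeval {κ : Type*} (x : κ → WittVector p k ⊗[ℤ_[p]] O) (g : Pt p O S)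
    (f : MvPolynomial κ (WittVector p k)) : ext c g (MvPolynomial.aeval x f) =
      MvPolynomial.eval₂ (c : WittVector p k →+* S) (fun i => ext c g (x i)) f := by
  induction f using MvPolynomial.induction_on with
  | C a =>
    rw [MvPolynomial.aeval_C, Algebra.algebraMap_eq_smul_one, ext_smul, map_one, mul_one,
      MvPolynomial.eval₂_C]
    rfl
  | add f g hf hg => rw [map_add, map_add, hf, hg, MvPolynomial.eval₂_add]
  | mul_X f i hf => rw [map_mul, map_mul, hf, MvPolynomial.aeval_X, MvPolynomial.eval₂_mul,
      MvPolynomial.eval₂_X]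

theorem Cochar.Pres.augm_aeval (f : MvPolynomial ι (WittVector p k)) :
    augm p k O (MvPolynomial.aeval P.x f) = MvPolynomial.constantCoeff f := by
  rw [augm, ext_aeval]
  have : (fun i => ext (AlgHom.id ℤ_[p] (WittVector p k)) (1 : Pt p O _) (P.x i)) = 0 :=
    funext P.augm_eq
  rw [this, MvPolynomial.eval₂_zero_apply]
  rfl

theorem Cochar.Pres.constantCoeff_ξ (i : ι) : MvPolynomial.constantCoeff (P.ξ i) = 0 := by
  rw [← P.augm_aeval, P.aeval_ξ, P.augm_eq]

/-- A solution of the equations of the presentation is a point. -/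
theorem Cochar.Pres.exists_pt (s : ι → S) (hs : ∀ f, MvPolynomial.aeval P.x f = 0 →
      MvPolynomial.eval₂ (c : WittVector p k →+* S) s f = 0) :
    ∃ g : Pt p O S, ∀ i, ext c g (P.x i) = s i := by
  set φ := (MvPolynomial.aeval P.x : MvPolynomial ι (WittVector p k) →ₐ[WittVector p k] _).toRingHom
    with hφ
  set ψ := RingHom.liftOfSurjective φ P.surj
    ⟨MvPolynomial.eval₂Hom (c : WittVector p k →+* S) s, fun f hf => hs f hf⟩ with hψ
  have hψφ : ∀ f, ψ (MvPolynomial.aeval P.x f) =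
      MvPolynomial.eval₂ (c : WittVector p k →+* S) s f := fun f =>
    RingHom.liftOfRightInverse_comp_apply _ _ (Function.rightInverse_surjInv P.surj) _ f
  have hC : ∀ a : WittVector p k, ψ (a ⊗ₜ 1) = c a := fun a => by
    have := hψφ (MvPolynomial.C a)
    rw [MvPolynomial.aeval_C, MvPolynomial.eval₂_C] at this
    exact this
  let F : (WittVector p k ⊗[ℤ_[p]] O) →ₐ[ℤ_[p]] S :=
    { ψ with
      commutes' := fun r => by
        change ψ (algebraMap ℤ_[p] _ r) = _
        rw [Algebra.TensorProduct.algebraMap_apply, hC, AlgHom.commutes] }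
  refine ⟨ptOfHom F, fun i => ?_⟩
  rw [ext_ptOfHom (c := c) (fun a => hC a)]
  have := hψφ (MvPolynomial.X i)
  rw [MvPolynomial.aeval_X, MvPolynomial.eval₂_X] at this
  exact this

theorem Cochar.Pres.eval₂_aeval_ξ (s : ι → S) (f : MvPolynomial ι (WittVector p k)) :
    MvPolynomial.eval₂ (c : WittVector p k →+* S) s (MvPolynomial.aeval P.ξ f) =
      MvPolynomial.eval₂ (c : WittVector p k →+* S)
        (fun i => MvPolynomial.eval₂ (c : WittVector p k →+* S) s (P.ξ i)) f := by
  induction f using MvPolynomial.induction_on with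
  | C a => rw [MvPolynomial.aeval_C, MvPolynomial.eval₂_C, MvPolynomial.algebraMap_eq,
      MvPolynomial.eval₂_C]
  | add f g hf hg => simp only [map_add, MvPolynomial.eval₂_add, hf, hg]
  | mul_X f i hf => simp only [map_mul, MvPolynomial.eval₂_mul, hf, MvPolynomial.aeval_X,
      MvPolynomial.eval₂_X]

/-- A Newton step that terminates: `ξ` carries equations into the square of the ideal of equations,
so only that square has to vanish at `s`. -/
theorem Cochar.Pres.exists_pt_of_sq (s : ι → S) (hs : ∀ f ∈ RingHom.ker
      (MvPolynomial.aeval P.x : MvPolynomial ι (WittVector p k) →ₐ[WittVector p k] _) ^ 2,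
      MvPolynomial.eval₂ (c : WittVector p k →+* S) s f = 0) :
    ∃ g : Pt p O S, ∀ i, ext c g (P.x i) =
      MvPolynomial.eval₂ (c : WittVector p k →+* S) s (P.ξ i) :=
  P.exists_pt c _ fun f hf => by rw [← P.eval₂_aeval_ξ, hs _ (P.ξ_ker f hf)]

open Classical in
theorem eval₂_inl_eps {R : Type*} [CommRing R] (j : ι) (f : MvPolynomial ι R) :
    MvPolynomial.eval₂ (TrivSqZeroExt.inlHom R R)
      (fun i => if i = j then (DualNumber.eps : DualNumber R) else 0) f =
      TrivSqZeroExt.inl (MvPolynomial.constantCoeff f) +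
        TrivSqZeroExt.inr (f.coeff (Finsupp.single j 1)) := by
  induction f using MvPolynomial.induction_on with
  | C a =>
    rw [MvPolynomial.eval₂_C, MvPolynomial.coeff_C, if_neg (by simp [eq_comm])]
    simp
  | add f g hf hg =>
    rw [MvPolynomial.eval₂_add, hf, hg, map_add, MvPolynomial.coeff_add, TrivSqZeroExt.inl_add,
      TrivSqZeroExt.inr_add]
    abel
  | mul_X f i hf =>
    rw [MvPolynomial.eval₂_mul, MvPolynomial.eval₂_X, hf, MvPolynomial.coeff_mul_X']
    by_cases h : i = j
    · subst h
      simp only [if_true, map_mul, MvPolynomial.constantCoeff_X, mul_zero]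
      ext <;> simp [MvPolynomial.constantCoeff_eq]
    · simp [h]

theorem lext_mul {d : O →ₗ[ℤ_[p]] S} (hd : d ∈ lieAlg p O S) (y z : WittVector p k ⊗[ℤ_[p]] O) :
    lext c d (y * z) = c (augm p k O y) * lext c d z + c (augm p k O z) * lext c d y := by
  induction y with
  | zero => simp
  | add y y' hy hy' => simp only [add_mul, map_add, hy, hy']; ring
  | tmul a y =>
    induction z with
    | zero => simp
    | add y y' hy hy' => simp only [mul_add, map_add, hy, hy']; ring
    | tmul b z =>
      rw [Algebra.TensorProduct.tmul_mul_tmul, lext_tmul, lext_tmul, lext_tmul, hd, augm_tmul,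
        augm_tmul, map_mul, map_mul, map_mul, AlgHom.commutes, AlgHom.commutes, Algebra.smul_def,
        Algebra.smul_def]
      ring

theorem lext_one {d : O →ₗ[ℤ_[p]] S} (hd : d ∈ lieAlg p O S) :
    lext c d (1 : WittVector p k ⊗[ℤ_[p]] O) = 0 := by
  have := lext_mul c hd (1 : WittVector p k ⊗[ℤ_[p]] O) 1
  rw [mul_one, map_one (augm p k O), map_one c, one_mul] at this
  simpa using this

theorem lext_sq {d : O →ₗ[ℤ_[p]] S} (hd : d ∈ lieAlg p O S) {y : WittVector p k ⊗[ℤ_[p]] O}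
    (hy : y ∈ augIdeal p k O ^ 2) : lext c d y = 0 := by
  rw [pow_two] at hy
  refine Submodule.mul_induction_on hy (fun a ha b hb => ?_) fun a b ha hb => by
    rw [map_add, ha, hb, add_zero]
  rw [lext_mul c hd, mem_augIdeal.mp ha, mem_augIdeal.mp hb, map_zero, zero_mul, zero_mul, add_zero]

open Classical in
/-- The derivations of `O` dual to the generators. -/
theorem Cochar.Pres.exists_deriv (j : ι) : ∃ D ∈ lieAlg p O (WittVector p k),
    ∀ i, lext (AlgHom.id ℤ_[p] _) D (P.x i) = (P.ξ i).coeff (Finsupp.single j 1) := by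
  set R := WittVector p k
  let cc : R →ₐ[ℤ_[p]] DualNumber R := TrivSqZeroExt.inlAlgHom ℤ_[p] R R
  let q : DualNumber R →ₐ[ℤ_[p]] R := TrivSqZeroExt.fstHom ℤ_[p] R R
  let s : ι → DualNumber R := fun i => if i = j then DualNumber.eps else 0
  have hev : ∀ f, MvPolynomial.eval₂ (cc : R →+* DualNumber R) s f =
      TrivSqZeroExt.inl (MvPolynomial.constantCoeff f) +
        TrivSqZeroExt.inr (f.coeff (Finsupp.single j 1)) := eval₂_inl_eps j
  -- The equations have no constant term, so products of two of them vanish at the tangent vector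
  -- `s` in the direction `j`. The vector `s` itself need not be a point, but its correction by `ξ`
  -- is.
  obtain ⟨g, hg⟩ := P.exists_pt_of_sq cc s fun f hf => by
    rw [pow_two] at hf
    refine Submodule.mul_induction_on hf (fun a ha b hb => ?_) fun a b ha hb => by
      rw [MvPolynomial.eval₂_add, ha, hb, add_zero]
    have ha' : MvPolynomial.constantCoeff a = 0 := by
      rw [← P.augm_aeval, show MvPolynomial.aeval P.x a = 0 from ha, map_zero]
    have hb' : MvPolynomial.constantCoeff b = 0 := by
      rw [← P.augm_aeval, show MvPolynomial.aeval P.x b = 0 from hb, map_zero]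
    rw [MvPolynomial.eval₂_mul, hev, hev, ha', hb']
    simp
  have hg1 : Pt.map q g = 1 := by
    refine ext_eq_of_forall (c := AlgHom.id ℤ_[p] R) fun y => ?_
    obtain ⟨f, rfl⟩ := P.surj y
    rw [ext_aeval, ext_aeval]
    congr 1
    ext1 i
    have h1 := ext_map q cc g (P.x i)
    rw [show q.comp cc = AlgHom.id ℤ_[p] R from AlgHom.ext fun _ => rfl] at h1
    rw [h1, hg, hev, P.constantCoeff_ξ, ext_one, P.augm_eq]
    simp [q]
  have hfst : ∀ y, (g.hom y).fst = algebraMap ℤ_[p] R (Coalgebra.counit y) := fun y => by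
    rw [← Pt.one_hom, ← hg1]
    rfl
  let sn : DualNumber R →ₗ[ℤ_[p]] R := (TrivSqZeroExt.sndHom R R).restrictScalars ℤ_[p]
  refine ⟨sn ∘ₗ g.hom.toLinearMap, fun y z => ?_, fun i => ?_⟩
  · change (g.hom (y * z)).snd = _ • (g.hom z).snd + _ • (g.hom y).snd
    rw [map_mul, TrivSqZeroExt.snd_mul, hfst, hfst, Algebra.smul_def, Algebra.smul_def]
    exact congrArg₂ (· + ·) rfl (mul_comm _ _)
  · have h1 : ∀ y, lext (AlgHom.id ℤ_[p] R) (sn ∘ₗ g.hom.toLinearMap) y = sn (ext cc g y) :=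
      fun y => by
        induction y with
        | zero => simp
        | add y z hy hz => rw [map_add, map_add, map_add, hy, hz]
        | tmul a y =>
          rw [lext_tmul, ext_tmul]
          change a * (g.hom y).snd = ((TrivSqZeroExt.inl a : DualNumber R) * g.hom y).snd
          simp
    rw [h1, hg, hev]
    change TrivSqZeroExt.snd _ = _
    simp

/-- The derivation of `O` dual to a generator. -/
def Cochar.Pres.D (j : ι) : O →ₗ[ℤ_[p]] WittVector p k := (P.exists_deriv j).choose

theorem Cochar.Pres.D_mem (j : ι) : P.D j ∈ lieAlg p O (WittVector p k) :=
  (P.exists_deriv j).choose_spec.1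

/-- The coordinates of the differential of a function at the unit section. -/
def Cochar.Pres.coord (j : ι) (y : WittVector p k ⊗[ℤ_[p]] O) : WittVector p k :=
  lext (AlgHom.id ℤ_[p] _) (P.D j) y

theorem Cochar.Pres.coord_x (i j : ι) :
    P.coord j (P.x i) = (P.ξ i).coeff (Finsupp.single j 1) :=
  (P.exists_deriv j).choose_spec.2 i

theorem Cochar.Pres.coord_mul (j : ι) (y z : WittVector p k ⊗[ℤ_[p]] O) :
    P.coord j (y * z) = augm p k O y * P.coord j z + augm p k O z * P.coord j y :=
  lext_mul _ (P.D_mem j) y z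

theorem Cochar.Pres.lext_D (j : ι) (y : WittVector p k ⊗[ℤ_[p]] O) :
    lext c (c.toLinearMap ∘ₗ P.D j) y = c (P.coord j y) := by
  rw [coord, ← lext_comp]
  rfl

open Classical in
theorem Cochar.Pres.sub_sum_coeff_mem [Fintype ι] (f : MvPolynomial ι (WittVector p k)) :
    MvPolynomial.aeval P.x f - MvPolynomial.constantCoeff f • 1 -
      ∑ j, f.coeff (Finsupp.single j 1) • P.x j ∈ augIdeal p k O ^ 2 := by
  induction f using MvPolynomial.induction_on with
  | C a =>
    rw [MvPolynomial.aeval_C, Algebra.algebraMap_eq_smul_one, MvPolynomial.constantCoeff_C,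
      sub_self, Finset.sum_eq_zero, sub_zero]
    · exact zero_mem _
    · intro j _
      rw [MvPolynomial.coeff_C, if_neg (by simp [eq_comm]), zero_smul]
  | add f g hf hg =>
    convert add_mem hf hg using 1
    simp only [map_add, add_smul, Finset.sum_add_distrib, MvPolynomial.coeff_add]
    abel
  | mul_X f i hf =>
    have h1 : ∑ j, (f * MvPolynomial.X i).coeff (Finsupp.single j 1) • P.x j =
        MvPolynomial.constantCoeff f • P.x i := by
      rw [Finset.sum_eq_single i]
      · rw [MvPolynomial.coeff_mul_X', if_pos (by simp), tsub_self]
        rfl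
      · intro j _ hj
        rw [MvPolynomial.coeff_mul_X', if_neg (by simp [hj.symm]),
          zero_smul]
      · simp
    rw [h1, map_mul, map_mul, MvPolynomial.aeval_X, MvPolynomial.constantCoeff_X, mul_zero,
      zero_smul, sub_zero, ← P.augm_aeval]
    convert pow_two (augIdeal p k O) ▸ Ideal.mul_mem_mul
      (sub_augm_mem (MvPolynomial.aeval P.x f)) (mem_augIdeal.mpr (P.augm_eq i)) using 1
    rw [sub_mul, smul_mul_assoc, one_mul]

/-- The generators can be dependent modulo the square of the augmentation ideal, so linear
coefficients of a polynomial representing `y` are ambiguous; the values `P.coord j y` are not. The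
identity `x i = ξ i (x)` shows that they serve as coefficients for the generators, and the product
rule extends this to all `y`. -/
theorem Cochar.Pres.sub_sum_mem [Fintype ι] (y : WittVector p k ⊗[ℤ_[p]] O) :
    y - augm p k O y • 1 - ∑ j, P.coord j y • P.x j ∈ augIdeal p k O ^ 2 := by
  obtain ⟨f, rfl⟩ := P.surj y
  induction f using MvPolynomial.induction_on with
  | C a =>
    have h : (MvPolynomial.aeval P.x (MvPolynomial.C a) : WittVector p k ⊗[ℤ_[p]] O) = a • 1 := by
      rw [MvPolynomial.aeval_C, Algebra.algebraMap_eq_smul_one]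
    have h2 : ∀ j, P.coord j (a • 1) = 0 := fun j => by
      rw [coord, lext_algebraMap_mul, lext_one _ (P.D_mem j), mul_zero]
    simp only [h, h2, augm_smul, map_one, mul_one, zero_smul,
      Finset.sum_const_zero, sub_self, zero_mem]
  | add f g hf hg =>
    convert add_mem hf hg using 1
    simp only [map_add, add_smul, Finset.sum_add_distrib, coord]
    abel
  | mul_X f i hf =>
    have hi := P.sub_sum_coeff_mem (P.ξ i)
    rw [P.aeval_ξ, P.constantCoeff_ξ, zero_smul, sub_zero] at hi
    simp only [← P.coord_x] at hi
    set y := (MvPolynomial.aeval P.x f : WittVector p k ⊗[ℤ_[p]] O) with hy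
    have h1 : (MvPolynomial.aeval P.x (f * MvPolynomial.X i) : WittVector p k ⊗[ℤ_[p]] O) =
      y * P.x i := by rw [map_mul, MvPolynomial.aeval_X]
    rw [h1]
    convert add_mem (pow_two (augIdeal p k O) ▸ Ideal.mul_mem_mul
      (sub_augm_mem y) (mem_augIdeal.mpr (P.augm_eq i)))
        ((augIdeal p k O ^ 2).smul_of_tower_mem (augm p k O y) hi) using 1
    simp only [P.coord_mul, P.augm_eq, zero_mul, add_zero, map_mul, mul_zero, zero_smul, sub_zero,
      smul_sub, Finset.smul_sum, smul_smul, sub_mul, smul_mul_assoc, one_mul]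
    abel

variable {c}

theorem ext_mem_sq {𝔞 : Ideal S} {g : Pt p O S} (hg : g ∈ Pt.congr p O 𝔞)
    {y : WittVector p k ⊗[ℤ_[p]] O} (hy : y ∈ augIdeal p k O ^ 2) : ext c g y ∈ 𝔞 ^ 2 := by
  rw [pow_two] at hy
  refine Submodule.mul_induction_on hy (fun a ha b hb => ?_) fun a b ha hb => by
    rw [map_add]; exact add_mem ha hb
  rw [map_mul, pow_two]
  exact Ideal.mul_mem_mul (ext_mem_of_augm_eq_zero hg c ha) (ext_mem_of_augm_eq_zero hg c hb)

/-- First order expansion of a point close to the unit. -/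
theorem Cochar.Pres.ext_sub_sum_mem [Fintype ι] {𝔞 : Ideal S} {g : Pt p O S}
    (hg : g ∈ Pt.congr p O 𝔞) (y : WittVector p k ⊗[ℤ_[p]] O) :
    ext c g y - c (augm p k O y) - ∑ j, c (P.coord j y) * ext c g (P.x j) ∈ 𝔞 ^ 2 := by
  have h := ext_mem_sq (c := c) hg (P.sub_sum_mem y)
  simpa only [map_sub, map_sum, ext_smul, map_one, mul_one] using h

theorem Cochar.Pres.lext_eq_sum [Fintype ι] {d : O →ₗ[ℤ_[p]] S} (hd : d ∈ lieAlg p O S)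
    (y : WittVector p k ⊗[ℤ_[p]] O) :
    lext c d y = ∑ j, c (P.coord j y) * lext c d (P.x j) := by
  have h := lext_sq c hd (P.sub_sum_mem y)
  simp only [map_sub, map_sum, lext_algebraMap_mul, lext_one c hd, mul_zero, sub_zero] at h
  exact sub_eq_zero.mp h

theorem lext_ext {d e : O →ₗ[ℤ_[p]] S}
    (h : ∀ y : WittVector p k ⊗[ℤ_[p]] O, lext c d y = lext c e y) : d = e :=
  LinearMap.ext fun y => by rw [← lext_one_tmul c, h, lext_one_tmul]

/-- The derivations `P.D j` generate the Lie algebra after every base change. Statements that are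
semilinear in `d` thus reduce to finitely many derivations defined over `W(k)`. -/
theorem Cochar.Pres.lie_eq_sum [Fintype ι] {d : O →ₗ[ℤ_[p]] S} (hd : d ∈ lieAlg p O S) :
    d = ∑ j, lext c d (P.x j) • (c.toLinearMap ∘ₗ P.D j) := by
  refine LinearMap.ext fun y => ?_
  rw [← lext_one_tmul c, P.lext_eq_sum hd, LinearMap.sum_apply]
  refine Finset.sum_congr rfl fun j _ => ?_
  rw [LinearMap.smul_apply, smul_eq_mul, mul_comm, ← P.lext_D, lext_one_tmul]

theorem Cochar.Pres.lie_ext [Fintype ι] {d e : O →ₗ[ℤ_[p]] S} (hd : d ∈ lieAlg p O S)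
    (he : e ∈ lieAlg p O S) (h : ∀ j, lext c d (P.x j) = lext c e (P.x j)) : d = e := by
  rw [P.lie_eq_sum (c := c) hd, P.lie_eq_sum (c := c) he]
  simp only [h]

theorem Cochar.Pres.mem_congr_of_x {𝔞 : Ideal S} {g : Pt p O S}
    (h : ∀ i, ext c g (P.x i) ∈ 𝔞) : g ∈ Pt.congr p O 𝔞 := by
  refine mem_congr_of_ext c fun y => ?_
  obtain ⟨f, rfl⟩ := P.surj y
  induction f using MvPolynomial.induction_on with
  | C a =>
    rw [MvPolynomial.aeval_C, Algebra.algebraMap_eq_smul_one, ext_smul,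
      augm_smul, map_one, map_one, mul_one, mul_one, sub_self]
    exact zero_mem _
  | add f g hf hg =>
    convert add_mem hf hg using 1
    simp only [map_add]
    ring
  | mul_X f i hf =>
    simp only [map_mul, MvPolynomial.aeval_X, P.augm_eq, mul_zero, map_zero,
      sub_zero]
    exact 𝔞.mul_mem_left _ (h i)

theorem Cochar.Pres.ext_x_mem {𝔞 : Ideal S} {g : Pt p O S} (hg : g ∈ Pt.congr p O 𝔞) (i : ι) :
    ext c g (P.x i) ∈ 𝔞 := ext_mem_of_augm_eq_zero hg c (P.augm_eq i)

/-- Homogeneity of `ξ` makes the dual derivations weight vectors: `ξ i` can contain `X j` linearly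
only if the degrees of `x i` and `x j` agree. -/
theorem Cochar.Pres.adj_D [Fintype ι] (j : ι) :
    adj (μ.gen (AlgHom.id ℤ_[p] (WittVector p k)))
        ((constLaurent p (WittVector p k)).toLinearMap ∘ₗ P.D j) =
      (LaurentPolynomial.T (P.deg j) : (WittVector p k)[T;T⁻¹]) •
        ((constLaurent p (WittVector p k)).toLinearMap ∘ₗ P.D j) := by
  have hD := comp_mem_lieAlg (constLaurent p (WittVector p k)).toLinearMap (P.D_mem j)
  refine P.lie_ext (c := constLaurent p (WittVector p k)) (adj_mem_lieAlg _ hD)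
    (Submodule.smul_mem _ _ hD) fun i => ?_
  rw [μ.gen_eq]
  have h1 := (P.isHom i).lext_adj' (constLaurent p (WittVector p k)) (unitT _)
    ((constLaurent p (WittVector p k)).toLinearMap ∘ₗ P.D j)
  refine h1.trans ?_
  rw [unitT_zpow, lext_smul, P.lext_D, P.coord_x, mul_comm]
  by_cases h : P.deg i = P.deg j
  · rw [h]
  · have : (P.ξ i).coeff (Finsupp.single j 1) = 0 := by
      refine (P.ξ_hom i).coeff_eq_zero _ ?_
      rw [Finsupp.weight_single, one_smul]
      exact fun e => h e.symm
    rw [this, map_zero, mul_zero, mul_zero]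

theorem Cochar.Pres.coord_eq_zero [Fintype ι] {n : ℤ} {y : WittVector p k ⊗[ℤ_[p]] O}
    (hy : μ.IsHom n y) {j : ι} (hn : n ≠ P.deg j) : P.coord j y = 0 := by
  have h1 := hy.lext_adj' (constLaurent p (WittVector p k)) (unitT _)
    ((constLaurent p (WittVector p k)).toLinearMap ∘ₗ P.D j)
  have h2 := P.adj_D j
  rw [μ.gen_eq] at h2
  have h3 : lext (constLaurent p (WittVector p k)) _ y = _ :=
    congrArg (fun d => lext (constLaurent p (WittVector p k)) d y) h2
  have h4 := h1.symm.trans h3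
  rw [lext_smul, P.lext_D, constLaurent_apply, unitT_zpow, mul_comm (LaurentPolynomial.T _)] at h4
  have h5 := congrArg (fun f => f.coeff n) h4
  simp only [coeff_C_mul_T, if_true, if_neg hn.symm] at h5
  exact h5

theorem Cochar.Pres.D_eq_zero [Fintype ι] (hμ : μ.IsPhiDatum) {j : ι}
    (hj : 2 ≤ P.deg j) : P.D j = 0 :=
  hμ.weight (P.deg j) (by omega) (by omega) _ (P.D_mem j) (P.adj_D j)

/-- The only dual derivations that can detect a function of degree `n` have weight `n`, and by the
weight condition they are zero for `n ≥ 2`. So the differential of `y` at the unit vanishes. -/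
theorem Cochar.Pres.mem_sq_of_isHom [Fintype ι] (P : μ.Pres ι) (hμ : μ.IsPhiDatum) {n : ℤ}
    {y : WittVector p k ⊗[ℤ_[p]] O} (hy : μ.IsHom n y) (hn : 2 ≤ n) :
    y ∈ augIdeal p k O ^ 2 := by
  have h := P.sub_sum_mem y
  rw [hy.augm_eq_zero (by omega), zero_smul, sub_zero, Finset.sum_eq_zero, sub_zero] at h
  · exact h
  · intro j _
    by_cases hj : n = P.deg j
    · rw [coord, P.D_eq_zero hμ (by omega)]
      have : lext (AlgHom.id ℤ_[p] (WittVector p k)) (0 : O →ₗ[ℤ_[p]] WittVector p k) y = 0 := by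
        have := lext_smul (AlgHom.id ℤ_[p] (WittVector p k)) 0 (0 : O →ₗ[ℤ_[p]] WittVector p k) y
        rwa [smul_zero, zero_mul] at this
      rw [this, zero_smul]
    · rw [P.coord_eq_zero hy hj, zero_smul]

end PresentationLie

/-! ### Values of the points of `G⁺` -/

section PosValues

variable {p : ℕ} [Fact p.Prime] {k : Type w} [Field k] [CharP k p]
  {O : Type v} [CommRing O] [HopfAlgebra ℤ_[p] O] {μ : Cochar p k O}
  {S S' : Type*} [CommRing S] [Algebra ℤ_[p] S] [CommRing S']
  {ι : Type} [Fintype ι]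

/-- The homogeneous elements of degree one. -/
def Cochar.degOne (μ : Cochar p k O) : Submodule (WittVector p k) (WittVector p k ⊗[ℤ_[p]] O) where
  carrier := {x | μ.IsHom 1 x}
  add_mem' := IsHom.add
  zero_mem' := IsHom.zero
  smul_mem' a _ h := h.smul a

/-- The ideal of functions that vanish on `G⁺`. -/
def Cochar.posIdeal (μ : Cochar p k O) : Ideal (WittVector p k ⊗[ℤ_[p]] O) :=
  Ideal.span {x | augm p k O x = 0 ∧ ∃ n ≤ 0, μ.IsHom n x}

theorem Cochar.augm_proj_zero (x : WittVector p k ⊗[ℤ_[p]] O) :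
    augm p k O (μ.proj 0 x) = augm p k O x := by
  obtain ⟨s, hs, hs'⟩ := μ.sum_proj x
  conv_rhs => rw [hs, map_sum]
  rw [Finset.sum_eq_single 0 (fun n _ hn => (μ.isHom_proj n x).augm_eq_zero hn)]
  intro h
  rw [hs' 0 h, map_zero]

theorem Cochar.augm_proj {x : WittVector p k ⊗[ℤ_[p]] O} (hx : augm p k O x = 0) (n : ℤ) :
    augm p k O (μ.proj n x) = 0 := by
  by_cases h : n = 0
  · rw [h, augm_proj_zero, hx]
  · exact (μ.isHom_proj n x).augm_eq_zero h

theorem Cochar.IsHom.proj_self {n : ℤ} {x : WittVector p k ⊗[ℤ_[p]] O} (hx : μ.IsHom n x) :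
    μ.proj n x = x := by rw [proj_of_isHom hx, if_pos rfl]

/-- Induction on the degree. For `n ≥ 2` the function is a sum of products `a b` in the augmentation
ideal, homogeneous with degrees adding up to `n`. If a factor has degree at most `0`, it vanishes on
`G⁺`; otherwise both degrees are smaller than `n`. -/
theorem Cochar.Pres.mem_sup_pow (P : μ.Pres ι) (hμ : μ.IsPhiDatum) (n : ℕ) (hn : 1 ≤ n)
    {x : WittVector p k ⊗[ℤ_[p]] O} (hx : μ.IsHom n x) :
    x ∈ μ.posIdeal.restrictScalars (WittVector p k) ⊔ μ.degOne ^ n := by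
  induction n using Nat.strong_induction_on generalizing x with
  | _ n ih =>
  rcases hn.eq_or_lt with rfl | hn
  · rw [pow_one]
    exact Submodule.mem_sup_right (show μ.IsHom 1 x by simpa using hx)
  have hsq := P.mem_sq_of_isHom hμ hx (by omega)
  rw [← hx.proj_self]
  rw [pow_two] at hsq
  refine Submodule.mul_induction_on hsq (fun a ha b hb => ?_) fun a b ha hb => by
    rw [proj_add]; exact add_mem ha hb
  obtain ⟨s, hs, -⟩ := μ.sum_proj a
  obtain ⟨t, ht, -⟩ := μ.sum_proj b
  rw [hs, ht, Finset.sum_mul_sum, proj_sum]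
  refine sum_mem fun i _ => ?_
  rw [proj_sum]
  refine sum_mem fun j _ => ?_
  rw [proj_of_isHom ((μ.isHom_proj i a).mul (μ.isHom_proj j b))]
  split_ifs with hij
  swap
  · exact zero_mem _
  rcases le_or_gt i 0 with hi | hi
  · exact Submodule.mem_sup_left (μ.posIdeal.mul_mem_right _ (Ideal.subset_span
      ⟨augm_proj ha _, i, hi, μ.isHom_proj i a⟩))
  rcases le_or_gt j 0 with hj | hj
  · exact Submodule.mem_sup_left (μ.posIdeal.mul_mem_left _ (Ideal.subset_span
      ⟨augm_proj hb _, j, hj, μ.isHom_proj j b⟩))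
  lift i to ℕ using hi.le
  lift j to ℕ using hj.le
  have hij' : i + j = n := by exact_mod_cast hij
  obtain ⟨a₁, ha₁, a₂, ha₂, ha'⟩ := Submodule.mem_sup.mp
    (ih i (by omega) (by omega) (μ.isHom_proj i a))
  obtain ⟨b₁, hb₁, b₂, hb₂, hb'⟩ := Submodule.mem_sup.mp
    (ih j (by omega) (by omega) (μ.isHom_proj j b))
  rw [← ha', ← hb', add_mul, mul_add a₂]
  refine add_mem (Submodule.mem_sup_left (μ.posIdeal.mul_mem_right _ ha₁))
    (add_mem (Submodule.mem_sup_left (μ.posIdeal.mul_mem_left _ hb₁))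
      (Submodule.mem_sup_right ?_))
  rw [← hij', pow_add]
  exact Submodule.mul_mem_mul ha₂ hb₂

theorem Cochar.ext_posIdeal {c : WittVector p k →ₐ[ℤ_[p]] S} {g : Pt p O S} (hg : g ∈ μ.pos c)
    {x : WittVector p k ⊗[ℤ_[p]] O} (hx : x ∈ μ.posIdeal) : ext c g x = 0 := by
  have : μ.posIdeal ≤ RingHom.ker (ext c g) := by
    rw [posIdeal, Ideal.span_le]
    rintro y ⟨h, n, hn, hy⟩
    change ext c g y = 0
    rw [mem_pos.mp hg n y hn hy, h, map_zero]
  exact this hx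

/-- A point of `G⁺` is determined by its values on functions of degree one. -/
theorem Cochar.Pres.pos_ext (P : μ.Pres ι) (hμ : μ.IsPhiDatum) {c : WittVector p k →ₐ[ℤ_[p]] S}
    {g h : Pt p O S} (hg : g ∈ μ.pos c) (hh : h ∈ μ.pos c)
    (H : ∀ x, μ.IsHom 1 x → ext c g x = ext c h x) : g = h := by
  refine eq_of_forall_isHom μ (c := c) fun n x hx => ?_
  rcases le_or_gt n 0 with hn | hn
  · rw [mem_pos.mp hg n x hn hx, mem_pos.mp hh n x hn hx]
  lift n to ℕ using hn.le
  obtain ⟨y, hy, z, hz, rfl⟩ := Submodule.mem_sup.mp (P.mem_sup_pow hμ n (by omega) hx)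
  rw [map_add, map_add, ext_posIdeal hg hy, ext_posIdeal hh hy]
  congr 1
  clear hx hn
  induction hz using Submodule.pow_induction_on_left' with
  | algebraMap r => rw [Algebra.algebraMap_eq_smul_one, ext_smul, ext_smul, map_one, map_one]
  | add x y i hx hy h1 h2 => rw [map_add, map_add, h1, h2]
  | mem_mul m hm i x hx h1 => rw [map_mul, map_mul, h1, H m hm]

/-- Supplies the divisibility by `pⁿ` in degree `n` from divisibility by `p` in degree `1`; this is
what makes conjugation by `μ(p)⁻¹` integral on suitable points of `G⁺`. -/
theorem Cochar.Pres.map_ext_mem_pow (P : μ.Pres ι) (hμ : μ.IsPhiDatum)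
    {c : WittVector p k →ₐ[ℤ_[p]] S} {g : Pt p O S} (hg : g ∈ μ.pos c) (φ : S →+* S')
    {𝔮 : Ideal S'} (H : ∀ x, μ.IsHom 1 x → φ (ext c g x) ∈ 𝔮) {n : ℕ} (hn : 1 ≤ n)
    {x : WittVector p k ⊗[ℤ_[p]] O} (hx : μ.IsHom n x) : φ (ext c g x) ∈ 𝔮 ^ n := by
  obtain ⟨y, hy, z, hz, rfl⟩ := Submodule.mem_sup.mp (P.mem_sup_pow hμ n (by omega) hx)
  rw [map_add, ext_posIdeal hg hy, zero_add]
  clear hx hn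
  induction hz using Submodule.pow_induction_on_left' with
  | algebraMap r => simp
  | add x y i hx hy h1 h2 => rw [map_add, map_add]; exact add_mem h1 h2
  | mem_mul m hm i x hx h1 =>
    rw [map_mul, map_mul, pow_succ']
    exact Ideal.mul_mem_mul (H m hm) h1

end PosValues

/-! ### Complete filtrations -/

section Filtration

variable {S : Type*} [CommRing S]

/-- A separated and complete filtration by ideals. -/
structure IsCompleteFiltration (N : ℕ → Ideal S) : Prop where
  anti : Antitone N
  sep : ∀ x, (∀ n, x ∈ N n) → x = 0
  lim : ∀ x : ℕ → S, (∀ n, x (n + 1) - x n ∈ N n) → ∃ y, ∀ n, y - x n ∈ N n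

/-- The closure of an ideal with respect to a filtration. -/
def idealClosure (N : ℕ → Ideal S) (𝔞 : Ideal S) : Ideal S := ⨅ n, 𝔞 ⊔ N n

variable {N : ℕ → Ideal S} {𝔞 𝔟 : Ideal S}

theorem mem_idealClosure {x : S} : x ∈ idealClosure N 𝔞 ↔ ∀ n, ∃ y ∈ 𝔞, x - y ∈ N n := by
  rw [idealClosure, Ideal.mem_iInf]
  refine forall_congr' fun n => ?_
  rw [Submodule.mem_sup]
  constructor
  · rintro ⟨y, hy, z, hz, rfl⟩
    exact ⟨y, hy, by simpa using hz⟩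
  · rintro ⟨y, hy, h⟩
    exact ⟨y, hy, _, h, by ring⟩

theorem le_idealClosure : 𝔞 ≤ idealClosure N 𝔞 := le_iInf fun _ => le_sup_left

theorem idealClosure_mono (h : 𝔞 ≤ 𝔟) : idealClosure N 𝔞 ≤ idealClosure N 𝔟 :=
  iInf_mono fun _ => sup_le_sup_right h _

theorem idealClosure_idealClosure_le :
    idealClosure N (idealClosure N 𝔞) ≤ idealClosure N 𝔞 :=
  le_iInf fun n => (iInf_le _ n).trans (sup_le (iInf_le _ n) le_sup_right)

theorem idealClosure_le_of_le {n : ℕ} (h : 𝔞 ≤ N n) : idealClosure N 𝔞 ≤ N n :=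
  (iInf_le _ n).trans (sup_le h le_rfl)

theorem idealClosure_sq_le : idealClosure N 𝔞 ^ 2 ≤ idealClosure N (𝔞 ^ 2) := by
  refine le_iInf fun n => ?_
  refine (Ideal.pow_right_mono (iInf_le _ n) 2).trans ?_
  rw [pow_two, pow_two, Ideal.mul_le]
  intro x hx y hy
  obtain ⟨a, ha, b, hb, rfl⟩ := Submodule.mem_sup.mp hx
  obtain ⟨a', ha', b', hb', rfl⟩ := Submodule.mem_sup.mp hy
  refine Submodule.mem_sup.mpr ⟨a * a', Ideal.mul_mem_mul ha ha', a * b' + b * (a' + b'),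
    add_mem ((N n).mul_mem_left _ hb') ((N n).mul_mem_right _ hb), by ring⟩

theorem IsCompleteFiltration.eq_of_sub_mem (hN : IsCompleteFiltration N) {x y : S}
    (h : ∀ n, x - y ∈ N n) : x = y := sub_eq_zero.mp (hN.sep _ h)

/-- The axiom `lim` prescribes the speed of convergence; passing to a subsequence removes this
restriction. -/
theorem IsCompleteFiltration.exists_lim (hN : IsCompleteFiltration N) (x : ℕ → S)
    (hx : ∀ n, ∃ M, ∀ m ≥ M, x (m + 1) - x m ∈ N n) :
    ∃ y, ∀ n, ∃ M, ∀ m ≥ M, y - x m ∈ N n := by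
  choose M hM using hx
  have hle : ∀ n m m', M n ≤ m → m ≤ m' → x m' - x m ∈ N n := fun n m m' hm hmm' => by
    induction m', hmm' using Nat.le_induction with
    | base => simp
    | succ m' hmm' ih =>
      convert add_mem (hM n m' (hm.trans hmm')) ih using 1
      ring
  -- Partial sums dominate `M n` and are monotone in `n`, which `M` itself need not be.
  let a : ℕ → ℕ := fun n => ∑ i ∈ Finset.range (n + 1), M i
  have ha : ∀ n, M n ≤ a n := fun n =>
    Finset.single_le_sum (f := M) (fun _ _ => Nat.zero_le _) (Finset.self_mem_range_succ n)
  have ha' : ∀ n, a n ≤ a (n + 1) := fun n => by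
    simp only [a, Finset.sum_range_succ (fun i => M i) (n + 1)]
    omega
  obtain ⟨y, hy⟩ := hN.lim (fun n => x (a n)) fun n => hle n _ _ (ha n) (ha' n)
  refine ⟨y, fun n => ⟨a n, fun m hm => ?_⟩⟩
  convert sub_mem (hy n) (hle n _ _ (ha n) hm) using 1
  ring

variable {p : ℕ} [Fact p.Prime] {O : Type v} [CommRing O] [HopfAlgebra ℤ_[p] O] [Algebra ℤ_[p] S]

theorem Pt.eq_of_forall_mem_congr (hN : IsCompleteFiltration N) {g h : Pt p O S}
    (H : ∀ n, g⁻¹ * h ∈ Pt.congr p O (N n)) : g = h :=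
  Pt.ext fun y => hN.eq_of_sub_mem fun n => Pt.inv_mul_mem_congr_iff.mp (H n) y

/-- Limits of points. -/
theorem Pt.exists_lim (hN : IsCompleteFiltration N) {𝔞 : ℕ → Ideal S} (h𝔞 : Antitone 𝔞)
    (hcl : ∀ j, idealClosure N (𝔞 j) ≤ 𝔞 j) (hev : ∀ n, ∃ j, 𝔞 j ≤ N n) (g : ℕ → Pt p O S)
    (hg : ∀ j, (g j)⁻¹ * g (j + 1) ∈ Pt.congr p O (𝔞 j)) :
    ∃ γ : Pt p O S, ∀ j, (g j)⁻¹ * γ ∈ Pt.congr p O (𝔞 j) := by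
  have hstep : ∀ j y, (g (j + 1)).hom y - (g j).hom y ∈ 𝔞 j := fun j y => by
    rw [← neg_sub]
    exact neg_mem (Pt.inv_mul_mem_congr_iff.mp (hg j) y)
  choose l hl using fun y => hN.exists_lim (fun j => (g j).hom y) fun n => by
    obtain ⟨j, hj⟩ := hev n
    exact ⟨j, fun m hm => hj (h𝔞 hm (hstep m y))⟩
  -- Limits are unique, so the pointwise limit `l` inherits each ring operation from the comorphisms
  -- of `g m`.
  have huniq : ∀ y z, (∀ n, ∃ M, ∀ m ≥ M, z - (g m).hom y ∈ N n) → l y = z := fun y z hz =>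
    hN.eq_of_sub_mem fun n => by
      obtain ⟨M, hM⟩ := hl y n
      obtain ⟨M', hM'⟩ := hz n
      convert sub_mem (hM (max M M') (le_max_left _ _)) (hM' (max M M') (le_max_right _ _)) using 1
      ring
  have two : ∀ y z (op : S → S → S) (w : O), (∀ m, (g m).hom w = op ((g m).hom y) ((g m).hom z)) →
      (∀ (I : Ideal S) a b a' b', a - a' ∈ I → b - b' ∈ I → op a b - op a' b' ∈ I) →
      l w = op (l y) (l z) := fun y z op w hw hop => huniq _ _ fun n => by
    obtain ⟨M, hM⟩ := hl y n
    obtain ⟨M', hM'⟩ := hl z n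
    refine ⟨max M M', fun m hm => ?_⟩
    rw [hw]
    exact hop _ _ _ _ _ (hM m (le_trans (le_max_left _ _) hm))
      (hM' m (le_trans (le_max_right _ _) hm))
  have hmul : ∀ y z, l (y * z) = l y * l z := fun y z => two y z (· * ·) _ (fun m => map_mul _ _ _)
    fun I a b a' b' h1 h2 => by
      convert add_mem (I.mul_mem_right b h1) (I.mul_mem_left a' h2) using 1
      ring
  have hadd : ∀ y z, l (y + z) = l y + l z := fun y z => two y z (· + ·) _ (fun m => map_add _ _ _)
    fun I a b a' b' h1 h2 => by
      convert add_mem h1 h2 using 1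
      ring
  have hcomm : ∀ r, l (algebraMap ℤ_[p] O r) = algebraMap ℤ_[p] S r := fun r =>
    huniq _ _ fun n => ⟨0, fun m _ => by rw [AlgHom.commutes, sub_self]; exact zero_mem _⟩
  have hzero : l 0 = 0 := by simpa using hcomm 0
  have hone : l 1 = 1 := by simpa using hcomm 1
  refine ⟨Pt.mk p ⟨⟨⟨⟨l, hone⟩, hmul⟩, hzero, hadd⟩, hcomm⟩, fun j => Pt.inv_mul_mem_congr_iff.mpr fun y => ?_⟩
  change (g j).hom y - l y ∈ 𝔞 j
  refine hcl j (mem_idealClosure.mpr fun n => ?_)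
  obtain ⟨M, hM⟩ := hl y n
  -- Approximating the limit by `g m` with `m ≥ j` gives elements of `𝔞 j`; closedness of `𝔞 j`
  -- passes this to the limit.
  refine ⟨(g j).hom y - (g (max M j)).hom y, ?_, ?_⟩
  · have : ∀ m ≥ j, (g j).hom y - (g m).hom y ∈ 𝔞 j := fun m hm => by
      induction m, hm using Nat.le_induction with
      | base => simp
      | succ m hm ih =>
        convert sub_mem ih (h𝔞 hm (hstep m y)) using 1
        ring
    exact this _ (le_max_right _ _)
  · convert neg_mem (hM (max M j) (le_max_left _ _)) using 1
    ring

end Filtration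

/-! ### Newton iteration and lifting of points -/

section Newton

variable {p : ℕ} [Fact p.Prime] {k : Type w} [Field k] [CharP k p]
  {O : Type v} [CommRing O] [HopfAlgebra ℤ_[p] O] {μ : Cochar p k O}
  {S S' : Type*} [CommRing S] [Algebra ℤ_[p] S] [CommRing S'] [Algebra ℤ_[p] S']
  {ι : Type} {P : μ.Pres ι} {c : WittVector p k →ₐ[ℤ_[p]] S}

/-- A monomial of positive weight contains a variable of positive weight. -/
theorem eval₂_eq_zero_of_deg_pos {R : Type*} [CommRing R] {f : MvPolynomial ι R} {w : ι → ℤ} {n : ℤ}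
    (hf : MvPolynomial.IsWeightedHomogeneous w f n) (hn : 0 < n) (c : R →+* S) {s : ι → S}
    (hs : ∀ i, 0 < w i → s i = 0) : MvPolynomial.eval₂ c s f = 0 := by
  rw [MvPolynomial.eval₂_eq]
  refine Finset.sum_eq_zero fun d hd => ?_
  have hd' := hf (MvPolynomial.mem_support_iff.mp hd)
  rw [Finsupp.weight_apply, Finsupp.sum] at hd'
  obtain ⟨i, hi, hi'⟩ : ∃ i ∈ d.support, 0 < d i • w i := by
    by_contra! h
    exact absurd (Finset.sum_nonpos h) (by omega)
  rw [Finset.prod_eq_zero hi, mul_zero]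
  have h1 : 0 < w i := by
    rw [nsmul_eq_mul] at hi'
    exact pos_of_mul_pos_right hi' (Int.natCast_nonneg _)
  rw [hs i h1, zero_pow (Finsupp.mem_support_iff.mp hi)]

/-- A non-constant monomial of weight at most `0` contains a variable of weight at most `0`. -/
theorem eval₂_eq_constantCoeff_of_deg_nonpos {R : Type*} [CommRing R] {f : MvPolynomial ι R}
    {w : ι → ℤ} {n : ℤ} (hf : MvPolynomial.IsWeightedHomogeneous w f n) (hn : n ≤ 0) (c : R →+* S)
    {s : ι → S} (hs : ∀ i, w i ≤ 0 → s i = 0) :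
    MvPolynomial.eval₂ c s f = c (MvPolynomial.constantCoeff f) := by
  rw [MvPolynomial.eval₂_eq, Finset.sum_eq_single 0]
  · simp [MvPolynomial.constantCoeff_eq]
  · intro d hd hd0
    have hd' := hf (MvPolynomial.mem_support_iff.mp hd)
    rw [Finsupp.weight_apply, Finsupp.sum] at hd'
    obtain ⟨i, hi, hi'⟩ : ∃ i ∈ d.support, w i ≤ 0 := by
      by_contra! h
      refine absurd (Finset.sum_pos (s := d.support) (f := fun i => d i • w i) (fun i hi => ?_)
        (Finsupp.support_nonempty_iff.mpr hd0)) (by omega)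
      have h1 : 0 < d i := Nat.pos_of_ne_zero (Finsupp.mem_support_iff.mp hi)
      exact smul_pos h1 (h i hi)
    rw [Finset.prod_eq_zero hi, mul_zero]
    rw [hs i hi', zero_pow (Finsupp.mem_support_iff.mp hi)]
  · intro h
    rw [MvPolynomial.notMem_support_iff.mp h]
    simp

theorem Cochar.Pres.exists_homogeneous (P : μ.Pres ι) {n : ℤ} {y : WittVector p k ⊗[ℤ_[p]] O}
    (hy : μ.IsHom n y) : ∃ f : MvPolynomial ι (WittVector p k), MvPolynomial.IsWeightedHomogeneous P.deg f n ∧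
      MvPolynomial.aeval P.x f = y := by
  obtain ⟨f, rfl⟩ := P.surj y
  refine ⟨_, MvPolynomial.weightedHomogeneousComponent_isWeightedHomogeneous n f, ?_⟩
  rw [← μ.proj_aeval P.isHom]
  exact hy.proj_self

theorem Cochar.Pres.mem_neg_of_x (P : μ.Pres ι) {g : Pt p O S}
    (h : ∀ i, 0 < P.deg i → ext c g (P.x i) = 0) : g ∈ μ.neg c := by
  refine mem_neg.mpr fun n y hn hy => ?_
  obtain ⟨f, hf, rfl⟩ := P.exists_homogeneous hy
  rw [ext_aeval]
  exact eval₂_eq_zero_of_deg_pos hf hn _ h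

theorem Cochar.Pres.mem_pos_of_x (P : μ.Pres ι) {g : Pt p O S}
    (h : ∀ i, P.deg i ≤ 0 → ext c g (P.x i) = 0) : g ∈ μ.pos c := by
  refine mem_pos.mpr fun n y hn hy => ?_
  obtain ⟨f, hf, rfl⟩ := P.exists_homogeneous hy
  rw [ext_aeval, P.augm_aeval]
  exact eval₂_eq_constantCoeff_of_deg_nonpos hf hn _ h

theorem Cochar.Pres.ker_fg [Finite ι] [Algebra.Smooth ℤ_[p] O] (P : μ.Pres ι) : (RingHom.ker
    (MvPolynomial.aeval P.x : MvPolynomial ι (WittVector p k) →ₐ[WittVector p k] _)).FG :=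
  have : Algebra.FinitePresentation ℤ_[p] O := inferInstance
  have : Algebra.FinitePresentation (WittVector p k) (WittVector p k ⊗[ℤ_[p]] O) := inferInstance
  Algebra.FinitePresentation.ker_fG_of_surjective _ P.surj

/-- The ideal generated by the values of the equations at a vector. -/
def Cochar.Pres.defect (P : μ.Pres ι) (c : WittVector p k →ₐ[ℤ_[p]] S) (s : ι → S) : Ideal S :=
  (RingHom.ker (MvPolynomial.aeval P.x :
    MvPolynomial ι (WittVector p k) →ₐ[WittVector p k] _)).map
    (MvPolynomial.eval₂Hom (c : WittVector p k →+* S) s)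

theorem Cochar.Pres.mem_defect {s : ι → S} {f : MvPolynomial ι (WittVector p k)}
    (hf : MvPolynomial.aeval P.x f = 0) :
    MvPolynomial.eval₂ (c : WittVector p k →+* S) s f ∈ P.defect c s :=
  Ideal.mem_map_of_mem (MvPolynomial.eval₂Hom (c : WittVector p k →+* S) s) hf

/-- Quadratic convergence: this translates `P.ξ_ker` into the squaring of the error ideal. -/
theorem Cochar.Pres.defect_step (s : ι → S) :
    P.defect c (fun i => MvPolynomial.eval₂ (c : WittVector p k →+* S) s (P.ξ i)) ≤
      P.defect c s ^ 2 := by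
  rw [defect, Ideal.map_le_iff_le_comap]
  intro f hf
  rw [Ideal.mem_comap, MvPolynomial.coe_eval₂Hom, ← P.eval₂_aeval_ξ, defect, ← Ideal.map_pow]
  exact Ideal.mem_map_of_mem (MvPolynomial.eval₂Hom (c : WittVector p k →+* S) s) (P.ξ_ker f hf)

theorem eval₂_sub_mem {R : Type*} [CommRing R] (I : Ideal S) (c : R →+* S) {s t : ι → S}
    (h : ∀ i, s i - t i ∈ I) (f : MvPolynomial ι R) :
    MvPolynomial.eval₂ c s f - MvPolynomial.eval₂ c t f ∈ I := by
  induction f using MvPolynomial.induction_on with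
  | C a => simp
  | add f g hf hg =>
    convert add_mem hf hg using 1
    simp only [MvPolynomial.eval₂_add]
    ring
  | mul_X f i hf =>
    convert add_mem (I.mul_mem_right (s i) hf)
      (I.mul_mem_left (MvPolynomial.eval₂ c t f) (h i)) using 1
    simp only [MvPolynomial.eval₂_mul, MvPolynomial.eval₂_X]
    ring

variable {N : ℕ → Ideal S} {𝔠 : Ideal S}

/-- An approximate solution of the equations of `G` is close to a point. -/
theorem Cochar.Pres.newton [Finite ι] [Algebra.Smooth ℤ_[p] O] (P : μ.Pres ι)
    (hN : IsCompleteFiltration N) (hcl : idealClosure N 𝔠 ≤ 𝔠) (hrad : ∀ n, 𝔠 ≤ (N n).radical)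
    {s : ι → S} (hs : ∀ f, MvPolynomial.aeval P.x f = 0 →
      MvPolynomial.eval₂ (c : WittVector p k →+* S) s f ∈ 𝔠) :
    ∃ g : Pt p O S, (∀ i, ext c g (P.x i) - s i ∈ 𝔠) ∧
      ((∀ i, 0 < P.deg i → s i = 0) → g ∈ μ.neg c) ∧
      ((∀ i, P.deg i ≤ 0 → s i = 0) → g ∈ μ.pos c) := by
  let t : ℕ → ι → S := fun m => Nat.rec s
    (fun _ t i => MvPolynomial.eval₂ (c : WittVector p k →+* S) t (P.ξ i)) m
  have ht0 : t 0 = s := rfl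
  have ht : ∀ m i, t (m + 1) i = MvPolynomial.eval₂ (c : WittVector p k →+* S) (t m) (P.ξ i) :=
    fun m i => rfl
  have hd0 : P.defect c s ≤ 𝔠 := Ideal.map_le_iff_le_comap.mpr fun f hf => hs f hf
  have hd : ∀ m, P.defect c (t m) ≤ P.defect c s ^ 2 ^ m := fun m => by
    induction m with
    | zero => rw [pow_zero, pow_one, ht0]
    | succ m ih =>
      refine (P.defect_step (t m)).trans ((Ideal.pow_right_mono ih 2).trans ?_)
      rw [← pow_mul, pow_succ]
  have hstep : ∀ m i, t (m + 1) i - t m i ∈ P.defect c (t m) := fun m i => by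
    rw [ht]
    have h1 := P.mem_defect (c := c) (s := t m) (f := P.ξ i - MvPolynomial.X i)
      (by rw [map_sub, P.aeval_ξ, MvPolynomial.aeval_X, sub_self])
    rwa [MvPolynomial.eval₂_sub, MvPolynomial.eval₂_X] at h1
  -- Only finitely many equations are needed. As `𝔠` is contained merely in the radical of each `N
  -- n`, finite generation is what forces a power of the defect into `N n`.
  have hfg : (P.defect c s).FG := P.ker_fg.map _
  have hsmall : ∀ n, ∃ M, ∀ m ≥ M, P.defect c (t m) ≤ N n := fun n => by
    obtain ⟨M, hM⟩ := Ideal.exists_pow_le_of_le_radical_of_fg (hd0.trans (hrad n)) hfg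
    exact ⟨M, fun m hm => (hd m).trans ((Ideal.pow_le_pow_right
      (hm.trans Nat.lt_two_pow_self.le)).trans hM)⟩
  choose l hl using fun i => hN.exists_lim (fun m => t m i) fun n => by
    obtain ⟨M, hM⟩ := hsmall n
    exact ⟨M, fun m hm => hM m hm (hstep m i)⟩
  have hl' : ∀ n, ∃ M, ∀ m ≥ M, ∀ i, l i - t m i ∈ N n := fun n => by
    choose M hM using fun i => hl i n
    obtain ⟨B, hB⟩ := (Set.finite_range M).bddAbove
    exact ⟨B, fun m hm i => hM i m ((hB ⟨i, rfl⟩).trans hm)⟩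
  obtain ⟨g, hg⟩ := P.exists_pt c l fun f hf => hN.sep _ fun n => by
    obtain ⟨M, hM⟩ := hl' n
    obtain ⟨M', hM'⟩ := hsmall n
    have h1 := eval₂_sub_mem (N n) (c : WittVector p k →+* S)
      (hM (max M M') (le_max_left _ _)) f
    have h2 := hM' (max M M') (le_max_right _ _) (P.mem_defect (c := c) hf)
    simpa using add_mem h1 h2
  have hmem : ∀ m i, t m i - s i ∈ 𝔠 := fun m i => by
    induction m with
    | zero => rw [ht0, sub_self]; exact zero_mem _
    | succ m ih =>
      have h1 : P.defect c (t m) ≤ 𝔠 := (hd m).trans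
        ((Ideal.pow_le_self (by positivity)).trans hd0)
      convert add_mem (h1 (hstep m i)) ih using 1
      ring
  refine ⟨g, fun i => ?_, fun hz => P.mem_neg_of_x fun i hi => ?_,
    fun hz => P.mem_pos_of_x fun i hi => ?_⟩
  · rw [hg]
    refine hcl (mem_idealClosure.mpr fun n => ?_)
    obtain ⟨M, hM⟩ := hl' n
    refine ⟨t M i - s i, hmem M i, ?_⟩
    convert hM M le_rfl i using 1
    ring
  · rw [hg]
    -- The components of `ξ` are homogeneous, so every iterate keeps vanishing coordinates in
    -- positive degrees.
    have h1 : ∀ m i, 0 < P.deg i → t m i = 0 := fun m => by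
      induction m with
      | zero => exact hz
      | succ m ih =>
        intro i hi
        rw [ht]
        exact eval₂_eq_zero_of_deg_pos (P.ξ_hom i) hi _ ih
    refine hN.sep _ fun n => ?_
    obtain ⟨M, hM⟩ := hl' n
    have h2 := hM M le_rfl i
    rwa [h1 M i hi, sub_zero] at h2
  · rw [hg]
    have h1 : ∀ m i, P.deg i ≤ 0 → t m i = 0 := fun m => by
      induction m with
      | zero => exact hz
      | succ m ih =>
        intro i hi
        rw [ht, eval₂_eq_constantCoeff_of_deg_nonpos (P.ξ_hom i) hi _ ih, P.constantCoeff_ξ,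
          map_zero]
    refine hN.sep _ fun n => ?_
    obtain ⟨M, hM⟩ := hl' n
    have h2 := hM M le_rfl i
    rwa [h1 M i hi, sub_zero] at h2

/-- Lifting of points along a surjection with small kernel. -/
theorem Cochar.Pres.exists_lift [Finite ι] [Algebra.Smooth ℤ_[p] O] (P : μ.Pres ι)
    (hN : IsCompleteFiltration N) (φ : S →ₐ[ℤ_[p]] S') (hφ : Function.Surjective φ)
    (hcl : idealClosure N (RingHom.ker φ) ≤ RingHom.ker φ)
    (hrad : ∀ n, RingHom.ker φ ≤ (N n).radical) (c : WittVector p k →ₐ[ℤ_[p]] S) (h : Pt p O S') :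
    ∃ g : Pt p O S, Pt.map φ g = h ∧ (h ∈ μ.neg (φ.comp c) → g ∈ μ.neg c) ∧
      (h ∈ μ.pos (φ.comp c) → g ∈ μ.pos c) := by
  classical
  choose s hs using fun i => hφ (ext (φ.comp c) h (P.x i))
  -- Zero values are lifted to zero, so that the conditions defining `G⁻` and `G⁺` hold already for
  -- the approximate solution.
  let s' : ι → S := fun i => if ext (φ.comp c) h (P.x i) = 0 then 0 else s i
  have hs' : ∀ i, φ (s' i) = ext (φ.comp c) h (P.x i) := fun i => by
    by_cases hi : ext (φ.comp c) h (P.x i) = 0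
    · simp [s', hi]
    · simp [s', hi, hs]
  obtain ⟨g, hg, hneg, hpos⟩ := P.newton (c := c) hN hcl hrad (s := s') fun f hf => by
    rw [RingHom.mem_ker, MvPolynomial.eval₂_eq, map_sum]
    have h1 := ext_aeval (φ.comp c) P.x h f
    rw [hf, map_zero, MvPolynomial.eval₂_eq] at h1
    rw [h1]
    refine Finset.sum_congr rfl fun d _ => ?_
    rw [map_mul, map_prod]
    simp only [map_pow, hs']
    rfl
  refine ⟨g, ?_, fun hh => hneg fun i hi => ?_, fun hh => hpos fun i hi => ?_⟩
  · refine ext_eq_of_forall (c := φ.comp c) fun y => ?_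
    obtain ⟨f, rfl⟩ := P.surj y
    rw [ext_aeval, ext_aeval]
    congr 1
    ext1 i
    rw [ext_map, ← hs', ← sub_eq_zero, ← map_sub]
    exact hg i
  · exact if_pos (mem_neg.mp hh _ _ hi (P.isHom i))
  · exact if_pos (by rw [mem_pos.mp hh _ _ hi (P.isHom i), P.augm_eq, map_zero])

/-! ### Products near the unit -/

/-- In the convolution algebra the expression is `(g - 1) * (h - 1)`: to first order, multiplication
is addition of coordinates. -/
theorem ext_mul_sub_mem {𝔞 𝔟 : Ideal S} {g h : Pt p O S} (hg : g ∈ Pt.congr p O 𝔞)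
    (hh : h ∈ Pt.congr p O 𝔟) (y : O) :
    (g * h).hom y - g.hom y - h.hom y + (1 : Pt p O S).hom y ∈ 𝔞 * 𝔟 := by
  have h1 : ∀ y, (g.lin - 1) y ∈ 𝔞 := fun y => Pt.mem_congr.mp hg y
  have h2 : ∀ y, (h.lin - 1) y ∈ 𝔟 := fun y => Pt.mem_congr.mp hh y
  have h3 := conv_mem_mul h1 h2 y
  have e : (g.lin - 1) * (h.lin - 1) = (g * h).lin - g.lin - h.lin + 1 := by
    rw [Pt.lin_mul]; noncomm_ring
  rw [e] at h3
  exact h3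

theorem lext_mem {I : Ideal S} {d : O →ₗ[ℤ_[p]] S} (h : ∀ y, d y ∈ I)
    (y : WittVector p k ⊗[ℤ_[p]] O) : lext c d y ∈ I := by
  induction y with
  | zero => simp
  | add x y hx hy => rw [map_add]; exact add_mem hx hy
  | tmul a x => exact I.mul_mem_left _ (h x)

theorem ext_mul_sub_mem' {𝔞 𝔟 : Ideal S} {g h : Pt p O S} (hg : g ∈ Pt.congr p O 𝔞)
    (hh : h ∈ Pt.congr p O 𝔟) {y : WittVector p k ⊗[ℤ_[p]] O} (hy : augm p k O y = 0) :
    ext c (g * h) y - ext c g y - ext c h y ∈ 𝔞 * 𝔟 := by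
  have h1 := lext_mem (c := c) (d := ((g * h).lin - g.lin - h.lin + 1).ofConv)
    (ext_mul_sub_mem hg hh) y
  have e : lext c ((g * h).lin - g.lin - h.lin + 1).ofConv y =
      ext c (g * h) y - ext c g y - ext c h y + c (augm p k O y) := by
    rw [← lext_counit, ext_toLinearMap, ext_toLinearMap, ext_toLinearMap]
    have e2 : ((g * h).lin - g.lin - h.lin + 1).ofConv + (g.lin.ofConv + h.lin.ofConv) =
        (g * h).lin.ofConv + (1 : WithConv (O →ₗ[ℤ_[p]] S)).ofConv := by
      change (g * h).lin.ofConv - g.lin.ofConv - h.lin.ofConv +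
        (1 : WithConv (O →ₗ[ℤ_[p]] S)).ofConv + (g.lin.ofConv + h.lin.ofConv) = _
      abel
    have h2 := congrArg (fun d => lext c d y) e2
    simp only [lext_add] at h2
    linear_combination h2
  rwa [e, hy, map_zero, add_zero] at h1

/-! ### Factorization of points near the unit -/

theorem eval₂_sub_sum_mem [Fintype ι] {R : Type*} [CommRing R] {𝔞 : Ideal S} (c : R →+* S)
    {s : ι → S} (h : ∀ i, s i ∈ 𝔞) (f : MvPolynomial ι R) :
    MvPolynomial.eval₂ c s f - c (MvPolynomial.constantCoeff f) -
      ∑ j, c (f.coeff (Finsupp.single j 1)) * s j ∈ 𝔞 ^ 2 := by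
  classical
  induction f using MvPolynomial.induction_on with
  | C a =>
    rw [MvPolynomial.eval₂_C, MvPolynomial.constantCoeff_C, sub_self, Finset.sum_eq_zero, sub_zero]
    · exact zero_mem _
    · intro j _
      rw [MvPolynomial.coeff_C, if_neg (by simp [eq_comm]), map_zero, zero_mul]
  | add f g hf hg =>
    convert add_mem hf hg using 1
    simp only [map_add, MvPolynomial.eval₂_add, add_mul, Finset.sum_add_distrib,
      MvPolynomial.coeff_add]
    ring
  | mul_X f i hf =>
    have h1 : ∑ j, c ((f * MvPolynomial.X i).coeff (Finsupp.single j 1)) * s j =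
        c (MvPolynomial.constantCoeff f) * s i := by
      rw [Finset.sum_eq_single i]
      · rw [MvPolynomial.coeff_mul_X', if_pos (by simp), tsub_self]
        rfl
      · intro j _ hj
        rw [MvPolynomial.coeff_mul_X', if_neg (by simp [hj.symm]), map_zero, zero_mul]
      · simp
    rw [h1, MvPolynomial.eval₂_mul, MvPolynomial.eval₂_X, map_mul, MvPolynomial.constantCoeff_X,
      mul_zero, map_zero, sub_zero]
    have h2 : MvPolynomial.eval₂ c s f - c (MvPolynomial.constantCoeff f) ∈ 𝔞 := by
      have h3 := add_mem (Ideal.pow_le_self two_ne_zero hf)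
        (sum_mem fun j (_ : j ∈ Finset.univ) =>
          𝔞.mul_mem_left (c (f.coeff (Finsupp.single j 1))) (h j))
      simpa using h3
    convert pow_two 𝔞 ▸ Ideal.mul_mem_mul h2 (h i) using 1
    ring

/-- Dropping the coordinates with degrees outside `Q` yields an approximate solution: the linear
part of an equation of degree `n` involves only generators of degree `n`, hence is either kept or
killed as a whole, and the remaining terms lie in `𝔞 ^ 2`. Newton iteration corrects the error. -/
theorem Cochar.Pres.exists_half [Fintype ι] [Algebra.Smooth ℤ_[p] O] (P : μ.Pres ι)
    (hN : IsCompleteFiltration N) {𝔞 𝔠 : Ideal S} (hcl : idealClosure N 𝔠 ≤ 𝔠)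
    (hrad : ∀ n, 𝔠 ≤ (N n).radical) (hsq : 𝔞 ^ 2 ≤ 𝔠) {g : Pt p O S} (hg : g ∈ Pt.congr p O 𝔞)
    (Q : ℤ → Prop) [DecidablePred Q] :
    ∃ h : Pt p O S, (∀ i, ext c h (P.x i) - (if Q (P.deg i) then ext c g (P.x i) else 0) ∈ 𝔠) ∧
      ((∀ n, 0 < n → ¬ Q n) → h ∈ μ.neg c) ∧ ((∀ n ≤ 0, ¬ Q n) → h ∈ μ.pos c) := by
  classical
  have hs : ∀ i, (if Q (P.deg i) then ext c g (P.x i) else 0) ∈ 𝔞 := fun i => by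
    split_ifs
    · exact P.ext_x_mem hg i
    · exact zero_mem _
  obtain ⟨h, h1, h2, h3⟩ := P.newton (c := c) hN hcl hrad
    (s := fun i => if Q (P.deg i) then ext c g (P.x i) else 0) fun f hf => by
      refine hsq ?_
      have key : ∀ n (f : MvPolynomial ι (WittVector p k)),
          MvPolynomial.IsWeightedHomogeneous P.deg f n → MvPolynomial.aeval P.x f = 0 →
          MvPolynomial.eval₂ (c : WittVector p k →+* S)
            (fun i => if Q (P.deg i) then ext c g (P.x i) else 0) f ∈ 𝔞 ^ 2 := fun n f hn hf => by
        have e1 := eval₂_sub_sum_mem (c : WittVector p k →+* S) hs f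
        have e2 := eval₂_sub_sum_mem (c : WittVector p k →+* S)
          (fun i => P.ext_x_mem (c := c) hg i) f
        rw [← ext_aeval, hf, map_zero] at e2
        rw [← P.augm_aeval, hf, map_zero, map_zero, sub_zero] at e1 e2
        have e3 : ∑ j, (c : WittVector p k →+* S) (f.coeff (Finsupp.single j 1)) *
            (if Q (P.deg j) then ext c g (P.x j) else 0) = if Q n then
            ∑ j, (c : WittVector p k →+* S) (f.coeff (Finsupp.single j 1)) * ext c g (P.x j)
              else 0 := by
          have e4 : ∀ j, (c : WittVector p k →+* S) (f.coeff (Finsupp.single j 1)) *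
            (if Q (P.deg j) then ext c g (P.x j) else 0) = if Q n then
              (c : WittVector p k →+* S) (f.coeff (Finsupp.single j 1)) * ext c g (P.x j)
              else 0 := fun j => by
            by_cases hj : P.deg j = n
            · rw [hj]; split_ifs <;> simp
            · have : f.coeff (Finsupp.single j 1) = 0 := by
                refine hn.coeff_eq_zero _ ?_
                rw [Finsupp.weight_single, one_smul]
                exact hj
              rw [this]
              simp
          rw [Finset.sum_congr rfl fun j _ => e4 j]
          split_ifs
          · rfl
          · simp
        rw [e3] at e1
        split_ifs at e1
        · rw [zero_sub] at e2
          have := add_mem e1 (neg_mem e2)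
          simpa using this
        · simpa using e1
      have hfin := MvPolynomial.sum_weightedHomogeneousComponent P.deg f
      rw [finsum_eq_sum _ (MvPolynomial.weightedHomogeneousComponent_finsupp f)] at hfin
      rw [← hfin, MvPolynomial.eval₂_sum]
      refine sum_mem fun n _ => key n _
        (MvPolynomial.weightedHomogeneousComponent_isWeightedHomogeneous _ _) ?_
      rw [← μ.proj_aeval P.isHom, hf, proj_zero]
  exact ⟨h, h1, fun H => h2 fun i hi => if_neg (H _ hi), fun H => h3 fun i hi => if_neg (H _ hi)⟩

/-- The coordinates in degrees at most `0` yield `m` and those in positive degrees yield `n`. Their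
product has the coordinates of `g` up to an error in `𝔠`, because products are additive modulo `𝔞 ^
2`. -/
theorem Cochar.Pres.factor_step [Fintype ι] [Algebra.Smooth ℤ_[p] O] (P : μ.Pres ι)
    (hN : IsCompleteFiltration N) {𝔞 𝔠 : Ideal S} (hcl : idealClosure N 𝔠 ≤ 𝔠)
    (hrad : ∀ n, 𝔠 ≤ (N n).radical) (hsq : 𝔞 ^ 2 ≤ 𝔠) (hle : 𝔠 ≤ 𝔞) {g : Pt p O S}
    (hg : g ∈ Pt.congr p O 𝔞) (c : WittVector p k →ₐ[ℤ_[p]] S) :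
    ∃ m ∈ μ.neg c, ∃ n ∈ μ.pos c, m ∈ Pt.congr p O 𝔞 ∧ n ∈ Pt.congr p O 𝔞 ∧
      m⁻¹ * g * n⁻¹ ∈ Pt.congr p O 𝔠 := by
  classical
  obtain ⟨m, hm, hm', -⟩ := P.exists_half (c := c) hN hcl hrad hsq hg (fun n => n ≤ 0)
  obtain ⟨n, hn, -, hn'⟩ := P.exists_half (c := c) hN hcl hrad hsq hg (fun n => 0 < n)
  have hm𝔞 : m ∈ Pt.congr p O 𝔞 := P.mem_congr_of_x (c := c) fun i => by
    have h1 := hle (hm i)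
    split_ifs at h1
    · simpa using add_mem h1 (P.ext_x_mem (c := c) hg i)
    · simpa using h1
  have hn𝔞 : n ∈ Pt.congr p O 𝔞 := P.mem_congr_of_x (c := c) fun i => by
    have h1 := hle (hn i)
    split_ifs at h1
    · simpa using add_mem h1 (P.ext_x_mem (c := c) hg i)
    · simpa using h1
  refine ⟨m, hm' fun n hn => by simpa using hn, n, hn' fun n hn => by simpa using hn, hm𝔞, hn𝔞, ?_⟩
  have h1 : (m * n)⁻¹ * g ∈ Pt.congr p O 𝔠 := by
    rw [← Pt.map_eq_iff_congr]
    refine ext_eq_of_forall (c := (Ideal.Quotient.mkₐ ℤ_[p] 𝔠).comp c) fun y => ?_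
    obtain ⟨f, rfl⟩ := P.surj y
    rw [ext_aeval, ext_aeval]
    congr 1
    ext1 i
    rw [ext_map, ext_map]
    refine Ideal.Quotient.eq.mpr ?_
    have h2 := hsq (pow_two 𝔞 ▸ ext_mul_sub_mem' (c := c) hm𝔞 hn𝔞 (P.augm_eq i))
    have h3 := add_mem h2 (add_mem (hm i) (hn i))
    by_cases hi : P.deg i ≤ 0
    · rw [if_pos hi, if_neg (by simpa using hi)] at h3
      convert h3 using 1
      ring
    · rw [if_neg hi, if_pos (by simpa using hi)] at h3
      convert h3 using 1
      ring
  have h2 : m⁻¹ * g * n⁻¹ = n * ((m * n)⁻¹ * g) * n⁻¹ := by group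
  rw [h2]
  exact Subgroup.Normal.conj_mem inferInstance _ h1 n

theorem exists_iterate {X : ℕ → Type*} (x₀ : X 0) (f : ∀ j, X j → X (j + 1)) :
    ∃ r : ∀ j, X j, r 0 = x₀ ∧ ∀ j, r (j + 1) = f j (r j) :=
  ⟨fun j => Nat.rec x₀ f j, rfl, fun _ => rfl⟩

/-- Points congruent to the unit modulo `𝔟` are products of points of
`G⁻` and of `G⁺`. -/
theorem Cochar.Pres.factor [Fintype ι] [Algebra.Smooth ℤ_[p] O] (P : μ.Pres ι)
    (hN : IsCompleteFiltration N) {𝔟 : Ideal S} (hcl : idealClosure N 𝔟 ≤ 𝔟)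
    (hrad : ∀ n, 𝔟 ≤ (N n).radical) (c : WittVector p k →ₐ[ℤ_[p]] S) {g : Pt p O S}
    (hg : g ∈ Pt.congr p O 𝔟) :
    ∃ m ∈ μ.neg c, ∃ n ∈ μ.pos c, g = m * n ∧
      ∀ 𝔞 : Ideal S, g ∈ Pt.congr p O 𝔞 → m ∈ Pt.congr p O 𝔞 ∧ n ∈ Pt.congr p O 𝔞 := by
  -- The ideal `𝔟` need not be finitely generated, but the coordinates of the given `g` span a
  -- finitely generated ideal, of which high powers lie in `N n`.
  obtain ⟨𝔤, h𝔤⟩ : ∃ 𝔤 : Ideal S, 𝔤 = Ideal.span (Set.range fun i => ext c g (P.x i)) := ⟨_, rfl⟩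
  have hfg : 𝔤.FG := ⟨(Set.finite_range fun i => ext c g (P.x i)).toFinset, by simp [h𝔤]⟩
  have h𝔤𝔟 : 𝔤 ≤ 𝔟 := h𝔤 ▸ Ideal.span_le.mpr (by rintro _ ⟨i, rfl⟩; exact P.ext_x_mem hg i)
  set 𝔞 : ℕ → Ideal S := fun j => idealClosure N (𝔤 ^ 2 ^ j) with h𝔞
  have hanti : Antitone 𝔞 := fun i j hij =>
    idealClosure_mono (Ideal.pow_le_pow_right (Nat.pow_le_pow_right two_pos hij))
  have h𝔞𝔟 : ∀ j, 𝔞 j ≤ 𝔟 := fun j => (idealClosure_mono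
    ((Ideal.pow_le_self (by positivity)).trans h𝔤𝔟)).trans hcl
  have hacl : ∀ j, idealClosure N (𝔞 j) ≤ 𝔞 j := fun j => idealClosure_idealClosure_le
  have hev : ∀ n, ∃ j, 𝔞 j ≤ N n := fun n => by
    obtain ⟨M, hM⟩ := Ideal.exists_pow_le_of_le_radical_of_fg (h𝔤𝔟.trans (hrad n)) hfg
    exact ⟨M, idealClosure_le_of_le ((Ideal.pow_le_pow_right Nat.lt_two_pow_self.le).trans hM)⟩
  have hstep : ∀ j, ∀ h : Pt.congr p O (𝔞 j), ∃ m ∈ μ.neg c, ∃ n ∈ μ.pos c,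
      m ∈ Pt.congr p O (𝔞 j) ∧ n ∈ Pt.congr p O (𝔞 j) ∧
      m⁻¹ * h * n⁻¹ ∈ Pt.congr p O (𝔞 (j + 1)) := fun j h =>
    P.factor_step hN (hacl (j + 1)) (fun n => (h𝔞𝔟 _).trans (hrad n))
      (idealClosure_sq_le.trans (by rw [← pow_mul, ← pow_succ])) (hanti (Nat.le_succ j)) h.2 c
  choose m hm n hn hm' hn' hmn using hstep
  have hg0 : g ∈ Pt.congr p O (𝔞 0) := P.mem_congr_of_x (c := c) fun i =>
    le_idealClosure (by rw [pow_zero, pow_one, h𝔤]; exact Ideal.subset_span ⟨i, rfl⟩)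
  obtain ⟨r, hr0, hr⟩ := exists_iterate (X := fun j => Pt.congr p O (𝔞 j)) ⟨g, hg0⟩
    fun j h => ⟨(m j h)⁻¹ * h * (n j h)⁻¹, hmn j h⟩
  replace hr : ∀ j, (r (j + 1) : Pt p O S) = (m j (r j))⁻¹ * r j * (n j (r j))⁻¹ :=
    fun j => congrArg Subtype.val (hr j)
  replace hr0 : (r 0 : Pt p O S) = g := congrArg Subtype.val hr0
  -- `A` collects the factors in `G⁻` on the left and `B` those in `G⁺` on the right, while the
  -- middle factor `r j` tends to the unit.
  obtain ⟨A, hA0, hA⟩ := exists_iterate (X := fun _ => Pt p O S) 1 fun j a => a * m j (r j)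
  obtain ⟨B, hB0, hB⟩ := exists_iterate (X := fun _ => Pt p O S) 1 fun j b => n j (r j) * b
  have hAB : ∀ j, g = A j * r j * B j := fun j => by
    induction j with
    | zero => rw [hA0, hB0, hr0, one_mul, mul_one]
    | succ j ih =>
      rw [hr, hA, hB]
      refine ih.trans ?_
      group
  have hAneg : ∀ j, A j ∈ μ.neg c := fun j => by
    induction j with
    | zero => rw [hA0]; exact one_mem _
    | succ j ih => rw [hA]; exact mul_mem ih (hm _ _)
  have hBpos : ∀ j, B j ∈ μ.pos c := fun j => by
    induction j with
    | zero => rw [hB0]; exact one_mem _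
    | succ j ih => rw [hB]; exact mul_mem (hn _ _) ih
  obtain ⟨a, ha⟩ := Pt.exists_lim hN hanti hacl hev A fun j => by
    rw [hA, inv_mul_cancel_left]
    exact hm' _ _
  obtain ⟨b, hb⟩ := Pt.exists_lim hN hanti hacl hev B fun j => by
    rw [hB, ← mul_assoc]
    simpa using Subgroup.Normal.conj_mem inferInstance _ (hn' j (r j)) (B j)⁻¹
  have hclose : ∀ (C : ℕ → Pt p O S) (γ : Pt p O S), (∀ j, (C j)⁻¹ * γ ∈ Pt.congr p O (𝔞 j)) →
      ∀ n, ∃ j, ∀ y : WittVector p k ⊗[ℤ_[p]] O, ext c (C j) y - ext c γ y ∈ N n :=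
    fun C γ h n => by
      obtain ⟨j, hj⟩ := hev n
      refine ⟨j, fun y => hj ?_⟩
      have h1 := Pt.map_eq_iff_congr.mpr (h j)
      have h2 := congrArg (fun g => ext ((Ideal.Quotient.mkₐ ℤ_[p] (𝔞 j)).comp c) g y) h1
      simp only [ext_map] at h2
      exact Ideal.Quotient.eq.mp h2
  have haneg : a ∈ μ.neg c := mem_neg.mpr fun i y hi hy => hN.sep _ fun n => by
    obtain ⟨j, hj⟩ := hclose A a ha n
    have h1 := hj y
    rw [mem_neg.mp (hAneg j) i y hi hy, zero_sub] at h1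
    simpa using neg_mem h1
  have hbpos : b ∈ μ.pos c := mem_pos.mpr fun i y hi hy => hN.eq_of_sub_mem fun n => by
    obtain ⟨j, hj⟩ := hclose B b hb n
    have h1 := hj y
    rw [mem_pos.mp (hBpos j) i y hi hy] at h1
    simpa using neg_mem h1
  have hgab : g = a * b := Pt.eq_of_forall_mem_congr hN fun n => by
    obtain ⟨j, hj⟩ := hev n
    refine Pt.congr_mono hj ?_
    rw [← Pt.map_eq_iff_congr]
    have h1 := Pt.map_eq_iff_congr.mpr (ha j)
    have h2 := Pt.map_eq_iff_congr.mpr (hb j)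
    rw [map_mul, ← h1, ← h2]
    have h3 : Pt.map (Ideal.Quotient.mkₐ ℤ_[p] (𝔞 j)) (r j : Pt p O S) = 1 := (r j).2
    rw [hAB j, map_mul, map_mul, h3, mul_one]
  refine ⟨a, haneg, b, hbpos, hgab, fun 𝔠 h𝔠 => ?_⟩
  -- If `g` is trivial modulo an ideal, then so are both factors: there `a` is inverse to `b`, hence
  -- lies in both `G⁻` and `G⁺`.
  have h1 : Pt.map (Ideal.Quotient.mkₐ ℤ_[p] 𝔠) a * Pt.map (Ideal.Quotient.mkₐ ℤ_[p] 𝔠) b = 1 := by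
    rw [← map_mul, ← hgab]
    exact h𝔠
  have h2 : Pt.map (Ideal.Quotient.mkₐ ℤ_[p] 𝔠) a = 1 := by
    refine eq_one_of_mem_neg_of_mem_pos (map_mem_neg _ haneg) ?_
    rw [eq_inv_of_mul_eq_one_left h1]
    exact inv_mem (map_mem_pos _ hbpos)
  exact ⟨h2, by rw [h2, one_mul] at h1; exact h1⟩

end Newton

/-! ### The operators `β` and `F♭` -/

section FrobFlat

variable {p : ℕ} [Fact p.Prime] {k : Type w} [Field k] [CharP k p]
  {O : Type v} [CommRing O] [HopfAlgebra ℤ_[p] O] {μ : Cochar p k O}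
  {S S' : Type*} [CommRing S] [Algebra ℤ_[p] S] [CommRing S'] [Algebra ℤ_[p] S']
  {ι : Type} [Fintype ι] {c : WittVector p k →ₐ[ℤ_[p]] S} {τ : S →ₐ[ℤ_[p]] S}

theorem evalTrunc_C_mul (s a : S) (f : S[T;T⁻¹]) :
    evalTrunc p s (LaurentPolynomial.C a * f) = a * evalTrunc p s f := by
  change (LaurentPolynomial.trunc _).eval s = a * (LaurentPolynomial.trunc f).eval s
  induction f using LaurentPolynomial.induction_on' with
  | add f g hf hg => simp only [mul_add, map_add, Polynomial.eval_add, hf, hg]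
  | C_mul_T n b =>
    rw [← mul_assoc, ← map_mul, LaurentPolynomial.trunc_C_mul_T, LaurentPolynomial.trunc_C_mul_T]
    split_ifs
    · simp [mul_assoc]
    · simp

theorem lext_evalTrunc (s : S) (d : O →ₗ[ℤ_[p]] S[T;T⁻¹]) (y : WittVector p k ⊗[ℤ_[p]] O) :
    lext c (evalTrunc p s ∘ₗ d) y = evalTrunc p s (lext ((constLaurent p S).comp c) d y) := by
  induction y with
  | zero => simp
  | add x y hx hy => rw [map_add, map_add, map_add, hx, hy]
  | tmul a x =>
    rw [lext_tmul, lext_tmul]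
    exact (evalTrunc_C_mul s (c a) (d x)).symm

/-- The case `n > 1` records the effect of `evalTrunc`, which discards negative powers of `T`. It
matters because `β` is also applied to functionals outside the Lie algebra, such as the difference
of a point and the unit. -/
theorem Cochar.IsHom.lext_beta {n : ℤ} {y : WittVector p k ⊗[ℤ_[p]] O} (hy : μ.IsHom n y)
    (c : WittVector p k →ₐ[ℤ_[p]] S) (d : O →ₗ[ℤ_[p]] S) :
    lext c (μ.beta c d) y = if n ≤ 1 then (p : S) ^ (1 - n).toNat * lext c d y else 0 := by
  rw [beta, lext_evalTrunc, lext_smul, μ.gen_eq, hy.lext_adj, unitT_zpow, lext_comp,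
    constLaurent_apply, mul_left_comm, ← LaurentPolynomial.T_add]
  change (LaurentPolynomial.trunc _).eval _ = _
  rw [LaurentPolynomial.trunc_C_mul_T]
  have e : (1 : ℤ) + -n = 1 - n := by ring
  rw [e]
  by_cases h : n ≤ 1
  · rw [if_pos (by omega), if_pos h]
    simp only [Polynomial.eval_monomial]
    rw [mul_comm]
  · rw [if_neg (by omega), if_neg h]
    simp

theorem lext_ext_isHom (μ : Cochar p k O) {d e : O →ₗ[ℤ_[p]] S}
    (h : ∀ n (y : WittVector p k ⊗[ℤ_[p]] O), μ.IsHom n y → lext c d y = lext c e y) : d = e :=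
  lext_ext (c := c) (μ.hom_induction h fun x y hx hy => by rw [map_add, map_add, hx, hy])

theorem Cochar.beta_add (d e : O →ₗ[ℤ_[p]] S) :
    μ.beta c (d + e) = μ.beta c d + μ.beta c e :=
  lext_ext_isHom μ (c := c) fun n y hy => by
    rw [lext_add, hy.lext_beta, hy.lext_beta, hy.lext_beta, lext_add]
    split_ifs <;> ring

theorem Cochar.beta_smul (s : S) (d : O →ₗ[ℤ_[p]] S) :
    μ.beta c (s • d) = s • μ.beta c d :=
  lext_ext_isHom μ (c := c) fun n y hy => by
    rw [lext_smul, hy.lext_beta, hy.lext_beta, lext_smul]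
    split_ifs <;> ring

theorem lext_mem_of_isHom (μ : Cochar p k O) {I : Ideal S} {d : O →ₗ[ℤ_[p]] S}
    (h : ∀ n (y : WittVector p k ⊗[ℤ_[p]] O), μ.IsHom n y → lext c d y ∈ I) (y : O) : d y ∈ I := by
  rw [← lext_one_tmul c]
  exact μ.hom_induction (P := fun z => lext c d z ∈ I) h
    (fun x y hx hy => by rw [map_add]; exact add_mem hx hy) _

theorem Cochar.beta_mem {I : Ideal S} {d : O →ₗ[ℤ_[p]] S} (h : ∀ y, d y ∈ I) (y : O) :
    μ.beta c d y ∈ I :=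
  lext_mem_of_isHom μ (c := c) (fun n y hy => by
    rw [hy.lext_beta]
    split_ifs
    · exact I.mul_mem_left _ (lext_mem h y)
    · exact zero_mem _) y

theorem Cochar.frobFlat_add (U : Pt p O S) (d e : O →ₗ[ℤ_[p]] S) :
    μ.frobFlat c τ U (d + e) = μ.frobFlat c τ U d + μ.frobFlat c τ U e := by
  rw [frobFlat, beta_add, LinearMap.comp_add, adj_add]
  rfl

theorem Cochar.frobFlat_smul (U : Pt p O S) (s : S) (d : O →ₗ[ℤ_[p]] S) :
    μ.frobFlat c τ U (s • d) = τ s • μ.frobFlat c τ U d := by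
  have : τ.toLinearMap ∘ₗ (s • μ.beta c d) = τ s • (τ.toLinearMap ∘ₗ μ.beta c d) :=
    LinearMap.ext fun y => map_mul τ _ _
  rw [frobFlat, beta_smul, this, adj_smul]
  rfl

theorem Cochar.frobFlat_sum {κ : Type*} (U : Pt p O S) (s : Finset κ) (d : κ → O →ₗ[ℤ_[p]] S) :
    μ.frobFlat c τ U (∑ i ∈ s, d i) = ∑ i ∈ s, μ.frobFlat c τ U (d i) :=
  map_sum (AddMonoidHom.mk' (μ.frobFlat c τ U) (frobFlat_add U)) d s

theorem Cochar.frobFlat_sub (U : Pt p O S) (d e : O →ₗ[ℤ_[p]] S) :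
    μ.frobFlat c τ U (d - e) = μ.frobFlat c τ U d - μ.frobFlat c τ U e :=
  map_sub (AddMonoidHom.mk' (μ.frobFlat c τ U) (frobFlat_add U)) d e

theorem Cochar.frobFlat_mem {I I' : Ideal S} (hI : ∀ a ∈ I, τ a ∈ I') (U : Pt p O S)
    {d : O →ₗ[ℤ_[p]] S} (h : ∀ y, d y ∈ I) (y : O) : μ.frobFlat c τ U d y ∈ I' :=
  adj_mem I' U (fun y => hI _ (beta_mem h y)) y

theorem Cochar.iterate_frobFlat_add (U : Pt p O S) (n : ℕ) (d e : O →ₗ[ℤ_[p]] S) :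
    (μ.frobFlat c τ U)^[n] (d + e) = (μ.frobFlat c τ U)^[n] d + (μ.frobFlat c τ U)^[n] e := by
  induction n generalizing d e with
  | zero => rfl
  | succ n ih => simp only [Function.iterate_succ_apply, frobFlat_add, ih]

theorem Cochar.iterate_frobFlat_smul (U : Pt p O S) (n : ℕ) (s : S) (d : O →ₗ[ℤ_[p]] S) :
    (μ.frobFlat c τ U)^[n] (s • d) = τ^[n] s • (μ.frobFlat c τ U)^[n] d := by
  induction n generalizing s d with
  | zero => rfl
  | succ n ih => simp only [Function.iterate_succ_apply, frobFlat_smul, ih]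

theorem Cochar.iterate_frobFlat_sum {κ : Type*} (U : Pt p O S) (n : ℕ) (s : Finset κ)
    (d : κ → O →ₗ[ℤ_[p]] S) :
    (μ.frobFlat c τ U)^[n] (∑ i ∈ s, d i) = ∑ i ∈ s, (μ.frobFlat c τ U)^[n] (d i) :=
  map_sum (AddMonoidHom.mk' ((μ.frobFlat c τ U)^[n]) (iterate_frobFlat_add U n)) d s

theorem Cochar.map_beta (φ : S →ₐ[ℤ_[p]] S') (d : O →ₗ[ℤ_[p]] S) :
    φ.toLinearMap ∘ₗ μ.beta c d = μ.beta (φ.comp c) (φ.toLinearMap ∘ₗ d) :=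
  lext_ext_isHom μ (c := φ.comp c) fun n y hy => by
    rw [lext_comp, hy.lext_beta, hy.lext_beta, lext_comp]
    split_ifs
    · simp
    · simp

theorem Cochar.map_frobFlat {φ : S →ₐ[ℤ_[p]] S'} {τ' : S' →ₐ[ℤ_[p]] S'}
    (hφ : φ.comp τ = τ'.comp φ) (U : Pt p O S) (d : O →ₗ[ℤ_[p]] S) :
    φ.toLinearMap ∘ₗ μ.frobFlat c τ U d =
      μ.frobFlat (φ.comp c) τ' (Pt.map φ U) (φ.toLinearMap ∘ₗ d) := by
  rw [frobFlat, map_adj, frobFlat, ← map_beta]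
  congr 1
  exact LinearMap.ext fun y => DFunLike.congr_fun hφ _

theorem Cochar.map_iterate_frobFlat {φ : S →ₐ[ℤ_[p]] S'} {τ' : S' →ₐ[ℤ_[p]] S'}
    (hφ : φ.comp τ = τ'.comp φ) (U : Pt p O S) (n : ℕ) (d : O →ₗ[ℤ_[p]] S) :
    φ.toLinearMap ∘ₗ (μ.frobFlat c τ U)^[n] d =
      (μ.frobFlat (φ.comp c) τ' (Pt.map φ U))^[n] (φ.toLinearMap ∘ₗ d) := by
  induction n generalizing d with
  | zero => rfl
  | succ n ih => rw [Function.iterate_succ_apply, ih, map_frobFlat hφ, Function.iterate_succ_apply]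

/-! #### The Lie algebra is stable -/

theorem Cochar.Pres.beta_D (P : μ.Pres ι) (hμ : μ.IsPhiDatum) (j : ι) :
    μ.beta c (c.toLinearMap ∘ₗ P.D j) =
      (p : S) ^ (1 - P.deg j).toNat • (c.toLinearMap ∘ₗ P.D j) :=
  lext_ext_isHom μ (c := c) fun n y hy => by
    rw [hy.lext_beta, lext_smul, P.lext_D]
    by_cases h : n = P.deg j
    · subst h
      split_ifs with h1
      · rfl
      · rw [coord, P.D_eq_zero hμ (by omega)]
        have h2 := lext_smul (AlgHom.id ℤ_[p] (WittVector p k)) 0 (0 : O →ₗ[ℤ_[p]] _) y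
        rw [smul_zero, zero_mul] at h2
        rw [h2, map_zero, mul_zero]
    · rw [P.coord_eq_zero hy h]
      simp

theorem Cochar.Pres.beta_mem_lieAlg (P : μ.Pres ι) (hμ : μ.IsPhiDatum) {d : O →ₗ[ℤ_[p]] S}
    (hd : d ∈ lieAlg p O S) : μ.beta c d ∈ lieAlg p O S := by
  rw [P.lie_eq_sum (c := c) hd]
  have h := map_sum (AddMonoidHom.mk' (μ.beta c) (beta_add (μ := μ) (c := c)))
    (fun j => lext c d (P.x j) • (c.toLinearMap ∘ₗ P.D j)) Finset.univ
  change μ.beta c _ = _ at h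
  rw [h]
  refine sum_mem fun j _ => ?_
  change μ.beta c _ ∈ _
  rw [beta_smul, P.beta_D hμ]
  exact Submodule.smul_mem _ _ (Submodule.smul_mem _ _ (comp_mem_lieAlg _ (P.D_mem j)))

theorem Cochar.Pres.frobFlat_mem_lieAlg (P : μ.Pres ι) (hμ : μ.IsPhiDatum) (U : Pt p O S)
    {d : O →ₗ[ℤ_[p]] S} (hd : d ∈ lieAlg p O S) : μ.frobFlat c τ U d ∈ lieAlg p O S :=
  adj_mem_lieAlg U (comp_mem_lieAlg _ (P.beta_mem_lieAlg hμ hd))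

theorem Cochar.Pres.iterate_frobFlat_mem_lieAlg (P : μ.Pres ι) (hμ : μ.IsPhiDatum) (U : Pt p O S)
    (n : ℕ) {d : O →ₗ[ℤ_[p]] S} (hd : d ∈ lieAlg p O S) :
    (μ.frobFlat c τ U)^[n] d ∈ lieAlg p O S := by
  induction n with
  | zero => exact hd
  | succ n ih => rw [Function.iterate_succ_apply']; exact P.frobFlat_mem_lieAlg hμ U ih

/-- Divisibility of all values suffices: divide the coefficients with respect to the `P.D j`. No
regularity of `s` is used. -/
theorem Cochar.Pres.exists_smul_of_mem (P : μ.Pres ι) (c : WittVector p k →ₐ[ℤ_[p]] S) {s : S}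
    {d : O →ₗ[ℤ_[p]] S} (hd : d ∈ lieAlg p O S) (h : ∀ y, d y ∈ Ideal.span {s}) :
    ∃ d' ∈ lieAlg p O S, d = s • d' := by
  choose a ha using fun j => Ideal.mem_span_singleton'.mp (lext_mem (c := c) h (P.x j))
  refine ⟨∑ j, a j • (c.toLinearMap ∘ₗ P.D j), sum_mem fun j _ =>
    Submodule.smul_mem _ _ (comp_mem_lieAlg _ (P.D_mem j)), ?_⟩
  rw [Finset.smul_sum]
  conv_lhs => rw [P.lie_eq_sum (c := c) hd]
  refine Finset.sum_congr rfl fun j _ => ?_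
  rw [← ha, smul_smul, mul_comm]

/-- Semilinearity of `F♭` reduces nilpotence to the finitely many `P.D j`, and divisibility in the
Lie algebra to divisibility of values. -/
theorem Cochar.Pres.isFNilpotent_iff (P : μ.Pres ι) (hμ : μ.IsPhiDatum) {U : Pt p O S} :
    μ.IsFNilpotent c τ U ↔ ∃ n, ∀ j y,
      (μ.frobFlat c τ U)^[n] (c.toLinearMap ∘ₗ P.D j) y ∈ Ideal.span {(p : S)} := by
  constructor
  · rintro ⟨n, hn⟩
    refine ⟨n, fun j y => ?_⟩
    obtain ⟨d', -, h⟩ := hn _ (comp_mem_lieAlg c.toLinearMap (P.D_mem j))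
    rw [h]
    exact Ideal.mem_span_singleton.mpr ⟨d' y, rfl⟩
  · rintro ⟨n, hn⟩
    refine ⟨n, fun d hd => P.exists_smul_of_mem c (P.iterate_frobFlat_mem_lieAlg hμ U n hd)
      fun y => ?_⟩
    rw [P.lie_eq_sum (c := c) hd, iterate_frobFlat_sum, LinearMap.sum_apply]
    refine sum_mem fun j _ => ?_
    rw [iterate_frobFlat_smul]
    exact Ideal.mul_mem_left _ _ (hn j y)

theorem Cochar.Pres.isFNilpotent_map (P : μ.Pres ι) (hμ : μ.IsPhiDatum) {φ : S →ₐ[ℤ_[p]] S'}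
    {τ' : S' →ₐ[ℤ_[p]] S'} (hφ : φ.comp τ = τ'.comp φ) {U : Pt p O S}
    (h : μ.IsFNilpotent c τ U) : μ.IsFNilpotent (φ.comp c) τ' (Pt.map φ U) := by
  obtain ⟨n, hn⟩ := (P.isFNilpotent_iff hμ).mp h
  refine (P.isFNilpotent_iff hμ).mpr ⟨n, fun j y => ?_⟩
  have h1 := map_iterate_frobFlat (μ := μ) (c := c) hφ U n (c.toLinearMap ∘ₗ P.D j)
  have h2 : (φ.comp c).toLinearMap ∘ₗ P.D j = φ.toLinearMap ∘ₗ c.toLinearMap ∘ₗ P.D j := rfl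
  rw [h2, ← h1]
  obtain ⟨z, hz⟩ := Ideal.mem_span_singleton'.mp (hn j y)
  refine Ideal.mem_span_singleton'.mpr ⟨φ z, ?_⟩
  rw [LinearMap.comp_apply, ← hz]
  simp

end FrobFlat

/-! ### Cancellation of powers of `p` -/

section Torsion

variable {p : ℕ} {S : Type u} [CommRing S]

theorem pow_mul_cancel (hp : ∀ a : S, (p : S) * a = 0 → a = 0) (n : ℕ) {a b : S}
    (h : (p : S) ^ n * a = (p : S) ^ n * b) : a = b := by
  induction n with
  | zero => simpa using h
  | succ n ih =>
    refine ih (sub_eq_zero.mp (hp _ ?_))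
    rw [mul_sub, ← mul_assoc, ← mul_assoc, ← pow_succ', h, sub_self]

theorem mem_of_pow_mul_mem (hp : ∀ a : S, (p : S) * a = 0 → a = 0) {n : ℕ} {𝔞 : Ideal S} {a : S}
    (h : (p : S) ^ n * a ∈ Ideal.span {(p : S) ^ n} * 𝔞) : a ∈ 𝔞 := by
  obtain ⟨b, hb, e⟩ := Ideal.mem_span_singleton_mul.mp h
  rwa [← pow_mul_cancel hp n e]

theorem mem_of_p_mul_mem (hp : ∀ a : S, (p : S) * a = 0 → a = 0) {𝔞 : Ideal S} {a : S}
    (h : (p : S) * a ∈ Ideal.span {(p : S)} * 𝔞) : a ∈ 𝔞 := by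
  rw [← pow_one (p : S)] at h
  exact mem_of_pow_mul_mem hp h

end Torsion

/-! ### The twist by `μ(p)` -/

section Twist

variable {p : ℕ} [Fact p.Prime] {k : Type w} [Field k] [CharP k p]
  {O : Type v} [CommRing O] [HopfAlgebra ℤ_[p] O] {μ : Cochar p k O}
  {S : Type u} [CommRing S] [Algebra ℤ_[p] S]
  {ι : Type} [Fintype ι] {c : WittVector p k →ₐ[ℤ_[p]] S} {τ : S →ₐ[ℤ_[p]] S}

/-- `h'` is obtained from `h` by conjugation with `μ(p)⁻¹`, followed by `τ`. -/
def Cochar.IsTwist (μ : Cochar p k O) (c : WittVector p k →ₐ[ℤ_[p]] S) (τ : S →ₐ[ℤ_[p]] S)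
    (h h' : Pt p O S) : Prop :=
  ∀ (n : ℤ) (y : WittVector p k ⊗[ℤ_[p]] O) (a b : ℕ), μ.IsHom n y → (a : ℤ) = b + n →
    (p : S) ^ a * ext (τ.comp c) h' y = (p : S) ^ b * τ (ext c h y)

theorem pUnit_coe : ((pUnit p S : (Localization.Away (p : S))ˣ) : Localization.Away (p : S)) =
    toLoc p S (p : S) := IsUnit.unit_spec _

theorem locMap_toLoc (s : S) : locMap τ (toLoc p S s) = toLoc p S (τ s) := by
  change IsLocalization.lift _ (algebraMap S _ s) = _
  rw [IsLocalization.lift_eq]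
  rfl

theorem locMap_pUnit_zpow (n : ℤ) : locMap τ ((pUnit p S ^ n : (Localization.Away (p : S))ˣ) :
    Localization.Away (p : S)) = (pUnit p S ^ n : (Localization.Away (p : S))ˣ) := by
  have h : Units.map (locMap τ : Localization.Away (p : S) →* Localization.Away (p : S))
      (pUnit p S) = pUnit p S := by
    ext
    change locMap τ (pUnit p S : (Localization.Away (p : S))ˣ) = _
    rw [pUnit_coe, locMap_toLoc, map_natCast]
  conv_rhs => rw [← h, ← map_zpow]
  rfl

theorem Cochar.IsHom.ext_windowTwist {n : ℤ} {y : WittVector p k ⊗[ℤ_[p]] O} (hy : μ.IsHom n y)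
    (h : Pt p O S) : ext ((toLoc p S).comp (τ.comp c)) (μ.windowTwist c τ h) y =
      toLoc p S (τ (ext c h y)) *
        (pUnit p S ^ (-n) : (Localization.Away (p : S))ˣ) := by
  have e : (toLoc p S).comp (τ.comp c) = (locMap τ).comp ((toLoc p S).comp c) :=
    AlgHom.ext fun a => (locMap_toLoc _).symm
  have e2 : μ.windowTwist c τ h = Pt.map (locMap τ)
      ((μ.atUnit ((toLoc p S).comp c) (pUnit p S))⁻¹ * Pt.map (toLoc p S) h *
        μ.atUnit ((toLoc p S).comp c) (pUnit p S)) := by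
    rw [windowTwist]
    simp
  rw [e2, e, ext_map, hy.ext_conj, map_mul, ext_map, locMap_toLoc, locMap_pUnit_zpow]

theorem toLoc_injective (hp : ∀ a : S, (p : S) * a = 0 → a = 0) :
    Function.Injective (toLoc p S) := by
  refine IsLocalization.injective (M := Submonoid.powers (p : S)) _ ?_
  rintro _ ⟨n, rfl⟩
  refine mem_nonZeroDivisors_iff_right.mpr fun x hx => ?_
  induction n with
  | zero => simpa using hx
  | succ n ih =>
    simp only [pow_succ, ← mul_assoc] at hx
    exact ih (hp _ (by rw [mul_comm]; exact hx))

/-- `IsTwist` clears denominators: in degree `n` the twist divides by `pⁿ`, and exponents `a`, `b`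
with `a - b = n` avoid both negative powers and `A[1/p]`. -/
theorem Cochar.isTwist_iff (hp : ∀ a : S, (p : S) * a = 0 → a = 0) {h h' : Pt p O S} :
    μ.IsTwist c τ h h' ↔ Pt.map (toLoc p S) h' = μ.windowTwist c τ h := by
  have key : ∀ (n : ℤ) (y : WittVector p k ⊗[ℤ_[p]] O) (a b : ℕ), μ.IsHom n y →
      (a : ℤ) = b + n → ((p : S) ^ a * ext (τ.comp c) h' y = (p : S) ^ b * τ (ext c h y) ↔
      ext ((toLoc p S).comp (τ.comp c)) (Pt.map (toLoc p S) h') y =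
        ext ((toLoc p S).comp (τ.comp c)) (μ.windowTwist c τ h) y) := fun n y a b hy hab => by
    rw [hy.ext_windowTwist, ext_map, ← (toLoc_injective hp).eq_iff, map_mul, map_mul, map_pow,
      map_pow, ← pUnit_coe, ← (pUnit p S).val_pow_eq_pow_val, ← (pUnit p S).val_pow_eq_pow_val,
      ← zpow_natCast, ← zpow_natCast, hab]
    have e : (pUnit p S) ^ ((b : ℤ) + n) = pUnit p S ^ (b : ℤ) * pUnit p S ^ n := zpow_add _ _ _
    rw [e, Units.val_mul, mul_assoc, Units.mul_right_inj, zpow_neg, Units.eq_mul_inv_iff_mul_eq,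
      mul_comm]
  constructor
  · intro H
    refine eq_of_forall_isHom μ (c := (toLoc p S).comp (τ.comp c)) fun n y hy => ?_
    exact (key n y n.toNat (-n).toNat hy (by omega)).mp (H n y _ _ hy (by omega))
  · intro H n y a b hy hab
    exact (key n y a b hy hab).mpr (by rw [H])

theorem Cochar.IsTwist.unique (hp : ∀ a : S, (p : S) * a = 0 → a = 0) {h h₁ h₂ : Pt p O S}
    (H₁ : μ.IsTwist c τ h h₁) (H₂ : μ.IsTwist c τ h h₂) : h₁ = h₂ :=
  Pt.map_injective (toLoc_injective hp)
    (((isTwist_iff hp).mp H₁).trans ((isTwist_iff hp).mp H₂).symm)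

theorem Cochar.IsTwist.mul (hp : ∀ a : S, (p : S) * a = 0 → a = 0) {h₁ h₂ h₁' h₂' : Pt p O S}
    (H₁ : μ.IsTwist c τ h₁ h₁') (H₂ : μ.IsTwist c τ h₂ h₂') :
    μ.IsTwist c τ (h₁ * h₂) (h₁' * h₂') := by
  rw [isTwist_iff hp] at *
  rw [map_mul, map_mul, H₁, H₂]

theorem Cochar.IsTwist.inv (hp : ∀ a : S, (p : S) * a = 0 → a = 0) {h h' : Pt p O S}
    (H : μ.IsTwist c τ h h') : μ.IsTwist c τ h⁻¹ h'⁻¹ := by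
  rw [isTwist_iff hp] at *
  rw [map_inv, map_inv, H]

theorem Cochar.isTwist_one (hp : ∀ a : S, (p : S) * a = 0 → a = 0) :
    μ.IsTwist c τ (1 : Pt p O S) 1 := by
  rw [isTwist_iff hp, map_one, map_one]

theorem Cochar.isTwist_of_neg {h : Pt p O S} {γ : Pt p O S[X]}
    (hγ : Pt.map (polyLaurent p S) γ =
      (μ.gen c)⁻¹ * Pt.map (constLaurent p S) h * μ.gen c) :
    μ.IsTwist c τ h (Pt.map τ (Pt.map (evalPoly p (p : S)) γ)) := by
  intro n y a b hy hab
  rw [ext_map]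
  rcases le_or_gt n 0 with hn | hn
  · rw [hy.ext_negExt_eval hn hγ, map_mul, map_pow, map_natCast, mul_left_comm, ← pow_add,
      mul_comm]
    congr 2
    omega
  · have h1 : ext c h y = 0 := mem_neg.mp (mem_neg_of_eq hγ) n y hn hy
    have h2 : ext ((constPoly p S).comp c) γ y = 0 := by
      refine polyLaurent_injective (p := p) ?_
      rw [← ext_map, polyLaurent_comp_constPoly, hγ, hy.ext_gen_conj, h1, map_zero, map_zero,
        zero_mul]
    rw [ext_evalPoly, h2, h1, Polynomial.eval_zero, map_zero, mul_zero, mul_zero]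

/-- On `G⁻` the twist is integral by extension to `𝔸¹`. On the other factor, `τ` makes the linear
coordinates divisible by `p`, hence coordinates of degree `n` divisible by `pⁿ`. Points with
integral twist form a subgroup. -/
theorem Cochar.Pres.hatNeg_le_range (P : μ.Pres ι) (hμ : μ.IsPhiDatum)
    (hp : ∀ a : S, (p : S) * a = 0 → a = 0) {𝔟 : Ideal S} (h𝔟 : ∀ b ∈ 𝔟, (p : S) ∣ τ b) :
    μ.hatNeg c 𝔟 ≤ (Pt.map (toLoc p S)).range.comap (μ.windowTwist c τ) := by
  refine sup_le (fun h hh => ?_) fun h hh => ?_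
  · obtain ⟨γ, hγ⟩ := exists_of_mem_neg hh
    exact ⟨_, (isTwist_iff hp).mp (isTwist_of_neg hγ)⟩
  · refine Pt.exists_map_eq (toLoc_injective hp) _ (ext_mem_range (μ := μ)
      (c' := (toLoc p S).comp (τ.comp c)) fun n y hy => ?_)
    rw [hy.ext_windowTwist]
    rcases le_or_gt n 0 with hn | hn
    · refine ⟨τ (ext c h y) * (p : S) ^ (-n).toNat, ?_⟩
      rw [map_mul, map_pow, ← pUnit_coe, ← Units.val_pow_eq_pow_val, ← zpow_natCast,
        Int.toNat_of_nonneg (by omega)]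
    · have h1 := P.map_ext_mem_pow hμ hh.1 (τ : S →+* S) (𝔮 := Ideal.span {(p : S)})
        (fun x hx => Ideal.mem_span_singleton.mpr (h𝔟 _ (ext_mem_of_augm_eq_zero hh.2 c
          (hx.augm_eq_zero one_ne_zero)))) (n := n.toNat) (by omega)
        (x := y) (by rwa [Int.toNat_of_nonneg hn.le])
      rw [Ideal.span_singleton_pow] at h1
      obtain ⟨z, hz⟩ := Ideal.mem_span_singleton'.mp h1
      refine ⟨z, ?_⟩
      change z * _ = τ (ext c h y) at hz
      rw [← hz, map_mul, map_pow, ← pUnit_coe, ← Units.val_pow_eq_pow_val, ← zpow_natCast,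
        Int.toNat_of_nonneg hn.le, zpow_neg, Units.mul_inv_cancel_right]

theorem Cochar.Pres.exists_isTwist (P : μ.Pres ι) (hμ : μ.IsPhiDatum)
    (hp : ∀ a : S, (p : S) * a = 0 → a = 0) {𝔟 : Ideal S} (h𝔟 : ∀ b ∈ 𝔟, (p : S) ∣ τ b)
    {h : Pt p O S} (hh : h ∈ μ.hatNeg c 𝔟) : ∃ h', μ.IsTwist c τ h h' := by
  obtain ⟨h', H⟩ := P.hatNeg_le_range hμ hp h𝔟 hh
  exact ⟨h', (isTwist_iff hp).mpr H⟩

/-- The two factors are treated separately. On `G⁻` only non-negative powers of `p` appear; on `G⁺`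
the value in degree `d` lies in `(p 𝔞') ^ d` after `τ`, and `p ^ d` can be cancelled. -/
theorem Cochar.Pres.isTwist_mem_congr (P : μ.Pres ι) (hμ : μ.IsPhiDatum)
    (hp : ∀ a : S, (p : S) * a = 0 → a = 0) {𝔞 𝔞' : Ideal S}
    (hτ : ∀ a ∈ 𝔞, τ a ∈ Ideal.span {(p : S)} * 𝔞') {m n h' : Pt p O S} (hm : m ∈ μ.neg c)
    (hn : n ∈ μ.pos c) (hm' : m ∈ Pt.congr p O 𝔞) (hn' : n ∈ Pt.congr p O 𝔞)
    (H : μ.IsTwist c τ (m * n) h') : h' ∈ Pt.congr p O 𝔞' := by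
  obtain ⟨γ, hγ⟩ := exists_of_mem_neg hm
  have H₁ := isTwist_of_neg (τ := τ) hγ
  set h₁ := Pt.map τ (Pt.map (evalPoly p (p : S)) γ)
  have H₂ : μ.IsTwist c τ n (h₁⁻¹ * h') := by simpa using (H₁.inv hp).mul hp H
  have hle : Ideal.span {(p : S)} * 𝔞' ≤ 𝔞' := Ideal.mul_le_right
  have h1 : h₁ ∈ Pt.congr p O 𝔞' := P.mem_congr_of_x (c := τ.comp c) fun i => by
    have e := H₁ (P.deg i) (P.x i) (P.deg i).toNat (-P.deg i).toNat (P.isHom i) (by omega)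
    rcases le_or_gt (P.deg i) 0 with hi | hi
    · rw [Int.toNat_of_nonpos hi, pow_zero, one_mul] at e
      rw [e]
      exact 𝔞'.mul_mem_left _ (hle (hτ _ (P.ext_x_mem hm' i)))
    · rw [mem_neg.mp hm _ _ hi (P.isHom i), map_zero, mul_zero] at e
      rw [pow_mul_cancel hp _ (e.trans (mul_zero _).symm)]
      exact zero_mem _
  have h2 : h₁⁻¹ * h' ∈ Pt.congr p O 𝔞' := P.mem_congr_of_x (c := τ.comp c) fun i => by
    have e := H₂ (P.deg i) (P.x i) (P.deg i).toNat (-P.deg i).toNat (P.isHom i) (by omega)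
    rcases le_or_gt (P.deg i) 0 with hi | hi
    · rw [mem_pos.mp hn _ _ hi (P.isHom i), P.augm_eq, map_zero, map_zero, mul_zero] at e
      rw [pow_mul_cancel hp _ (e.trans (mul_zero _).symm)]
      exact zero_mem _
    · have h3 := P.map_ext_mem_pow hμ hn (τ : S →+* S) (𝔮 := Ideal.span {(p : S)} * 𝔞')
        (fun x hx => hτ _ (ext_mem_of_augm_eq_zero hn' c
          (hx.augm_eq_zero one_ne_zero))) (n := (P.deg i).toNat) (by omega)
        (x := P.x i) (by rw [Int.toNat_of_nonneg hi.le]; exact P.isHom i)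
      rw [mul_pow, Ideal.span_singleton_pow] at h3
      rw [Int.toNat_of_nonpos (by omega : -P.deg i ≤ 0), pow_zero, one_mul] at e
      have h4 : τ (ext c n (P.x i)) ∈ _ := h3
      rw [← e] at h4
      exact Ideal.pow_le_self (by omega) (mem_of_pow_mul_mem hp h4)
  simpa using mul_mem h1 h2

/-- The difference between a point and the unit. -/
def Pt.dev (h : Pt p O S) : O →ₗ[ℤ_[p]] S := (h.lin - 1).ofConv

theorem Pt.dev_mem {𝔞 : Ideal S} {h : Pt p O S} : (∀ y, h.dev y ∈ 𝔞) ↔ h ∈ Pt.congr p O 𝔞 :=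
  Pt.mem_congr.symm

theorem lext_dev (h : Pt p O S) (y : WittVector p k ⊗[ℤ_[p]] O) :
    lext c h.dev y = ext c h y - c (augm p k O y) := by
  have e : h.lin.ofConv = h.dev + (1 : WithConv (O →ₗ[ℤ_[p]] S)).ofConv := by
    change _ = h.lin.ofConv - (1 : WithConv (O →ₗ[ℤ_[p]] S)).ofConv + _
    abel
  rw [ext_toLinearMap, e, lext_add, lext_counit]
  ring

theorem Pt.dev_conj (U h : Pt p O S) : (U * h * U⁻¹).dev = adj U h.dev := by
  change (U * h * U⁻¹).lin.ofConv - (1 : WithConv (O →ₗ[ℤ_[p]] S)).ofConv =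
    adj U (h.lin.ofConv - (1 : WithConv (O →ₗ[ℤ_[p]] S)).ofConv)
  rw [adj_sub, adj_unit, lin_conj]

/-- First order expansion of the twist. -/
theorem Cochar.Pres.isTwist_dev (P : μ.Pres ι) (hμ : μ.IsPhiDatum) {𝔞' : Ideal S} {h h' : Pt p O S}
    (H : μ.IsTwist c τ h h') (hh' : h' ∈ Pt.congr p O 𝔞') (U : Pt p O S) (y : O) :
    (p : S) * (U * h' * U⁻¹).dev y - μ.frobFlat c τ U h.dev y ∈
      Ideal.span {(p : S)} * 𝔞' ^ 2 := by
  have key : ∀ y, ((p : S) • h'.dev - τ.toLinearMap ∘ₗ μ.beta c h.dev) y ∈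
      Ideal.span {(p : S)} * 𝔞' ^ 2 := by
    refine lext_mem_of_isHom μ (c := τ.comp c) fun n y hy => ?_
    have e1 := lext_add (τ.comp c) ((p : S) • h'.dev - τ.toLinearMap ∘ₗ μ.beta c h.dev)
      (τ.toLinearMap ∘ₗ μ.beta c h.dev) y
    rw [sub_add_cancel, lext_smul, lext_comp, hy.lext_beta, lext_dev, lext_dev] at e1
    rw [← sub_eq_iff_eq_add.mpr e1]
    -- In degrees at most `1` both sides agree exactly, because `β` multiplies by `p ^ (1 - n)` and
    -- the twist by `p ^ (-n)`. In degrees at least `2`, `β` gives zero and the value of `h'` is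
    -- quadratically small.
    rcases lt_trichotomy n 1 with hn | rfl | hn
    · rw [if_pos hn.le]
      have e2 := H n y 0 (-n).toNat hy (by omega)
      have e3 : (1 - n).toNat = (-n).toNat + 1 := by omega
      rw [pow_zero, one_mul] at e2
      rw [e2, e3, map_mul, map_pow, map_natCast, map_sub]
      by_cases h0 : n = 0
      · subst h0
        simp
      · rw [hy.augm_eq_zero h0, map_zero, map_zero, map_zero, sub_zero, sub_zero, pow_succ' (p : S),
          mul_assoc, sub_self]
        exact zero_mem _
    · have e2 := H 1 y 1 0 hy (by simp)
      rw [pow_one, pow_zero, one_mul] at e2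
      rw [if_pos le_rfl, hy.augm_eq_zero one_ne_zero, map_zero, map_zero, sub_zero, sub_zero, e2]
      simp
    · rw [if_neg (by omega), map_zero, sub_zero, hy.augm_eq_zero (by omega), map_zero, sub_zero]
      exact Ideal.mul_mem_mul (Ideal.mem_span_singleton_self _)
        (ext_mem_sq hh' (P.mem_sq_of_isHom hμ hy (by omega)))
  have h2 := adj_mem _ U key y
  rw [adj_sub, adj_smul, ← Pt.dev_conj] at h2
  exact h2

/-- On the Lie algebra nothing is lost by truncation: derivations kill the functions of degree at
least `2`, which lie in the square of the augmentation ideal. -/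
theorem Cochar.Pres.map_toLoc_beta (P : μ.Pres ι) (hμ : μ.IsPhiDatum) {d : O →ₗ[ℤ_[p]] S}
    (hd : d ∈ lieAlg p O S) : (toLoc p S).toLinearMap ∘ₗ μ.beta c d =
      toLoc p S p • adj (μ.atUnit ((toLoc p S).comp c) (pUnit p S))⁻¹
        ((toLoc p S).toLinearMap ∘ₗ d) := by
  refine P.lie_ext (c := (toLoc p S).comp c) (comp_mem_lieAlg _ (P.beta_mem_lieAlg hμ hd))
    (Submodule.smul_mem _ _ (adj_mem_lieAlg _ (comp_mem_lieAlg _ hd))) fun j => ?_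
  rw [lext_comp, (P.isHom j).lext_beta, lext_smul, (P.isHom j).lext_adj, lext_comp]
  split_ifs with hj
  · rw [map_mul, map_pow, ← pUnit_coe, mul_left_comm, ← Units.val_pow_eq_pow_val, ← Units.val_mul,
      mul_comm]
    congr 2
    rw [← zpow_natCast, Int.toNat_of_nonneg (by omega), ← zpow_one_add, sub_eq_add_neg]
  · rw [lext_sq c hd (P.mem_sq_of_isHom hμ (P.isHom j) (by omega)), map_zero, zero_mul, mul_zero]

/-- After inverting `p` this is the identity between `Ad(μ(p)⁻¹) Ad(h)` and `Ad(μ(p)⁻¹ h μ(p))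
Ad(μ(p)⁻¹)`, to which `τ` is applied. -/
theorem Cochar.Pres.adj_twist (P : μ.Pres ι) (hμ : μ.IsPhiDatum)
    (hp : ∀ a : S, (p : S) * a = 0 → a = 0) {h h' : Pt p O S} (H : μ.IsTwist c τ h h')
    {d : O →ₗ[ℤ_[p]] S} (hd : d ∈ lieAlg p O S) :
    τ.toLinearMap ∘ₗ μ.beta c (adj h d) = adj h' (τ.toLinearMap ∘ₗ μ.beta c d) := by
  have hinj := toLoc_injective (p := p) hp
  refine LinearMap.ext fun y => hinj ?_
  have e1 : ∀ e : O →ₗ[ℤ_[p]] S, (toLoc p S).toLinearMap ∘ₗ τ.toLinearMap ∘ₗ e =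
      (locMap τ).toLinearMap ∘ₗ (toLoc p S).toLinearMap ∘ₗ e := fun e =>
    LinearMap.ext fun y => (locMap_toLoc _).symm
  have e2 : ∀ (s : Localization.Away (p : S)) (e : O →ₗ[ℤ_[p]] Localization.Away (p : S)),
      (locMap τ).toLinearMap ∘ₗ (s • e) = locMap τ s • ((locMap τ).toLinearMap ∘ₗ e) :=
    fun s e => LinearMap.ext fun y => map_mul (locMap τ) _ _
  have e3 : (toLoc p S).toLinearMap ∘ₗ τ.toLinearMap ∘ₗ μ.beta c (adj h d) =
      (toLoc p S).toLinearMap ∘ₗ adj h' (τ.toLinearMap ∘ₗ μ.beta c d) := by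
    rw [map_adj, e1, e1, P.map_toLoc_beta hμ hd, P.map_toLoc_beta hμ (adj_mem_lieAlg h hd),
      map_adj (toLoc p S) h d, e2, e2, adj_smul, (isTwist_iff hp).mp H]
    congr 1
    rw [windowTwist, MonoidHom.comp_apply, ← map_adj (locMap τ), ← adj_mul, ← adj_mul]
    congr 2
    simp [mul_assoc]
  exact DFunLike.congr_fun e3 y

/-- The operator `F♭` of a conjugate. -/
theorem Cochar.Pres.frobFlat_conj (P : μ.Pres ι) (hμ : μ.IsPhiDatum)
    (hp : ∀ a : S, (p : S) * a = 0 → a = 0) {h h' : Pt p O S} (H : μ.IsTwist c τ h h')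
    (U : Pt p O S) (n : ℕ) {d : O →ₗ[ℤ_[p]] S} (hd : d ∈ lieAlg p O S) :
    (μ.frobFlat c τ (h⁻¹ * U * h'))^[n] d =
      adj h⁻¹ ((μ.frobFlat c τ U)^[n] (adj h d)) := by
  induction n with
  | zero => exact (adj_inv_adj h d).symm
  | succ n ih =>
    rw [Function.iterate_succ_apply', Function.iterate_succ_apply', ih]
    set e := (μ.frobFlat c τ U)^[n] (adj h d) with he
    have hlie : e ∈ lieAlg p O S := P.iterate_frobFlat_mem_lieAlg hμ U n (adj_mem_lieAlg h hd)
    have h1 := P.adj_twist hμ hp H (adj_mem_lieAlg h⁻¹ hlie)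
    rw [adj_adj_inv] at h1
    rw [frobFlat, adj_mul, ← h1, adj_mul]
    rfl

theorem Cochar.Pres.isFNilpotent_conj (P : μ.Pres ι) (hμ : μ.IsPhiDatum)
    (hp : ∀ a : S, (p : S) * a = 0 → a = 0) {h h' : Pt p O S} (H : μ.IsTwist c τ h h')
    {U : Pt p O S} (hU : μ.IsFNilpotent c τ U) : μ.IsFNilpotent c τ (h⁻¹ * U * h') := by
  obtain ⟨n, hn⟩ := hU
  refine ⟨n, fun d hd => ?_⟩
  obtain ⟨d', hd', e⟩ := hn _ (adj_mem_lieAlg h hd)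
  exact ⟨adj h⁻¹ d', adj_mem_lieAlg _ hd', by
    rw [P.frobFlat_conj hμ hp H U n hd, e, adj_smul]⟩

end Twist

/-! ### Ideals of Witt vectors defined by ghost components -/

section Ghost

variable {p : ℕ} {A : Type u} [CommRing A]

theorem span_pow_mul_le {H : Ideal A} {m n : ℕ} (h : m ≤ n) :
    Ideal.span {(p : A) ^ n} * H ≤ Ideal.span {(p : A) ^ m} * H :=
  Ideal.mul_mono_left (Ideal.span_singleton_le_span_singleton.mpr (pow_dvd_pow _ h))

theorem mem_span_pow_mul {H : Ideal A} {n : ℕ} {a : A} :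
    a ∈ Ideal.span {(p : A) ^ n} * H ↔ ∃ b ∈ H, (p : A) ^ n * b = a :=
  Ideal.mem_span_singleton_mul

theorem pow_mul_mem {H : Ideal A} {m n l : ℕ} {a : A} (ha : a ∈ Ideal.span {(p : A) ^ n} * H)
    (h : l ≤ m + n) : (p : A) ^ m * a ∈ Ideal.span {(p : A) ^ l} * H := by
  obtain ⟨b, hb, rfl⟩ := mem_span_pow_mul.mp ha
  refine span_pow_mul_le h (mem_span_pow_mul.mpr ⟨b, hb, ?_⟩)
  rw [pow_add, mul_assoc]

theorem eq_zero_of_forall_mem_span [IsHausdorff (Ideal.span {(p : A)}) A] {a : A}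
    (h : ∀ n, a ∈ Ideal.span {(p : A) ^ n}) : a = 0 := by
  refine (IsHausdorff.eq_iff_smodEq (I := Ideal.span {(p : A)})).mpr fun n => ?_
  rw [SModEq.sub_mem, sub_zero, smul_eq_mul, Ideal.mul_top, Ideal.span_singleton_pow]
  exact h n

variable [Fact p.Prime]

theorem witt_torsionFree (hp : ∀ a : A, (p : A) * a = 0 → a = 0) (a : WittVector p A)
    (ha : (p : WittVector p A) * a = 0) : a = 0 :=
  ghost_ext hp fun n => by
    rw [map_zero]
    refine hp _ ?_
    have := congrArg (WittVector.ghostComponent n) ha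
    rwa [map_mul, map_natCast, map_zero] at this

/-- From here on, divided powers on `H` enter only through the condition `x ^ p ∈ pH`. -/
theorem pow_mem_of_frobPow {H : Ideal A} (hH : ∀ x ∈ H, x ^ p ∈ Ideal.span {(p : A)} * H) {x : A}
    (hx : x ∈ H) (m : ℕ) : x ^ p ^ m ∈ Ideal.span {(p : A) ^ m} * H := by
  induction m with
  | zero => exact mem_span_pow_mul.mpr ⟨x, hx, by simp⟩
  | succ m ih =>
    obtain ⟨y, hy, e⟩ := mem_span_pow_mul.mp ih
    rw [pow_succ p, pow_mul, ← e, mul_pow, ← pow_mul]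
    have h1 := hH y hy
    rw [← pow_one (p : A)] at h1
    refine pow_mul_mem h1 ?_
    have := (Fact.out : p.Prime).one_lt
    nlinarith

theorem ghost_term_mem {H : Ideal A} (hH : ∀ x ∈ H, x ^ p ∈ Ideal.span {(p : A)} * H)
    {x : A} (hx : x ∈ H) {i n : ℕ} (hi : i ≤ n) :
    (p : A) ^ i * x ^ p ^ (n - i) ∈ Ideal.span {(p : A) ^ n} * H :=
  pow_mul_mem (pow_mem_of_frobPow hH hx (n - i)) (by omega)

theorem ghost_mem_of_coeff {H : Ideal A} (hH : ∀ x ∈ H, x ^ p ∈ Ideal.span {(p : A)} * H)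
    {a : WittVector p A} {n : ℕ} (h : ∀ i ≤ n, a.coeff i ∈ H) :
    WittVector.ghostComponent n a ∈ Ideal.span {(p : A) ^ n} * H := by
  rw [ghostComponent_eq_sum]
  exact sum_mem fun i hi => ghost_term_mem hH (h i (by simpa [Nat.lt_succ_iff] using hi))
    (by simpa [Nat.lt_succ_iff] using hi)

/-- With `ghost_mem_of_coeff`, this identifies `W(H)` with the Witt vectors whose `n`th ghost
component lies in `pⁿH`: the logarithmic coordinates of `W(H)`. -/
theorem coeff_mem_of_ghost (hp : ∀ a : A, (p : A) * a = 0 → a = 0) {H : Ideal A}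
    (hH : ∀ x ∈ H, x ^ p ∈ Ideal.span {(p : A)} * H) {a : WittVector p A} {n : ℕ}
    (h : ∀ i < n, WittVector.ghostComponent i a ∈ Ideal.span {(p : A) ^ i} * H) :
    ∀ i < n, a.coeff i ∈ H := by
  intro i
  induction i using Nat.strong_induction_on with
  | _ i ih =>
    intro hi
    have h1 := h i hi
    rw [ghostComponent_eq_sum, Finset.sum_range_succ, Nat.sub_self, pow_zero, pow_one] at h1
    refine mem_of_pow_mul_mem hp ((Ideal.add_mem_iff_right _ (sum_mem fun j hj => ?_)).mp h1)
    have hj' := Finset.mem_range.mp hj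
    exact ghost_term_mem hH (ih j hj' (hj'.trans hi)) hj'.le

/-- Witt coordinates for given ghost components. -/
def ghostCoeff (p : ℕ) {A : Type u} [CommRing A] (z : ℕ → A) (n : ℕ) : A :=
  Classical.epsilon fun y : A => (p : A) ^ n * y =
    z n - ∑ i : Fin n, (p : A) ^ (i : ℕ) * ghostCoeff p z i ^ p ^ (n - (i : ℕ))
  termination_by n
  decreasing_by exact i.2

/-- No further congruences between the `z n` are required. The contributions of the earlier Witt
coordinates to the `n`th ghost component lie in `pⁿH` already, so the equation for the next
coordinate is solvable in `H`. -/
theorem exists_ghost {H : Ideal A} (hH : ∀ x ∈ H, x ^ p ∈ Ideal.span {(p : A)} * H)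
    (hp : ∀ a : A, (p : A) * a = 0 → a = 0)
    {z : ℕ → A} (hz : ∀ n, z n ∈ Ideal.span {(p : A) ^ n} * H) :
    ∃ a : WittVector p A, ∀ n, WittVector.ghostComponent n a = z n := by
  refine ⟨WittVector.mk p (ghostCoeff p z), fun n => ?_⟩
  have key : ∀ n, ghostCoeff p z n ∈ H ∧ (p : A) ^ n * ghostCoeff p z n =
      z n - ∑ i : Fin n, (p : A) ^ (i : ℕ) * ghostCoeff p z i ^ p ^ (n - (i : ℕ)) := by
    intro n
    induction n using Nat.strong_induction_on with
    | _ n ih =>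
      obtain ⟨y, hy, e⟩ := mem_span_pow_mul.mp (sub_mem (hz n) (sum_mem (t := Finset.univ)
        (fun (i : Fin n) _ => ghost_term_mem hH (ih i i.2).1 i.2.le)))
      have h1 := Classical.epsilon_spec (p := fun y : A => (p : A) ^ n * y =
        z n - ∑ i : Fin n, (p : A) ^ (i : ℕ) * ghostCoeff p z i ^ p ^ (n - (i : ℕ))) ⟨y, e⟩
      rw [← ghostCoeff] at h1
      exact ⟨pow_mul_cancel hp n (h1.trans e.symm) ▸ hy, h1⟩
  rw [ghostComponent_eq_sum, Finset.sum_range_succ, Finset.sum_range]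
  simp only [Nat.sub_self, pow_zero, pow_one, WittVector.coeff_mk]
  rw [(key n).2]
  ring

theorem ker_map_mk_iff (hp : ∀ a : A, (p : A) * a = 0 → a = 0) {H : Ideal A}
    (hH : ∀ x ∈ H, x ^ p ∈ Ideal.span {(p : A)} * H) {a : WittVector p A} :
    WittVector.map (Ideal.Quotient.mk H) a = 0 ↔
      ∀ n, WittVector.ghostComponent n a ∈ Ideal.span {(p : A) ^ n} * H := by
  constructor
  · intro h n
    refine ghost_mem_of_coeff hH fun i _ => ?_
    rw [← Ideal.Quotient.eq_zero_iff_mem, ← WittVector.map_coeff, h, WittVector.zero_coeff]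
  · intro h
    ext i
    rw [WittVector.map_coeff, WittVector.zero_coeff, Ideal.Quotient.eq_zero_iff_mem]
    exact coeff_mem_of_ghost hp hH (n := i + 1) (fun j _ => h j) i i.lt_succ_self

/-- The ideal of the Witt vectors of which the ghost components lie in given ideals. -/
def ghostIdeal (p : ℕ) [Fact p.Prime] {A : Type u} [CommRing A] (I : ℕ → Ideal A) :
    Ideal (WittVector p A) :=
  ⨅ n, (I n).comap (WittVector.ghostComponent n)

theorem mem_ghostIdeal {I : ℕ → Ideal A} {a : WittVector p A} :
    a ∈ ghostIdeal p I ↔ ∀ n, WittVector.ghostComponent n a ∈ I n := by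
  simp only [ghostIdeal, Ideal.mem_iInf, Ideal.mem_comap]

/-- The kernel of `W(A) → W_n(A/p^n)`. -/
def wittFil (p : ℕ) [Fact p.Prime] (A : Type u) [CommRing A] (n : ℕ) : Ideal (WittVector p A) :=
  ghostIdeal p fun k => if k < n then Ideal.span {(p : A) ^ (k + n)} else ⊤

theorem mem_wittFil {n : ℕ} {a : WittVector p A} :
    a ∈ wittFil p A n ↔ ∀ k < n, WittVector.ghostComponent k a ∈ Ideal.span {(p : A) ^ (k + n)} := by
  rw [wittFil, mem_ghostIdeal]
  refine forall_congr' fun k => ?_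
  by_cases h : k < n <;> simp [h]

theorem frobPow_span {n : ℕ} (hn : 1 ≤ n) :
    ∀ x ∈ Ideal.span {(p : A) ^ n}, x ^ p ∈ Ideal.span {(p : A)} * Ideal.span {(p : A) ^ n} := by
  intro x hx
  obtain ⟨y, rfl⟩ := Ideal.mem_span_singleton.mp hx
  rw [Ideal.span_singleton_mul_span_singleton, Ideal.mem_span_singleton, mul_pow, ← pow_mul,
    ← pow_succ']
  refine Dvd.dvd.mul_right (pow_dvd_pow _ ?_) _
  have := (Fact.out : p.Prime).two_le
  nlinarith

theorem mem_wittFil_iff_coeff (hp : ∀ a : A, (p : A) * a = 0 → a = 0) {n : ℕ}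
    {a : WittVector p A} :
    a ∈ wittFil p A n ↔ ∀ i < n, a.coeff i ∈ Ideal.span {(p : A) ^ n} := by
  rcases Nat.eq_zero_or_pos n with rfl | hn
  · simp [mem_wittFil]
  have e : ∀ k, Ideal.span {(p : A) ^ (k + n)} =
      Ideal.span {(p : A) ^ k} * Ideal.span {(p : A) ^ n} := fun k => by
    rw [Ideal.span_singleton_mul_span_singleton, pow_add]
  rw [mem_wittFil]
  simp only [e]
  constructor
  · exact coeff_mem_of_ghost hp (frobPow_span hn)
  · intro h k hk
    exact ghost_mem_of_coeff (frobPow_span hn) fun i hi => h i (hi.trans_lt hk)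

/-- The filtration is the kernel of truncation over `A/pⁿ`, and equality of truncated Witt vectors
can be read off from their coordinates. -/
theorem sub_mem_wittFil_iff (hp : ∀ a : A, (p : A) * a = 0 → a = 0) {n : ℕ}
    {a b : WittVector p A} :
    a - b ∈ wittFil p A n ↔ ∀ i < n, a.coeff i - b.coeff i ∈ Ideal.span {(p : A) ^ n} := by
  set π := Ideal.Quotient.mk (Ideal.span {(p : A) ^ n})
  have e : ∀ a : WittVector p A, (WittVector.truncate n (WittVector.map π a) = 0 ↔
      a ∈ wittFil p A n) := fun a => by
    rw [mem_wittFil_iff_coeff hp, ← RingHom.mem_ker, WittVector.mem_ker_truncate]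
    refine forall₂_congr fun i _ => ?_
    rw [WittVector.map_coeff, Ideal.Quotient.eq_zero_iff_mem]
  rw [← e, map_sub, map_sub, sub_eq_zero]
  simp only [← Ideal.Quotient.eq]
  constructor
  · intro h i hi
    have := congrArg (TruncatedWittVector.coeff (⟨i, hi⟩ : Fin n)) h
    rwa [WittVector.coeff_truncate, WittVector.coeff_truncate, WittVector.map_coeff,
      WittVector.map_coeff] at this
  · intro h
    refine TruncatedWittVector.ext fun i => ?_
    rw [WittVector.coeff_truncate, WittVector.coeff_truncate, WittVector.map_coeff,
      WittVector.map_coeff]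
    exact h i i.2

theorem ghost_mem_of_mem_wittFil {n k m : ℕ} (hk : k < n) (hm : m ≤ n) {a : WittVector p A}
    (h : a ∈ wittFil p A n) : WittVector.ghostComponent k a ∈ Ideal.span {(p : A) ^ m} :=
  Ideal.span_singleton_le_span_singleton.mpr (pow_dvd_pow _ (by omega)) (mem_wittFil.mp h k hk)

theorem isCompleteFiltration_wittFil (hp : ∀ a : A, (p : A) * a = 0 → a = 0)
    [IsAdicComplete (Ideal.span {(p : A)}) A] : IsCompleteFiltration (wittFil p A) where
  anti m n hmn a ha := mem_wittFil.mpr fun k hk =>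
    Ideal.span_singleton_le_span_singleton.mpr (pow_dvd_pow _ (by omega))
      (mem_wittFil.mp ha k (hk.trans_le hmn))
  sep a ha := ghost_ext hp fun k => by
    rw [map_zero]
    refine eq_zero_of_forall_mem_span (p := p) fun n => ?_
    exact ghost_mem_of_mem_wittFil (n := k + n + 1) (by omega) (by omega) (ha _)
  lim x hx := by
    have h1 : ∀ i, ∃ y : A, ∀ n, i < n → (x n).coeff i - y ∈ Ideal.span {(p : A) ^ n} := by
      intro i
      -- The hypothesis at index `n` controls only the coordinates `i < n`, so the sequence of `i`th
      -- coordinates is started at index `i + 1`.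
      have h2 : ∀ n, (x (max (n + 1) (i + 1))).coeff i - (x (max n (i + 1))).coeff i ∈
          Ideal.span {(p : A) ^ n} := fun n => by
        rcases Nat.lt_or_ge i n with hn | hn
        · rw [max_eq_left (by omega), max_eq_left (by omega)]
          exact (sub_mem_wittFil_iff hp).mp (hx n) i hn
        · rw [max_eq_right (by omega), max_eq_right (by omega), sub_self]
          exact zero_mem _
      have h3 : ∀ {m n}, m ≤ n → (x (max m (i + 1))).coeff i ≡ (x (max n (i + 1))).coeff i
          [SMOD (Ideal.span {(p : A)} ^ m • ⊤ : Ideal A)] := fun {m n} hmn => by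
        rw [SModEq.sub_mem, smul_eq_mul, Ideal.mul_top, Ideal.span_singleton_pow]
        induction n, hmn using Nat.le_induction with
        | base => simp
        | succ n hmn ih =>
          have h4 := Ideal.span_singleton_le_span_singleton.mpr (pow_dvd_pow (p : A) hmn) (h2 n)
          convert sub_mem ih h4 using 1
          ring
      obtain ⟨y, hy⟩ := IsPrecomplete.prec (I := Ideal.span {(p : A)}) inferInstance h3
      refine ⟨y, fun n hn => ?_⟩
      have h5 := hy n
      rw [SModEq.sub_mem, smul_eq_mul, Ideal.mul_top, Ideal.span_singleton_pow,
        max_eq_left (by omega)] at h5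
      exact h5
    choose y hy using h1
    refine ⟨WittVector.mk p y, fun n => ?_⟩
    rw [← neg_sub]
    exact neg_mem ((sub_mem_wittFil_iff hp).mpr fun i hi => hy i n hi)

/-- Each condition `I n` contains a power of `p`, hence is open for the topology induced by the
ghost components. -/
theorem ghostIdeal_closed {I : ℕ → Ideal A} (hI : ∀ n, ∃ m, (p : A) ^ m ∈ I n) :
    idealClosure (wittFil p A) (ghostIdeal p I) ≤ ghostIdeal p I := by
  intro a ha
  refine mem_ghostIdeal.mpr fun k => ?_
  obtain ⟨m, hm⟩ := hI k
  obtain ⟨y, hy, h⟩ := mem_idealClosure.mp ha (m + k + 1)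
  have h1 := (Ideal.span_singleton_le_iff_mem _).mpr hm
    (ghost_mem_of_mem_wittFil (n := m + k + 1) (k := k) (m := m) (by omega) (by omega) h)
  rw [map_sub] at h1
  simpa using add_mem h1 (mem_ghostIdeal.mp hy k)

end Ghost

section WittIdeals

variable {p : ℕ} [Fact p.Prime] {A : Type u} [CommRing A] {J : Ideal A}

/-! ### The ideals of `W(A)` attached to an ideal with divided powers -/

/-- The Witt vectors with `n`th ghost component in `p ^ (n + m) J`, for all `n`. -/
def wittPD (p : ℕ) [Fact p.Prime] {A : Type u} [CommRing A] (J : Ideal A) (m : ℕ) :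
    Ideal (WittVector p A) :=
  ghostIdeal p fun n => Ideal.span {(p : A) ^ (n + m)} * J

/-- The Witt vectors with zeroth ghost component in `p ^ m J` and `n`th ghost component in
`p ^ (n + m + 1) J`, for all `n ≥ 1`. -/
def wittPDHalf (p : ℕ) [Fact p.Prime] {A : Type u} [CommRing A] (J : Ideal A) (m : ℕ) :
    Ideal (WittVector p A) :=
  ghostIdeal p fun n => Ideal.span {(p : A) ^ (if n = 0 then m else n + m + 1)} * J

theorem mem_wittPD {m : ℕ} {a : WittVector p A} : a ∈ wittPD p J m ↔
    ∀ n, WittVector.ghostComponent n a ∈ Ideal.span {(p : A) ^ (n + m)} * J := mem_ghostIdeal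

theorem mem_wittPDHalf {m : ℕ} {a : WittVector p A} : a ∈ wittPDHalf p J m ↔
    ∀ n, WittVector.ghostComponent n a ∈
      Ideal.span {(p : A) ^ (if n = 0 then m else n + m + 1)} * J := mem_ghostIdeal

theorem wittPD_zero (hp : ∀ a : A, (p : A) * a = 0 → a = 0)
    (hJ : ∀ x ∈ J, x ^ p ∈ Ideal.span {(p : A)} * J) :
    RingHom.ker (WittVector.map (Ideal.Quotient.mk J) :
      WittVector p A →+* WittVector p (A ⧸ J)) = wittPD p J 0 := by
  ext a
  rw [RingHom.mem_ker, ker_map_mk_iff hp hJ, mem_wittPD]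
  rfl

theorem wittPD_antitone : Antitone (wittPD p J) := fun m n hmn _ ha =>
  mem_wittPD.mpr fun k => span_pow_mul_le (by omega) (mem_wittPD.mp ha k)

theorem wittPD_succ_le_half (m : ℕ) : wittPD p J (m + 1) ≤ wittPDHalf p J m := fun _ ha =>
  mem_wittPDHalf.mpr fun k => span_pow_mul_le (by split_ifs <;> omega) (mem_wittPD.mp ha k)

theorem wittPDHalf_le (m : ℕ) : wittPDHalf p J m ≤ wittPD p J m := fun _ ha =>
  mem_wittPD.mpr fun k => span_pow_mul_le (by split_ifs <;> omega) (mem_wittPDHalf.mp ha k)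

theorem p_mul_wittPD_le (m : ℕ) :
    Ideal.span {(p : WittVector p A)} * wittPD p J m ≤ wittPDHalf p J m := by
  refine le_trans (fun a ha => ?_) (wittPD_succ_le_half m)
  obtain ⟨b, hb, rfl⟩ := Ideal.mem_span_singleton_mul.mp ha
  refine mem_wittPD.mpr fun n => ?_
  rw [map_mul, map_natCast]
  have := pow_mul_mem (m := 1) (l := n + (m + 1)) (mem_wittPD.mp hb n) (by omega)
  rwa [pow_one] at this

/-- The square gains powers of `p` at the ghost components `n ≥ 1`, but none at `n = 0` if `m = 0`,
since `J ^ 2` need not lie in `pJ`. The ideal `wittPDHalf` accounts for this; the Frobenius shifts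
ghost components and so never sees the zeroth one. -/
theorem wittPD_sq_le (m : ℕ) : wittPD p J m ^ 2 ≤ wittPDHalf p J m := by
  rw [pow_two, Ideal.mul_le]
  intro a ha b hb
  refine mem_wittPDHalf.mpr fun n => ?_
  rw [map_mul]
  obtain ⟨x, hx, e⟩ := mem_span_pow_mul.mp (mem_wittPD.mp ha n)
  rw [← e, mul_assoc]
  refine pow_mul_mem (n := n + m) (Ideal.mul_mem_left _ _ (mem_wittPD.mp hb n)) ?_
  split_ifs <;> omega

/-- Division by `p` is performed on ghost components; `exists_ghost` provides a Witt vector with the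
quotients as ghost components. -/
theorem mem_p_mul_ghostIdeal (hp : ∀ a : A, (p : A) * a = 0 → a = 0)
    (hJ : ∀ x ∈ J, x ^ p ∈ Ideal.span {(p : A)} * J) {I : ℕ → Ideal A}
    (hI : ∀ n, I n ≤ Ideal.span {(p : A) ^ n} * J) {a : WittVector p A}
    (ha : ∀ n, WittVector.ghostComponent n a ∈ Ideal.span {(p : A)} * I n) :
    a ∈ Ideal.span {(p : WittVector p A)} * ghostIdeal p I := by
  choose z hz hz' using fun n => Ideal.mem_span_singleton_mul.mp (ha n)
  obtain ⟨b, hb⟩ := exists_ghost hJ hp fun n => hI n (hz n)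
  refine Ideal.mem_span_singleton_mul.mpr ⟨b, mem_ghostIdeal.mpr fun n => by rw [hb]; exact hz n,
    ghost_ext hp fun n => ?_⟩
  rw [map_mul, map_natCast, hb, hz']

theorem frobenius_mem_wittPD (hp : ∀ a : A, (p : A) * a = 0 → a = 0)
    (hJ : ∀ x ∈ J, x ^ p ∈ Ideal.span {(p : A)} * J) {m : ℕ} {a : WittVector p A}
    (ha : a ∈ wittPD p J m) :
    WittVector.frobenius a ∈ Ideal.span {(p : WittVector p A)} * wittPD p J m :=
  mem_p_mul_ghostIdeal hp hJ (fun n => span_pow_mul_le (by omega)) fun n => by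
    rw [WittVector.ghostComponent_frobenius, ← mul_assoc, Ideal.span_singleton_mul_span_singleton,
      ← pow_succ']
    exact span_pow_mul_le (by omega) (mem_wittPD.mp ha (n + 1))

theorem frobenius_mem_wittPD_succ (hp : ∀ a : A, (p : A) * a = 0 → a = 0)
    (hJ : ∀ x ∈ J, x ^ p ∈ Ideal.span {(p : A)} * J) {m : ℕ} {a : WittVector p A}
    (ha : a ∈ wittPDHalf p J m) :
    WittVector.frobenius a ∈ Ideal.span {(p : WittVector p A)} * wittPD p J (m + 1) :=
  mem_p_mul_ghostIdeal hp hJ (fun n => span_pow_mul_le (by omega)) fun n => by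
    rw [WittVector.ghostComponent_frobenius, ← mul_assoc, Ideal.span_singleton_mul_span_singleton,
      ← pow_succ']
    refine span_pow_mul_le ?_ (mem_wittPDHalf.mp ha (n + 1))
    rw [if_neg (by omega)]
    omega

theorem wittPD_closed (hJ' : ∃ n, (p : A) ^ n ∈ J) (m : ℕ) :
    idealClosure (wittFil p A) (wittPD p J m) ≤ wittPD p J m :=
  ghostIdeal_closed fun n => by
    obtain ⟨l, hl⟩ := hJ'
    exact ⟨n + m + l, by
      rw [pow_add _ (n + m)]
      exact Ideal.mul_mem_mul (Ideal.mem_span_singleton_self _) hl⟩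

theorem wittPD_le_wittFil (n : ℕ) : wittPD p J n ≤ wittFil p A n := fun _ ha =>
  mem_wittFil.mpr fun k _ => Ideal.mul_le_left (mem_wittPD.mp ha k)

theorem mem_wittIdeal {a : WittVector p A} :
    a ∈ wittIdeal p J ↔ WittVector.ghostComponent 0 a ∈ J := by
  constructor
  · intro h
    obtain ⟨x, hx, y, hy, rfl⟩ := Submodule.mem_sup.mp h
    rw [map_add, RingHom.mem_ker.mp hy, add_zero, ← Ideal.Quotient.eq_zero_iff_mem,
      ← ghostComponent_map, RingHom.mem_ker.mp hx, map_zero]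
  · intro h
    refine Submodule.mem_sup.mpr ⟨WittVector.teichmuller p (WittVector.ghostComponent 0 a), ?_,
      a - WittVector.teichmuller p (WittVector.ghostComponent 0 a), ?_, by ring⟩
    · rw [RingHom.mem_ker, WittVector.map_teichmuller, Ideal.Quotient.eq_zero_iff_mem.mpr h,
        WittVector.teichmuller_zero]
    · rw [RingHom.mem_ker, map_sub, sub_eq_zero]
      simp [ghostComponent_eq_sum]

theorem wittIdeal_closed (hJ' : ∃ n, (p : A) ^ n ∈ J) :
    idealClosure (wittFil p A) (wittIdeal p J) ≤ wittIdeal p J := by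
  have e : wittIdeal p J = ghostIdeal p fun n => if n = 0 then J else ⊤ := by
    refine Ideal.ext fun a => mem_wittIdeal.trans (Iff.trans ⟨fun h n => ?_, fun h => ?_⟩
      mem_ghostIdeal.symm)
    · split_ifs with hn
      · exact hn ▸ h
      · trivial
    · simpa using h 0
  rw [e]
  refine ghostIdeal_closed fun n => ?_
  split_ifs
  · exact hJ'
  · exact ⟨0, trivial⟩

theorem ghost_sub_pow_mem (a : WittVector p A) (n : ℕ) :
    WittVector.ghostComponent n a - WittVector.ghostComponent 0 a ^ p ^ n ∈
      Ideal.span {(p : A)} := by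
  rw [ghostComponent_eq_sum, ghostComponent_eq_sum, Finset.sum_range_succ']
  simp only [Finset.sum_range_one, pow_zero, one_mul, Nat.sub_zero, pow_one, zero_add,
    add_sub_cancel_right]
  refine sum_mem fun i _ => ?_
  rw [pow_succ', mul_assoc]
  exact Ideal.mul_mem_right _ _ (Ideal.mem_span_singleton_self _)

/-- Modulo `p` every ghost component is a power of the zeroth one, whose `p`th power lies in `pJ`.
-/
theorem wittIdeal_le_radical (hJ : ∀ x ∈ J, x ^ p ∈ Ideal.span {(p : A)} * J) (n : ℕ) :
    wittIdeal p J ≤ (wittFil p A n).radical := by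
  intro a ha
  have h0 := mem_wittIdeal.mp ha
  have h1 : ∀ k, WittVector.ghostComponent k a ^ p ∈ Ideal.span {(p : A)} := fun k => by
    rcases Nat.eq_zero_or_pos k with rfl | hk
    · exact Ideal.mul_le_left (hJ _ h0)
    · refine Ideal.pow_mem_of_mem _ ?_ _ (Fact.out : p.Prime).pos
      have h2 : WittVector.ghostComponent 0 a ^ p ^ k ∈ Ideal.span {(p : A)} := by
        obtain ⟨k, rfl⟩ := Nat.exists_eq_add_of_lt hk
        rw [zero_add, pow_succ' p, pow_mul]
        exact Ideal.pow_mem_of_mem _ (Ideal.mul_le_left (hJ _ h0)) _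
          (pow_pos (Fact.out : p.Prime).pos _)
      simpa using add_mem (ghost_sub_pow_mem a k) h2
  -- A `p`th power makes all ghost components divisible by `p`; the `2n`th power then reaches `p ^
  -- (k + n)` for all `k < n`.
  refine ⟨p * (2 * n), mem_wittFil.mpr fun k hk => ?_⟩
  rw [map_pow, pow_mul]
  have h3 := Ideal.pow_mem_pow (h1 k) (2 * n)
  rw [Ideal.span_singleton_pow] at h3
  exact Ideal.span_singleton_le_span_singleton.mpr (pow_dvd_pow _ (by omega)) h3

theorem wittPD_le_wittIdeal (m : ℕ) : wittPD p J m ≤ wittIdeal p J := fun _ ha =>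
  mem_wittIdeal.mpr (Ideal.mul_le_right (mem_wittPD.mp ha 0))

theorem exists_verschiebung_of_ghost_zero {a : WittVector p A}
    (h : WittVector.ghostComponent 0 a = 0) : ∃ b, a = WittVector.verschiebung b := by
  have h0 : a.coeff 0 = 0 := by simpa [ghostComponent_eq_sum] using h
  refine ⟨a.shift 1, ?_⟩
  rw [WittVector.verschiebung_shift a 0 (fun i hi => by
    obtain rfl : i = 0 := by omega
    exact h0)]
  ext n
  simp [WittVector.shift_coeff]

/-- One element `b` is both `F(a)/p` over `W(A)` and `V⁻¹` of `a` over `W(A/J)`, which ties the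
window twist to the `V⁻¹` in the twisted Frobenius. On `I(A)` it is `V⁻¹`; on `W(J)` it is `F/p`,
which stays in `W(J)` and disappears in the quotient. -/
theorem exists_of_mem_wittIdeal (hp : ∀ a : A, (p : A) * a = 0 → a = 0)
    (hJ : ∀ x ∈ J, x ^ p ∈ Ideal.span {(p : A)} * J) {a : WittVector p A}
    (ha : a ∈ wittIdeal p J) : ∃ b, WittVector.frobenius a = (p : WittVector p A) * b ∧
      WittVector.map (Ideal.Quotient.mk J) a =
        WittVector.verschiebung (WittVector.map (Ideal.Quotient.mk J) b) := by
  obtain ⟨x, hx, y, hy, rfl⟩ := Submodule.mem_sup.mp ha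
  obtain ⟨z, rfl⟩ := exists_verschiebung_of_ghost_zero hy
  have hx' := hx
  rw [wittPD_zero hp hJ] at hx'
  obtain ⟨t, ht, e⟩ := Ideal.mem_span_singleton_mul.mp (frobenius_mem_wittPD hp hJ hx')
  rw [← wittPD_zero hp hJ] at ht
  refine ⟨t + z, ?_, ?_⟩
  · rw [map_add, ← e, WittVector.frobenius_verschiebung]
    ring
  · rw [map_add, map_add, RingHom.mem_ker.mp hx, RingHom.mem_ker.mp ht, zero_add, zero_add,
      WittVector.map_verschiebung]

theorem p_dvd_frobenius (hp : ∀ a : A, (p : A) * a = 0 → a = 0)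
    (hJ : ∀ x ∈ J, x ^ p ∈ Ideal.span {(p : A)} * J) {a : WittVector p A}
    (ha : a ∈ wittIdeal p J) : (p : WittVector p A) ∣ WittVector.frobenius a := by
  obtain ⟨b, hb, -⟩ := exists_of_mem_wittIdeal hp hJ ha
  exact ⟨b, hb⟩

/-! ### The powers of `p` and the augmentation ideal of `W(A)` -/

/-- The ideal `p ^ m I(A)` of `W(A)`. -/
def wittAug (p : ℕ) [Fact p.Prime] (A : Type u) [CommRing A] (m : ℕ) : Ideal (WittVector p A) :=
  Ideal.span {(p : WittVector p A) ^ m} *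
    RingHom.ker (WittVector.ghostComponent 0 : WittVector p A →+* A)

theorem mem_wittAug (hp : ∀ a : A, (p : A) * a = 0 → a = 0) {m : ℕ} {a : WittVector p A} :
    a ∈ wittAug p A m ↔
      WittVector.ghostComponent 0 a = 0 ∧ a ∈ Ideal.span {(p : WittVector p A) ^ m} := by
  constructor
  · intro h
    exact ⟨Ideal.mul_le_right h, Ideal.mul_le_left h⟩
  · rintro ⟨h0, h1⟩
    obtain ⟨b, rfl⟩ := Ideal.mem_span_singleton.mp h1
    refine Ideal.mul_mem_mul (Ideal.mem_span_singleton_self _) ?_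
    rw [map_mul, map_pow, map_natCast] at h0
    exact pow_mul_cancel hp m (h0.trans (mul_zero _).symm)

theorem wittAug_antitone : Antitone (wittAug p A) := fun _ _ hmn => span_pow_mul_le hmn

theorem wittAug_zero : wittAug p A 0 =
    RingHom.ker (WittVector.ghostComponent 0 : WittVector p A →+* A) := by
  rw [wittAug, pow_zero, Ideal.span_singleton_one, Ideal.top_mul]

theorem ghost_zero_of_mem_wittAug {m : ℕ} {a : WittVector p A} (ha : a ∈ wittAug p A m) :
    WittVector.ghostComponent 0 a = 0 :=
  Ideal.mul_le_right ha

theorem wittAug_le_wittIdeal (m : ℕ) : wittAug p A m ≤ wittIdeal p J := fun a ha =>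
  mem_wittIdeal.mpr (by rw [ghost_zero_of_mem_wittAug ha]; exact zero_mem _)

/-- As `F V = p`, a factor `p` is gained, but `F(a)` no longer has zeroth ghost component `0`. The
vanishing is restored later by dividing out the diagonal part. -/
theorem frobenius_mem_of_mem_wittAug {m : ℕ} {a : WittVector p A} (ha : a ∈ wittAug p A m) :
    WittVector.frobenius a ∈ Ideal.span {(p : WittVector p A)} *
      Ideal.span {(p : WittVector p A) ^ m} := by
  obtain ⟨b, hb, rfl⟩ := mem_span_pow_mul.mp ha
  obtain ⟨z, rfl⟩ := exists_verschiebung_of_ghost_zero hb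
  rw [map_mul, map_pow, map_natCast, WittVector.frobenius_verschiebung]
  have e : (p : WittVector p A) ^ m * (z * p) = p * (z * p ^ m) := by ring
  rw [e]
  exact Ideal.mul_mem_mul (Ideal.mem_span_singleton_self _)
    (Ideal.mul_mem_left _ _ (Ideal.mem_span_singleton_self _))

/-- By the projection formula, `V x · V y = p V(x y)`. -/
theorem wittAug_sq_le (m : ℕ) : wittAug p A m ^ 2 ≤ wittAug p A (m + 1) := by
  have h : RingHom.ker (WittVector.ghostComponent 0 : WittVector p A →+* A) *
      RingHom.ker (WittVector.ghostComponent 0 : WittVector p A →+* A) ≤ wittAug p A 1 := by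
    rw [Ideal.mul_le]
    intro a ha b hb
    obtain ⟨z, rfl⟩ := exists_verschiebung_of_ghost_zero hb
    obtain ⟨y, rfl⟩ := exists_verschiebung_of_ghost_zero ha
    rw [mul_comm, ← WittVector.verschiebung_mul_frobenius, WittVector.frobenius_verschiebung]
    refine mem_span_pow_mul.mpr ⟨WittVector.verschiebung (z * y), ?_, ?_⟩
    · rw [RingHom.mem_ker, WittVector.ghostComponent_zero_verschiebung]
    · have e : z * (y * (p : WittVector p A)) = (p : ℕ) • (z * y) := by
        rw [nsmul_eq_mul]; ring
      rw [e, map_nsmul, nsmul_eq_mul, pow_one]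
  rw [pow_two, Ideal.mul_le]
  intro a ha b hb
  obtain ⟨x, hx, rfl⟩ := mem_span_pow_mul.mp ha
  obtain ⟨y, hy, rfl⟩ := mem_span_pow_mul.mp hb
  have h1 := pow_mul_mem (m := m + m) (l := m + 1) (h (Ideal.mul_mem_mul hx hy)) (by omega)
  have e : (p : WittVector p A) ^ m * x * (p ^ m * y) = p ^ (m + m) * (x * y) := by ring
  rw [e]
  exact h1

theorem pow_closed (hp : ∀ a : A, (p : A) * a = 0 → a = 0)
    [IsAdicComplete (Ideal.span {(p : A)}) A] (m : ℕ) :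
    idealClosure (wittFil p A) (Ideal.span {(p : WittVector p A) ^ m}) ≤
      Ideal.span {(p : WittVector p A) ^ m} := by
  have hN := isCompleteFiltration_wittFil (p := p) hp
  intro a ha
  have h1 : ∀ n, ∃ b, a - (p : WittVector p A) ^ m * b ∈ wittFil p A n := fun n => by
    obtain ⟨y, hy, h⟩ := mem_idealClosure.mp ha n
    obtain ⟨b, rfl⟩ := Ideal.mem_span_singleton.mp hy
    exact ⟨b, h⟩
  choose b hb using h1
  -- Cancelling `p ^ m` costs `m` steps of the filtration, hence the shift of the index.
  have h2 : ∀ n, b (n + 1 + m) - b (n + m) ∈ wittFil p A n := fun n => by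
    have h3 : (p : WittVector p A) ^ m * (b (n + 1 + m) - b (n + m)) ∈ wittFil p A (n + m) := by
      convert sub_mem (hb (n + m)) (hN.anti (show n + m ≤ n + 1 + m by omega)
        (hb (n + 1 + m))) using 1
      ring
    refine mem_wittFil.mpr fun k hk => ?_
    have h4 := mem_wittFil.mp h3 k (by omega)
    rw [map_mul, map_pow, map_natCast, show k + (n + m) = m + (k + n) by omega, pow_add,
      ← Ideal.span_singleton_mul_span_singleton] at h4
    exact mem_of_pow_mul_mem hp h4
  obtain ⟨y, hy⟩ := hN.lim (fun n => b (n + m)) h2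
  refine Ideal.mem_span_singleton.mpr ⟨y, hN.eq_of_sub_mem fun n => ?_⟩
  convert sub_mem (hN.anti (show n ≤ n + m by omega) (hb (n + m)))
    (Ideal.mul_mem_left _ ((p : WittVector p A) ^ m) (hy n)) using 1
  ring

theorem wittAug_closed (hp : ∀ a : A, (p : A) * a = 0 → a = 0)
    [IsAdicComplete (Ideal.span {(p : A)}) A] (m : ℕ) :
    idealClosure (wittFil p A) (wittAug p A m) ≤ wittAug p A m := by
  intro a ha
  refine (mem_wittAug hp).mpr ⟨eq_zero_of_forall_mem_span (p := p) fun n => ?_,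
    pow_closed hp m (idealClosure_mono Ideal.mul_le_left ha)⟩
  obtain ⟨y, hy, h⟩ := mem_idealClosure.mp ha (n + 1)
  have h1 := ghost_mem_of_mem_wittFil (k := 0) (m := n) (by omega) (by omega) h
  rwa [map_sub, ghost_zero_of_mem_wittAug hy, sub_zero] at h1

theorem pow_le_wittFil (n : ℕ) :
    Ideal.span {(p : WittVector p A) ^ (2 * n)} ≤ wittFil p A n := by
  rw [Ideal.span_singleton_le_iff_mem]
  refine mem_wittFil.mpr fun k hk => ?_
  rw [map_pow, map_natCast]
  exact Ideal.mem_span_singleton.mpr (pow_dvd_pow _ (by omega))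

end WittIdeals

/-! ### Compatibilities of the Frobenius lift of a frame -/

section Frame

theorem DividedPowers.pow_mem_mul {A : Type u} [CommRing A] {J : Ideal A} (hJ : DividedPowers J)
    {p : ℕ} (hp : p.Prime) {x : A} (hx : x ∈ J) : x ^ p ∈ Ideal.span {(p : A)} * J := by
  rw [← hJ.factorial_mul_dpow_eq_pow hx, ← Nat.mul_factorial_pred hp.ne_zero, Nat.cast_mul,
    mul_assoc]
  exact Ideal.mul_mem_mul (Ideal.mem_span_singleton_self _)
    (Ideal.mul_mem_left _ _ (hJ.dpow_mem hp.ne_zero hx))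

variable {p : ℕ} [Fact p.Prime] {k : Type w} [Field k] [Finite k] [CharP k p]

/-- As `k` is perfect, each `x` has the form `p z + [y] ^ p ^ (n + 1)`. Homomorphisms that agree
modulo `p` agree on `p ^ (n + 1)`th powers modulo `p ^ (n + 2)`, and induction handles `p z`. -/
theorem witt_hom_ext {A : Type u} [CommRing A] [IsHausdorff (Ideal.span {(p : A)}) A]
    {f g : WittVector p k →+* A} (h : ∀ x, (p : A) ∣ f x - g x) : f = g := by
  have key : ∀ n x, (p : A) ^ (n + 1) ∣ f x - g x := by
    intro n
    induction n with
    | zero => simpa using h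
    | succ n ih =>
      intro x
      have hperf : Function.Bijective (fun y : k => y ^ p ^ (n + 1)) := by
        rw [Finite.injective_iff_bijective.symm]
        exact iterateFrobenius_inj k p (n + 1)
      obtain ⟨y, hy⟩ := hperf.2 (x.coeff 0)
      have h1 : x - WittVector.teichmuller p y ^ p ^ (n + 1) ∈
          Ideal.span {(p : WittVector p k)} := by
        rw [WittVector.mem_span_p_iff_coeff_zero_eq_zero]
        change WittVector.constantCoeff (x - WittVector.teichmuller p y ^ p ^ (n + 1)) = 0
        rw [map_sub, map_pow]
        change x.coeff 0 - ((WittVector.teichmuller p y).coeff 0) ^ p ^ (n + 1) = 0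
        rw [WittVector.teichmuller_coeff_zero, ← hy, sub_self]
      obtain ⟨z, hz⟩ := Ideal.mem_span_singleton.mp h1
      rw [sub_eq_iff_eq_add.mp hz]
      have e : f (p * z + WittVector.teichmuller p y ^ p ^ (n + 1)) -
          g (p * z + WittVector.teichmuller p y ^ p ^ (n + 1)) = p * (f z - g z) +
          (f (WittVector.teichmuller p y) ^ p ^ (n + 1) -
            g (WittVector.teichmuller p y) ^ p ^ (n + 1)) := by
        simp only [map_add, map_mul, map_pow, map_natCast]
        ring
      rw [e]
      refine dvd_add ?_ (dvd_sub_pow_of_dvd_sub (h _) _)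
      rw [pow_succ']
      exact mul_dvd_mul_left _ (ih z)
  ext x
  refine sub_eq_zero.mp (eq_zero_of_forall_mem_span (p := p) fun n => ?_)
  exact Ideal.mem_span_singleton.mpr ((pow_dvd_pow _ n.le_succ).trans (key n x))

theorem frobenius_dvd {S : Type*} [CommRing S] {c : WittVector p k →+* S} (x : WittVector p k) :
    (p : S) ∣ c (WittVector.frobenius x) - c x ^ p := by
  have h := map_dvd c (wittField_frobenius x)
  rwa [map_natCast, map_sub, map_pow] at h

namespace IsFrame

variable {A : Type u} [CommRing A] [Algebra (WittVector p k) A] {J : Ideal A} {τ : A →+* A}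

theorem frobPow (h : IsFrame p k A J τ) : ∀ x ∈ J, x ^ p ∈ Ideal.span {(p : A)} * J :=
  fun _ hx => DividedPowers.pow_mem_mul h.pd.some Fact.out hx

variable [Algebra ℤ_[p] A]

theorem ghost_diag (h : IsFrame p k A J τ) (a : A) (n : ℕ) :
    WittVector.ghostComponent n (h.diag a) = τ^[n] a :=
  ghostComponent_cartierDiagonal τ h.eq_zero_of_p_mul h.frobenius a n

theorem frob_comp_diag (h : IsFrame p k A J τ) :
    (wittFrob p A).comp h.diag = h.diag.comp h.tau := by
  refine AlgHom.ext fun a => ghost_ext h.eq_zero_of_p_mul fun n => ?_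
  change WittVector.ghostComponent n (WittVector.frobenius (h.diag a)) =
    WittVector.ghostComponent n (h.diag (τ a))
  rw [WittVector.ghostComponent_frobenius, h.ghost_diag, h.ghost_diag,
    Function.iterate_succ_apply]

theorem zero_comp_diag (h : IsFrame p k A J τ) :
    (wittZero p A).comp h.diag = AlgHom.id ℤ_[p] A :=
  AlgHom.ext fun a => h.ghost_diag a 0

variable [IsScalarTower ℤ_[p] (WittVector p k) A]

/-- The definition of a frame does not ask for this compatibility: both homomorphisms lift the `p`th
power map modulo `p`, so they coincide. -/
theorem tau_baseMap (h : IsFrame p k A J τ) (x : WittVector p k) :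
    h.tau (baseMap p k A x) = baseMap p k A (WittVector.frobenius x) := by
  have := h.complete
  have e := witt_hom_ext (p := p) (f := τ.comp (baseMap p k A : WittVector p k →+* A))
    (g := (baseMap p k A : WittVector p k →+* A).comp WittVector.frobenius) fun x => by
      have := dvd_sub (h.frobenius (baseMap p k A x))
        (frobenius_dvd (c := (baseMap p k A : WittVector p k →+* A)) x)
      simpa using this
  exact DFunLike.congr_fun e x

theorem diag_comp_baseMap (h : IsFrame p k A J τ) :
    h.diag.comp (baseMap p k A) = wittStr (baseMap p k A) := by
  refine AlgHom.ext fun x => ghost_ext h.eq_zero_of_p_mul fun n => ?_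
  have e : WittVector.ghostComponent n (wittStr (baseMap p k A) x) =
      baseMap p k A (WittVector.ghostComponent n (wittDiagonal p k x)) :=
    ghostComponent_map (baseMap p k A : WittVector p k →+* A) (wittDiagonal p k x) n
  have e2 : WittVector.ghostComponent n (wittDiagonal p k x) = WittVector.frobenius^[n] x :=
    ghostComponent_cartierDiagonal _ wittField_torsionFree wittField_frobenius x n
  rw [e, e2]
  change WittVector.ghostComponent n (h.diag (baseMap p k A x)) = _
  rw [h.ghost_diag]
  clear e e2
  induction n generalizing x with
  | zero => rfl
  | succ n ih =>
    rw [Function.iterate_succ_apply, Function.iterate_succ_apply, ← ih]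
    exact congrArg _ (h.tau_baseMap x)

end IsFrame

theorem wittZero_comp_wittStr {R : Type u} [CommRing R] [Algebra ℤ_[p] R]
    (c : WittVector p k →ₐ[ℤ_[p]] R) : (wittZero p R).comp (wittStr c) = c := by
  refine AlgHom.ext fun x => ?_
  refine (ghostComponent_map (c : WittVector p k →+* R) (wittDiagonal p k x) 0).trans ?_
  have e2 : WittVector.ghostComponent 0 (wittDiagonal p k x) = x :=
    ghostComponent_cartierDiagonal _ wittField_torsionFree wittField_frobenius x 0
  rw [e2]
  rfl

theorem wittMap_comp_wittStr {R R' : Type u} [CommRing R] [Algebra ℤ_[p] R] [CommRing R']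
    [Algebra ℤ_[p] R'] (φ : R →ₐ[ℤ_[p]] R') (c : WittVector p k →ₐ[ℤ_[p]] R) :
    (wittMap p φ).comp (wittStr c) = wittStr (φ.comp c) := by
  refine AlgHom.ext fun x => ?_
  change WittVector.map _ (WittVector.map _ _) = WittVector.map _ _
  ext n
  simp [WittVector.map_coeff]

end Frame

/-! ### Linear coordinates of `G⁺` -/

section Additive

variable {p : ℕ} [Fact p.Prime] {k : Type w} [Field k] [CharP k p]
  {O : Type v} [CommRing O] [HopfAlgebra ℤ_[p] O] {μ : Cochar p k O}
  {S : Type u} [CommRing S] [Algebra ℤ_[p] S] {c : WittVector p k →ₐ[ℤ_[p]] S}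

/-- The linear coordinates of `G⁺` are additive. -/
theorem Cochar.IsHom.ext_mul_of_pos {y : WittVector p k ⊗[ℤ_[p]] O} (hy : μ.IsHom 1 y)
    {g h : Pt p O S} (hg : g ∈ μ.pos c) (hh : h ∈ μ.pos c) :
    ext c (g * h) y = ext c g y + ext c h y := by
  obtain ⟨γ, h0, hγ⟩ := mem_pos_iff_exists.mp hg
  obtain ⟨η, k0, hη⟩ := mem_pos_iff_exists.mp hh
  have hmem : ∀ {γ : Pt p O S[X]}, Pt.map (evalPoly p (0 : S)) γ = 1 →
      γ ∈ Pt.congr p O (Ideal.span {(X : S[X])}) := fun {γ} h => by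
    refine Pt.mem_congr.mpr fun x => ?_
    rw [Ideal.mem_span_singleton, Polynomial.X_dvd_iff, Polynomial.coeff_zero_eq_eval_zero,
      Polynomial.eval_sub, sub_eq_zero]
    have e : (γ.hom x).eval 0 = (Pt.map (evalPoly p (0 : S)) γ).hom x := rfl
    rw [e, h]
    simp [Pt.one_hom, Polynomial.algebraMap_apply]
  have hγη : Pt.map (polyLaurent p S) (γ * η) =
      μ.gen c * Pt.map (constLaurent p S) (g * h) * (μ.gen c)⁻¹ := by
    rw [map_mul, map_mul, hγ, hη]
    group
  -- Both extensions are trivial modulo `T`, so products are additive modulo `T ^ 2`; the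
  -- coefficients of `T` are the values in question.
  have h1 := ext_mul_sub_mem' (c := (constPoly p S).comp c) (hmem h0) (hmem k0)
    (hy.augm_eq_zero one_ne_zero)
  rw [hy.ext_posExt zero_le_one hγ, hy.ext_posExt zero_le_one hη, hy.ext_posExt zero_le_one hγη,
    Ideal.span_singleton_mul_span_singleton, Ideal.mem_span_singleton, ← pow_two,
    Polynomial.X_pow_dvd_iff] at h1
  have h2 := h1 1 one_lt_two
  simp only [Int.toNat_one, pow_one, Polynomial.coeff_sub, Polynomial.coeff_C_mul_X] at h2
  simp only [if_true] at h2
  linear_combination h2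

end Additive

/-! ### Contraction properties of twisted conjugation -/

section Contraction

variable {p : ℕ} [Fact p.Prime] {k : Type w} [Field k] [CharP k p]
  {O : Type v} [CommRing O] [HopfAlgebra ℤ_[p] O] {μ : Cochar p k O}
  {S : Type u} [CommRing S] [Algebra ℤ_[p] S]
  {ι : Type} [Fintype ι] {c : WittVector p k →ₐ[ℤ_[p]] S} {τ : S →ₐ[ℤ_[p]] S}

theorem Cochar.Pres.dev_sub_sum_mem (P : μ.Pres ι) (c : WittVector p k →ₐ[ℤ_[p]] S) {𝔞 : Ideal S}
    {g : Pt p O S} (hg : g ∈ Pt.congr p O 𝔞) (y : O) :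
    g.dev y - ∑ j, ext c g (P.x j) * c (P.D j y) ∈ 𝔞 ^ 2 := by
  have h := P.ext_sub_sum_mem (c := c) hg (1 ⊗ₜ y)
  rw [← lext_dev, lext_one_tmul] at h
  convert h using 3 with j
  rw [← P.lext_D, lext_one_tmul, mul_comm]
  rfl

variable [Algebra.Smooth ℤ_[p] O] {N : ℕ → Ideal S} {𝔟 : Ideal S}

/-- The twist of a point close to the unit is close to the unit. -/
theorem Cochar.Pres.twist_mem_congr (P : μ.Pres ι) (hμ : μ.IsPhiDatum)
    (hp : ∀ a : S, (p : S) * a = 0 → a = 0) (hN : IsCompleteFiltration N)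
    (hcl : idealClosure N 𝔟 ≤ 𝔟) (hrad : ∀ n, 𝔟 ≤ (N n).radical) {𝔞 𝔞' : Ideal S} (h𝔞 : 𝔞 ≤ 𝔟)
    (hτ : ∀ a ∈ 𝔞, τ a ∈ Ideal.span {(p : S)} * 𝔞') {h h' : Pt p O S}
    (hh : h ∈ Pt.congr p O 𝔞) (H : μ.IsTwist c τ h h') : h' ∈ Pt.congr p O 𝔞' := by
  obtain ⟨m, hm, n, hn, rfl, hmn⟩ := P.factor hN hcl hrad c (Pt.congr_mono h𝔞 hh)
  exact P.isTwist_mem_congr hμ hp hτ hm hn (hmn _ hh).1 (hmn _ hh).2 H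

theorem Cochar.Pres.congr_le_hatNeg (P : μ.Pres ι) (hN : IsCompleteFiltration N)
    (hcl : idealClosure N 𝔟 ≤ 𝔟) (hrad : ∀ n, 𝔟 ≤ (N n).radical)
    (c : WittVector p k →ₐ[ℤ_[p]] S) : Pt.congr p O 𝔟 ≤ μ.hatNeg c 𝔟 := by
  intro h hh
  obtain ⟨m, hm, n, hn, rfl, hmn⟩ := P.factor hN hcl hrad c hh
  exact mul_mem (Subgroup.mem_sup_left hm) (Subgroup.mem_sup_right ⟨hn, (hmn _ hh).2⟩)

/-- The limit of a sequence of twisted conjugations. -/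
theorem Cochar.Pres.exists_twist_lim (P : μ.Pres ι) (hμ : μ.IsPhiDatum)
    (hp : ∀ a : S, (p : S) * a = 0 → a = 0) (hN : IsCompleteFiltration N)
    (hcl : idealClosure N 𝔟 ≤ 𝔟) (hrad : ∀ n, 𝔟 ≤ (N n).radical) (h𝔟 : ∀ b ∈ 𝔟, (p : S) ∣ τ b)
    {𝔞 : ℕ → Ideal S} (h𝔞 : Antitone 𝔞) (hcl' : ∀ j, idealClosure N (𝔞 j) ≤ 𝔞 j)
    (hev : ∀ n, ∃ j, 𝔞 j ≤ N n) (h0 : 𝔞 0 ≤ 𝔟) {e q U : ℕ → Pt p O S}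
    (he : ∀ j, e j ∈ Pt.congr p O (𝔞 j)) (hq : ∀ j, μ.IsTwist c τ (e j) (q j))
    (hU : ∀ j, U (j + 1) = (e j)⁻¹ * U j * q j) :
    ∃ h ∈ Pt.congr p O (𝔞 0), ∃ h', μ.IsTwist c τ h h' ∧
      ∀ j, ∃ r ∈ Pt.congr p O (𝔞 j), ∃ r', μ.IsTwist c τ r r' ∧
        h⁻¹ * U 0 * h' = r⁻¹ * U j * r' := by
  -- Running products of the conjugating elements and of their twists.
  obtain ⟨g, hg0, hg⟩ := exists_iterate (X := fun _ => Pt p O S × Pt p O S) (1, 1)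
    fun j x => (x.1 * e j, x.2 * q j)
  have hgt : ∀ j, μ.IsTwist c τ (g j).1 (g j).2 := fun j => by
    induction j with
    | zero => rw [hg0]; exact isTwist_one hp
    | succ j ih => rw [hg]; exact ih.mul hp (hq j)
  have hgU : ∀ j, U j = (g j).1⁻¹ * U 0 * (g j).2 := fun j => by
    induction j with
    | zero => rw [hg0]; simp
    | succ j ih => rw [hU, ih, hg]; simp [mul_assoc]
  obtain ⟨h, hh⟩ := Pt.exists_lim hN h𝔞 hcl' hev (fun j => (g j).1) fun j => by
    rw [hg]; simpa using he j
  have hh0 : h ∈ Pt.congr p O (𝔞 0) := by simpa [hg0] using hh 0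
  obtain ⟨h', H⟩ := P.exists_isTwist hμ hp h𝔟
    (P.congr_le_hatNeg hN hcl hrad c (Pt.congr_mono h0 hh0))
  refine ⟨h, hh0, h', H, fun j => ⟨_, hh j, _, ((hgt j).inv hp).mul hp H, ?_⟩⟩
  rw [hgU j]
  group

/-- Twisted conjugation by a nilpotent point contracts the congruence subgroup of an ideal with
divided powers. -/
theorem Cochar.Pres.contraction (P : μ.Pres ι) (hμ : μ.IsPhiDatum)
    (hp : ∀ a : S, (p : S) * a = 0 → a = 0) (hN : IsCompleteFiltration N)
    (hcl : idealClosure N 𝔟 ≤ 𝔟) (hrad : ∀ n, 𝔟 ≤ (N n).radical) {𝔞 𝔮 𝔞' : Ideal S} (h𝔞 : 𝔞 ≤ 𝔟)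
    (h1 : ∀ a ∈ 𝔞, τ a ∈ Ideal.span {(p : S)} * 𝔞)
    (h2 : ∀ a ∈ 𝔮, τ a ∈ Ideal.span {(p : S)} * 𝔞') (h3 : 𝔞' ≤ 𝔮) (h4 : 𝔮 ≤ 𝔞)
    (h5 : 𝔞 ^ 2 ≤ 𝔮) (h6 : Ideal.span {(p : S)} * 𝔞 ≤ 𝔮) {U : Pt p O S} {M : ℕ}
    (hU : ∀ j y, (μ.frobFlat c τ U)^[M] (c.toLinearMap ∘ₗ P.D j) y ∈ Ideal.span {(p : S)})
    {e q : ℕ → Pt p O S} (he : ∀ j, e (j + 1) = U * q j * U⁻¹)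
    (hq : ∀ j, μ.IsTwist c τ (e j) (q j)) (h0 : e 0 ∈ Pt.congr p O 𝔞) :
    (∀ j, e j ∈ Pt.congr p O 𝔞) ∧ e (M + 1) ∈ Pt.congr p O 𝔞' := by
  have hconj : ∀ {𝔠 : Ideal S} {j}, q j ∈ Pt.congr p O 𝔠 → e (j + 1) ∈ Pt.congr p O 𝔠 :=
    fun {𝔠 j} h => by rw [he]; exact Subgroup.Normal.conj_mem inferInstance _ h _
  have hall : ∀ j, e j ∈ Pt.congr p O 𝔞 := fun j => by
    induction j with
    | zero => exact h0
    | succ j ih => exact hconj (P.twist_mem_congr hμ hp hN hcl hrad h𝔞 h1 ih (hq j))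
  -- To first order the iteration is linear: modulo `𝔮`, the deviation of `e j` stays a combination
  -- of the `j`th iterates of `F♭` on the dual derivations, with coefficients in `𝔞`.
  have key : ∀ j, ∃ a : ι → S, (∀ i, a i ∈ 𝔞) ∧ ∀ y, (e j).dev y -
      (∑ i, a i • (μ.frobFlat c τ U)^[j] (c.toLinearMap ∘ₗ P.D i)) y ∈ 𝔮 := by
    intro j
    induction j with
    | zero =>
      refine ⟨fun i => ext c (e 0) (P.x i), fun i => P.ext_x_mem h0 i, fun y => ?_⟩
      have := h5 (P.dev_sub_sum_mem c h0 y)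
      simpa [LinearMap.sum_apply] using this
    | succ j ih =>
      obtain ⟨a, ha, hy⟩ := ih
      -- The new coefficients are `τ(a i)/p`, again in `𝔞`. The quadratic error and the image of the
      -- old error under `F♭` both lie in `p 𝔮`, so `p` can be cancelled.
      choose a' ha' e' using fun i => Ideal.mem_span_singleton_mul.mp (h1 _ (ha i))
      refine ⟨a', ha', fun y => mem_of_p_mul_mem hp ?_⟩
      have i1 := P.isTwist_dev hμ (hq j)
        (P.twist_mem_congr hμ hp hN hcl hrad h𝔞 h1 (hall j) (hq j)) U y
      rw [← he] at i1
      have i2 := frobFlat_mem (μ := μ) (c := c) (I' := Ideal.span {(p : S)} * 𝔮)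
        (fun b hb => Ideal.mul_mono_right h3 (h2 b hb)) U (d := (e j).dev -
          ∑ i, a i • (μ.frobFlat c τ U)^[j] (c.toLinearMap ∘ₗ P.D i)) hy y
      rw [frobFlat_sub, frobFlat_sum] at i2
      simp only [frobFlat_smul, ← e', ← Function.iterate_succ_apply' (μ.frobFlat c τ U)] at i2
      have i3 := add_mem (Ideal.mul_mono_right h5 i1) i2
      convert i3 using 1
      simp only [LinearMap.sub_apply, LinearMap.sum_apply, LinearMap.smul_apply, smul_eq_mul,
        mul_assoc, ← Finset.mul_sum]
      ring
  refine ⟨hall, ?_⟩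
  obtain ⟨a, ha, hy⟩ := key M
  -- After `M` steps the combination lies in `p 𝔞`, hence in `𝔮`; one more Frobenius passes from `𝔮`
  -- to `𝔞'`.
  have h7 : e M ∈ Pt.congr p O 𝔮 := Pt.dev_mem.mp fun y => by
    refine (Submodule.sub_mem_iff_left _ ?_).mp (hy y)
    rw [LinearMap.sum_apply]
    refine sum_mem fun i _ => h6 ?_
    rw [LinearMap.smul_apply, smul_eq_mul, mul_comm (a i)]
    exact Ideal.mul_mem_mul (hU i y) (ha i)
  exact hconj (P.twist_mem_congr hμ hp hN hcl hrad (h4.trans h𝔞) h2 h7 (hq M))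

end Contraction

/-! ### Contraction towards the image of the diagonal -/

section Diagonal

variable {p : ℕ} [Fact p.Prime] {k : Type w} [Field k] [CharP k p]
  {O : Type v} [CommRing O] [HopfAlgebra ℤ_[p] O] {μ : Cochar p k O}
  {S : Type u} [CommRing S] [Algebra ℤ_[p] S]
  {ι : Type} [Fintype ι] {c : WittVector p k →ₐ[ℤ_[p]] S} {τ θ : S →ₐ[ℤ_[p]] S}

theorem sub_map_mem {m : ℕ} {𝔞 : ℕ → Ideal S}
    (hθ : ∀ m x, (p : S) ^ m * (x - θ x) ∈ 𝔞 m) {x : S} (hx : x ∈ Ideal.span {(p : S) ^ m}) :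
    x - θ x ∈ 𝔞 m := by
  obtain ⟨z, rfl⟩ := Ideal.mem_span_singleton.mp hx
  rw [map_mul, map_pow, map_natCast, ← mul_sub]
  exact hθ m z

theorem map_span_pow (m : ℕ) {x : S} (hx : x ∈ Ideal.span {(p : S) ^ m}) :
    θ x ∈ Ideal.span {(p : S) ^ m} := by
  obtain ⟨z, rfl⟩ := Ideal.mem_span_singleton.mp hx
  rw [map_mul, map_pow, map_natCast]
  exact Ideal.mul_mem_right _ _ (Ideal.mem_span_singleton_self _)

/-- The twist of a point congruent to the unit modulo `𝔞`, where `τ 𝔞 ⊆ (s)`, lies in `G⁺`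
modulo `s`. -/
theorem Cochar.isTwist_mem_pos {𝔞 : Ideal S} {s : S} (hτ : ∀ a ∈ 𝔞, τ a ∈ Ideal.span {s})
    {e q : Pt p O S} (he : e ∈ Pt.congr p O 𝔞) (H : μ.IsTwist c τ e q) :
    Pt.map (Ideal.Quotient.mkₐ ℤ_[p] (Ideal.span {s})) q ∈
      μ.pos ((Ideal.Quotient.mkₐ ℤ_[p] (Ideal.span {s})).comp (τ.comp c)) := by
  refine mem_pos.mpr fun n y hn hy => ?_
  rw [ext_map]
  refine Ideal.Quotient.eq.mpr ?_
  have e1 := H n y 0 (-n).toNat hy (by omega)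
  rw [pow_zero, one_mul] at e1
  have e2 := hτ _ (ext_sub_augm_mem he c y)
  rw [e1]
  rcases hn.lt_or_eq with hn | rfl
  · rw [hy.augm_eq_zero hn.ne, map_zero, sub_zero] at e2 ⊢
    exact Ideal.mul_mem_left _ _ e2
  · simpa using e2

/-- First order form of the passage from `e` to `q θ(q)⁻¹`: it is `(1 - θ) τ β / p`. Modulo `p ^ (m
+ 1)` both `q` and `θ(q)` lie in `G⁺`. There values in degrees at most `0` are trivial and those in
degree `1` are additive, which improves the naive error `𝔞 m` to `𝔞 (m + 1)`. In degrees at least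
`2` the error is quadratic. -/
theorem Cochar.Pres.isTwist_diag (P : μ.Pres ι) (hμ : μ.IsPhiDatum) {𝔞 : ℕ → Ideal S} {m : ℕ}
    (h𝔞 : ∀ a ∈ 𝔞 m, a ∈ Ideal.span {(p : S) ^ (m + 1)} → a ∈ 𝔞 (m + 1))
    (hθ : ∀ m x, (p : S) ^ m * (x - θ x) ∈ 𝔞 m) (hsq : 𝔞 m ^ 2 ≤ 𝔞 (m + 1))
    (hτ : ∀ a ∈ 𝔞 m, τ a ∈ Ideal.span {(p : S) ^ (m + 1)})
    (hθc : θ.comp (τ.comp c) = τ.comp c)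
    {e q : Pt p O S} (he : e ∈ Pt.congr p O (𝔞 m)) (H : μ.IsTwist c τ e q)
    (hq : q * (Pt.map θ q)⁻¹ ∈ Pt.congr p O (𝔞 m)) (y : O) :
    (p : S) * (q * (Pt.map θ q)⁻¹).dev y -
      (τ (μ.beta c e.dev y) - θ (τ (μ.beta c e.dev y))) ∈ Ideal.span {(p : S)} * 𝔞 (m + 1) := by
  set r := q * (Pt.map θ q)⁻¹ with hr
  set b := τ.toLinearMap ∘ₗ μ.beta c e.dev with hb
  set π := Ideal.Quotient.mkₐ ℤ_[p] (Ideal.span {(p : S) ^ (m + 1)}) with hπ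
  have hpq : Pt.map π q ∈ μ.pos (π.comp (τ.comp c)) := isTwist_mem_pos hτ he H
  have hpθ : Pt.map π (Pt.map θ q) ∈ μ.pos (π.comp (τ.comp c)) := by
    refine mem_pos.mpr fun n y hn hy => ?_
    have h1 := mem_pos.mp hpq n y hn hy
    rw [ext_map] at h1 ⊢
    nth_rewrite 1 [← hθc]
    rw [ext_map]
    have h2 : π.comp (τ.comp c) (augm p k O y) = π (θ (τ (c (augm p k O y)))) :=
      congrArg π (DFunLike.congr_fun hθc (augm p k O y)).symm
    rw [h2]
    refine Ideal.Quotient.eq.mpr ?_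
    rw [← map_sub]
    exact map_span_pow _ (Ideal.Quotient.eq.mp h1)
  have hpr : Pt.map π r ∈ μ.pos (π.comp (τ.comp c)) := by
    rw [hr, map_mul, map_inv]
    exact mul_mem hpq (inv_mem hpθ)
  have key : ∀ y, ((p : S) • r.dev - (b - θ.toLinearMap ∘ₗ b)) y ∈
      Ideal.span {(p : S)} * 𝔞 (m + 1) := by
    refine lext_mem_of_isHom μ (c := τ.comp c) fun n y hy => ?_
    have l1 : lext (τ.comp c) b y = τ (lext c (μ.beta c e.dev) y) := lext_comp _ _ _ _
    have l2 : lext (τ.comp c) (θ.toLinearMap ∘ₗ b) y = θ (lext (τ.comp c) b y) := by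
      conv_lhs => rw [← hθc]
      exact lext_comp _ _ _ _
    have lsub : ∀ d d' : O →ₗ[ℤ_[p]] S, lext (τ.comp c) (d - d') y =
        lext (τ.comp c) d y - lext (τ.comp c) d' y := fun d d' => by
      rw [eq_sub_iff_add_eq, ← lext_add, sub_add_cancel]
    rw [lsub, lsub, lext_smul, l2, l1, lext_dev, hy.lext_beta, lext_dev]
    have hspan : ∀ {a : S}, a ∈ 𝔞 (m + 1) → (p : S) * a ∈ Ideal.span {(p : S)} * 𝔞 (m + 1) :=
      fun h => Ideal.mul_mem_mul (Ideal.mem_span_singleton_self _) h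
    rcases lt_trichotomy n 1 with hn | rfl | hn
    · rw [if_pos hn.le]
      refine sub_mem (hspan (h𝔞 _ (ext_sub_augm_mem hq _ y) ?_)) ?_
      · have h1 := mem_pos.mp hpr n y (by omega) hy
        rw [ext_map] at h1
        exact Ideal.Quotient.eq.mp h1
      · have h1 := hτ _ (ext_sub_augm_mem he c y)
        have e3 : (1 - n).toNat = (-n).toNat + 1 := by omega
        rw [e3, pow_succ' (p : S), mul_assoc, map_mul τ, map_natCast τ, map_mul θ, map_natCast θ,
          ← mul_sub]
        refine hspan (sub_map_mem hθ ?_)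
        rw [map_mul]
        exact Ideal.mul_mem_left _ _ h1
    · have e2 := H 1 y 1 0 hy (by simp)
      rw [pow_one, pow_zero, one_mul] at e2
      rw [if_pos le_rfl, hy.augm_eq_zero one_ne_zero, map_zero, map_zero, sub_zero, sub_zero]
      simp only [sub_self, Int.toNat_zero, pow_zero, one_mul]
      rw [← e2, map_mul, map_natCast, ← mul_sub, ← mul_sub]
      have e4 : θ (ext (τ.comp c) q y) = ext (τ.comp c) (Pt.map θ q) y := by
        conv_rhs => rw [← hθc, ext_map]
      have e5 : q = r * Pt.map θ q := by rw [hr]; simp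
      refine hspan (h𝔞 _ ?_ ?_)
      · have h1 := ext_mul_sub_mem' (c := τ.comp c) hq (𝔟 := ⊤) (h := Pt.map θ q)
          (Pt.mem_congr.mpr fun _ => trivial) (hy.augm_eq_zero one_ne_zero)
        rw [← e5, Ideal.mul_top, ← e4] at h1
        convert neg_mem h1 using 1
        ring
      · refine Ideal.Quotient.eq.mp ?_
        change π _ = π _
        rw [map_sub, e4, ← ext_map π, ← ext_map π, ← ext_map π]
        conv_rhs => rw [e5, map_mul, hy.ext_mul_of_pos hpr hpθ]
        rw [← e5]
        simp
    · rw [if_neg (by omega), map_zero, map_zero, sub_zero, sub_zero, hy.augm_eq_zero (by omega),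
        map_zero, sub_zero]
      exact hspan (hsq (ext_mem_sq hq (P.mem_sq_of_isHom hμ hy (by omega))))
  exact key y

variable [Algebra.Smooth ℤ_[p] O] {N : ℕ → Ideal S} {𝔟 : Ideal S}
  {A : Type u} [CommRing A] [Algebra ℤ_[p] A] {c' : WittVector p k →ₐ[ℤ_[p]] A}
  {τ' : A →ₐ[ℤ_[p]] A} {δ : A →ₐ[ℤ_[p]] S} {w₀ : S →ₐ[ℤ_[p]] A}

/-- The deviation of `e j` is followed modulo `𝔞 (m + 1)` as a combination of `δ` of iterates of the
fixed operator `F♭` of `v`. The varying `V j` may be replaced by `v`, because their operators agree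
modulo `p` and the coefficients gain another `p ^ (m + 1)` under `τ`. -/
theorem Cochar.Pres.diag_contraction (P : μ.Pres ι) (hμ : μ.IsPhiDatum)
    (hp : ∀ a : S, (p : S) * a = 0 → a = 0) (hN : IsCompleteFiltration N)
    (hcl : idealClosure N 𝔟 ≤ 𝔟) (hrad : ∀ n, 𝔟 ≤ (N n).radical)
    (hw : w₀.comp δ = AlgHom.id ℤ_[p] A) (hδ : τ.comp δ = δ.comp τ') (hc : δ.comp c' = c)
    {𝔞 : ℕ → Ideal S} (h𝔟 : ∀ m, 𝔞 m ≤ 𝔟)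
    (h𝔞 : ∀ m a, a ∈ 𝔞 m ↔ w₀ a = 0 ∧ a ∈ Ideal.span {(p : S) ^ m})
    (hsq : ∀ m, 𝔞 m ^ 2 ≤ 𝔞 (m + 1))
    (hτ : ∀ m, ∀ a ∈ 𝔞 m, τ a ∈ Ideal.span {(p : S)} * Ideal.span {(p : S) ^ m})
    {v : Pt p O A} {M : ℕ}
    (hv : ∀ j y, (μ.frobFlat c' τ' v)^[M] (c'.toLinearMap ∘ₗ P.D j) y ∈ Ideal.span {(p : A)})
    {e q : ℕ → Pt p O S} {V : ℕ → Pt p O A}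
    (hV : ∀ j, ∀ d ∈ lieAlg p O A, ∀ y,
      μ.frobFlat c' τ' (V j) d y - μ.frobFlat c' τ' v d y ∈ Ideal.span {(p : A)})
    (he : ∀ j, e (j + 1) = Pt.map δ (V j) * (q j * (Pt.map δ (Pt.map w₀ (q j)))⁻¹) *
      (Pt.map δ (V j))⁻¹)
    (hq : ∀ j, μ.IsTwist c τ (e j) (q j)) {m : ℕ} (h0 : e 0 ∈ Pt.congr p O (𝔞 m)) :
    (∀ j, e j ∈ Pt.congr p O (𝔞 m)) ∧ e M ∈ Pt.congr p O (𝔞 (m + 1)) := by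
  set θ : S →ₐ[ℤ_[p]] S := δ.comp w₀ with hθdef
  have hwδ : ∀ a, w₀ (δ a) = a := fun a => DFunLike.congr_fun hw a
  have hθδ : θ.comp δ = δ := AlgHom.ext fun a => congrArg δ (hwδ a)
  have hθc : θ.comp (τ.comp c) = τ.comp c := by
    rw [← hc, ← AlgHom.comp_assoc, ← AlgHom.comp_assoc, AlgHom.comp_assoc θ τ δ, hδ,
      ← AlgHom.comp_assoc, hθδ, ← hδ, AlgHom.comp_assoc]
  have hθ : ∀ m x, (p : S) ^ m * (x - θ x) ∈ 𝔞 m := fun m x => (h𝔞 _ _).mpr ⟨by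
    change w₀ (_ * (x - δ (w₀ x))) = 0
    rw [map_mul, map_sub, hwδ, sub_self, mul_zero],
    Ideal.mul_mem_right _ _ (Ideal.mem_span_singleton_self _)⟩
  have hle : 𝔞 (m + 1) ≤ 𝔞 m := fun a ha => (h𝔞 _ _).mpr ⟨((h𝔞 _ _).mp ha).1,
    Ideal.span_singleton_le_span_singleton.mpr (pow_dvd_pow _ m.le_succ) ((h𝔞 _ _).mp ha).2⟩
  have hτ' : ∀ m, ∀ a ∈ 𝔞 m, τ a ∈ Ideal.span {(p : S) ^ (m + 1)} := fun m a ha => by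
    have := hτ m a ha
    rwa [Ideal.span_singleton_mul_span_singleton, ← pow_succ'] at this
  have key : ∀ j, ∃ a : ι → S, (∀ i, a i ∈ 𝔞 m) ∧ ∀ y, (e j).dev y -
      (∑ i, a i • (δ.toLinearMap ∘ₗ (μ.frobFlat c' τ' v)^[j] (c'.toLinearMap ∘ₗ P.D i))) y ∈
        𝔞 (m + 1) := by
    intro j
    induction j with
    | zero =>
      refine ⟨fun i => ext c (e 0) (P.x i), fun i => P.ext_x_mem h0 i, fun y => ?_⟩
      have := hsq m (P.dev_sub_sum_mem c h0 y)
      rw [← hc] at this ⊢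
      simpa [LinearMap.sum_apply] using this
    | succ j ih =>
      obtain ⟨a, ha, hy⟩ := ih
      have hej : e j ∈ Pt.congr p O (𝔞 m) := Pt.dev_mem.mp fun y => by
        refine (Submodule.sub_mem_iff_left _ ?_).mp (hle (hy y))
        rw [LinearMap.sum_apply]
        exact sum_mem fun i _ => Ideal.mul_mem_right _ _ (ha i)
      have hqj := P.twist_mem_congr hμ hp hN hcl hrad (h𝔟 m) (hτ m) hej (hq j)
      have hr : q j * (Pt.map θ (q j))⁻¹ ∈ Pt.congr p O (𝔞 m) := by
        have r1 : q j * (Pt.map θ (q j))⁻¹ ∈ Pt.congr p O (Ideal.span {(p : S) ^ m}) :=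
          mul_mem hqj (inv_mem (Pt.map_mem_congr θ (fun _ => map_span_pow m) hqj))
        refine Pt.mem_congr.mpr fun y => (h𝔞 _ _).mpr ⟨?_, Pt.mem_congr.mp r1 y⟩
        have r2 : Pt.map w₀ (q j * (Pt.map θ (q j))⁻¹) = 1 := by
          have : Pt.map w₀ (Pt.map θ (q j)) = Pt.map w₀ (q j) :=
            Pt.ext fun x => hwδ _
          rw [map_mul, map_inv, this, mul_inv_cancel]
        have r3 := congrArg (fun g : Pt p O A => g.hom y) r2
        rw [map_sub, AlgHom.commutes, sub_eq_zero]
        exact r3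
      -- Write `τ(a i) = p ^ (m + 1) b i`; the new coefficient is `(1 - θ)(τ(a i))/p`, which has
      -- trivial `w₀` and is divisible by `p ^ m`.
      choose b hb using fun i => Ideal.mem_span_singleton.mp (hτ' m _ (ha i))
      refine ⟨fun i => (p : S) ^ m * (b i - θ (b i)), fun i => hθ m _,
        fun y => mem_of_p_mul_mem hp ?_⟩
      have i1 := adj_mem _ (Pt.map δ (V j)) (d := (p : S) • (q j * (Pt.map θ (q j))⁻¹).dev -
        (τ.toLinearMap ∘ₗ μ.beta c (e j).dev -
          θ.toLinearMap ∘ₗ τ.toLinearMap ∘ₗ μ.beta c (e j).dev))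
        (P.isTwist_diag hμ (fun a ha h => (h𝔞 _ _).mpr ⟨((h𝔞 _ _).mp ha).1, h⟩) hθ (hsq m)
          (hτ' m) hθc hej (hq j) hr) y
      -- Points in the image of `δ` are fixed by `θ`, so that conjugation by them commutes with `1 -
      -- θ`.
      have i0 : Pt.map δ (V j) = Pt.map θ (Pt.map δ (V j)) := by
        rw [← Pt.map_comp, hθδ]
      rw [adj_sub, adj_smul, ← Pt.dev_conj, adj_sub] at i1
      have i0' : adj (Pt.map δ (V j)) (θ.toLinearMap ∘ₗ τ.toLinearMap ∘ₗ μ.beta c (e j).dev) =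
          θ.toLinearMap ∘ₗ μ.frobFlat c τ (Pt.map δ (V j)) (e j).dev := by
        conv_lhs => rw [i0]
        rw [frobFlat, map_adj]
      have i0'' : e (j + 1) = Pt.map δ (V j) * (q j * (Pt.map θ (q j))⁻¹) *
        (Pt.map δ (V j))⁻¹ := he j
      rw [i0', ← i0''] at i1
      set Y := μ.frobFlat c τ (Pt.map δ (V j)) (e j).dev with hY
      have i2 : Y y - ∑ i, τ (a i) * δ ((μ.frobFlat c' τ' v)^[j + 1] (c'.toLinearMap ∘ₗ P.D i) y) ∈
          Ideal.span {(p : S) ^ (m + 2)} := by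
        have i3 := frobFlat_mem (μ := μ) (c := c) (hτ' (m + 1)) (Pt.map δ (V j))
          (d := (e j).dev - ∑ i, a i • (δ.toLinearMap ∘ₗ
            (μ.frobFlat c' τ' v)^[j] (c'.toLinearMap ∘ₗ P.D i))) hy y
        have i4 : ∀ d : O →ₗ[ℤ_[p]] A, μ.frobFlat c τ (Pt.map δ (V j)) (δ.toLinearMap ∘ₗ d) =
            δ.toLinearMap ∘ₗ μ.frobFlat c' τ' (V j) d := fun d => by
          rw [map_frobFlat hδ.symm, hc]
        rw [frobFlat_sub, frobFlat_sum] at i3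
        simp only [frobFlat_smul, i4] at i3
        have i5 : ∑ i, τ (a i) * δ (μ.frobFlat c' τ' (V j) ((μ.frobFlat c' τ' v)^[j]
            (c'.toLinearMap ∘ₗ P.D i)) y - μ.frobFlat c' τ' v ((μ.frobFlat c' τ' v)^[j]
            (c'.toLinearMap ∘ₗ P.D i)) y) ∈ Ideal.span {(p : S) ^ (m + 2)} := by
          refine sum_mem fun i _ => ?_
          obtain ⟨z, hz⟩ := Ideal.mem_span_singleton.mp (hV j _ (P.iterate_frobFlat_mem_lieAlg
            (c := c') (τ := τ') hμ v j (comp_mem_lieAlg c'.toLinearMap (P.D_mem i))) y)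
          rw [hz, hb, map_mul, map_natCast]
          exact Ideal.mem_span_singleton.mpr ⟨b i * δ z, by ring⟩
        convert add_mem i3 i5 using 1
        simp only [LinearMap.sub_apply, LinearMap.sum_apply, LinearMap.smul_apply, smul_eq_mul,
          map_sub, mul_sub, Finset.sum_sub_distrib, Function.iterate_succ_apply',
          LinearMap.comp_apply, AlgHom.toLinearMap_apply]
        ring
      obtain ⟨z, hz⟩ := Ideal.mem_span_singleton.mp i2
      have i6 : Y y - θ (Y y) = (p : S) * (∑ i, (p : S) ^ m * (b i - θ (b i)) *
          δ ((μ.frobFlat c' τ' v)^[j + 1] (c'.toLinearMap ∘ₗ P.D i) y)) +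
          (p : S) * ((p : S) ^ (m + 1) * (z - θ z)) := by
        have hθδ' : ∀ x, θ (δ x) = δ x := fun x => DFunLike.congr_fun hθδ x
        rw [sub_eq_iff_eq_add.mp hz]
        simp only [hb, map_add, map_sum, map_mul, map_pow, map_natCast, hθδ', Finset.mul_sum]
        rw [add_sub_add_comm, ← Finset.sum_sub_distrib, add_comm]
        refine congrArg₂ _ (Finset.sum_congr rfl fun i _ => ?_) ?_ <;> ring
      have i7 := add_mem i1 (Ideal.mul_mem_mul (Ideal.mem_span_singleton_self (p : S))
        (hθ (m + 1) z))
      convert i7 using 1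
      have i8 : ((p : S) • (e (j + 1)).dev - (adj (Pt.map δ (V j))
          (τ.toLinearMap ∘ₗ μ.beta c (e j).dev) - θ.toLinearMap ∘ₗ Y)) y =
          (p : S) * (e (j + 1)).dev y - (Y y - θ (Y y)) := rfl
      rw [i8, i6]
      simp only [LinearMap.sum_apply, LinearMap.smul_apply, smul_eq_mul,
        LinearMap.comp_apply, AlgHom.toLinearMap_apply]
      ring
  constructor
  · intro j
    obtain ⟨a, ha, hy⟩ := key j
    refine Pt.dev_mem.mp fun y => (Submodule.sub_mem_iff_left _ ?_).mp (hle (hy y))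
    rw [LinearMap.sum_apply]
    exact sum_mem fun i _ => Ideal.mul_mem_right _ _ (ha i)
  · obtain ⟨a, ha, hy⟩ := key M
    refine Pt.dev_mem.mp fun y => (Submodule.sub_mem_iff_left _ ?_).mp (hy y)
    rw [LinearMap.sum_apply]
    refine sum_mem fun i _ => ?_
    obtain ⟨z, hz⟩ := Ideal.mem_span_singleton.mp (hv i y)
    rw [LinearMap.smul_apply, LinearMap.comp_apply, hz, AlgHom.toLinearMap_apply, map_mul,
      map_natCast, smul_eq_mul]
    obtain ⟨h1, h2⟩ := (h𝔞 _ _).mp (ha i)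
    refine (h𝔞 _ _).mpr ⟨by rw [map_mul, h1, zero_mul], ?_⟩
    obtain ⟨x, hx⟩ := Ideal.mem_span_singleton.mp h2
    exact Ideal.mem_span_singleton.mpr ⟨x * δ z, by rw [hx]; ring⟩

end Diagonal

/-! ### Normal forms of windows over `W(A)` -/

section NormalForm

theorem eventually_of_step {Q : ℕ → ℕ → Prop} {K : ℕ}
    (step : ∀ m i, Q m i → (∀ j, Q m (i + j)) ∧ Q (m + 1) (i + K)) (h0 : Q 0 0) {m j : ℕ}
    (hj : m * K ≤ j) : Q m j := by
  have h1 : ∀ m, Q m (m * K) := fun m => by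
    induction m with
    | zero => simpa using h0
    | succ m ih => rw [Nat.succ_mul]; exact (step _ _ ih).2
  obtain ⟨i, rfl⟩ := Nat.exists_eq_add_of_le hj
  exact (step _ _ (h1 m)).1 i

variable {p : ℕ} [Fact p.Prime] {k : Type w} [Field k] [Finite k] [CharP k p]
  {O : Type v} [CommRing O] [HopfAlgebra ℤ_[p] O] {μ : Cochar p k O}
  {A : Type u} [CommRing A] [Algebra (WittVector p k) A] [Algebra ℤ_[p] A] {J : Ideal A} {τ : A →+* A}
  {ι : Type} [Fintype ι]

/-- The endomorphism of `A/p` induced by the Frobenius lift. -/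
def IsFrame.tauMod (h : IsFrame p k A J τ) :
    (A ⧸ Ideal.span {(p : A)}) →ₐ[ℤ_[p]] A ⧸ Ideal.span {(p : A)} :=
  Ideal.quotientMapₐ _ h.tau (by
    rw [Ideal.span_singleton_le_iff_mem, Ideal.mem_comap, map_natCast]
    exact Ideal.mem_span_singleton_self _)

theorem IsFrame.mk_comp_tau (h : IsFrame p k A J τ) :
    (Ideal.Quotient.mkₐ ℤ_[p] (Ideal.span {(p : A)})).comp h.tau =
      h.tauMod.comp (Ideal.Quotient.mkₐ ℤ_[p] (Ideal.span {(p : A)})) := rfl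

/-- The homomorphism `W(A) → A/p`. -/
def wittMod (p : ℕ) [Fact p.Prime] (A : Type u) [CommRing A] [Algebra ℤ_[p] A] :
    WittVector p A →ₐ[ℤ_[p]] A ⧸ Ideal.span {(p : A)} :=
  (Ideal.Quotient.mkₐ ℤ_[p] (Ideal.span {(p : A)})).comp (wittZero p A)

/-- `w₀` itself does not intertwine `F` with `τ`, but modulo `p` both induce the `p`th power map.
This transports nilpotence from `W(A)` to `A`. -/
theorem IsFrame.wittMod_comp_frob (h : IsFrame p k A J τ) :
    (wittMod p A).comp (wittFrob p A) = h.tauMod.comp (wittMod p A) := by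
  refine AlgHom.ext fun a => Ideal.Quotient.eq.mpr ?_
  change WittVector.ghostComponent 0 (WittVector.frobenius a) -
    τ (WittVector.ghostComponent 0 a) ∈ _
  rw [WittVector.ghostComponent_frobenius]
  have h1 := ghost_sub_pow_mem a 1
  have h2 := Ideal.mem_span_singleton.mpr (h.frobenius (WittVector.ghostComponent 0 a))
  rw [pow_one] at h1
  convert sub_mem h1 h2 using 1
  ring

variable [IsScalarTower ℤ_[p] (WittVector p k) A]

theorem wittMod_comp_wittStr : (wittMod p A).comp (wittStr (baseMap p k A)) =
    (Ideal.Quotient.mkₐ ℤ_[p] (Ideal.span {(p : A)})).comp (baseMap p k A) := by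
  rw [wittMod, AlgHom.comp_assoc, wittZero_comp_wittStr]

theorem IsFrame.wittMod_iterate_frobFlat (h : IsFrame p k A J τ) (U : Pt p O (WittVector p A))
    (n : ℕ) (d : O →ₗ[ℤ_[p]] WittVector p A) :
    (wittMod p A).toLinearMap ∘ₗ
        (μ.frobFlat (wittStr (baseMap p k A)) (wittFrob p A) U)^[n] d =
      (Ideal.Quotient.mkₐ ℤ_[p] (Ideal.span {(p : A)})).toLinearMap ∘ₗ
        (μ.frobFlat (baseMap p k A) h.tau (Pt.map (wittZero p A) U))^[n]
          ((wittZero p A).toLinearMap ∘ₗ d) := by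
  rw [Cochar.map_iterate_frobFlat h.wittMod_comp_frob, Cochar.map_iterate_frobFlat h.mk_comp_tau,
    wittMod_comp_wittStr]
  rfl

theorem IsFrame.isFNilpotent_zero (h : IsFrame p k A J τ) (P : μ.Pres ι) (hμ : μ.IsPhiDatum)
    {U : Pt p O (WittVector p A)}
    (hU : μ.IsFNilpotent (wittStr (baseMap p k A)) (wittFrob p A) U) :
    μ.IsFNilpotent (baseMap p k A) h.tau (Pt.map (wittZero p A) U) := by
  obtain ⟨n, hn⟩ := (P.isFNilpotent_iff hμ).mp hU
  refine (P.isFNilpotent_iff hμ).mpr ⟨n, fun j y => ?_⟩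
  have h1 := DFunLike.congr_fun (h.wittMod_iterate_frobFlat (μ := μ) U n
    ((wittStr (baseMap p k A)).toLinearMap ∘ₗ P.D j)) y
  obtain ⟨z, hz⟩ := Ideal.mem_span_singleton.mp (hn j y)
  have h2 : (wittZero p A).toLinearMap ∘ₗ (wittStr (baseMap p k A)).toLinearMap ∘ₗ P.D j =
      (baseMap p k A).toLinearMap ∘ₗ P.D j :=
    LinearMap.ext fun y => DFunLike.congr_fun (wittZero_comp_wittStr (baseMap p k A)) (P.D j y)
  rw [LinearMap.comp_apply, hz, h2] at h1
  refine Ideal.Quotient.eq_zero_iff_mem.mp (h1.symm.trans ?_)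
  change Ideal.Quotient.mk _ (WittVector.ghostComponent 0 ((p : WittVector p A) * z)) = 0
  rw [map_mul, map_natCast, Ideal.Quotient.eq_zero_iff_mem]
  exact Ideal.mul_mem_right _ _ (Ideal.mem_span_singleton_self _)

theorem map_wittZero_eq_one {m : ℕ} {e : Pt p O (WittVector p A)}
    (he : e ∈ Pt.congr p O (wittAug p A m)) : Pt.map (wittZero p A) e = 1 :=
  Pt.eq_one_of_mem_congr_bot (Pt.map_mem_congr (wittZero p A)
    (fun _ ha => (Submodule.mem_bot _).mpr (ghost_zero_of_mem_wittAug ha)) he)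

theorem mem_congr_wittAug_zero {e : Pt p O (WittVector p A)}
    (he : Pt.map (wittZero p A) e = 1) : e ∈ Pt.congr p O (wittAug p A 0) := by
  refine Pt.mem_congr.mpr fun x => ?_
  rw [wittAug_zero, RingHom.mem_ker]
  have h1 := congrArg (fun g : Pt p O A => g.hom x) he
  change wittZero p A (_ - _) = 0
  rw [map_sub, AlgHom.commutes, sub_eq_zero]
  exact h1

/-- Twisted conjugation by a point with trivial zeroth ghost component does not change `F♭` of the
zeroth ghost component modulo `p`. -/
theorem IsFrame.frobFlat_sub_mem (h : IsFrame p k A J τ) (P : μ.Pres ι) (hμ : μ.IsPhiDatum)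
    {e q U : Pt p O (WittVector p A)} (he : Pt.map (wittZero p A) e = 1)
    (H : μ.IsTwist (wittStr (baseMap p k A)) (wittFrob p A) e q) {d : O →ₗ[ℤ_[p]] A}
    (hd : d ∈ lieAlg p O A) (y : O) :
    μ.frobFlat (baseMap p k A) h.tau (Pt.map (wittZero p A) (e⁻¹ * U * q)) d y -
      μ.frobFlat (baseMap p k A) h.tau (Pt.map (wittZero p A) U) d y ∈ Ideal.span {(p : A)} := by
  have hd' : (wittZero p A).toLinearMap ∘ₗ h.diag.toLinearMap ∘ₗ d = d :=
    LinearMap.ext fun y => DFunLike.congr_fun h.zero_comp_diag (d y)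
  have h1 := h.wittMod_iterate_frobFlat (μ := μ) (e⁻¹ * U * q) 1 (h.diag.toLinearMap ∘ₗ d)
  have h2 := h.wittMod_iterate_frobFlat (μ := μ) U 1 (adj e (h.diag.toLinearMap ∘ₗ d))
  have h3 := P.frobFlat_conj hμ (witt_torsionFree h.eq_zero_of_p_mul) H U 1
    (comp_mem_lieAlg h.diag.toLinearMap hd)
  have he' : Pt.map (wittMod p A) e = 1 := by
    rw [wittMod, Pt.map_comp, he, map_one]
  rw [h3, map_adj, map_inv, he', inv_one, adj_one, h2, hd', map_adj, he, adj_one, hd'] at h1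
  rw [← neg_sub]
  exact neg_mem (Ideal.Quotient.eq.mp (DFunLike.congr_fun h1 y))

theorem IsFrame.exists_isTwist (h : IsFrame p k A J τ) (P : μ.Pres ι) (hμ : μ.IsPhiDatum)
    {e : Pt p O (WittVector p A)}
    (he : e ∈ μ.hatNeg (wittStr (baseMap p k A)) (wittIdeal p J)) :
    ∃ q, μ.IsTwist (wittStr (baseMap p k A)) (wittFrob p A) e q :=
  P.exists_isTwist hμ (witt_torsionFree h.eq_zero_of_p_mul)
    (fun _ hb => p_dvd_frobenius h.eq_zero_of_p_mul h.frobPow hb) he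

theorem eq_one_of_forall_wittPD [IsAdicComplete (Ideal.span {(p : A)}) A]
    (hp : ∀ a : A, (p : A) * a = 0 → a = 0) {e : Pt p O (WittVector p A)}
    (he : ∀ m, e ∈ Pt.congr p O (wittPD p J m)) : e = 1 :=
  (Pt.eq_of_forall_mem_congr (isCompleteFiltration_wittFil hp) (g := 1) fun n => by
    rw [inv_one, one_mul]
    exact Pt.congr_mono (wittPD_le_wittFil n) (he n)).symm

variable [Algebra.Smooth ℤ_[p] O]

theorem IsFrame.congr_le_hatNeg (h : IsFrame p k A J τ) (P : μ.Pres ι) :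
    Pt.congr p O (wittIdeal p J) ≤ μ.hatNeg (wittStr (baseMap p k A)) (wittIdeal p J) :=
  have := h.complete
  P.congr_le_hatNeg (isCompleteFiltration_wittFil h.eq_zero_of_p_mul) (wittIdeal_closed h.pow_mem)
    (wittIdeal_le_radical h.frobPow) _

theorem IsFrame.twist_mem_congr (h : IsFrame p k A J τ) (P : μ.Pres ι) (hμ : μ.IsPhiDatum)
    {𝔞 𝔞' : Ideal (WittVector p A)} (h𝔞 : 𝔞 ≤ wittIdeal p J)
    (hτ : ∀ a ∈ 𝔞, WittVector.frobenius a ∈ Ideal.span {(p : WittVector p A)} * 𝔞')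
    {e q : Pt p O (WittVector p A)} (he : e ∈ Pt.congr p O 𝔞)
    (H : μ.IsTwist (wittStr (baseMap p k A)) (wittFrob p A) e q) : q ∈ Pt.congr p O 𝔞' :=
  have := h.complete
  P.twist_mem_congr hμ (witt_torsionFree h.eq_zero_of_p_mul)
    (isCompleteFiltration_wittFil h.eq_zero_of_p_mul) (wittIdeal_closed h.pow_mem)
    (wittIdeal_le_radical h.frobPow) h𝔞 hτ he H

theorem IsFrame.twist_mem_wittPD (h : IsFrame p k A J τ) (P : μ.Pres ι) (hμ : μ.IsPhiDatum)
    {m : ℕ} {e q : Pt p O (WittVector p A)} (he : e ∈ Pt.congr p O (wittPD p J m))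
    (H : μ.IsTwist (wittStr (baseMap p k A)) (wittFrob p A) e q) :
    q ∈ Pt.congr p O (wittPD p J m) :=
  h.twist_mem_congr P hμ (wittPD_le_wittIdeal m)
    (fun _ ha => frobenius_mem_wittPD h.eq_zero_of_p_mul h.frobPow ha) he H

theorem IsFrame.contraction (h : IsFrame p k A J τ) (P : μ.Pres ι) (hμ : μ.IsPhiDatum)
    {U : Pt p O (WittVector p A)}
    (hU : μ.IsFNilpotent (wittStr (baseMap p k A)) (wittFrob p A) U) :
    ∃ K, ∀ e q : ℕ → Pt p O (WittVector p A), (∀ j, e (j + 1) = U * q j * U⁻¹) →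
      (∀ j, μ.IsTwist (wittStr (baseMap p k A)) (wittFrob p A) (e j) (q j)) →
      e 0 ∈ Pt.congr p O (wittPD p J 0) → ∀ m j, m * K ≤ j →
        e j ∈ Pt.congr p O (wittPD p J m) := by
  have := h.complete
  obtain ⟨M, hM⟩ := (P.isFNilpotent_iff hμ).mp hU
  refine ⟨M + 1, fun e q he hq h0 m j hj => ?_⟩
  refine eventually_of_step (Q := fun m j => e j ∈ Pt.congr p O (wittPD p J m)) (fun m i hi => ?_)
    h0 hj
  exact P.contraction hμ (witt_torsionFree h.eq_zero_of_p_mul)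
    (isCompleteFiltration_wittFil h.eq_zero_of_p_mul) (wittIdeal_closed h.pow_mem)
    (wittIdeal_le_radical h.frobPow) (wittPD_le_wittIdeal m)
    (fun _ ha => frobenius_mem_wittPD h.eq_zero_of_p_mul h.frobPow ha)
    (fun _ ha => frobenius_mem_wittPD_succ h.eq_zero_of_p_mul h.frobPow ha)
    (wittPD_succ_le_half m) (wittPDHalf_le m) (wittPD_sq_le m) (p_mul_wittPD_le m) hM
    (e := fun j => e (i + j)) (q := fun j => q (i + j)) (fun j => he (i + j))
    (fun j => hq (i + j)) hi

/-- An automorphism of a nilpotent window over `W(A)` that is trivial modulo `W(J)` is trivial. -/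
theorem IsFrame.eq_one_of_wittPD (h : IsFrame p k A J τ) (P : μ.Pres ι) (hμ : μ.IsPhiDatum)
    {U : Pt p O (WittVector p A)}
    (hU : μ.IsFNilpotent (wittStr (baseMap p k A)) (wittFrob p A) U)
    {e q : Pt p O (WittVector p A)} (he : e ∈ Pt.congr p O (wittPD p J 0))
    (H : μ.IsTwist (wittStr (baseMap p k A)) (wittFrob p A) e q) (hUe : U = e⁻¹ * U * q) :
    e = 1 := by
  have := h.complete
  obtain ⟨K, hK⟩ := h.contraction P hμ hU
  -- An automorphism is a constant sequence for the contracting operator.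
  refine eq_one_of_forall_wittPD (J := J) h.eq_zero_of_p_mul fun m =>
    hK (fun _ => e) (fun _ => q) (fun _ => ?_) (fun _ => H) he m _ le_rfl
  rw [eq_mul_inv_iff_mul_eq]
  conv_lhs => rw [hUe]
  group

/-- Nilpotent windows over `W(A)` that agree modulo `W(J)` are isomorphic. -/
theorem IsFrame.exists_of_wittPD (h : IsFrame p k A J τ) (P : μ.Pres ι) (hμ : μ.IsPhiDatum)
    {U U' : Pt p O (WittVector p A)}
    (hU : μ.IsFNilpotent (wittStr (baseMap p k A)) (wittFrob p A) U')
    (hUU : U * U'⁻¹ ∈ Pt.congr p O (wittPD p J 0)) :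
    ∃ e ∈ Pt.congr p O (wittPD p J 0), ∃ q,
      μ.IsTwist (wittStr (baseMap p k A)) (wittFrob p A) e q ∧ U' = e⁻¹ * U * q := by
  have := h.complete
  obtain ⟨K, hK⟩ := h.contraction P hμ hU
  choose tw htw using fun x : Pt.congr p O (wittPD p J 0) =>
    h.exists_isTwist P hμ (h.congr_le_hatNeg P (Pt.congr_mono (wittPD_le_wittIdeal 0) x.2))
  -- Conjugating `x j * U'` by `x j` gives `U'` times the twist of `x j`, which is `x (j + 1) * U'`.
  -- As `x j` tends to the unit, the accumulated conjugates of `U` tend to `U'`.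
  obtain ⟨x, hx0, hx⟩ := exists_iterate (X := fun _ => Pt.congr p O (wittPD p J 0)) ⟨_, hUU⟩
    fun _ x => ⟨U' * tw x * U'⁻¹, Subgroup.Normal.conj_mem inferInstance _
      (h.twist_mem_wittPD P hμ x.2 (htw x)) _⟩
  have hx' : ∀ j, (x (j + 1)).1 = U' * tw (x j) * U'⁻¹ := fun j => by rw [hx]
  have hmem := hK (fun j => (x j).1) (fun j => tw (x j)) hx' (fun j => htw (x j)) (x 0).2
  obtain ⟨e, he, q, H, hr⟩ := P.exists_twist_lim hμ (witt_torsionFree h.eq_zero_of_p_mul)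
    (isCompleteFiltration_wittFil h.eq_zero_of_p_mul) (wittIdeal_closed h.pow_mem)
    (wittIdeal_le_radical h.frobPow)
    (fun _ hb => p_dvd_frobenius h.eq_zero_of_p_mul h.frobPow hb)
    -- Level `m` is guaranteed only from index `m * K` on; the divisor `K + 1` also covers the case
    -- `K = 0`.
    (𝔞 := fun j => wittPD p J (j / (K + 1)))
    (fun i j hij => wittPD_antitone (Nat.div_le_div_right hij))
    (fun j => wittPD_closed h.pow_mem _)
    (fun n => ⟨n * (K + 1), by
      rw [Nat.mul_div_cancel _ K.succ_pos]; exact wittPD_le_wittFil n⟩)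
    (by simpa using wittPD_le_wittIdeal 0)
    (e := fun j => (x j).1) (q := fun j => tw (x j)) (U := fun j => (x j).1 * U')
    (fun j => hmem _ j (le_trans (Nat.mul_le_mul_left _ K.le_succ) (Nat.div_mul_le_self j (K + 1))))
    (fun j => htw (x j)) (fun j => by simp only [hx']; group)
  have hU0 : (x 0).1 * U' = U := by rw [hx0]; simp
  simp only [hU0, Nat.zero_div] at hr he
  refine ⟨e, he, q, H, ?_⟩
  refine mul_inv_eq_one.mp (eq_one_of_forall_wittPD (J := J) h.eq_zero_of_p_mul fun m => ?_)
  obtain ⟨r, hr1, r', hr2, hr3⟩ := hr (m * (K + 1))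
  rw [Nat.mul_div_cancel _ K.succ_pos] at hr1
  have h1 := h.twist_mem_wittPD P hμ hr1 hr2
  have h2 := hmem m (m * (K + 1)) (Nat.mul_le_mul_left _ K.le_succ)
  rw [hr3]
  have h3 : U' * (r⁻¹ * ((x (m * (K + 1))).1 * U') * r')⁻¹ =
      (U' * r'⁻¹ * U'⁻¹) * (x (m * (K + 1))).1⁻¹ * r := by group
  rw [h3]
  exact mul_mem (mul_mem (Subgroup.Normal.conj_mem inferInstance _ (inv_mem h1) _) (inv_mem h2)) hr1

theorem IsFrame.diag_contraction (h : IsFrame p k A J τ) (P : μ.Pres ι) (hμ : μ.IsPhiDatum)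
    {v : Pt p O A} (hv : μ.IsFNilpotent (baseMap p k A) h.tau v) :
    ∃ K, ∀ (e q : ℕ → Pt p O (WittVector p A)) (V : ℕ → Pt p O A),
      (∀ j, ∀ d ∈ lieAlg p O A, ∀ y, μ.frobFlat (baseMap p k A) h.tau (V j) d y -
        μ.frobFlat (baseMap p k A) h.tau v d y ∈ Ideal.span {(p : A)}) →
      (∀ j, e (j + 1) = Pt.map h.diag (V j) *
        (q j * (Pt.map h.diag (Pt.map (wittZero p A) (q j)))⁻¹) * (Pt.map h.diag (V j))⁻¹) →
      (∀ j, μ.IsTwist (wittStr (baseMap p k A)) (wittFrob p A) (e j) (q j)) →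
      e 0 ∈ Pt.congr p O (wittAug p A 0) → ∀ m j, m * K ≤ j →
        e j ∈ Pt.congr p O (wittAug p A m) := by
  have := h.complete
  obtain ⟨M, hM⟩ := (P.isFNilpotent_iff hμ).mp hv
  refine ⟨M, fun e q V hV he hq h0 m j hj => ?_⟩
  refine eventually_of_step (Q := fun m j => e j ∈ Pt.congr p O (wittAug p A m))
    (fun m i hi => ?_) h0 hj
  exact P.diag_contraction hμ (witt_torsionFree h.eq_zero_of_p_mul)
    (isCompleteFiltration_wittFil h.eq_zero_of_p_mul) (wittIdeal_closed h.pow_mem)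
    (wittIdeal_le_radical h.frobPow) h.zero_comp_diag h.frob_comp_diag h.diag_comp_baseMap
    (fun m => wittAug_le_wittIdeal m) (fun m a => mem_wittAug h.eq_zero_of_p_mul)
    wittAug_sq_le (fun m a ha => frobenius_mem_of_mem_wittAug ha) hM
    (e := fun j => e (i + j)) (q := fun j => q (i + j)) (V := fun j => V (i + j))
    (fun j => hV (i + j)) (fun j => he (i + j)) (fun j => hq (i + j)) hi

/-- Applying `w₀` to the equation gives `v' = v w₀(q)`. Substituting this back turns `e` into a
fixed point of the iteration in `diag_contraction`. -/
theorem IsFrame.eq_one_of_wittAug (h : IsFrame p k A J τ) (P : μ.Pres ι) (hμ : μ.IsPhiDatum)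
    {v v' : Pt p O A} (hv : μ.IsFNilpotent (baseMap p k A) h.tau v)
    {e q : Pt p O (WittVector p A)} (he : e ∈ Pt.congr p O (wittAug p A 0))
    (H : μ.IsTwist (wittStr (baseMap p k A)) (wittFrob p A) e q)
    (hve : Pt.map h.diag v' = e⁻¹ * Pt.map h.diag v * q) : e = 1 := by
  have := h.complete
  obtain ⟨K, hK⟩ := h.diag_contraction P hμ hv
  have hw : ∀ g : Pt p O A, Pt.map (wittZero p A) (Pt.map h.diag g) = g := fun g => by
    rw [← Pt.map_comp, h.zero_comp_diag]
    rfl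
  have h1 : v' = v * Pt.map (wittZero p A) q := by
    have := congrArg (Pt.map (wittZero p A)) hve
    rwa [map_mul, map_mul, map_inv, map_wittZero_eq_one he, hw, hw, inv_one, one_mul] at this
  have h2 : e = Pt.map h.diag v * (q * (Pt.map h.diag (Pt.map (wittZero p A) q))⁻¹) *
      (Pt.map h.diag v)⁻¹ := by
    rw [h1, map_mul] at hve
    rw [eq_mul_inv_iff_mul_eq, ← mul_assoc, eq_mul_inv_iff_mul_eq, mul_assoc, hve]
    group
  refine (Pt.eq_of_forall_mem_congr (isCompleteFiltration_wittFil h.eq_zero_of_p_mul)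
    (g := 1) fun n => ?_).symm
  rw [inv_one, one_mul]
  exact Pt.congr_mono (Ideal.mul_le_left.trans (pow_le_wittFil n))
    (hK (fun _ => e) (fun _ => q) (fun _ => v) (fun _ d _ y => by simp) (fun _ => h2) (fun _ => H)
      he (2 * n) _ le_rfl)

/-- Every nilpotent window over `W(A)` is isomorphic to one in the image of the diagonal. -/
theorem IsFrame.exists_diag (h : IsFrame p k A J τ) (P : μ.Pres ι) (hμ : μ.IsPhiDatum)
    {U : Pt p O (WittVector p A)}
    (hU : μ.IsFNilpotent (wittStr (baseMap p k A)) (wittFrob p A) U) :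
    ∃ e ∈ Pt.congr p O (wittAug p A 0), ∃ q,
      μ.IsTwist (wittStr (baseMap p k A)) (wittFrob p A) e q ∧
      Pt.map h.diag (Pt.map (wittZero p A) (e⁻¹ * U * q)) = e⁻¹ * U * q := by
  have := h.complete
  have hpW := witt_torsionFree (p := p) h.eq_zero_of_p_mul
  have hw : ∀ g : Pt p O A, Pt.map (wittZero p A) (Pt.map h.diag g) = g := fun g => by
    rw [← Pt.map_comp, h.zero_comp_diag]
    rfl
  -- The deviation `E U` from the diagonal serves as conjugating element. Each step changes `w₀(U)`,
  -- but its `F♭` stays the same modulo `p`, so one constant `K` serves for the whole sequence.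
  obtain ⟨K, hK⟩ := h.diag_contraction P hμ (h.isFNilpotent_zero P hμ hU)
  let E : Pt p O (WittVector p A) → Pt p O (WittVector p A) := fun U =>
    U * (Pt.map h.diag (Pt.map (wittZero p A) U))⁻¹
  have hE0 : ∀ U, Pt.map (wittZero p A) (E U) = 1 := fun U => by
    rw [map_mul, map_inv, hw, mul_inv_cancel]
  have hE : ∀ U, E U ∈ Pt.congr p O (wittAug p A 0) := fun U => mem_congr_wittAug_zero (hE0 U)
  choose tw htw using fun U => h.exists_isTwist P hμ
    (h.congr_le_hatNeg P (Pt.congr_mono (wittAug_le_wittIdeal 0) (hE U)))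
  obtain ⟨x, hx0, hx⟩ := exists_iterate (X := fun _ => Pt p O (WittVector p A)) U
    fun _ U => (E U)⁻¹ * U * tw U
  have hV : ∀ j, ∀ d ∈ lieAlg p O A, ∀ y,
      μ.frobFlat (baseMap p k A) h.tau (Pt.map (wittZero p A) (x j)) d y -
        μ.frobFlat (baseMap p k A) h.tau (Pt.map (wittZero p A) U) d y ∈
          Ideal.span {(p : A)} := fun j d hd y => by
    induction j with
    | zero => rw [hx0, sub_self]; exact zero_mem _
    | succ j ih =>
      have h1 := h.frobFlat_sub_mem P hμ (U := x j) (hE0 (x j)) (htw (x j)) hd y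
      rw [← hx] at h1
      simpa using add_mem h1 ih
  have hmem := hK (fun j => E (x j)) (fun j => tw (x j)) (fun j => Pt.map (wittZero p A) (x j)) hV
    (fun j => by
      have h1 : x (j + 1) = Pt.map h.diag (Pt.map (wittZero p A) (x j)) * tw (x j) := by
        rw [hx]
        simp only [E]
        group
      simp only [E]
      rw [h1, map_mul, map_mul, hw]
      group) (fun j => htw (x j)) (hE _)
  obtain ⟨e, he, q, H, hr⟩ := P.exists_twist_lim hμ hpW
    (isCompleteFiltration_wittFil h.eq_zero_of_p_mul) (wittIdeal_closed h.pow_mem)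
    (wittIdeal_le_radical h.frobPow)
    (fun _ hb => p_dvd_frobenius h.eq_zero_of_p_mul h.frobPow hb)
    (𝔞 := fun j => wittAug p A (j / (K + 1)))
    (fun i j hij => wittAug_antitone (Nat.div_le_div_right hij))
    (fun j => wittAug_closed h.eq_zero_of_p_mul _)
    (fun n => ⟨2 * n * (K + 1), by
      rw [Nat.mul_div_cancel _ K.succ_pos]; exact Ideal.mul_le_left.trans (pow_le_wittFil n)⟩)
    (by simpa using wittAug_le_wittIdeal 0)
    (e := fun j => E (x j)) (q := fun j => tw (x j)) (U := x)
    (fun j => hmem _ j (le_trans (Nat.mul_le_mul_left _ K.le_succ) (Nat.div_mul_le_self j (K + 1))))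
    (fun j => htw (x j)) (fun j => hx j)
  simp only [hx0, Nat.zero_div] at hr he
  refine ⟨e, he, q, H, ?_⟩
  set Y := e⁻¹ * U * q with hY
  refine (Pt.eq_of_forall_mem_congr (isCompleteFiltration_wittFil h.eq_zero_of_p_mul)
    fun n => Pt.congr_mono (pow_le_wittFil n) ?_).symm
  obtain ⟨r, hr1, r', hr2, hr3⟩ := hr (2 * n * (K + 1))
  have h2 := hmem (2 * n) (2 * n * (K + 1)) (Nat.mul_le_mul_left _ K.le_succ)
  set V := x (2 * n * (K + 1)) with hVdef
  rw [Nat.mul_div_cancel _ K.succ_pos] at hr1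
  have h1 := h.twist_mem_congr P hμ (wittAug_le_wittIdeal (2 * n))
    (fun a ha => frobenius_mem_of_mem_wittAug ha) hr1 hr2
  have hsub : Pt.congr p O (wittAug p A (2 * n)) ≤
      Pt.congr p O (Ideal.span {(p : WittVector p A) ^ (2 * n)}) :=
    Pt.congr_mono Ideal.mul_le_left
  set D := Pt.map h.diag (Pt.map (wittZero p A) V) with hD
  -- The limit `Y` is congruent modulo `p ^ (2 * n)` to the diagonal point `D`; applying `θ` to this
  -- congruence shows the same for `Y` and `θ(Y)`.
  have h3 : Y⁻¹ * D ∈ Pt.congr p O (Ideal.span {(p : WittVector p A) ^ (2 * n)}) := by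
    have e1 : Y⁻¹ * D = r'⁻¹ * (V⁻¹ * r * V⁻¹⁻¹) * (D⁻¹ * (E V)⁻¹ * D⁻¹⁻¹) := by
      rw [hr3]
      simp only [E, ← hD]
      group
    rw [e1]
    exact mul_mem (mul_mem (inv_mem h1) (Subgroup.Normal.conj_mem inferInstance _ (hsub hr1) _))
      (Subgroup.Normal.conj_mem inferInstance _ (inv_mem (hsub h2)) _)
  have h4 := Pt.map_mem_congr (h.diag.comp (wittZero p A)) (fun _ => map_span_pow (2 * n)) h3
  rw [map_mul, map_inv, Pt.map_comp, Pt.map_comp, hD, hw, ← hD] at h4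
  have e2 : Y⁻¹ * Pt.map h.diag (Pt.map (wittZero p A) Y) = (Y⁻¹ * D) *
      ((Pt.map h.diag (Pt.map (wittZero p A) Y))⁻¹ * D)⁻¹ := by group
  rw [e2]
  exact mul_mem h3 (inv_mem h4)

end NormalForm

/-! ### The group `Ĝ⁻`, linear coordinates and base change -/

section HatNeg

variable {p : ℕ} [Fact p.Prime] {k : Type w} [Field k] [CharP k p]
  {O : Type v} [CommRing O] [HopfAlgebra ℤ_[p] O] {μ : Cochar p k O}
  {S : Type u} [CommRing S] [Algebra ℤ_[p] S] {S' : Type u} [CommRing S'] [Algebra ℤ_[p] S']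
  {ι : Type} {c : WittVector p k →ₐ[ℤ_[p]] S} {τ : S →ₐ[ℤ_[p]] S}

theorem Cochar.map_mem_hatNeg (φ : S →ₐ[ℤ_[p]] S') {𝔟 : Ideal S} {𝔟' : Ideal S'}
    (hφ : ∀ a ∈ 𝔟, φ a ∈ 𝔟') {h : Pt p O S} (hh : h ∈ μ.hatNeg c 𝔟) :
    Pt.map φ h ∈ μ.hatNeg (φ.comp c) 𝔟' := by
  have hle : μ.hatNeg c 𝔟 ≤ (μ.hatNeg (φ.comp c) 𝔟').comap (Pt.map φ) :=
    sup_le (fun g hg => Subgroup.mem_sup_left (map_mem_neg φ hg))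
      fun g hg => Subgroup.mem_sup_right ⟨map_mem_pos φ hg.1, Pt.map_mem_congr φ hφ hg.2⟩
  exact hle hh

theorem Pt.mem_congr_ker {φ : S →ₐ[ℤ_[p]] S'} {h : Pt p O S} :
    h ∈ Pt.congr p O (RingHom.ker φ) ↔ Pt.map φ h = 1 := by
  rw [Pt.mem_congr]
  constructor
  · intro H
    refine Pt.ext fun x => ?_
    have := RingHom.mem_ker.mp (H x)
    rw [map_sub, AlgHom.commutes, sub_eq_zero] at this
    exact this
  · intro H x
    rw [RingHom.mem_ker, map_sub, AlgHom.commutes, sub_eq_zero]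
    exact congrArg (fun g : Pt p O S' => g.hom x) H

/-- A point of `G⁻` over the quotient lifts to `G⁻`; the quotient of two lifts is near the unit, and
factors into points of `G⁻` and of the kernel on `G⁺`. -/
theorem Cochar.Pres.mem_hatNeg_iff [Fintype ι] [Algebra.Smooth ℤ_[p] O] (P : μ.Pres ι)
    {N : ℕ → Ideal S} (hN : IsCompleteFiltration N) (φ : S →ₐ[ℤ_[p]] S')
    (hφ : Function.Surjective φ)
    (hcl : idealClosure N (RingHom.ker φ) ≤ RingHom.ker φ)
    (hrad : ∀ n, RingHom.ker φ ≤ (N n).radical) {h : Pt p O S} :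
    h ∈ μ.hatNeg c (RingHom.ker φ) ↔ Pt.map φ h ∈ μ.neg (φ.comp c) := by
  constructor
  · intro hh
    have hle : μ.hatNeg c (RingHom.ker φ) ≤ (μ.neg (φ.comp c)).comap (Pt.map φ) :=
      sup_le (fun g hg => map_mem_neg φ hg) fun g hg => by
        have h1 : Pt.map φ g = 1 := Pt.mem_congr_ker.mp hg.2
        rw [Subgroup.mem_comap, h1]
        exact one_mem _
    exact hle hh
  · intro hh
    obtain ⟨m, hm, hm', -⟩ := P.exists_lift hN φ hφ hcl hrad c (Pt.map φ h)
    have h1 : m⁻¹ * h ∈ Pt.congr p O (RingHom.ker φ) := Pt.mem_congr_ker.mpr (by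
      rw [map_mul, map_inv, hm, inv_mul_cancel])
    have h2 := mul_mem (Subgroup.mem_sup_left (hm' hh) : m ∈ μ.hatNeg c (RingHom.ker φ))
      (P.congr_le_hatNeg hN hcl hrad c h1)
    rwa [mul_inv_cancel_left] at h2

/-- The linear coordinates of a point of `G⁺`. -/
theorem Cochar.coeff_one_ext {g : Pt p O S} {γ : Pt p O S[X]}
    (hγ : Pt.map (polyLaurent p S) γ = μ.gen c * Pt.map (constLaurent p S) g * (μ.gen c)⁻¹)
    (h0 : Pt.map (evalPoly p (0 : S)) γ = 1) (y : WittVector p k ⊗[ℤ_[p]] O) :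
    (ext ((constPoly p S).comp c) γ y).coeff 1 = ext c g (μ.proj 1 y) := by
  have hg : g ∈ μ.pos c := mem_pos_iff_exists.mpr ⟨γ, h0, hγ⟩
  refine μ.hom_induction (P := fun y => (ext ((constPoly p S).comp c) γ y).coeff 1 =
    ext c g (μ.proj 1 y)) (fun n y hy => ?_) (fun x y hx hy => ?_) y
  · rw [proj_of_isHom hy]
    rcases lt_or_ge n 0 with hn | hn
    · rw [if_neg (by omega), map_zero]
      have h1 : ext ((constPoly p S).comp c) γ y = 0 := by
        refine polyLaurent_injective (p := p) ?_
        rw [← ext_map, polyLaurent_comp_constPoly, hγ, hy.ext_gen_conj',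
          mem_pos.mp hg n y hn.le hy, hy.augm_eq_zero hn.ne, map_zero, map_zero, map_zero, zero_mul]
      rw [h1, Polynomial.coeff_zero]
    · rw [hy.ext_posExt hn hγ, Polynomial.coeff_C_mul_X_pow]
      by_cases h : n = 1
      · subst h
        simp
      · rw [if_neg (by omega), if_neg (by omega), map_zero]
  · rw [map_add, Polynomial.coeff_add, hx, hy, proj_add, map_add]

theorem Cochar.IsTwist.mem_pos {h h' : Pt p O S} (hh : h ∈ μ.pos c) (H : μ.IsTwist c τ h h') :
    h' ∈ μ.pos (τ.comp c) := by
  refine Cochar.mem_pos.mpr fun n y hn hy => ?_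
  have e := H n y 0 (-n).toNat hy (by omega)
  rw [pow_zero, one_mul, Cochar.mem_pos.mp hh n y hn hy] at e
  rw [e]
  rcases hn.lt_or_eq with hn | rfl
  · rw [hy.augm_eq_zero hn.ne]
    simp
  · simp

theorem Cochar.IsHom.ext_negExt_eval_of_pos {n : ℤ} {y : WittVector p k ⊗[ℤ_[p]] O}
    (hy : μ.IsHom n y) (hn : 0 < n) {g : Pt p O S} {γ : Pt p O S[X]}
    (hγ : Pt.map (polyLaurent p S) γ = (μ.gen c)⁻¹ * Pt.map (constLaurent p S) g * μ.gen c)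
    (s : S) : ext c (Pt.map (evalPoly p s) γ) y = 0 := by
  have h2 : ext ((constPoly p S).comp c) γ y = 0 := by
    refine polyLaurent_injective (p := p) ?_
    rw [← ext_map, polyLaurent_comp_constPoly, hγ, hy.ext_gen_conj,
      mem_neg.mp (mem_neg_of_eq hγ) n y hn hy, map_zero, map_zero, zero_mul]
  rw [ext_evalPoly, h2, Polynomial.eval_zero]

/-- The value at `s` of the extension of `μ(T)⁻¹ g μ(T)` is compatible with base change. -/
theorem Cochar.map_evalPoly_negExt (φ : S →ₐ[ℤ_[p]] S') {g : Pt p O S} {γ : Pt p O S[X]}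
    {γ' : Pt p O S'[X]}
    (hγ : Pt.map (polyLaurent p S) γ = (μ.gen c)⁻¹ * Pt.map (constLaurent p S) g * μ.gen c)
    (hγ' : Pt.map (polyLaurent p S') γ' = (μ.gen (φ.comp c))⁻¹ *
      Pt.map (constLaurent p S') (Pt.map φ g) * μ.gen (φ.comp c)) :
    Pt.map φ (Pt.map (evalPoly p (p : S)) γ) = Pt.map (evalPoly p (p : S')) γ' := by
  refine eq_of_forall_isHom μ (c := φ.comp c) fun n y hy => ?_
  rw [ext_map]
  rcases le_or_gt n 0 with hn | hn
  · rw [hy.ext_negExt_eval hn hγ, hy.ext_negExt_eval hn hγ', ext_map, map_mul, map_pow,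
      map_natCast]
  · rw [hy.ext_negExt_eval_of_pos hn hγ, hy.ext_negExt_eval_of_pos hn hγ', map_zero]

end HatNeg

/-! ### The twisted Frobenius over `A/J` -/

section TwistedFrobenius

variable {p : ℕ} [Fact p.Prime] {k : Type w} [Field k] [Finite k] [CharP k p]
  {O : Type v} [CommRing O] [HopfAlgebra ℤ_[p] O] {μ : Cochar p k O}
  {A : Type u} [CommRing A] [Algebra (WittVector p k) A] [Algebra ℤ_[p] A]
  [IsScalarTower ℤ_[p] (WittVector p k) A] {J : Ideal A} {τ : A →+* A}
  {ι : Type} [Fintype ι]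

/-- The homomorphism `W(A) → W(A/J)`. -/
abbrev wittRed (p : ℕ) [Fact p.Prime] {A : Type u} [CommRing A] [Algebra ℤ_[p] A] (J : Ideal A) :
    WittVector p A →ₐ[ℤ_[p]] WittVector p (A ⧸ J) :=
  wittMap p (Ideal.Quotient.mkₐ ℤ_[p] J)

theorem wittRed_surjective : Function.Surjective (wittRed p J) :=
  WittVector.map_surjective _ Ideal.Quotient.mk_surjective

theorem wittRed_comp_wittStr : (wittRed p J).comp (wittStr (baseMap p k A)) =
    wittStr (baseMap p k (A ⧸ J)) := wittMap_comp_wittStr _ _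

theorem wittRed_comp_frob :
    (wittRed p J).comp (wittFrob p A) = (wittFrob p (A ⧸ J)).comp (wittRed p J) :=
  AlgHom.ext fun a => (frobenius_map (Ideal.Quotient.mk J) a).symm

theorem wittZero_comp_wittRed : (wittZero p (A ⧸ J)).comp (wittRed p J) =
    (Ideal.Quotient.mkₐ ℤ_[p] J).comp (wittZero p A) :=
  AlgHom.ext fun a => ghostComponent_map (Ideal.Quotient.mk J) a 0

theorem IsFrame.ker_wittRed (h : IsFrame p k A J τ) :
    RingHom.ker (wittRed p J) = wittPD p J 0 := wittPD_zero h.eq_zero_of_p_mul h.frobPow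

theorem ker_mk_comp_wittZero :
    RingHom.ker ((Ideal.Quotient.mkₐ ℤ_[p] J).comp (wittZero p A)) = wittIdeal p J :=
  Ideal.ext fun a => by
    rw [mem_wittIdeal]
    exact Ideal.Quotient.eq_zero_iff_mem

theorem mk_comp_wittZero_comp_wittStr :
    ((Ideal.Quotient.mkₐ ℤ_[p] J).comp (wittZero p A)).comp (wittStr (baseMap p k A)) =
      baseMap p k (A ⧸ J) := by
  rw [AlgHom.comp_assoc, wittZero_comp_wittStr]
  rfl

variable [Algebra.Smooth ℤ_[p] O]

theorem IsFrame.exists_lift (h : IsFrame p k A J τ) (P : μ.Pres ι)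
    (g : Pt p O (WittVector p (A ⧸ J))) : ∃ g' : Pt p O (WittVector p A),
      Pt.map (wittRed p J) g' = g ∧
      (g ∈ μ.neg (wittStr (baseMap p k (A ⧸ J))) → g' ∈ μ.neg (wittStr (baseMap p k A))) ∧
      (g ∈ μ.pos (wittStr (baseMap p k (A ⧸ J))) → g' ∈ μ.pos (wittStr (baseMap p k A))) := by
  have := h.complete
  have := P.exists_lift (isCompleteFiltration_wittFil h.eq_zero_of_p_mul) (wittRed p J)
    wittRed_surjective (by rw [h.ker_wittRed]; exact wittPD_closed h.pow_mem 0)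
    (fun n => by
      rw [h.ker_wittRed]
      exact (wittPD_le_wittIdeal 0).trans (wittIdeal_le_radical h.frobPow n))
    (wittStr (baseMap p k A)) g
  rwa [wittRed_comp_wittStr] at this

/-- Both groups are the preimage of `G⁻(A/J)`, along the two factorizations of `W(A) → A/J`. -/
theorem IsFrame.map_mem_displayGroup (h : IsFrame p k A J τ) (P : μ.Pres ι)
    {g : Pt p O (WittVector p A)} :
    Pt.map (wittRed p J) g ∈ μ.displayGroup (baseMap p k (A ⧸ J)) ↔
      g ∈ μ.hatNeg (wittStr (baseMap p k A)) (wittIdeal p J) := by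
  have := h.complete
  have h1 := P.mem_hatNeg_iff (c := wittStr (baseMap p k A)) (h := g)
    (isCompleteFiltration_wittFil h.eq_zero_of_p_mul)
    ((Ideal.Quotient.mkₐ ℤ_[p] J).comp (wittZero p A))
    (Ideal.Quotient.mk_surjective.comp (fun a => ⟨WittVector.teichmuller p a, by
      change WittVector.ghostComponent 0 _ = _
      simp [ghostComponent_eq_sum]⟩))
    (by rw [ker_mk_comp_wittZero]; exact wittIdeal_closed h.pow_mem)
    (fun n => by rw [ker_mk_comp_wittZero]; exact wittIdeal_le_radical h.frobPow n)
  rw [ker_mk_comp_wittZero, mk_comp_wittZero_comp_wittStr] at h1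
  rw [h1, Cochar.displayGroup, Subgroup.mem_comap, ← Pt.map_comp, wittZero_comp_wittRed]

/-- The twist preserves congruence modulo `W(J)`, hence descends. -/
theorem IsFrame.map_eq_of_isTwist (h : IsFrame p k A J τ) (P : μ.Pres ι) (hμ : μ.IsPhiDatum)
    {g₁ g₂ q₁ q₂ : Pt p O (WittVector p A)}
    (hg : Pt.map (wittRed p J) g₁ = Pt.map (wittRed p J) g₂)
    (H₁ : μ.IsTwist (wittStr (baseMap p k A)) (wittFrob p A) g₁ q₁)
    (H₂ : μ.IsTwist (wittStr (baseMap p k A)) (wittFrob p A) g₂ q₂) :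
    Pt.map (wittRed p J) q₁ = Pt.map (wittRed p J) q₂ := by
  have hpW := witt_torsionFree (p := p) h.eq_zero_of_p_mul
  have h1 : g₁⁻¹ * g₂ ∈ Pt.congr p O (wittPD p J 0) := by
    rw [← h.ker_wittRed, Pt.mem_congr_ker, map_mul, map_inv, hg, inv_mul_cancel]
  have h2 := h.twist_mem_wittPD P hμ h1 ((H₁.inv hpW).mul hpW H₂)
  rwa [← h.ker_wittRed, Pt.mem_congr_ker, map_mul, map_inv, inv_mul_eq_one] at h2

/-- The twisted Frobenius over `A/J`, by descent from `W(A)`. -/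
theorem IsFrame.exists_descent (h : IsFrame p k A J τ) (P : μ.Pres ι) (hμ : μ.IsPhiDatum) :
    ∃ Φ : μ.displayGroup (baseMap p k (A ⧸ J)) →* Pt p O (WittVector p (A ⧸ J)),
      ∀ (g : μ.displayGroup (baseMap p k (A ⧸ J))) (g' q : Pt p O (WittVector p A)),
        Pt.map (wittRed p J) g' = g →
        μ.IsTwist (wittStr (baseMap p k A)) (wittFrob p A) g' q →
        Φ g = Pt.map (wittRed p J) q := by
  have hpW := witt_torsionFree (p := p) h.eq_zero_of_p_mul
  have h1 : ∀ g : μ.displayGroup (baseMap p k (A ⧸ J)), ∃ x : Pt p O (WittVector p A) ×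
      Pt p O (WittVector p A), Pt.map (wittRed p J) x.1 = g ∧
        μ.IsTwist (wittStr (baseMap p k A)) (wittFrob p A) x.1 x.2 := fun g => by
    obtain ⟨g', hg, -⟩ := h.exists_lift P g.1
    obtain ⟨q, hq⟩ := h.exists_isTwist P hμ ((h.map_mem_displayGroup P).mp
      (by rw [hg]; exact g.2))
    exact ⟨(g', q), hg, hq⟩
  choose x hx hx' using h1
  refine ⟨MonoidHom.mk' (fun g => Pt.map (wittRed p J) (x g).2) fun g₁ g₂ => ?_,
    fun g g' q hg H => h.map_eq_of_isTwist P hμ ((hx g).trans hg.symm) (hx' g) H⟩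
  rw [← map_mul]
  exact h.map_eq_of_isTwist P hμ (by rw [hx, map_mul, hx, hx]; rfl) (hx' _)
    ((hx' g₁).mul hpW (hx' g₂))

theorem IsFrame.isTwistedFrobenius (h : IsFrame p k A J τ) (P : μ.Pres ι) (hμ : μ.IsPhiDatum)
    {Φ : μ.displayGroup (baseMap p k (A ⧸ J)) →* Pt p O (WittVector p (A ⧸ J))}
    (hΦ : ∀ (g : μ.displayGroup (baseMap p k (A ⧸ J))) (g' q : Pt p O (WittVector p A)),
        Pt.map (wittRed p J) g' = g →
        μ.IsTwist (wittStr (baseMap p k A)) (wittFrob p A) g' q →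
        Φ g = Pt.map (wittRed p J) q) :
    μ.IsTwistedFrobenius (baseMap p k (A ⧸ J)) Φ := by
  have hpW := witt_torsionFree (p := p) h.eq_zero_of_p_mul
  constructor
  · intro g γ hγ
    obtain ⟨g', hg, hg', -⟩ := h.exists_lift P g.1
    obtain ⟨γ', hγ'⟩ := Cochar.exists_of_mem_neg (hg' (Cochar.mem_neg_of_eq hγ))
    rw [hΦ g g' _ hg (Cochar.isTwist_of_neg hγ'), ← Pt.map_comp, wittRed_comp_frob, Pt.map_comp]
    congr 1
    refine Cochar.map_evalPoly_negExt (wittRed p J) hγ' ?_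
    rw [wittRed_comp_wittStr, hg]
    exact hγ
  · intro g γ hg1 hγ h0
    obtain ⟨g', hg, -, hg'⟩ := h.exists_lift P g.1
    have hpos := hg' (Cochar.mem_pos_iff_exists.mpr ⟨γ, h0, hγ⟩)
    have hcongr : g' ∈ Pt.congr p O (wittIdeal p J) := by
      rw [← ker_mk_comp_wittZero, Pt.mem_congr_ker, ← wittZero_comp_wittRed, Pt.map_comp, hg, hg1]
    obtain ⟨q, hq⟩ := h.exists_isTwist P hμ (h.congr_le_hatNeg P hcongr)
    have hq' := Cochar.map_mem_pos (wittRed p J) (hq.mem_pos hpos)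
    rw [← AlgHom.comp_assoc, wittRed_comp_frob, AlgHom.comp_assoc, wittRed_comp_wittStr] at hq'
    obtain ⟨γ', h0', hγ'⟩ := Cochar.mem_pos_iff_exists.mp hq'
    rw [← hΦ g g' q hg hq] at hγ'
    refine ⟨γ', hγ', h0', fun x => ?_⟩
    have e1 := Cochar.coeff_one_ext hγ h0 (1 ⊗ₜ x)
    have e2 := Cochar.coeff_one_ext hγ' h0' (1 ⊗ₜ x)
    rw [ext_one_tmul] at e1 e2
    rw [e1, e2, hΦ g g' q hg hq, ← hg]
    set y := μ.proj 1 ((1 : WittVector p k) ⊗ₜ[ℤ_[p]] x)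
    have hy : μ.IsHom 1 y := μ.isHom_proj 1 _
    -- The twist divides `F` of a linear coordinate by `p`, and this quotient reduces to `V⁻¹` of
    -- the coordinate over `A/J`.
    obtain ⟨b, hb1, hb2⟩ := exists_of_mem_wittIdeal h.eq_zero_of_p_mul h.frobPow
      (ext_mem_of_augm_eq_zero hcongr (wittStr (baseMap p k A)) (hy.augm_eq_zero one_ne_zero))
    have e3 := hq 1 y 1 0 hy (by simp)
    rw [pow_one, pow_zero, one_mul] at e3
    have e4 : ext ((wittFrob p A).comp (wittStr (baseMap p k A))) q y = b := by
      refine pow_mul_cancel hpW 1 ?_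
      rw [pow_one, e3]
      exact hb1
    rw [← wittRed_comp_wittStr, ext_map, ← AlgHom.comp_assoc, ← wittRed_comp_frob,
      AlgHom.comp_assoc, ext_map, e4]
    exact hb2

/-- The two conditions determine a homomorphism on generators of `Ĝ⁻`, which surjects onto the
display group. On the part in `G⁺`, injectivity of `V` fixes the linear coordinates of the value,
and these determine a point of `G⁺`. -/
theorem IsFrame.isTwistedFrobenius_unique (h : IsFrame p k A J τ) (P : μ.Pres ι)
    (hμ : μ.IsPhiDatum)
    {Φ₁ Φ₂ : μ.displayGroup (baseMap p k (A ⧸ J)) →* Pt p O (WittVector p (A ⧸ J))}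
    (h₁ : μ.IsTwistedFrobenius (baseMap p k (A ⧸ J)) Φ₁)
    (h₂ : μ.IsTwistedFrobenius (baseMap p k (A ⧸ J)) Φ₂) : Φ₁ = Φ₂ := by
  have key : μ.hatNeg (wittStr (baseMap p k A)) (wittIdeal p J) ≤
      ((MonoidHom.eqLocus Φ₁ Φ₂).map (Subgroup.subtype _)).comap (Pt.map (wittRed p J)) := by
    refine sup_le (fun g hg => ?_) fun g hg => ?_
    · have hd := (h.map_mem_displayGroup P).mpr
        (Subgroup.mem_sup_left hg : g ∈ μ.hatNeg (wittStr (baseMap p k A)) (wittIdeal p J))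
      refine ⟨⟨_, hd⟩, ?_, rfl⟩
      have hn := Cochar.map_mem_neg (wittRed p J) hg
      rw [wittRed_comp_wittStr] at hn
      obtain ⟨γ, hγ⟩ := Cochar.exists_of_mem_neg hn
      exact (h₁.on_neg ⟨_, hd⟩ γ hγ).trans (h₂.on_neg ⟨_, hd⟩ γ hγ).symm
    · have hd := (h.map_mem_displayGroup P).mpr
        (Subgroup.mem_sup_right hg : g ∈ μ.hatNeg (wittStr (baseMap p k A)) (wittIdeal p J))
      refine ⟨⟨_, hd⟩, ?_, rfl⟩
      have hn := Cochar.map_mem_pos (wittRed p J) hg.1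
      rw [wittRed_comp_wittStr] at hn
      obtain ⟨γ, h0, hγ⟩ := Cochar.mem_pos_iff_exists.mp hn
      have hz : Pt.map (wittZero p (A ⧸ J)) (Pt.map (wittRed p J) g) = 1 := by
        have h3 : g ∈ Pt.congr p O (wittIdeal p J) := hg.2
        rwa [← ker_mk_comp_wittZero, Pt.mem_congr_ker, ← wittZero_comp_wittRed, Pt.map_comp] at h3
      obtain ⟨γ₁, hγ₁, k₁, c₁⟩ := h₁.on_pos ⟨_, hd⟩ γ hz hγ h0
      obtain ⟨γ₂, hγ₂, k₂, c₂⟩ := h₂.on_pos ⟨_, hd⟩ γ hz hγ h0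
      have hc : ∀ y : WittVector p k ⊗[ℤ_[p]] O,
          (ext ((constPoly p _).comp ((wittFrob p (A ⧸ J)).comp
            (wittStr (baseMap p k (A ⧸ J))))) γ₁ y).coeff 1 =
          (ext ((constPoly p _).comp ((wittFrob p (A ⧸ J)).comp
            (wittStr (baseMap p k (A ⧸ J))))) γ₂ y).coeff 1 := fun y => by
        induction y with
        | zero => simp
        | add x y hx hy => rw [map_add, map_add, Polynomial.coeff_add, Polynomial.coeff_add, hx, hy]
        | tmul a x =>
          rw [ext_tmul, ext_tmul, AlgHom.comp_apply, constPoly_apply, Polynomial.coeff_C_mul,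
            Polynomial.coeff_C_mul,
            WittVector.verschiebung_injective _ _ ((c₁ x).symm.trans (c₂ x))]
      refine P.pos_ext hμ (Cochar.mem_pos_iff_exists.mpr ⟨γ₁, k₁, hγ₁⟩)
        (Cochar.mem_pos_iff_exists.mpr ⟨γ₂, k₂, hγ₂⟩) fun y hy => ?_
      have e1 := Cochar.coeff_one_ext hγ₁ k₁ y
      have e2 := Cochar.coeff_one_ext hγ₂ k₂ y
      rw [hy.proj_self] at e1 e2
      rw [← e1, ← e2, hc]
  refine MonoidHom.ext fun g => ?_
  obtain ⟨g', hg, -⟩ := h.exists_lift P g.1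
  obtain ⟨g₀, h3, h4⟩ := key ((h.map_mem_displayGroup P).mp (by rw [hg]; exact g.2))
  have h5 : g₀ = g := Subtype.ext (h4.trans hg)
  exact h5 ▸ h3

theorem IsFrame.existsUnique_twistedFrobenius (h : IsFrame p k A J τ) (P : μ.Pres ι)
    (hμ : μ.IsPhiDatum) :
    ∃! Φ : μ.displayGroup (baseMap p k (A ⧸ J)) →* Pt p O (WittVector p (A ⧸ J)),
      μ.IsTwistedFrobenius (baseMap p k (A ⧸ J)) Φ := by
  obtain ⟨Φ, hΦ⟩ := h.exists_descent P hμ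
  have h1 := h.isTwistedFrobenius P hμ hΦ
  exact ⟨Φ, h1, fun Φ' h2 => h.isTwistedFrobenius_unique P hμ h2 h1⟩

/-- The twisted Frobenius is compatible with the twist over `W(A)`. -/
theorem IsFrame.twistedFrobenius_apply (h : IsFrame p k A J τ) (P : μ.Pres ι) (hμ : μ.IsPhiDatum)
    (g : μ.displayGroup (baseMap p k (A ⧸ J))) {g' q : Pt p O (WittVector p A)}
    (hg : Pt.map (wittRed p J) g' = g)
    (H : μ.IsTwist (wittStr (baseMap p k A)) (wittFrob p A) g' q) :
    μ.twistedFrobenius (baseMap p k (A ⧸ J)) g = Pt.map (wittRed p J) q := by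
  obtain ⟨Φ, hΦ⟩ := h.exists_descent P hμ
  have h1 := h.isTwistedFrobenius P hμ hΦ
  rw [Cochar.twistedFrobenius,
    h.isTwistedFrobenius_unique P hμ (Classical.epsilon_spec ⟨Φ, h1⟩) h1, hΦ g g' q hg H]

end TwistedFrobenius

/-! ### Nilpotence over `W(A)` and over `W(A/J)` -/

section Nilpotence

/-- A ring element that vanishes locally on the spectrum is zero. -/
theorem eq_zero_of_toSections {B : Type u} [CommRing B] {z : B}
    (h : ∀ x : AlgebraicGeometry.Spec (CommRingCat.of B),
      ∃ V : (AlgebraicGeometry.Spec (CommRingCat.of B)).Opens, x ∈ V ∧ toSections B V z = 0) :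
    z = 0 := by
  choose V hx hV using h
  have h1 : (AlgebraicGeometry.Scheme.ΓSpecIso (CommRingCat.of B)).inv.hom z = 0 := by
    refine (AlgebraicGeometry.Spec (CommRingCat.of B)).sheaf.eq_of_locally_eq' V ⊤
      (fun x => homOfLE le_top) (fun x _ => TopologicalSpace.Opens.mem_iSup.mpr ⟨x, hx x⟩) _ _
      fun x => ?_
    refine (hV x).trans ?_
    symm
    exact map_zero ((AlgebraicGeometry.Spec (CommRingCat.of B)).presheaf.map
      (homOfLE (le_top : V x ≤ ⊤)).op).hom
  have h2 := congrArg (AlgebraicGeometry.Scheme.ΓSpecIso (CommRingCat.of B)).hom.hom h1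
  rw [map_zero] at h2
  rw [← h2]
  exact (CategoryTheory.Iso.inv_hom_id_apply
    (AlgebraicGeometry.Scheme.ΓSpecIso (CommRingCat.of B)) z).symm

variable {p : ℕ} [Fact p.Prime] {k : Type w} [Field k] [Finite k] [CharP k p]
  {O : Type v} [CommRing O] [HopfAlgebra ℤ_[p] O] {μ : Cochar p k O}
  {ι : Type} [Fintype ι]

theorem Cochar.iterate_frobFlat_mem_span {S : Type*} [CommRing S] [Algebra ℤ_[p] S]
    {c : WittVector p k →ₐ[ℤ_[p]] S} {τ : S →ₐ[ℤ_[p]] S} {U : Pt p O S} {d : O →ₗ[ℤ_[p]] S}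
    (hd : ∀ y, d y ∈ Ideal.span {(p : S)}) (n : ℕ) :
    ∀ y, (μ.frobFlat c τ U)^[n] d y ∈ Ideal.span {(p : S)} := by
  induction n with
  | zero => exact hd
  | succ n ih =>
    rw [Function.iterate_succ_apply']
    refine frobFlat_mem (fun a ha => ?_) U ih
    have := map_span_pow (θ := τ) 1 (x := a) (by rwa [pow_one])
    rwa [pow_one] at this

theorem wittFrob_comp_wittMap {R R' : Type u} [CommRing R] [Algebra ℤ_[p] R] [CommRing R']
    [Algebra ℤ_[p] R'] (ψ : R →ₐ[ℤ_[p]] R') :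
    (wittMap p ψ).comp (wittFrob p R) = (wittFrob p R').comp (wittMap p ψ) :=
  AlgHom.ext fun a => (frobenius_map (ψ : R →+* R') a).symm

theorem wittMap_comp_wittMap {R R' R'' : Type u} [CommRing R] [Algebra ℤ_[p] R] [CommRing R']
    [Algebra ℤ_[p] R'] [CommRing R''] [Algebra ℤ_[p] R''] (φ : R' →ₐ[ℤ_[p]] R'')
    (ψ : R →ₐ[ℤ_[p]] R') : (wittMap p φ).comp (wittMap p ψ) = wittMap p (φ.comp ψ) := by
  refine AlgHom.ext fun x => ?_
  change WittVector.map _ (WittVector.map _ _) = WittVector.map _ _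
  ext n
  simp [WittVector.map_coeff]

theorem Cochar.Pres.isFNilpotent_wittMap (P : μ.Pres ι) (hμ : μ.IsPhiDatum) {R R' : Type u}
    [CommRing R] [Algebra ℤ_[p] R] [CommRing R'] [Algebra ℤ_[p] R'] (ψ : R →ₐ[ℤ_[p]] R')
    {c : WittVector p k →ₐ[ℤ_[p]] R} {U : Pt p O (WittVector p R)}
    (h : μ.IsFNilpotent (wittStr c) (wittFrob p R) U) :
    μ.IsFNilpotent (wittStr (ψ.comp c)) (wittFrob p R') (Pt.map (wittMap p ψ) U) := by
  have := P.isFNilpotent_map hμ (wittFrob_comp_wittMap ψ) h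
  rwa [wittMap_comp_wittStr] at this

/-- Divisibility by `p` persists under further iteration, so vanishing holds for all large `N`. This
permits a common exponent for a finite covering. -/
theorem Cochar.Pres.exists_wittZero_eq_zero (P : μ.Pres ι) (hμ : μ.IsPhiDatum) {R R' : Type u}
    [CommRing R] [Algebra ℤ_[p] R] [CommRing R'] [Algebra ℤ_[p] R'] (ψ : R →ₐ[ℤ_[p]] R')
    (hp : (p : R') = 0) {c : WittVector p k →ₐ[ℤ_[p]] R} {U : Pt p O (WittVector p R)}
    (h : μ.IsFNilpotent (wittStr (ψ.comp c)) (wittFrob p R') (Pt.map (wittMap p ψ) U)) :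
    ∃ n, ∀ N ≥ n, ∀ j y, ψ (wittZero p R ((μ.frobFlat (wittStr c) (wittFrob p R) U)^[N]
      ((wittStr c).toLinearMap ∘ₗ P.D j) y)) = 0 := by
  obtain ⟨n, hn⟩ := (P.isFNilpotent_iff hμ).mp h
  refine ⟨n, fun N hN j y => ?_⟩
  obtain ⟨m, rfl⟩ := Nat.exists_eq_add_of_le' hN
  have h1 := Cochar.iterate_frobFlat_mem_span (μ := μ) (c := wittStr (ψ.comp c))
    (τ := wittFrob p R') (U := Pt.map (wittMap p ψ) U) (hn j) m y
  rw [← Function.iterate_add_apply, ← wittMap_comp_wittStr] at h1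
  have h2 := DFunLike.congr_fun (Cochar.map_iterate_frobFlat (μ := μ) (c := wittStr c)
    (wittFrob_comp_wittMap ψ) U (m + n) ((wittStr c).toLinearMap ∘ₗ P.D j)) y
  have h3 : ((wittMap p ψ).comp (wittStr c)).toLinearMap ∘ₗ P.D j =
    (wittMap p ψ).toLinearMap ∘ₗ (wittStr c).toLinearMap ∘ₗ P.D j := rfl
  rw [h3, ← h2] at h1
  obtain ⟨z, hz⟩ := Ideal.mem_span_singleton.mp h1
  have h4 := congrArg (wittZero p R') hz
  rw [map_mul, map_natCast, hp, zero_mul] at h4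
  refine Eq.trans ?_ h4
  exact (ghostComponent_map (ψ : R →+* R') _ 0).symm

theorem Cochar.Pres.exists_eq_zero_of_isFNilpotentAlong (P : μ.Pres ι) (hμ : μ.IsPhiDatum)
    {R R' R'' : Type u} [CommRing R] [Algebra ℤ_[p] R] [CommRing R'] [Algebra ℤ_[p] R']
    [CommRing R''] (π : R →ₐ[ℤ_[p]] R') (φ : R' →+* R'') (hp : (p : R'') = 0)
    {c : WittVector p k →ₐ[ℤ_[p]] R} {U : Pt p O (WittVector p R)}
    (h : μ.IsFNilpotentAlong (π.comp c) φ (Pt.map (wittMap p π) U)) :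
    ∃ n, ∀ N ≥ n, ∀ j y, φ (π (wittZero p R ((μ.frobFlat (wittStr c) (wittFrob p R) U)^[N]
      ((wittStr c).toLinearMap ∘ₗ P.D j) y))) = 0 := by
  let : Algebra ℤ_[p] R'' := (φ.comp (algebraMap ℤ_[p] R')).toAlgebra
  let φ' : R' →ₐ[ℤ_[p]] R'' := { φ with commutes' := fun _ => rfl }
  have h1 : μ.IsFNilpotent (wittStr (φ'.comp (π.comp c))) (wittFrob p R'')
    (Pt.map (wittMap p φ') (Pt.map (wittMap p π) U)) := h
  rw [← AlgHom.comp_assoc, ← Pt.map_comp, wittMap_comp_wittMap] at h1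
  exact P.exists_wittZero_eq_zero hμ (φ'.comp π) hp h1

variable {A : Type u} [CommRing A] [Algebra (WittVector p k) A] [Algebra ℤ_[p] A]
  [IsScalarTower ℤ_[p] (WittVector p k) A] {J : Ideal A} {τ : A →+* A}

theorem Cochar.Pres.isDisplay_of_isFNilpotent (P : μ.Pres ι) (hμ : μ.IsPhiDatum)
    {R : Type u} [CommRing R] [Algebra ℤ_[p] R] {c : WittVector p k →ₐ[ℤ_[p]] R}
    {U : Pt p O (WittVector p R)}
    (hU : μ.IsFNilpotent (wittStr c) (wittFrob p R) U) : μ.IsDisplay c U := fun x =>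
  ⟨⊤, trivial, AlgebraicGeometry.isAffineOpen_top _, by
    rw [Cochar.IsFNilpotentAlong]
    exact @Cochar.Pres.isFNilpotent_wittMap p _ k _ _ _ O _ _ μ ι _ P hμ R _ _ _ _ (_) _ c U hU⟩

theorem IsFrame.pow_mem_span (h : IsFrame p k A J τ) {a : A}
    (ha : Ideal.Quotient.mk (Ideal.span {(p : A ⧸ J)}) (Ideal.Quotient.mk J a) = 0) :
    a ^ p ∈ Ideal.span {(p : A)} := by
  obtain ⟨y, hy⟩ := Ideal.mem_span_singleton.mp (Ideal.Quotient.eq_zero_iff_mem.mp ha)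
  obtain ⟨y, rfl⟩ := Ideal.Quotient.mk_surjective y
  have h1 : a - p * y ∈ J := by
    rw [← Ideal.Quotient.eq_zero_iff_mem, map_sub, hy]
    simp
  have h2 : (a - p * y) ^ p ∈ Ideal.span {(p : A)} := Ideal.mul_le_left (h.frobPow _ h1)
  have h3 : a ^ p - (a - p * y) ^ p ∈ Ideal.span {(p : A)} :=
    Ideal.mem_span_singleton.mpr ((Dvd.intro y (by ring)).trans (sub_dvd_pow_sub_pow _ _ p))
  simpa using add_mem h3 h2

/-- Quasi-compactness gives one exponent for which the values have trivial `w₀` modulo `J` and `p`.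
One Frobenius raises this component to the `p`th power modulo `p`, which makes it divisible by `p`;
a second one makes the whole Witt vector divisible by `p`. -/
theorem IsFrame.isFNilpotent_of_isDisplay (h : IsFrame p k A J τ) (P : μ.Pres ι)
    (hμ : μ.IsPhiDatum) {U : Pt p O (WittVector p A)}
    (hU : μ.IsDisplay (baseMap p k (A ⧸ J)) (Pt.map (wittRed p J) U)) :
    μ.IsFNilpotent (wittStr (baseMap p k A)) (wittFrob p A) U := by
  let φ : A →+* (A ⧸ J) ⧸ Ideal.span {(p : A ⧸ J)} :=
    (Ideal.Quotient.mk (Ideal.span {(p : A ⧸ J)})).comp (Ideal.Quotient.mk J)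
  have hloc : ∀ x : AlgebraicGeometry.Spec (CommRingCat.of ((A ⧸ J) ⧸ Ideal.span {(p : A ⧸ J)})),
      ∃ V : (AlgebraicGeometry.Spec
        (CommRingCat.of ((A ⧸ J) ⧸ Ideal.span {(p : A ⧸ J)}))).Opens, x ∈ V ∧
        ∃ n, ∀ N ≥ n, ∀ j y, toSections _ V (φ (wittZero p A
          ((μ.frobFlat (wittStr (baseMap p k A)) (wittFrob p A) U)^[N]
            ((wittStr (baseMap p k A)).toLinearMap ∘ₗ P.D j) y))) = 0 := fun x => by
    obtain ⟨V, hx, -, hV⟩ := hU x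
    have hp : ((toSections _ V).comp (Ideal.Quotient.mk (Ideal.span {(p : A ⧸ J)}))) (p : A ⧸ J)
        = 0 := by
      rw [RingHom.comp_apply, Ideal.Quotient.eq_zero_iff_mem.mpr
        (Ideal.mem_span_singleton_self _), map_zero]
    rw [map_natCast] at hp
    obtain ⟨n, hn⟩ := P.exists_eq_zero_of_isFNilpotentAlong (c := baseMap p k A) (U := U) hμ
      (Ideal.Quotient.mkₐ ℤ_[p] J)
      ((toSections _ V).comp (Ideal.Quotient.mk (Ideal.span {(p : A ⧸ J)}))) hp hV
    exact ⟨V, hx, n, fun N hN j y => hn N hN j y⟩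
  choose V hx n hn using hloc
  obtain ⟨t, ht⟩ := CompactSpace.elim_nhds_subcover (fun x => (V x : Set _))
    fun x => (V x).isOpen.mem_nhds (hx x)
  have hzero : ∀ j y, φ (wittZero p A ((μ.frobFlat (wittStr (baseMap p k A))
      (wittFrob p A) U)^[t.sup n] ((wittStr (baseMap p k A)).toLinearMap ∘ₗ P.D j) y)) = 0 :=
    fun j y => eq_zero_of_toSections fun x => by
      have hxt : x ∈ ⋃ x ∈ t, (V x : Set _) := by rw [ht]; trivial
      simp only [Set.mem_iUnion] at hxt
      obtain ⟨x', hx', hxV⟩ := hxt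
      exact ⟨V x', hxV, hn x' _ (Finset.le_sup hx') j y⟩
  let 𝔧 : Ideal (WittVector p A) := RingHom.ker (φ.comp (wittZero p A : WittVector p A →+* A))
  let 𝔨 : Ideal (WittVector p A) := wittIdeal p (Ideal.span {(p : A) ^ 1})
  have h1 : ∀ a ∈ 𝔧, wittFrob p A a ∈ 𝔨 := fun a ha => by
    refine mem_wittIdeal.mpr ?_
    change WittVector.ghostComponent 0 (WittVector.frobenius a) ∈ _
    rw [WittVector.ghostComponent_frobenius, pow_one]
    have h2 := ghost_sub_pow_mem a 1
    rw [pow_one] at h2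
    have h3 : WittVector.ghostComponent 0 a ^ p ∈ Ideal.span {(p : A)} := h.pow_mem_span ha
    simpa using add_mem h2 h3
  have h2 : ∀ a ∈ 𝔨, wittFrob p A a ∈ Ideal.span {(p : WittVector p A)} := fun a ha =>
    Ideal.mem_span_singleton.mpr
      (p_dvd_frobenius h.eq_zero_of_p_mul (frobPow_span le_rfl) ha)
  generalize t.sup n = N at hzero
  refine (P.isFNilpotent_iff hμ).mpr ⟨N + 1 + 1, fun j => ?_⟩
  rw [Function.iterate_succ_apply', Function.iterate_succ_apply']
  have h3 := Cochar.frobFlat_mem (μ := μ) (c := wittStr (baseMap p k A)) h1 U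
    (d := (μ.frobFlat (wittStr (baseMap p k A)) (wittFrob p A) U)^[N]
      ((wittStr (baseMap p k A)).toLinearMap ∘ₗ P.D j)) fun y => hzero j y
  exact Cochar.frobFlat_mem h2 U h3

end Nilpotence

/-! ### Functors between groupoids of twisted conjugacy classes -/

section TwistedConjFunctor

variable {X Y X' Y' : Type*} [Group X] [Group Y] [Group X'] [Group Y']
  {ι : X →* Y} {K : Subgroup X} {φ : K →* Y} {N : X → Prop}
  {ι' : X' →* Y'} {K' : Subgroup X'} {φ' : K' →* Y'} {N' : X' → Prop}

/-- The functor that is induced by a homomorphism of groups. -/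
def TwistedConj.functor (f : X →* X') (hN : ∀ x, N x → N' (f x)) (hK : ∀ x ∈ K, f x ∈ K')
    (hφ : ∀ (U' U : X) (h : K), ι U' = (ι h)⁻¹ * ι U * φ h →
      ι' (f U') = (ι' (f h))⁻¹ * ι' (f U) * φ' ⟨f h, hK h h.2⟩) :
    TwistedConj ι K φ N ⥤ TwistedConj ι' K' φ' N' where
  obj U := ⟨f U.pt, hN _ U.prop⟩
  map {U' U} h := (⟨⟨f h.elt, hK _ h.elt.2⟩, hφ U'.pt U.pt h.elt h.eq⟩ : TwistedConj.Hom _ _)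
  map_id _ := TwistedConj.Hom.ext (Subtype.ext (map_one f))
  map_comp h g := TwistedConj.Hom.ext (Subtype.ext (map_mul f (g.elt : X) (h.elt : X)))

variable {f : X →* X'} {hN : ∀ x, N x → N' (f x)} {hK : ∀ x ∈ K, f x ∈ K'}
  {hφ : ∀ (U' U : X) (h : K), ι U' = (ι h)⁻¹ * ι U * φ h →
      ι' (f U') = (ι' (f h))⁻¹ * ι' (f U) * φ' ⟨f h, hK h h.2⟩}

theorem TwistedConj.functor_isEquivalence
    (hfaithful : ∀ U' U, N U' → N U → ∀ h₁ h₂ : K, ι U' = (ι h₁)⁻¹ * ι U * φ h₁ →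
      ι U' = (ι h₂)⁻¹ * ι U * φ h₂ → f h₁ = f h₂ → h₁ = h₂)
    (hfull : ∀ U' U, N U' → N U → ∀ h' : K', ι' (f U') = (ι' h')⁻¹ * ι' (f U) * φ' h' →
      ∃ h : K, ι U' = (ι h)⁻¹ * ι U * φ h ∧ f h = h')
    (hsurj : ∀ V, N' V → ∃ U, N U ∧ ∃ h : K', ι' (f U) = (ι' h)⁻¹ * ι' V * φ' h) :
    (TwistedConj.functor f hN hK hφ).IsEquivalence where
  faithful := ⟨fun {U' U} h₁ h₂ e => TwistedConj.Hom.ext (hfaithful _ _ U'.prop U.prop _ _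
    h₁.eq h₂.eq (congrArg (fun g => (TwistedConj.Hom.elt g : X')) e))⟩
  full := ⟨fun {U' U} g => by
    obtain ⟨h, hh, e⟩ := hfull _ _ U'.prop U.prop g.elt g.eq
    exact ⟨(⟨h, hh⟩ : TwistedConj.Hom _ _), TwistedConj.Hom.ext (Subtype.ext e)⟩⟩
  essSurj := ⟨fun V => by
    obtain ⟨U, hU, h, e⟩ := hsurj _ V.prop
    exact ⟨⟨U, hU⟩, ⟨(Groupoid.isoEquivHom _ _).symm (⟨h, e⟩ : TwistedConj.Hom _ _)⟩⟩⟩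

end TwistedConjFunctor

/-! ### The two functors and their equivalence -/

section Functors

variable {p : ℕ} [Fact p.Prime] {k : Type w} [Field k] [Finite k] [CharP k p]
  {O : Type v} [CommRing O] [HopfAlgebra ℤ_[p] O] {μ : Cochar p k O}
  {ι : Type} [Fintype ι]

theorem Cochar.IsTwist.map {S : Type*} {S' : Type*} [CommRing S] [Algebra ℤ_[p] S] [CommRing S']
    [Algebra ℤ_[p] S'] {c : WittVector p k →ₐ[ℤ_[p]] S} {τ : S →ₐ[ℤ_[p]] S} {φ : S →ₐ[ℤ_[p]] S'}
    {τ' : S' →ₐ[ℤ_[p]] S'} (hφ : φ.comp τ = τ'.comp φ) {h h' : Pt p O S}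
    (H : μ.IsTwist c τ h h') : μ.IsTwist (φ.comp c) τ' (Pt.map φ h) (Pt.map φ h') := by
  intro n y a b hy hab
  have h1 := congrArg φ (H n y a b hy hab)
  rw [map_mul, map_mul, map_pow, map_pow, map_natCast, ← ext_map, ← AlgHom.comp_apply φ τ, hφ,
    AlgHom.comp_apply, ← ext_map] at h1
  rwa [← AlgHom.comp_assoc, ← hφ, AlgHom.comp_assoc]

/-- A morphism `U' → U` is an `h` whose twist is the integral point `U⁻¹ h U'`; this removes
`A[1/p]` from the remaining arguments. -/
theorem Cochar.window_eq_iff {S : Type*} [CommRing S] [Algebra ℤ_[p] S]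
    {c : WittVector p k →ₐ[ℤ_[p]] S} {τ : S →ₐ[ℤ_[p]] S}
    (hp : ∀ a : S, (p : S) * a = 0 → a = 0) {U' U h : Pt p O S} :
    Pt.map (toLoc p S) U' = (Pt.map (toLoc p S) h)⁻¹ * Pt.map (toLoc p S) U * μ.windowTwist c τ h ↔
      μ.IsTwist c τ h (U⁻¹ * h * U') := by
  rw [isTwist_iff hp, map_mul, map_mul, map_inv]
  constructor
  · intro e
    rw [e]
    group
  · intro e
    rw [← e]
    group

variable {A : Type u} [CommRing A] [Algebra (WittVector p k) A] [Algebra ℤ_[p] A]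
  [IsScalarTower ℤ_[p] (WittVector p k) A] {J : Ideal A} {τ : A →+* A}

namespace IsFrame

theorem diag_mem_wittIdeal (h : IsFrame p k A J τ) {a : A} (ha : a ∈ J) :
    h.diag a ∈ wittIdeal p J :=
  mem_wittIdeal.mpr (by rwa [h.ghost_diag])

theorem map_zero_diag (h : IsFrame p k A J τ) (g : Pt p O A) :
    Pt.map (wittZero p A) (Pt.map h.diag g) = g := by
  rw [← Pt.map_comp, h.zero_comp_diag]
  rfl

theorem p_dvd_tau (h : IsFrame p k A J τ) {a : A} (ha : a ∈ J) : (p : A) ∣ h.tau a := by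
  have h1 := Ideal.mem_span_singleton.mp (Ideal.mul_le_left (h.frobPow a ha))
  have h2 : (p : A) ∣ h.tau a - a ^ p := h.frobenius a
  simpa using dvd_add h2 h1

theorem isTwist_diag (h : IsFrame p k A J τ) {g q : Pt p O A}
    (H : μ.IsTwist (baseMap p k A) h.tau g q) :
    μ.IsTwist (wittStr (baseMap p k A)) (wittFrob p A) (Pt.map h.diag g) (Pt.map h.diag q) := by
  have := H.map h.frob_comp_diag.symm
  rwa [h.diag_comp_baseMap] at this

theorem map_diag_mem_hatNeg (h : IsFrame p k A J τ) {g : Pt p O A}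
    (hg : g ∈ μ.hatNeg (baseMap p k A) J) :
    Pt.map h.diag g ∈ μ.hatNeg (wittStr (baseMap p k A)) (wittIdeal p J) := by
  have := Cochar.map_mem_hatNeg h.diag (fun _ ha => h.diag_mem_wittIdeal ha) hg
  rwa [h.diag_comp_baseMap] at this

theorem map_zero_mem_hatNeg {g : Pt p O (WittVector p A)}
    (hg : g ∈ μ.hatNeg (wittStr (baseMap p k A)) (wittIdeal p J)) :
    Pt.map (wittZero p A) g ∈ μ.hatNeg (baseMap p k A) J := by
  have := Cochar.map_mem_hatNeg (wittZero p A) (𝔟' := J) (fun _ ha => mem_wittIdeal.mp ha) hg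
  rwa [wittZero_comp_wittStr] at this

/-- The functor that is induced by Cartier's diagonal. -/
def diagFunctor (h : IsFrame p k A J τ) (P : μ.Pres ι) (hμ : μ.IsPhiDatum) :
    NilpWindow μ (baseMap p k A) h.tau J ⥤
      NilpWindow μ (wittStr (baseMap p k A)) (wittFrob p A) (wittIdeal p J) :=
  TwistedConj.functor (Pt.map h.diag)
    (fun U hU => by
      have := P.isFNilpotent_map hμ h.frob_comp_diag.symm hU
      rwa [h.diag_comp_baseMap] at this)
    (fun g hg => h.map_diag_mem_hatNeg hg)
    (fun U' U g e => by
      refine (Cochar.window_eq_iff (witt_torsionFree h.eq_zero_of_p_mul)).mpr ?_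
      rw [← map_inv, ← map_mul, ← map_mul]
      exact h.isTwist_diag ((Cochar.window_eq_iff h.eq_zero_of_p_mul).mp e))

/-- A morphism between windows in the image of the diagonal comes from `A`. -/
theorem eq_diag [Algebra.Smooth ℤ_[p] O] (h : IsFrame p k A J τ) (P : μ.Pres ι) (hμ : μ.IsPhiDatum) {U U' : Pt p O A}
    (hU : μ.IsFNilpotent (baseMap p k A) h.tau U) {g : Pt p O (WittVector p A)}
    (hg : g ∈ μ.hatNeg (wittStr (baseMap p k A)) (wittIdeal p J))
    (H : μ.IsTwist (wittStr (baseMap p k A)) (wittFrob p A) g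
      ((Pt.map h.diag U)⁻¹ * g * Pt.map h.diag U')) :
    Pt.map h.diag (Pt.map (wittZero p A) g) = g := by
  have hpW := witt_torsionFree (p := p) h.eq_zero_of_p_mul
  obtain ⟨q, hq⟩ := P.exists_isTwist hμ h.eq_zero_of_p_mul (fun _ ha => h.p_dvd_tau ha)
    (map_zero_mem_hatNeg hg)
  have h1 := H.mul hpW ((h.isTwist_diag hq).inv hpW)
  -- The quotient of `g` by `δ(w₀(g))` is a morphism to `δ(U)` from another diagonal point and has
  -- trivial `w₀`.
  refine (mul_inv_eq_one.mp (h.eq_one_of_wittAug P hμ hU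
    (v' := Pt.map (wittZero p A) g * U' * q⁻¹) (mem_congr_wittAug_zero ?_) h1 ?_)).symm
  · rw [map_mul, map_inv, h.map_zero_diag, mul_inv_cancel]
  · rw [map_mul, map_mul, map_inv]
    group

theorem diagFunctor_isEquivalence [Algebra.Smooth ℤ_[p] O] (h : IsFrame p k A J τ) (P : μ.Pres ι) (hμ : μ.IsPhiDatum) :
    (h.diagFunctor P hμ).IsEquivalence := by
  have hp := h.eq_zero_of_p_mul
  have hpW := witt_torsionFree (p := p) hp
  have hinj : Function.Injective (Pt.map h.diag : Pt p O A →* Pt p O (WittVector p A)) :=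
    Function.LeftInverse.injective h.map_zero_diag
  refine TwistedConj.functor_isEquivalence (fun U' U _ _ h₁ h₂ _ _ e => Subtype.ext (hinj e))
    (fun U' U _ hU g e => ?_) (fun V hV => ?_)
  · have H := (Cochar.window_eq_iff hpW).mp e
    have hg := h.eq_diag P hμ hU g.2 H
    refine ⟨⟨_, map_zero_mem_hatNeg g.2⟩, ?_, hg⟩
    refine (Cochar.window_eq_iff hp).mpr ?_
    obtain ⟨q, hq⟩ := P.exists_isTwist hμ hp (fun _ ha => h.p_dvd_tau ha)
      (map_zero_mem_hatNeg g.2)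
    have h1 := h.isTwist_diag hq
    rw [hg] at h1
    -- The twist of `g` is known in two ways, from the morphism and through the diagonal; comparing
    -- them under `w₀` gives the morphism condition over `A`.
    have h2 := congrArg (Pt.map (wittZero p A)) (H.unique hpW h1)
    rw [map_mul, map_mul, map_inv, h.map_zero_diag, h.map_zero_diag, h.map_zero_diag] at h2
    rwa [h2]
  · obtain ⟨e, he, q, H, hd⟩ := h.exists_diag P hμ hV
    refine ⟨_, h.isFNilpotent_zero P hμ (P.isFNilpotent_conj hμ hpW H hV),
      ⟨e, h.congr_le_hatNeg P (Pt.congr_mono (wittAug_le_wittIdeal 0) he)⟩, ?_⟩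
    refine (Cochar.window_eq_iff hpW).mpr ?_
    rw [hd]
    convert H using 1
    group

theorem isDisplay_of_isFNilpotent (P : μ.Pres ι) (hμ : μ.IsPhiDatum)
    {U : Pt p O (WittVector p A)}
    (hU : μ.IsFNilpotent (wittStr (baseMap p k A)) (wittFrob p A) U) :
    μ.IsDisplay (baseMap p k (A ⧸ J)) (Pt.map (wittRed p J) U) := by
  have h1 := P.isFNilpotent_map hμ (wittRed_comp_frob (J := J)) hU
  rw [wittRed_comp_wittStr] at h1
  exact P.isDisplay_of_isFNilpotent hμ h1

/-- The functor that is induced by the reduction `W(A) → W(A/J)`. -/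
def redFunctor [Algebra.Smooth ℤ_[p] O] (h : IsFrame p k A J τ) (P : μ.Pres ι) (hμ : μ.IsPhiDatum) :
    NilpWindow μ (wittStr (baseMap p k A)) (wittFrob p A) (wittIdeal p J) ⥤
      NilpBanalDisplay μ (baseMap p k (A ⧸ J)) :=
  TwistedConj.functor (Pt.map (wittMap p (Ideal.Quotient.mkₐ ℤ_[p] J)))
    (fun _ hU => isDisplay_of_isFNilpotent P hμ hU)
    (fun g hg => (h.map_mem_displayGroup P).mpr hg)
    (fun U' U g e => by
      have H := (Cochar.window_eq_iff (witt_torsionFree h.eq_zero_of_p_mul)).mp e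
      have h1 := h.twistedFrobenius_apply P hμ
        ⟨Pt.map (wittRed p J) g.1, (h.map_mem_displayGroup P).mpr g.2⟩ rfl H
      refine Eq.trans ?_ (congrArg (fun x => (Pt.map (wittRed p J) g.1)⁻¹ *
        Pt.map (wittRed p J) U * x) h1.symm)
      rw [map_mul, map_mul, map_inv, MonoidHom.id_apply]
      group)

theorem redFunctor_isEquivalence [Algebra.Smooth ℤ_[p] O] (h : IsFrame p k A J τ) (P : μ.Pres ι) (hμ : μ.IsPhiDatum) :
    (h.redFunctor P hμ).IsEquivalence := by
  have hpW := witt_torsionFree (p := p) h.eq_zero_of_p_mul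
  have hker : ∀ g : Pt p O (WittVector p A),
      g ∈ Pt.congr p O (wittPD p J 0) ↔ Pt.map (wittRed p J) g = 1 := fun g => by
    rw [← h.ker_wittRed, Pt.mem_congr_ker]
  refine TwistedConj.functor_isEquivalence (fun U' U _ hU h₁ h₂ e₁ e₂ e => ?_)
    (fun U' U hU' hU g e => ?_) (fun V hV => ?_)
  · have H₁ := (Cochar.window_eq_iff hpW).mp e₁
    have H₂ := (Cochar.window_eq_iff hpW).mp e₂
    -- Two lifts of one morphism differ by an automorphism of `U` that is trivial modulo `W(J)`.
    refine Subtype.ext (mul_inv_eq_one.mp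
      (h.eq_one_of_wittPD P hμ hU ((hker _).mpr ?_) (H₁.mul hpW (H₂.inv hpW)) ?_))
    · rw [map_mul, map_inv]
      exact mul_inv_eq_one.mpr e
    · group
  · obtain ⟨g', hg', -⟩ := h.exists_lift P (g : Pt p O (WittVector p (A ⧸ J)))
    have hmem : g' ∈ μ.hatNeg (wittStr (baseMap p k A)) (wittIdeal p J) := by
      rw [← h.map_mem_displayGroup P, hg']
      exact g.2
    obtain ⟨q, H⟩ := h.exists_isTwist P hμ hmem
    rw [h.twistedFrobenius_apply P hμ g hg' H, ← hg'] at e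
    -- Conjugating `U` by a lift `g'` gives a point that agrees with `U'` only modulo `W(J)`; `x`
    -- corrects the difference without changing the reduction of `g'`.
    obtain ⟨x, hx, r, Hx, hU''⟩ := h.exists_of_wittPD P hμ (U := g'⁻¹ * U * q) hU' ((hker _).mpr (by
      rw [map_mul, map_inv, mul_inv_eq_one, map_mul, map_mul, map_inv]
      exact e.symm))
    refine ⟨⟨g' * x, mul_mem hmem
      (h.congr_le_hatNeg P (Pt.congr_mono (wittPD_le_wittIdeal 0) hx))⟩, ?_, ?_⟩
    · refine (Cochar.window_eq_iff hpW).mpr ?_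
      convert H.mul hpW Hx using 1
      rw [hU'']
      group
    · change Pt.map (wittRed p J) (g' * x) = _
      rw [map_mul, (hker _).mp hx, mul_one, hg']
  · obtain ⟨U, hU, -⟩ := h.exists_lift P V
    subst hU
    -- Every banal display lifts on the nose, so the identity serves as isomorphism.
    refine ⟨U, h.isFNilpotent_of_isDisplay P hμ hV, 1, ?_⟩
    simp

end IsFrame

end Functors

end GDisplay

end

theorem mainTheorem7 (p : ℕ) [Fact p.Prime] (k : Type*) [Field k] [Finite k] [CharP k p]
    (O : Type*) [CommRing O] [HopfAlgebra ℤ_[p] O] [Algebra.Smooth ℤ_[p] O]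
    (μ : Cochar p k O) (hμ : μ.IsPhiDatum)
    (A : Type*) [CommRing A] [Algebra (WittVector p k) A] [Algebra ℤ_[p] A]
    [IsScalarTower ℤ_[p] (WittVector p k) A]
    (J : Ideal A) (τ : A →+* A) (hA : IsFrame p k A J τ) :
    (∃! Φ : μ.displayGroup (baseMap p k (A ⧸ J)) →* Pt p O (WittVector p (A ⧸ J)),
      μ.IsTwistedFrobenius (baseMap p k (A ⧸ J)) Φ) ∧
    ∃ (δ : NilpWindow μ (baseMap p k A) hA.tau J ⥤
          NilpWindow μ (wittStr (baseMap p k A)) (wittFrob p A) (wittIdeal p J))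
      (ρ : NilpWindow μ (wittStr (baseMap p k A)) (wittFrob p A) (wittIdeal p J) ⥤
          NilpBanalDisplay μ (baseMap p k (A ⧸ J))),
      (∀ U, (δ.obj U).pt = Pt.map hA.diag U.pt) ∧
      (∀ U' U (h : U' ⟶ U), TwistedConj.elt (δ.map h) = Pt.map hA.diag (TwistedConj.elt h)) ∧
      (∀ U, (ρ.obj U).pt = Pt.map (wittMap p (Ideal.Quotient.mkₐ ℤ_[p] J)) U.pt) ∧
      (∀ U' U (h : U' ⟶ U), TwistedConj.elt (ρ.map h) =
        Pt.map (wittMap p (Ideal.Quotient.mkₐ ℤ_[p] J)) (TwistedConj.elt h)) ∧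
      δ.IsEquivalence ∧ ρ.IsEquivalence ∧ (δ ⋙ ρ).IsEquivalence := by
  obtain ⟨n, ⟨P⟩⟩ := μ.exists_pres
  have hδ := hA.diagFunctor_isEquivalence P hμ
  have hρ := hA.redFunctor_isEquivalence P hμ
  exact ⟨hA.existsUnique_twistedFrobenius P hμ, hA.diagFunctor P hμ, hA.redFunctor P hμ,
    fun _ => rfl, fun _ _ _ => rfl, fun _ => rfl, fun _ _ _ => rfl, hδ, hρ,
    Functor.isEquivalence_trans _ _⟩
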